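/- Let $\mathrm{PILL}_Y$ be the polymorphic dual intuitionistic/linear lambda calculus with a polymorphic fixed point combinator $Y:\prod\alpha.(\alpha\to\alpha)\to\alpha$, over an arbitrary polymorphic signature (type constants with arities and term constants of closed type). Its types are built from type variables and type constants with $I,\ \otimes,\ \multimap,\ !,\ \prod\alpha.$, and $\sigma\to\tau$ abbreviates $!\sigma\multimap\tau$. Let LAPL be Linear Abadi--Plotkin logic, the higher-order logic over $\mathrm{PILL}_Y$ with internal equality $t=_\sigma u$, definable and admissible relations, and the relational interpretation $\sigma[\vec\rho]$ of types at admissible relations. Provability below means provability in LAPL together with two axiom schemes: * extensionality: $(\forall x\colon\sigma.\ t\,x=_\tau u\,x)\supset t=_{\sigma\multimap\tau}u$ and $(\forall\alpha.\ t\,\alpha=_\tau u\,\alpha)\supset t=_{\prod\alpha.\tau}u$; * identity extension: $\forall\vec\alpha.\ \sigma[\mathrm{eq}_{\vec\alpha}]\equiv\mathrm{eq}_{\sigma(\vec\alpha)}$ for all types $\sigma(\vec\alpha)$. For a kind context $\Xi$ (a finite list of type variables), let $\mathbf{LinType}_\Xi$ be the category whose objects are the types in context $\Xi$ and whose morphisms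 $\sigma\multimap\tau$ are the terms $\Xi\mid -;-\vdash f\colon\sigma\multimap\tau$, two of them being identified if their internal equality is provable. Let $\alpha,\beta\vdash\sigma(\alpha,\beta)$ be an inductively constructed type (i.e. one built from type variables and closed types with the type constructors $\multimap,\otimes,I,!,\prod$) in which $\alpha$ occurs only negatively and $\beta$ only positively. For $f\colon\alpha'\multimap\alpha$ and $g\colon\beta\multimap\beta'$ let $\sigma(f,g)\colon\sigma(\alpha,\beta)\multimap\sigma(\alpha',\beta')$ be its functorial action, given by a closed polymorphic term defined by recursion on $\sigma$. A dialgebra for $\sigma$ in $\mathbf{LinType}_\Xi$ is a quadruple $(\tau,\tau',f,f')$ of types $\tau,\tau'$ and morphisms $f\colon\sigma(\tau',\tau)\multimap\tau$ and $f'\colon\tau'\multimap\sigma(\tau,\tau')$. A morphism from $(\tau_0,\tau_0',f_0,f_0')$ to $(\tau_1,\tau_1',f_1,f_1')$ is a pair $h\colon\tau_0\multimap\tau_1$, $h'\colon\tau_1'\multimap\tau_0'$ such that, provably, $$h\circ f_0=f_1\circ\sigma(h',h),\qquad f_0'\circ h'=\sigma(h,h')\circ f_1'.$$ **Theorem.**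 There are a closed type $\mathrm{rec}\,\alpha.\sigma(\alpha,\alpha)$, abbreviated $\mathrm{rec}$, and closed terms $i\colon\sigma(\mathrm{rec},\mathrm{rec})\multimap\mathrm{rec}$ and $i^{-1}\colon\mathrm{rec}\multimap\sigma(\mathrm{rec},\mathrm{rec})$, provably inverse to each other, such that for every kind context $\Xi$ the quadruple $(\mathrm{rec},\mathrm{rec},i,i^{-1})$ is an initial dialgebra for $\sigma$ in $\mathbf{LinType}_\Xi$: for every dialgebra $(\tau_0,\tau_0',g,g')$ there is a morphism of dialgebras from $(\mathrm{rec},\mathrm{rec},i,i^{-1})$ to it, and any two such morphisms $(h,h')$, $(k,k')$ satisfy $h=_{\mathrm{rec}\multimap\tau_0}k$ and $h'=_{\tau_0'\multimap\mathrm{rec}}k'$ provably. -/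

import Mathlib

/-!
The calculus PILL_Y (dual intuitionistic / linear lambda calculus with polymorphism and a fixed
point combinator) over an arbitrary polymorphic signature, the logic LAPL over it, and
initial dialgebras for bifunctors induced by types.

Everything is a deep embedding with well-scoped de Bruijn indices: the indices `n`, `k`, `r` of
the syntactic families are the numbers of type variables, term variables and relation variables
in scope.  The most recently bound variable has index `0`.
-/

universe u

namespace LAPL

/-! ### Types -/

/-- Type constants with arities. -/
structure TySig where
  Con : Type u
  arity : Con → ℕ

/-- Types in a kind context of `n` type variables. -/
inductive Ty (S : TySig.{u}) : ℕ → Type u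
  | var {n : ℕ} (i : Fin n) : Ty S n
  | con {n : ℕ} (K : S.Con) (args : Fin (S.arity K) → Ty S n) : Ty S n
  | unit {n : ℕ} : Ty S n
  | tensor {n : ℕ} (σ τ : Ty S n) : Ty S n
  | lolli {n : ℕ} (σ τ : Ty S n) : Ty S n
  | bang {n : ℕ} (σ : Ty S n) : Ty S n
  | all {n : ℕ} (σ : Ty S (n + 1)) : Ty S n

/-- Extend a finite family by a new value at index `0`. -/
abbrev scons {A : Type*} {n : ℕ} (a : A) (f : Fin n → A) : Fin (n + 1) → A :=
  Fin.cons (α := fun _ => A) a f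

/-- Lift a renaming under a binder. -/
def liftR {m n : ℕ} (f : Fin m → Fin n) : Fin (m + 1) → Fin (n + 1) :=
  scons 0 (fun i => (f i).succ)

namespace Ty

variable {S : TySig.{u}}

def ren : {n m : ℕ} → (Fin n → Fin m) → Ty S n → Ty S m
  | _, _, f, var i => var (f i)
  | _, _, f, con K args => con K (fun a => ren f (args a))
  | _, _, _, unit => unit
  | _, _, f, tensor σ τ => tensor (ren f σ) (ren f τ)
  | _, _, f, lolli σ τ => lolli (ren f σ) (ren f τ)
  | _, _, f, bang σ => bang (ren f σ)
  | _, _, f, all σ => all (ren (liftR f) σ)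

/-- Weakening by one fresh type variable. -/
abbrev wk {n : ℕ} (σ : Ty S n) : Ty S (n + 1) := ren Fin.succ σ

/-- Lift a type substitution under a type binder. -/
def lift {n m : ℕ} (s : Fin n → Ty S m) : Fin (n + 1) → Ty S (m + 1) :=
  scons (var 0) (fun i => (s i).wk)

/-- Simultaneous substitution `σ(s₀, …, sₙ₋₁)`. -/
def sub : {n m : ℕ} → (Fin n → Ty S m) → Ty S n → Ty S m
  | _, _, s, var i => s i
  | _, _, s, con K args => con K (fun a => sub s (args a))
  | _, _, _, unit => unit
  | _, _, s, tensor σ τ => tensor (sub s σ) (sub s τ)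
  | _, _, s, lolli σ τ => lolli (sub s σ) (sub s τ)
  | _, _, s, bang σ => bang (sub s σ)
  | _, _, s, all σ => all (sub (lift s) σ)

/-- `σ[τ/α]` for the most recent type variable `α`. -/
abbrev inst {n : ℕ} (σ : Ty S (n + 1)) (τ : Ty S n) : Ty S n := sub (scons τ var) σ

/-- A closed type viewed in a larger kind context. -/
abbrev ofClosed {n : ℕ} (σ : Ty S 0) : Ty S n := ren Fin.elim0 σ

/-- Intuitionistic function types, by the Girard encoding. -/
abbrev arrow {n : ℕ} (σ τ : Ty S n) : Ty S n := lolli (bang σ) τ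

/-- Inductively constructed types: built from type variables and closed types with the type
constructors of the calculus. -/
inductive IndConstructed : {n : ℕ} → Ty S n → Prop
  | var {n : ℕ} (i : Fin n) : IndConstructed (Ty.var i : Ty S n)
  | closed {n : ℕ} (σ : Ty S 0) : IndConstructed (ofClosed σ : Ty S n)
  | unit {n : ℕ} : IndConstructed (Ty.unit : Ty S n)
  | tensor {n : ℕ} {σ τ : Ty S n} : IndConstructed σ → IndConstructed τ →
      IndConstructed (Ty.tensor σ τ)
  | lolli {n : ℕ} {σ τ : Ty S n} : IndConstructed σ → IndConstructed τ →
      IndConstructed (Ty.lolli σ τ)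
  | bang {n : ℕ} {σ : Ty S n} : IndConstructed σ → IndConstructed (Ty.bang σ)
  | all {n : ℕ} {σ : Ty S (n + 1)} : IndConstructed σ → IndConstructed (Ty.all σ)

/-- `Occurs true i σ`: the variable `i` has a positive occurrence in `σ`; `Occurs false i σ`: it
has a negative one.  An occurrence below a type constant (which cannot happen in an
inductively constructed type) counts as both. -/
def Occurs : {n : ℕ} → Bool → Fin n → Ty S n → Prop
  | _, p, i, var j => i = j ∧ p = true
  | _, _, i, con _ args => ∃ a p, Occurs p i (args a)
  | _, _, _, unit => False
  | _, p, i, tensor σ τ => Occurs p i σ ∨ Occurs p i τ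
  | _, p, i, lolli σ τ => Occurs (!p) i σ ∨ Occurs p i τ
  | _, p, i, bang σ => Occurs p i σ
  | _, p, i, all σ => Occurs p i.succ σ

/-- The variable `i` occurs only positively (if at all). -/
def OnlyPositive {n : ℕ} (i : Fin n) (σ : Ty S n) : Prop := ¬ Occurs false i σ

/-- The variable `i` occurs only negatively (if at all). -/
def OnlyNegative {n : ℕ} (i : Fin n) (σ : Ty S n) : Prop := ¬ Occurs true i σ

/-- The type `∏ α. (α → α) → α` of the fixed point combinator. -/
def fixTy {n : ℕ} : Ty S n := all (arrow (arrow (var 0) (var 0)) (var 0))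

end Ty

/-! ### Terms -/

/-- A polymorphic signature: type constants with arities and term constants of closed
(possibly polymorphic) type. -/
structure Sig where
  ty : TySig.{u}
  TmCon : Type u
  tmTy : TmCon → Ty ty 0

/-- Raw terms with `n` type variables and `k` term variables in scope. -/
inductive Tm (S : Sig.{u}) : ℕ → ℕ → Type u
  | var {n k : ℕ} (i : Fin k) : Tm S n k
  | con {n k : ℕ} (c : S.TmCon) : Tm S n k
  | star {n k : ℕ} : Tm S n k
  | fix {n k : ℕ} : Tm S n k
  | lam {n k : ℕ} (σ : Ty S.ty n) (t : Tm S n (k + 1)) : Tm S n k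
  | app {n k : ℕ} (t u : Tm S n k) : Tm S n k
  | tens {n k : ℕ} (t u : Tm S n k) : Tm S n k
  | bang {n k : ℕ} (t : Tm S n k) : Tm S n k
  | tlam {n k : ℕ} (t : Tm S (n + 1) k) : Tm S n k
  | tapp {n k : ℕ} (t : Tm S n k) (σ : Ty S.ty n) : Tm S n k
  /-- `let x : σ ⊗ y : τ be t in u`; in `u`, `x` has index `1` and `y` has index `0` -/
  | letTens {n k : ℕ} (σ τ : Ty S.ty n) (t : Tm S n k) (u : Tm S n (k + 2)) : Tm S n k
  /-- `let !x : !σ be t in u` -/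
  | letBang {n k : ℕ} (σ : Ty S.ty n) (t : Tm S n k) (u : Tm S n (k + 1)) : Tm S n k
  /-- `let ⋆ be t in u` -/
  | letStar {n k : ℕ} (t u : Tm S n k) : Tm S n k

namespace Tm

variable {S : Sig.{u}}

/-- Simultaneous renaming of type and term variables. -/
def ren : {n m k l : ℕ} → (Fin n → Fin m) → (Fin k → Fin l) → Tm S n k → Tm S m l
  | _, _, _, _, _, g, var i => var (g i)
  | _, _, _, _, _, _, con c => con c
  | _, _, _, _, _, _, star => star
  | _, _, _, _, _, _, fix => fix
  | _, _, _, _, f, g, lam σ t => lam (σ.ren f) (ren f (liftR g) t)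
  | _, _, _, _, f, g, app t u => app (ren f g t) (ren f g u)
  | _, _, _, _, f, g, tens t u => tens (ren f g t) (ren f g u)
  | _, _, _, _, f, g, bang t => bang (ren f g t)
  | _, _, _, _, f, g, tlam t => tlam (ren (liftR f) g t)
  | _, _, _, _, f, g, tapp t σ => tapp (ren f g t) (σ.ren f)
  | _, _, _, _, f, g, letTens σ τ t u =>
      letTens (σ.ren f) (τ.ren f) (ren f g t) (ren f (liftR (liftR g)) u)
  | _, _, _, _, f, g, letBang σ t u => letBang (σ.ren f) (ren f g t) (ren f (liftR g) u)
  | _, _, _, _, f, g, letStar t u => letStar (ren f g t) (ren f g u)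

/-- Weakening by one term variable. -/
abbrev wk {n k : ℕ} (t : Tm S n k) : Tm S n (k + 1) := ren id Fin.succ t

/-- Weakening by one type variable. -/
abbrev wkTy {n k : ℕ} (t : Tm S n k) : Tm S (n + 1) k := ren Fin.succ id t

/-- Lift a term substitution under a term binder. -/
def lift {n k l : ℕ} (e : Fin k → Tm S n l) : Fin (k + 1) → Tm S n (l + 1) :=
  scons (var 0) (fun i => (e i).wk)

/-- Simultaneous capture-avoiding substitution of types for type variables and terms for term
variables. -/
def sub : {n m k l : ℕ} → (Fin n → Ty S.ty m) → (Fin k → Tm S m l) → Tm S n k → Tm S m l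
  | _, _, _, _, _, e, var i => e i
  | _, _, _, _, _, _, con c => con c
  | _, _, _, _, _, _, star => star
  | _, _, _, _, _, _, fix => fix
  | _, _, _, _, s, e, lam σ t => lam (σ.sub s) (sub s (lift e) t)
  | _, _, _, _, s, e, app t u => app (sub s e t) (sub s e u)
  | _, _, _, _, s, e, tens t u => tens (sub s e t) (sub s e u)
  | _, _, _, _, s, e, bang t => bang (sub s e t)
  | _, _, _, _, s, e, tlam t => tlam (sub (Ty.lift s) (fun i => (e i).wkTy) t)
  | _, _, _, _, s, e, tapp t σ => tapp (sub s e t) (σ.sub s)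
  | _, _, _, _, s, e, letTens σ τ t u =>
      letTens (σ.sub s) (τ.sub s) (sub s e t) (sub s (lift (lift e)) u)
  | _, _, _, _, s, e, letBang σ t u => letBang (σ.sub s) (sub s e t) (sub s (lift e) u)
  | _, _, _, _, s, e, letStar t u => letStar (sub s e t) (sub s e u)

/-- `t[u/x]` for the most recent term variable `x`. -/
abbrev inst {n k : ℕ} (t : Tm S n (k + 1)) (u : Tm S n k) : Tm S n k :=
  sub Ty.var (scons u var) t

/-- `t[u, v / x, y]` where `x` has index `1` and `y` has index `0`. -/
abbrev inst₂ {n k : ℕ} (t : Tm S n (k + 2)) (u v : Tm S n k) : Tm S n k :=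
  sub Ty.var (scons v (scons u var)) t

/-- `t[σ/α]` for the most recent type variable `α`. -/
abbrev instTy {n k : ℕ} (t : Tm S (n + 1) k) (σ : Ty S.ty n) : Tm S n k :=
  sub (scons σ Ty.var) var t

/-- A closed term viewed in a larger context. -/
abbrev ofClosed {n k : ℕ} (t : Tm S 0 0) : Tm S n k := ren Fin.elim0 Fin.elim0 t

/-- The identity `λ° x : σ. x`. -/
abbrev idTm {n k : ℕ} (σ : Ty S.ty n) : Tm S n k := lam σ (var 0)

/-- `g ∘ f = λ° x : ω. g (f x)`. -/
def comp {n k : ℕ} (ω : Ty S.ty n) (g f : Tm S n k) : Tm S n k :=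
  lam ω (app g.wk (app f.wk (var 0)))

/-- Intuitionistic abstraction `λ x : σ. t = λ° y : !σ. let !x be y in t` with `y` fresh. -/
def ilam {n k : ℕ} (σ : Ty S.ty n) (t : Tm S n (k + 1)) : Tm S n k :=
  lam (Ty.bang σ) (letBang σ (var 0) (ren id (liftR Fin.succ) t))

end Tm

/-! ### Typing -/

/-- The two zones `Γ; Δ` of a term context are kept in a single list of variables: every variable
is either intuitionistic (in `Γ`), or linear (in `Δ`), or absent from the context. -/
inductive Entry (S : TySig.{u}) (n : ℕ) : Type u
  | unr (σ : Ty S n) : Entry S n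
  | lin (σ : Ty S n) : Entry S n
  | off : Entry S n

namespace Entry

variable {S : TySig.{u}}

def wkTy {n : ℕ} : Entry S n → Entry S (n + 1)
  | unr σ => unr σ.wk
  | lin σ => lin σ.wk
  | off => off

/-- The variable is not linear. -/
def NotLin {n : ℕ} : Entry S n → Prop
  | lin _ => False
  | _ => True

/-- Intuitionistic variables are shared, a linear variable goes to exactly one side. -/
inductive Split {n : ℕ} : Entry S n → Entry S n → Entry S n → Prop
  | unr (σ : Ty S n) : Split (unr σ) (unr σ) (unr σ)
  | left (σ : Ty S n) : Split (lin σ) (lin σ) off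
  | right (σ : Ty S n) : Split (lin σ) off (lin σ)
  | off : Split off off off

end Entry

/-- Contexts `Γ; Δ` with `k` variables. -/
abbrev Cx (S : Sig.{u}) (n k : ℕ) : Type u := Fin k → Entry S.ty n

/-- `Γ; Δ, Δ'` is split into `Γ; Δ` and `Γ; Δ'`, with `Δ` and `Δ'` disjoint. -/
def Cx.Split {S : Sig.{u}} {n k : ℕ} (Γ Γ₁ Γ₂ : Cx S n k) : Prop :=
  ∀ i, Entry.Split (Γ i) (Γ₁ i) (Γ₂ i)

/-- The linear zone is empty. -/
def Cx.NoLin {S : Sig.{u}} {n k : ℕ} (Γ : Cx S n k) : Prop := ∀ i, (Γ i).NotLin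

def Cx.wkTy {S : Sig.{u}} {n k : ℕ} (Γ : Cx S n k) : Cx S (n + 1) k := fun i => (Γ i).wkTy

/-- Purely intuitionistic contexts `Γ; -` as they occur in the logic. -/
abbrev ICx (S : Sig.{u}) (n k : ℕ) : Type u := Fin k → Ty S.ty n

def ICx.wkTy {S : Sig.{u}} {n k : ℕ} (Γ : ICx S n k) : ICx S (n + 1) k := fun i => (Γ i).wk

abbrev ICx.toCx {S : Sig.{u}} {n k : ℕ} (Γ : ICx S n k) : Cx S n k := fun i => Entry.unr (Γ i)

/-- The typing judgement `Ξ | Γ; Δ ⊢ t : σ`. -/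
inductive HasType {S : Sig.{u}} : {n k : ℕ} → Cx S n k → Tm S n k → Ty S.ty n → Prop
  | star {n k : ℕ} {Γ : Cx S n k} : Γ.NoLin → HasType Γ Tm.star Ty.unit
  | fix {n k : ℕ} {Γ : Cx S n k} : Γ.NoLin → HasType Γ Tm.fix Ty.fixTy
  | con {n k : ℕ} {Γ : Cx S n k} (c : S.TmCon) : Γ.NoLin →
      HasType Γ (Tm.con c) (S.tmTy c).ofClosed
  | ivar {n k : ℕ} {Γ : Cx S n k} {σ : Ty S.ty n} (i : Fin k) :
      Γ.NoLin → Γ i = Entry.unr σ → HasType Γ (Tm.var i) σ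
  | lvar {n k : ℕ} {Γ : Cx S n k} {σ : Ty S.ty n} (i : Fin k) :
      (∀ j, j ≠ i → (Γ j).NotLin) → Γ i = Entry.lin σ → HasType Γ (Tm.var i) σ
  | app {n k : ℕ} {Γ Γ₁ Γ₂ : Cx S n k} {σ τ : Ty S.ty n} {t u : Tm S n k} :
      Γ.Split Γ₁ Γ₂ → HasType Γ₁ t (Ty.lolli σ τ) → HasType Γ₂ u σ → HasType Γ (Tm.app t u) τ
  | lam {n k : ℕ} {Γ : Cx S n k} {σ τ : Ty S.ty n} {t : Tm S n (k + 1)} :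
      HasType (scons (Entry.lin σ) Γ) t τ → HasType Γ (Tm.lam σ t) (Ty.lolli σ τ)
  | tens {n k : ℕ} {Γ Γ₁ Γ₂ : Cx S n k} {σ τ : Ty S.ty n} {t u : Tm S n k} :
      Γ.Split Γ₁ Γ₂ → HasType Γ₁ t σ → HasType Γ₂ u τ →
      HasType Γ (Tm.tens t u) (Ty.tensor σ τ)
  | bang {n k : ℕ} {Γ : Cx S n k} {σ : Ty S.ty n} {t : Tm S n k} :
      Γ.NoLin → HasType Γ t σ → HasType Γ (Tm.bang t) (Ty.bang σ)
  | tlam {n k : ℕ} {Γ : Cx S n k} {σ : Ty S.ty (n + 1)} {t : Tm S (n + 1) k} :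
      HasType Γ.wkTy t σ → HasType Γ (Tm.tlam t) (Ty.all σ)
  | tapp {n k : ℕ} {Γ : Cx S n k} {σ : Ty S.ty (n + 1)} {t : Tm S n k} (τ : Ty S.ty n) :
      HasType Γ t (Ty.all σ) → HasType Γ (Tm.tapp t τ) (σ.inst τ)
  | letTens {n k : ℕ} {Γ Γ₁ Γ₂ : Cx S n k} {σ σ' τ : Ty S.ty n} {t : Tm S n k}
      {u : Tm S n (k + 2)} :
      Γ.Split Γ₁ Γ₂ → HasType Γ₁ t (Ty.tensor σ σ') →
      HasType (scons (Entry.lin σ') (scons (Entry.lin σ) Γ₂)) u τ →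
      HasType Γ (Tm.letTens σ σ' t u) τ
  | letBang {n k : ℕ} {Γ Γ₁ Γ₂ : Cx S n k} {σ τ : Ty S.ty n} {t : Tm S n k}
      {u : Tm S n (k + 1)} :
      Γ.Split Γ₁ Γ₂ → HasType Γ₁ t (Ty.bang σ) → HasType (scons (Entry.unr σ) Γ₂) u τ →
      HasType Γ (Tm.letBang σ t u) τ
  | letStar {n k : ℕ} {Γ Γ₁ Γ₂ : Cx S n k} {τ : Ty S.ty n} {t u : Tm S n k} :
      Γ.Split Γ₁ Γ₂ → HasType Γ₁ t Ty.unit → HasType Γ₂ u τ → HasType Γ (Tm.letStar t u) τ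

/-! ### External equality -/

/-- The external equality judgement `Ξ | Γ; Δ ⊢ t = u : σ`.

Congruence is stated constructor by constructor.  In the commuting conversions
`let p be t in C[u] = C[let p be t in u]` the linear context `C[-]` is given as a term `c` with a
hole that is a linear variable (index `0`), so that `C[u]` is `c.inst u`: a linear variable occurs
exactly once and never below `!`.  The instances in which `C` binds variables of `u` follow from
these by the `η` and `β` rules. -/
inductive ExtEq {S : Sig.{u}} : {n k : ℕ} → Cx S n k → Tm S n k → Tm S n k → Ty S.ty n → Prop
  -- equivalence relation
  | refl {n k : ℕ} {Γ : Cx S n k} {t : Tm S n k} {σ : Ty S.ty n} :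
      HasType Γ t σ → ExtEq Γ t t σ
  | symm {n k : ℕ} {Γ : Cx S n k} {t u : Tm S n k} {σ : Ty S.ty n} :
      ExtEq Γ t u σ → ExtEq Γ u t σ
  | trans {n k : ℕ} {Γ : Cx S n k} {t u v : Tm S n k} {σ : Ty S.ty n} :
      ExtEq Γ t u σ → ExtEq Γ u v σ → ExtEq Γ t v σ
  -- congruence
  | app {n k : ℕ} {Γ Γ₁ Γ₂ : Cx S n k} {σ τ : Ty S.ty n} {t t' u u' : Tm S n k} :
      Γ.Split Γ₁ Γ₂ → ExtEq Γ₁ t t' (Ty.lolli σ τ) → ExtEq Γ₂ u u' σ →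
      ExtEq Γ (Tm.app t u) (Tm.app t' u') τ
  | lam {n k : ℕ} {Γ : Cx S n k} {σ τ : Ty S.ty n} {t t' : Tm S n (k + 1)} :
      ExtEq (scons (Entry.lin σ) Γ) t t' τ →
      ExtEq Γ (Tm.lam σ t) (Tm.lam σ t') (Ty.lolli σ τ)
  | tens {n k : ℕ} {Γ Γ₁ Γ₂ : Cx S n k} {σ τ : Ty S.ty n} {t t' u u' : Tm S n k} :
      Γ.Split Γ₁ Γ₂ → ExtEq Γ₁ t t' σ → ExtEq Γ₂ u u' τ →
      ExtEq Γ (Tm.tens t u) (Tm.tens t' u') (Ty.tensor σ τ)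
  | bang {n k : ℕ} {Γ : Cx S n k} {σ : Ty S.ty n} {t t' : Tm S n k} :
      Γ.NoLin → ExtEq Γ t t' σ → ExtEq Γ (Tm.bang t) (Tm.bang t') (Ty.bang σ)
  | tlam {n k : ℕ} {Γ : Cx S n k} {σ : Ty S.ty (n + 1)} {t t' : Tm S (n + 1) k} :
      ExtEq Γ.wkTy t t' σ → ExtEq Γ (Tm.tlam t) (Tm.tlam t') (Ty.all σ)
  | tapp {n k : ℕ} {Γ : Cx S n k} {σ : Ty S.ty (n + 1)} {t t' : Tm S n k} (τ : Ty S.ty n) :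
      ExtEq Γ t t' (Ty.all σ) → ExtEq Γ (Tm.tapp t τ) (Tm.tapp t' τ) (σ.inst τ)
  | letTens {n k : ℕ} {Γ Γ₁ Γ₂ : Cx S n k} {σ σ' τ : Ty S.ty n} {t t' : Tm S n k}
      {u u' : Tm S n (k + 2)} :
      Γ.Split Γ₁ Γ₂ → ExtEq Γ₁ t t' (Ty.tensor σ σ') →
      ExtEq (scons (Entry.lin σ') (scons (Entry.lin σ) Γ₂)) u u' τ →
      ExtEq Γ (Tm.letTens σ σ' t u) (Tm.letTens σ σ' t' u') τ
  | letBang {n k : ℕ} {Γ Γ₁ Γ₂ : Cx S n k} {σ τ : Ty S.ty n} {t t' : Tm S n k}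
      {u u' : Tm S n (k + 1)} :
      Γ.Split Γ₁ Γ₂ → ExtEq Γ₁ t t' (Ty.bang σ) →
      ExtEq (scons (Entry.unr σ) Γ₂) u u' τ →
      ExtEq Γ (Tm.letBang σ t u) (Tm.letBang σ t' u') τ
  | letStar {n k : ℕ} {Γ Γ₁ Γ₂ : Cx S n k} {τ : Ty S.ty n} {t t' u u' : Tm S n k} :
      Γ.Split Γ₁ Γ₂ → ExtEq Γ₁ t t' Ty.unit → ExtEq Γ₂ u u' τ →
      ExtEq Γ (Tm.letStar t u) (Tm.letStar t' u') τ
  -- beta and eta rules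
  | betaTm {n k : ℕ} {Γ Γ₁ Γ₂ : Cx S n k} {σ τ : Ty S.ty n} {t : Tm S n (k + 1)}
      {u : Tm S n k} :
      Γ.Split Γ₁ Γ₂ → HasType (scons (Entry.lin σ) Γ₁) t τ → HasType Γ₂ u σ →
      ExtEq Γ (Tm.app (Tm.lam σ t) u) (t.inst u) τ
  | betaTy {n k : ℕ} {Γ : Cx S n k} {τ : Ty S.ty (n + 1)} {t : Tm S (n + 1) k}
      (σ : Ty S.ty n) :
      HasType Γ.wkTy t τ → ExtEq Γ (Tm.tapp (Tm.tlam t) σ) (t.instTy σ) (τ.inst σ)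
  | etaTm {n k : ℕ} {Γ : Cx S n k} {σ τ : Ty S.ty n} {t : Tm S n k} :
      HasType Γ t (Ty.lolli σ τ) →
      ExtEq Γ (Tm.lam σ (Tm.app t.wk (Tm.var 0))) t (Ty.lolli σ τ)
  | etaTy {n k : ℕ} {Γ : Cx S n k} {σ : Ty S.ty (n + 1)} {t : Tm S n k} :
      HasType Γ t (Ty.all σ) →
      ExtEq Γ (Tm.tlam (Tm.tapp t.wkTy (Ty.var 0))) t (Ty.all σ)
  | betaStar {n k : ℕ} {Γ : Cx S n k} {σ : Ty S.ty n} {t : Tm S n k} :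
      HasType Γ t σ → ExtEq Γ (Tm.letStar Tm.star t) t σ
  | etaStar {n k : ℕ} {Γ : Cx S n k} {t : Tm S n k} :
      HasType Γ t Ty.unit → ExtEq Γ (Tm.letStar t Tm.star) t Ty.unit
  | betaTens {n k : ℕ} {Γ Γ₀ Γ₁ Γ₂ Γ₃ : Cx S n k} {σ σ' τ : Ty S.ty n} {s u : Tm S n k}
      {t : Tm S n (k + 2)} :
      Γ.Split Γ₀ Γ₃ → Γ₀.Split Γ₁ Γ₂ → HasType Γ₁ s σ → HasType Γ₂ u σ' →
      HasType (scons (Entry.lin σ') (scons (Entry.lin σ) Γ₃)) t τ →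
      ExtEq Γ (Tm.letTens σ σ' (Tm.tens s u) t) (t.inst₂ s u) τ
  | etaTens {n k : ℕ} {Γ : Cx S n k} {σ σ' : Ty S.ty n} {t : Tm S n k} :
      HasType Γ t (Ty.tensor σ σ') →
      ExtEq Γ (Tm.letTens σ σ' t (Tm.tens (Tm.var 1) (Tm.var 0))) t (Ty.tensor σ σ')
  | betaBang {n k : ℕ} {Γ Γ₁ Γ₂ : Cx S n k} {σ τ : Ty S.ty n} {u : Tm S n k}
      {t : Tm S n (k + 1)} :
      Γ.Split Γ₁ Γ₂ → Γ₁.NoLin → HasType Γ₁ u σ → HasType (scons (Entry.unr σ) Γ₂) t τ →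
      ExtEq Γ (Tm.letBang σ (Tm.bang u) t) (t.inst u) τ
  | etaBang {n k : ℕ} {Γ : Cx S n k} {σ : Ty S.ty n} {t : Tm S n k} :
      HasType Γ t (Ty.bang σ) →
      ExtEq Γ (Tm.letBang σ t (Tm.bang (Tm.var 0))) t (Ty.bang σ)
  -- commuting conversions
  | commStar {n k : ℕ} {Γ Γ₀ Γ₁ Γ₂ Γ₃ : Cx S n k} {ρ τ : Ty S.ty n} {t u : Tm S n k}
      {c : Tm S n (k + 1)} :
      Γ.Split Γ₀ Γ₃ → Γ₀.Split Γ₁ Γ₂ → HasType Γ₁ t Ty.unit → HasType Γ₂ u ρ →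
      HasType (scons (Entry.lin ρ) Γ₃) c τ →
      ExtEq Γ (Tm.letStar t (c.inst u)) (c.inst (Tm.letStar t u)) τ
  | commTens {n k : ℕ} {Γ Γ₀ Γ₁ Γ₂ Γ₃ : Cx S n k} {σ σ' ρ τ : Ty S.ty n} {t : Tm S n k}
      {u : Tm S n (k + 2)} {c : Tm S n (k + 1)} :
      Γ.Split Γ₀ Γ₃ → Γ₀.Split Γ₁ Γ₂ → HasType Γ₁ t (Ty.tensor σ σ') →
      HasType (scons (Entry.lin σ') (scons (Entry.lin σ) Γ₂)) u ρ →
      HasType (scons (Entry.lin ρ) Γ₃) c τ →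
      ExtEq Γ
        (Tm.letTens σ σ' t
          (Tm.inst (c.ren id (liftR (fun i => i.succ.succ)) : Tm S n (k + 2 + 1)) u))
        (c.inst (Tm.letTens σ σ' t u)) τ
  | commBang {n k : ℕ} {Γ Γ₀ Γ₁ Γ₂ Γ₃ : Cx S n k} {σ ρ τ : Ty S.ty n} {t : Tm S n k}
      {u : Tm S n (k + 1)} {c : Tm S n (k + 1)} :
      Γ.Split Γ₀ Γ₃ → Γ₀.Split Γ₁ Γ₂ → HasType Γ₁ t (Ty.bang σ) →
      HasType (scons (Entry.unr σ) Γ₂) u ρ →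
      HasType (scons (Entry.lin ρ) Γ₃) c τ →
      ExtEq Γ
        (Tm.letBang σ t (Tm.inst (c.ren id (liftR Fin.succ) : Tm S n (k + 1 + 1)) u))
        (c.inst (Tm.letBang σ t u)) τ
  -- unfolding of the fixed point combinator
  | fix {n k : ℕ} {Γ : Cx S n k} {σ : Ty S.ty n} {f : Tm S n k} :
      Γ.NoLin → HasType Γ f (Ty.lolli (Ty.bang σ) σ) →
      ExtEq Γ (Tm.app f (Tm.bang (Tm.app (Tm.tapp Tm.fix σ) (Tm.bang f))))
        (Tm.app (Tm.tapp Tm.fix σ) (Tm.bang f)) σ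

/-! ### Formulas and definable relations -/

/-- Relation variables range over all definable relations or over the admissible ones. -/
inductive Kind : Type
  | rel : Kind
  | adm : Kind

mutual

/-- Propositions with `n` type, `k` term and `r` relation variables in scope. -/
inductive Fm (S : Sig.{u}) : ℕ → ℕ → ℕ → Type u
  /-- internal equality `t =_σ u` -/
  | eq {n k r : ℕ} (σ : Ty S.ty n) (t u : Tm S n k) : Fm S n k r
  /-- `ρ(t, u)` -/
  | rel {n k r : ℕ} (ρ : Rl S n k r) (t u : Tm S n k) : Fm S n k r
  | imp {n k r : ℕ} (φ ψ : Fm S n k r) : Fm S n k r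
  | bot {n k r : ℕ} : Fm S n k r
  | top {n k r : ℕ} : Fm S n k r
  | and {n k r : ℕ} (φ ψ : Fm S n k r) : Fm S n k r
  | or {n k r : ℕ} (φ ψ : Fm S n k r) : Fm S n k r
  | allTy {n k r : ℕ} (φ : Fm S (n + 1) k r) : Fm S n k r
  | allTm {n k r : ℕ} (σ : Ty S.ty n) (φ : Fm S n (k + 1) r) : Fm S n k r
  | allRl {n k r : ℕ} (κ : Kind) (σ τ : Ty S.ty n) (φ : Fm S n k (r + 1)) : Fm S n k r
  | exTy {n k r : ℕ} (φ : Fm S (n + 1) k r) : Fm S n k r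
  | exTm {n k r : ℕ} (σ : Ty S.ty n) (φ : Fm S n (k + 1) r) : Fm S n k r
  | exRl {n k r : ℕ} (κ : Kind) (σ τ : Ty S.ty n) (φ : Fm S n k (r + 1)) : Fm S n k r

/-- Definable relations. -/
inductive Rl (S : Sig.{u}) : ℕ → ℕ → ℕ → Type u
  | var {n k r : ℕ} (i : Fin r) : Rl S n k r
  /-- `(x : σ, y : τ). φ`; in `φ`, `x` has index `1` and `y` has index `0` -/
  | abs {n k r : ℕ} (σ τ : Ty S.ty n) (φ : Fm S n (k + 2) r) : Rl S n k r
  /-- the relational interpretation `σ[ρ₀, …, ρₘ₋₁]` of a type in `m` type variables -/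
  | interp {n k r : ℕ} (m : ℕ) (σ : Ty S.ty m) (ρ : Fin m → Rl S n k r) : Rl S n k r

end

variable {S : Sig.{u}}

mutual

/-- Simultaneous renaming of type, term and relation variables. -/
def Fm.ren : {n m k l r q : ℕ} → (Fin n → Fin m) → (Fin k → Fin l) → (Fin r → Fin q) →
    Fm S n k r → Fm S m l q
  | _, _, _, _, _, _, f, g, _, .eq σ t u => .eq (σ.ren f) (t.ren f g) (u.ren f g)
  | _, _, _, _, _, _, f, g, h, .rel ρ t u => .rel (ρ.ren f g h) (t.ren f g) (u.ren f g)
  | _, _, _, _, _, _, f, g, h, .imp φ ψ => .imp (φ.ren f g h) (ψ.ren f g h)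
  | _, _, _, _, _, _, _, _, _, .bot => .bot
  | _, _, _, _, _, _, _, _, _, .top => .top
  | _, _, _, _, _, _, f, g, h, .and φ ψ => .and (φ.ren f g h) (ψ.ren f g h)
  | _, _, _, _, _, _, f, g, h, .or φ ψ => .or (φ.ren f g h) (ψ.ren f g h)
  | _, _, _, _, _, _, f, g, h, .allTy φ => .allTy (φ.ren (liftR f) g h)
  | _, _, _, _, _, _, f, g, h, .allTm σ φ => .allTm (σ.ren f) (φ.ren f (liftR g) h)
  | _, _, _, _, _, _, f, g, h, .allRl κ σ τ φ =>
      .allRl κ (σ.ren f) (τ.ren f) (φ.ren f g (liftR h))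
  | _, _, _, _, _, _, f, g, h, .exTy φ => .exTy (φ.ren (liftR f) g h)
  | _, _, _, _, _, _, f, g, h, .exTm σ φ => .exTm (σ.ren f) (φ.ren f (liftR g) h)
  | _, _, _, _, _, _, f, g, h, .exRl κ σ τ φ =>
      .exRl κ (σ.ren f) (τ.ren f) (φ.ren f g (liftR h))

def Rl.ren : {n m k l r q : ℕ} → (Fin n → Fin m) → (Fin k → Fin l) → (Fin r → Fin q) →
    Rl S n k r → Rl S m l q
  | _, _, _, _, _, _, _, _, h, .var i => .var (h i)
  | _, _, _, _, _, _, f, g, h, .abs σ τ φ =>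
      .abs (σ.ren f) (τ.ren f) (φ.ren f (liftR (liftR g)) h)
  | _, _, _, _, _, _, f, g, h, .interp m σ ρ => .interp m σ (fun i => (ρ i).ren f g h)

end

namespace Rl

abbrev wkTy {n k r : ℕ} (ρ : Rl S n k r) : Rl S (n + 1) k r := ρ.ren Fin.succ id id
abbrev wkTm {n k r : ℕ} (ρ : Rl S n k r) : Rl S n (k + 1) r := ρ.ren id Fin.succ id
abbrev wkRl {n k r : ℕ} (ρ : Rl S n k r) : Rl S n k (r + 1) := ρ.ren id id Fin.succ

/-- Lift a relation substitution under a relation binder. -/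
def lift {n k r q : ℕ} (s : Fin r → Rl S n k q) : Fin (r + 1) → Rl S n k (q + 1) :=
  scons (.var 0) (fun i => (s i).wkRl)

end Rl

mutual

/-- Simultaneous capture-avoiding substitution for type, term and relation variables. -/
def Fm.sub : {n m k l r q : ℕ} → (Fin n → Ty S.ty m) → (Fin k → Tm S m l) →
    (Fin r → Rl S m l q) → Fm S n k r → Fm S m l q
  | _, _, _, _, _, _, s, e, _, .eq σ t u => .eq (σ.sub s) (t.sub s e) (u.sub s e)
  | _, _, _, _, _, _, s, e, d, .rel ρ t u => .rel (ρ.sub s e d) (t.sub s e) (u.sub s e)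
  | _, _, _, _, _, _, s, e, d, .imp φ ψ => .imp (φ.sub s e d) (ψ.sub s e d)
  | _, _, _, _, _, _, _, _, _, .bot => .bot
  | _, _, _, _, _, _, _, _, _, .top => .top
  | _, _, _, _, _, _, s, e, d, .and φ ψ => .and (φ.sub s e d) (ψ.sub s e d)
  | _, _, _, _, _, _, s, e, d, .or φ ψ => .or (φ.sub s e d) (ψ.sub s e d)
  | _, _, _, _, _, _, s, e, d, .allTy φ =>
      .allTy (φ.sub (Ty.lift s) (fun i => (e i).wkTy) (fun i => (d i).wkTy))
  | _, _, _, _, _, _, s, e, d, .allTm σ φ =>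
      .allTm (σ.sub s) (φ.sub s (Tm.lift e) (fun i => (d i).wkTm))
  | _, _, _, _, _, _, s, e, d, .allRl κ σ τ φ =>
      .allRl κ (σ.sub s) (τ.sub s) (φ.sub s e (Rl.lift d))
  | _, _, _, _, _, _, s, e, d, .exTy φ =>
      .exTy (φ.sub (Ty.lift s) (fun i => (e i).wkTy) (fun i => (d i).wkTy))
  | _, _, _, _, _, _, s, e, d, .exTm σ φ =>
      .exTm (σ.sub s) (φ.sub s (Tm.lift e) (fun i => (d i).wkTm))
  | _, _, _, _, _, _, s, e, d, .exRl κ σ τ φ =>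
      .exRl κ (σ.sub s) (τ.sub s) (φ.sub s e (Rl.lift d))

def Rl.sub : {n m k l r q : ℕ} → (Fin n → Ty S.ty m) → (Fin k → Tm S m l) →
    (Fin r → Rl S m l q) → Rl S n k r → Rl S m l q
  | _, _, _, _, _, _, _, _, d, .var i => d i
  | _, _, _, _, _, _, s, e, d, .abs σ τ φ =>
      .abs (σ.sub s) (τ.sub s)
        (φ.sub s (Tm.lift (Tm.lift e)) (fun i => (d i).wkTm.wkTm))
  | _, _, _, _, _, _, s, e, d, .interp m σ ρ => .interp m σ (fun i => (ρ i).sub s e d)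

end

namespace Fm

abbrev wkTy {n k r : ℕ} (φ : Fm S n k r) : Fm S (n + 1) k r := φ.ren Fin.succ id id
abbrev wkTm {n k r : ℕ} (φ : Fm S n k r) : Fm S n (k + 1) r := φ.ren id Fin.succ id
abbrev wkRl {n k r : ℕ} (φ : Fm S n k r) : Fm S n k (r + 1) := φ.ren id id Fin.succ

/-- `φ[σ/α]` -/
abbrev instTy {n k r : ℕ} (φ : Fm S (n + 1) k r) (σ : Ty S.ty n) : Fm S n k r :=
  φ.sub (scons σ Ty.var) Tm.var Rl.var

/-- `φ[t/x]` -/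
abbrev instTm {n k r : ℕ} (φ : Fm S n (k + 1) r) (t : Tm S n k) : Fm S n k r :=
  φ.sub Ty.var (scons t Tm.var) Rl.var

/-- `φ[t, u / x, y]` where `x` has index `1` and `y` has index `0` -/
abbrev instTm₂ {n k r : ℕ} (φ : Fm S n (k + 2) r) (t u : Tm S n k) : Fm S n k r :=
  φ.sub Ty.var (scons u (scons t Tm.var)) Rl.var

/-- `φ[ρ/R]` -/
abbrev instRl {n k r : ℕ} (φ : Fm S n k (r + 1)) (ρ : Rl S n k r) : Fm S n k r :=
  φ.sub Ty.var Tm.var (scons ρ Rl.var)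

/-- Biimplication. -/
def iff {n k r : ℕ} (φ ψ : Fm S n k r) : Fm S n k r := .and (.imp φ ψ) (.imp ψ φ)

end Fm

/-! ### Constructions on definable relations -/

namespace Rl

/-- `ρ ≡ ρ'`, i.e. `∀ x : σ, y : τ. ρ(x, y) ⊃⊂ ρ'(x, y)`. -/
def equiv {n k r : ℕ} (σ τ : Ty S.ty n) (ρ ρ' : Rl S n k r) : Fm S n k r :=
  .allTm σ (.allTm τ (.iff
    (.rel ρ.wkTm.wkTm (.var 1) (.var 0)) (.rel ρ'.wkTm.wkTm (.var 1) (.var 0))))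

/-- The graph `⟨f⟩ = (x : σ, y : τ). f x =_τ y`. -/
def graph {n k r : ℕ} (σ τ : Ty S.ty n) (f : Tm S n k) : Rl S n k r :=
  .abs σ τ (.eq τ (.app f.wk.wk (.var 1)) (.var 0))

/-- The equality relation, defined as the graph of the identity. -/
def eqRel {n k r : ℕ} (σ : Ty S.ty n) : Rl S n k r := graph σ σ (Tm.idTm σ)

/-- `ρ ⊸ ρ' : Rel(σ ⊸ σ', τ ⊸ τ')` for `ρ : Rel(σ, τ)` and `ρ' : Rel(σ', τ')`:
`(f, g). ∀ x : σ. ∀ y : τ. ρ(x, y) ⊃ ρ'(f x, g y)`. -/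
def lolli {n k r : ℕ} (σ τ σ' τ' : Ty S.ty n) (ρ ρ' : Rl S n k r) : Rl S n k r :=
  .abs (.lolli σ σ') (.lolli τ τ') (.allTm σ (.allTm τ (.imp
    (.rel ρ.wkTm.wkTm.wkTm.wkTm (.var 1) (.var 0))
    (.rel ρ'.wkTm.wkTm.wkTm.wkTm (.app (.var 3) (.var 1)) (.app (.var 2) (.var 0))))))

/-- `ρ → ρ' : Rel(σ → σ', τ → τ')` for `ρ : Rel(σ, τ)` and `ρ' : Rel(σ', τ')`:
`(f, g). ∀ x : σ. ∀ y : τ. ρ(x, y) ⊃ ρ'(f (!x), g (!y))`. -/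
def arrow {n k r : ℕ} (σ τ σ' τ' : Ty S.ty n) (ρ ρ' : Rl S n k r) : Rl S n k r :=
  .abs (.arrow σ σ') (.arrow τ τ') (.allTm σ (.allTm τ (.imp
    (.rel ρ.wkTm.wkTm.wkTm.wkTm (.var 1) (.var 0))
    (.rel ρ'.wkTm.wkTm.wkTm.wkTm
      (.app (.var 3) (.bang (.var 1))) (.app (.var 2) (.bang (.var 0)))))))

/-- `∀ α, β, R : Adm(α, β). φ`; in `φ` the variable `α` has index `1` and `β` has index `0`. -/
def allAdm {n k r : ℕ} (φ : Fm S (n + 2) k (r + 1)) : Fm S n k r :=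
  .allTy (.allTy (.allRl .adm (.var 1) (.var 0) φ))

/-- Weakening under `∀ α, β, R : Adm(α, β)`. -/
abbrev wkAdm {n k r : ℕ} (ρ : Rl S n k r) : Rl S (n + 2) k (r + 1) := ρ.wkTy.wkTy.wkRl

/-- `∀ (α, β, R : Adm(α, β)). ρ : Rel(∏ α. σ, ∏ β. τ)`:
`(t, u). ∀ α, β. ∀ R : Adm(α, β). ρ(t α, u β)`. -/
def all {n k r : ℕ} (σ τ : Ty S.ty (n + 1)) (ρ : Rl S (n + 2) k (r + 1)) : Rl S n k r :=
  .abs (.all σ) (.all τ) (allAdm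
    (.rel ρ.wkTm.wkTm (.tapp (.var 1) (.var 1)) (.tapp (.var 0) (.var 0))))

/-- `ρ ⊗ ρ' : Rel(σ ⊗ σ', τ ⊗ τ')` for `ρ : Rel(σ, τ)` and `ρ' : Rel(σ', τ')`:
`(x, y). ∀ α, β, R : Adm(α, β). ∀ t : σ ⊸ σ' ⊸ α, t' : τ ⊸ τ' ⊸ β.
  (ρ ⊸ ρ' ⊸ R)(t, t') ⊃ R(let x' ⊗ x'' be x in t x' x'', let y' ⊗ y'' be y in t' y' y'')`. -/
def tensor {n k r : ℕ} (σ τ σ' τ' : Ty S.ty n) (ρ ρ' : Rl S n k r) : Rl S n k r :=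
  .abs (.tensor σ σ') (.tensor τ τ') (allAdm
    (.allTm (.lolli σ.wk.wk (.lolli σ'.wk.wk (.var 1)))
    (.allTm (.lolli τ.wk.wk (.lolli τ'.wk.wk (.var 0))) (.imp
      (.rel
        (lolli σ.wk.wk τ.wk.wk (.lolli σ'.wk.wk (.var 1)) (.lolli τ'.wk.wk (.var 0))
          ρ.wkAdm.wkTm.wkTm.wkTm.wkTm
          (lolli σ'.wk.wk τ'.wk.wk (.var 1) (.var 0) ρ'.wkAdm.wkTm.wkTm.wkTm.wkTm (.var 0)))
        (.var 1) (.var 0))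
      (.rel (.var 0)
        (.letTens σ.wk.wk σ'.wk.wk (.var 3) (.app (.app (.var 3) (.var 1)) (.var 0)))
        (.letTens τ.wk.wk τ'.wk.wk (.var 2) (.app (.app (.var 2) (.var 1)) (.var 0))))))))

/-- `I_Rel : Rel(I, I)`:
`(x, y). ∀ α, β, R : Adm(α, β). ∀ z : α, w : β. R(z, w) ⊃ R(let ⋆ be x in z, let ⋆ be y in w)`. -/
def unit {n k r : ℕ} : Rl S n k r :=
  .abs .unit .unit (allAdm (.allTm (.var 1) (.allTm (.var 0) (.imp
    (.rel (.var 0) (.var 1) (.var 0))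
    (.rel (.var 0) (.letStar (.var 3) (.var 1)) (.letStar (.var 2) (.var 0)))))))

/-- `!ρ : Rel(!σ, !τ)` for `ρ : Rel(σ, τ)`:
`(x, y). ∀ α, β, R : Adm(α, β). ∀ g : σ → α, h : τ → β. (ρ → R)(g, h) ⊃ R(g x, h y)`. -/
def bang {n k r : ℕ} (σ τ : Ty S.ty n) (ρ : Rl S n k r) : Rl S n k r :=
  .abs (.bang σ) (.bang τ) (allAdm
    (.allTm (.arrow σ.wk.wk (.var 1)) (.allTm (.arrow τ.wk.wk (.var 0)) (.imp
      (.rel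
        (arrow σ.wk.wk τ.wk.wk (.var 1) (.var 0) ρ.wkAdm.wkTm.wkTm.wkTm.wkTm (.var 0))
        (.var 1) (.var 0))
      (.rel (.var 0) (.app (.var 1) (.var 3)) (.app (.var 0) (.var 2)))))))

end Rl

/-! ### The logic -/

/-- Declaration `R : Rel(σ, τ)` or `R : Adm(σ, τ)` of a relation variable. -/
structure RlDecl (S : Sig.{u}) (n : ℕ) where
  kind : Kind
  dom : Ty S.ty n
  cod : Ty S.ty n

/-- Relational contexts. -/
abbrev RCx (S : Sig.{u}) (n r : ℕ) : Type u := Fin r → RlDecl S n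

def RCx.wkTy {n r : ℕ} (Θ : RCx S n r) : RCx S (n + 1) r :=
  fun i => ⟨(Θ i).kind, (Θ i).dom.wk, (Θ i).cod.wk⟩

/-- Which of the two optional axiom schemes are assumed. -/
structure Schemes where
  extensionality : Prop
  identityExtension : Prop

mutual

/-- `Ξ | Γ | Θ ⊢ φ : Prop`. -/
inductive WfFm (P : Schemes) : {n k r : ℕ} → ICx S n k → RCx S n r → Fm S n k r → Prop
  | eq {n k r : ℕ} {Γ : ICx S n k} {Θ : RCx S n r} {σ : Ty S.ty n} {t u : Tm S n k} :
      HasType Γ.toCx t σ → HasType Γ.toCx u σ → WfFm P Γ Θ (.eq σ t u)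
  | rel {n k r : ℕ} {Γ : ICx S n k} {Θ : RCx S n r} {σ τ : Ty S.ty n} {ρ : Rl S n k r}
      {t u : Tm S n k} :
      WfRl P Γ Θ ρ σ τ → HasType Γ.toCx t σ → HasType Γ.toCx u τ → WfFm P Γ Θ (.rel ρ t u)
  | imp {n k r : ℕ} {Γ : ICx S n k} {Θ : RCx S n r} {φ ψ : Fm S n k r} :
      WfFm P Γ Θ φ → WfFm P Γ Θ ψ → WfFm P Γ Θ (.imp φ ψ)
  | bot {n k r : ℕ} {Γ : ICx S n k} {Θ : RCx S n r} : WfFm P Γ Θ .bot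
  | top {n k r : ℕ} {Γ : ICx S n k} {Θ : RCx S n r} : WfFm P Γ Θ .top
  | and {n k r : ℕ} {Γ : ICx S n k} {Θ : RCx S n r} {φ ψ : Fm S n k r} :
      WfFm P Γ Θ φ → WfFm P Γ Θ ψ → WfFm P Γ Θ (.and φ ψ)
  | or {n k r : ℕ} {Γ : ICx S n k} {Θ : RCx S n r} {φ ψ : Fm S n k r} :
      WfFm P Γ Θ φ → WfFm P Γ Θ ψ → WfFm P Γ Θ (.or φ ψ)
  | allTy {n k r : ℕ} {Γ : ICx S n k} {Θ : RCx S n r} {φ : Fm S (n + 1) k r} :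
      WfFm P Γ.wkTy Θ.wkTy φ → WfFm P Γ Θ (.allTy φ)
  | allTm {n k r : ℕ} {Γ : ICx S n k} {Θ : RCx S n r} {σ : Ty S.ty n}
      {φ : Fm S n (k + 1) r} :
      WfFm P (scons σ Γ) Θ φ → WfFm P Γ Θ (.allTm σ φ)
  | allRl {n k r : ℕ} {Γ : ICx S n k} {Θ : RCx S n r} {κ : Kind} {σ τ : Ty S.ty n}
      {φ : Fm S n k (r + 1)} :
      WfFm P Γ (scons ⟨κ, σ, τ⟩ Θ) φ → WfFm P Γ Θ (.allRl κ σ τ φ)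
  | exTy {n k r : ℕ} {Γ : ICx S n k} {Θ : RCx S n r} {φ : Fm S (n + 1) k r} :
      WfFm P Γ.wkTy Θ.wkTy φ → WfFm P Γ Θ (.exTy φ)
  | exTm {n k r : ℕ} {Γ : ICx S n k} {Θ : RCx S n r} {σ : Ty S.ty n}
      {φ : Fm S n (k + 1) r} :
      WfFm P (scons σ Γ) Θ φ → WfFm P Γ Θ (.exTm σ φ)
  | exRl {n k r : ℕ} {Γ : ICx S n k} {Θ : RCx S n r} {κ : Kind} {σ τ : Ty S.ty n}
      {φ : Fm S n k (r + 1)} :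
      WfFm P Γ (scons ⟨κ, σ, τ⟩ Θ) φ → WfFm P Γ Θ (.exRl κ σ τ φ)

/-- `Ξ | Γ | Θ ⊢ ρ : Rel(σ, τ)`. -/
inductive WfRl (P : Schemes) : {n k r : ℕ} → ICx S n k → RCx S n r → Rl S n k r →
    Ty S.ty n → Ty S.ty n → Prop
  | var {n k r : ℕ} {Γ : ICx S n k} {Θ : RCx S n r} {σ τ : Ty S.ty n} (i : Fin r) :
      Θ i = ⟨.rel, σ, τ⟩ → WfRl P Γ Θ (.var i) σ τ
  | abs {n k r : ℕ} {Γ : ICx S n k} {Θ : RCx S n r} {σ τ : Ty S.ty n}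
      {φ : Fm S n (k + 2) r} :
      WfFm P (scons τ (scons σ Γ)) Θ φ → WfRl P Γ Θ (.abs σ τ φ) σ τ
  | ofAdm {n k r : ℕ} {Γ : ICx S n k} {Θ : RCx S n r} {σ τ : Ty S.ty n} {ρ : Rl S n k r} :
      Adm P Γ Θ ρ σ τ → WfRl P Γ Θ ρ σ τ

/-- `Ξ | Γ | Θ ⊢ ρ : Adm(σ, τ)`. -/
inductive Adm (P : Schemes) : {n k r : ℕ} → ICx S n k → RCx S n r → Rl S n k r →
    Ty S.ty n → Ty S.ty n → Prop
  | var {n k r : ℕ} {Γ : ICx S n k} {Θ : RCx S n r} {σ τ : Ty S.ty n} (i : Fin r) :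
      Θ i = ⟨.adm, σ, τ⟩ → Adm P Γ Θ (.var i) σ τ
  | eqRel {n k r : ℕ} {Γ : ICx S n k} {Θ : RCx S n r} (σ : Ty S.ty n) :
      Adm P Γ Θ (Rl.eqRel σ) σ σ
  | reindex {n k r : ℕ} {Γ : ICx S n k} {Θ : RCx S n r} {σ τ σ' τ' : Ty S.ty n}
      {ρ : Rl S n k r} {t u : Tm S n k} :
      Adm P Γ Θ ρ σ τ → HasType Γ.toCx t (.lolli σ' σ) → HasType Γ.toCx u (.lolli τ' τ) →
      Adm P Γ Θ
        (.abs σ' τ' (.rel ρ.wkTm.wkTm (.app t.wk.wk (.var 1)) (.app u.wk.wk (.var 0)))) σ' τ'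
  | and {n k r : ℕ} {Γ : ICx S n k} {Θ : RCx S n r} {σ τ : Ty S.ty n} {ρ ρ' : Rl S n k r} :
      Adm P Γ Θ ρ σ τ → Adm P Γ Θ ρ' σ τ →
      Adm P Γ Θ
        (.abs σ τ (.and (.rel ρ.wkTm.wkTm (.var 1) (.var 0))
          (.rel ρ'.wkTm.wkTm (.var 1) (.var 0)))) σ τ
  | op {n k r : ℕ} {Γ : ICx S n k} {Θ : RCx S n r} {σ τ : Ty S.ty n} {ρ : Rl S n k r} :
      Adm P Γ Θ ρ σ τ → Adm P Γ Θ (.abs τ σ (.rel ρ.wkTm.wkTm (.var 0) (.var 1))) τ σ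
  | top {n k r : ℕ} {Γ : ICx S n k} {Θ : RCx S n r} (σ τ : Ty S.ty n) :
      Adm P Γ Θ (.abs σ τ .top) σ τ
  | imp {n k r : ℕ} {Γ : ICx S n k} {Θ : RCx S n r} {σ τ : Ty S.ty n} {ρ : Rl S n k r}
      {φ : Fm S n k r} :
      Adm P Γ Θ ρ σ τ → WfFm P Γ Θ φ →
      Adm P Γ Θ (.abs σ τ (.imp φ.wkTm.wkTm (.rel ρ.wkTm.wkTm (.var 1) (.var 0)))) σ τ
  | allTy {n k r : ℕ} {Γ : ICx S n k} {Θ : RCx S n r} {σ τ : Ty S.ty n}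
      {ρ : Rl S (n + 1) k r} :
      Adm P Γ.wkTy Θ.wkTy ρ σ.wk τ.wk →
      Adm P Γ Θ (.abs σ τ (.allTy (.rel ρ.wkTm.wkTm (.var 1) (.var 0)))) σ τ
  | allTm {n k r : ℕ} {Γ : ICx S n k} {Θ : RCx S n r} {σ τ ω : Ty S.ty n}
      {ρ : Rl S n (k + 1) r} :
      Adm P (scons ω Γ) Θ ρ σ τ →
      Adm P Γ Θ
        (.abs σ τ (.allTm ω
          (.rel (ρ.ren id (liftR (fun i => i.succ.succ)) id) (.var 2) (.var 1)))) σ τ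
  | allRl {n k r : ℕ} {Γ : ICx S n k} {Θ : RCx S n r} {κ : Kind} {σ τ ω ω' : Ty S.ty n}
      {ρ : Rl S n k (r + 1)} :
      Adm P Γ (scons ⟨κ, ω, ω'⟩ Θ) ρ σ τ →
      Adm P Γ Θ (.abs σ τ (.allRl κ ω ω' (.rel ρ.wkTm.wkTm (.var 1) (.var 0)))) σ τ
  | ofEquiv {n k r : ℕ} {Γ : ICx S n k} {Θ : RCx S n r} {σ τ : Ty S.ty n}
      {ρ ρ' : Rl S n k r} :
      Adm P Γ Θ ρ σ τ → WfRl P Γ Θ ρ' σ τ → Prov P Γ Θ [] (Rl.equiv σ τ ρ ρ') →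
      Adm P Γ Θ ρ' σ τ
  | interp {n k r m : ℕ} {Γ : ICx S n k} {Θ : RCx S n r} (σ : Ty S.ty m)
      {τ τ' : Fin m → Ty S.ty n} {ρ : Fin m → Rl S n k r} :
      (∀ i, Adm P Γ Θ (ρ i) (τ i) (τ' i)) →
      Adm P Γ Θ (.interp m σ ρ) (σ.sub τ) (σ.sub τ')

/-- `Ξ | Γ | Θ | Φ ⊢ φ`: provability in (intuitionistic) LAPL. -/
inductive Prov (P : Schemes) : {n k r : ℕ} → ICx S n k → RCx S n r → List (Fm S n k r) →
    Fm S n k r → Prop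
  -- propositional logic
  | hyp {n k r : ℕ} {Γ : ICx S n k} {Θ : RCx S n r} {Φ : List (Fm S n k r)}
      {φ : Fm S n k r} :
      WfFm P Γ Θ φ → φ ∈ Φ → Prov P Γ Θ Φ φ
  | topI {n k r : ℕ} {Γ : ICx S n k} {Θ : RCx S n r} {Φ : List (Fm S n k r)} :
      Prov P Γ Θ Φ .top
  | botE {n k r : ℕ} {Γ : ICx S n k} {Θ : RCx S n r} {Φ : List (Fm S n k r)}
      {φ : Fm S n k r} :
      WfFm P Γ Θ φ → Prov P Γ Θ Φ .bot → Prov P Γ Θ Φ φ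
  | andI {n k r : ℕ} {Γ : ICx S n k} {Θ : RCx S n r} {Φ : List (Fm S n k r)}
      {φ ψ : Fm S n k r} :
      Prov P Γ Θ Φ φ → Prov P Γ Θ Φ ψ → Prov P Γ Θ Φ (.and φ ψ)
  | andE₁ {n k r : ℕ} {Γ : ICx S n k} {Θ : RCx S n r} {Φ : List (Fm S n k r)}
      {φ ψ : Fm S n k r} :
      Prov P Γ Θ Φ (.and φ ψ) → Prov P Γ Θ Φ φ
  | andE₂ {n k r : ℕ} {Γ : ICx S n k} {Θ : RCx S n r} {Φ : List (Fm S n k r)}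
      {φ ψ : Fm S n k r} :
      Prov P Γ Θ Φ (.and φ ψ) → Prov P Γ Θ Φ ψ
  | orI₁ {n k r : ℕ} {Γ : ICx S n k} {Θ : RCx S n r} {Φ : List (Fm S n k r)}
      {φ ψ : Fm S n k r} :
      WfFm P Γ Θ ψ → Prov P Γ Θ Φ φ → Prov P Γ Θ Φ (.or φ ψ)
  | orI₂ {n k r : ℕ} {Γ : ICx S n k} {Θ : RCx S n r} {Φ : List (Fm S n k r)}
      {φ ψ : Fm S n k r} :
      WfFm P Γ Θ φ → Prov P Γ Θ Φ ψ → Prov P Γ Θ Φ (.or φ ψ)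
  | orE {n k r : ℕ} {Γ : ICx S n k} {Θ : RCx S n r} {Φ : List (Fm S n k r)}
      {φ ψ χ : Fm S n k r} :
      Prov P Γ Θ Φ (.or φ ψ) → Prov P Γ Θ (φ :: Φ) χ → Prov P Γ Θ (ψ :: Φ) χ →
      Prov P Γ Θ Φ χ
  | impI {n k r : ℕ} {Γ : ICx S n k} {Θ : RCx S n r} {Φ : List (Fm S n k r)}
      {φ ψ : Fm S n k r} :
      WfFm P Γ Θ φ → Prov P Γ Θ (φ :: Φ) ψ → Prov P Γ Θ Φ (.imp φ ψ)
  | impE {n k r : ℕ} {Γ : ICx S n k} {Θ : RCx S n r} {Φ : List (Fm S n k r)}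
      {φ ψ : Fm S n k r} :
      Prov P Γ Θ Φ (.imp φ ψ) → Prov P Γ Θ Φ φ → Prov P Γ Θ Φ ψ
  -- universal quantification
  | allTyI {n k r : ℕ} {Γ : ICx S n k} {Θ : RCx S n r} {Φ : List (Fm S n k r)}
      {φ : Fm S (n + 1) k r} :
      Prov P Γ.wkTy Θ.wkTy (Φ.map Fm.wkTy) φ → Prov P Γ Θ Φ (.allTy φ)
  | allTyE {n k r : ℕ} {Γ : ICx S n k} {Θ : RCx S n r} {Φ : List (Fm S n k r)}
      {φ : Fm S (n + 1) k r} (σ : Ty S.ty n) :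
      Prov P Γ Θ Φ (.allTy φ) → Prov P Γ Θ Φ (φ.instTy σ)
  | allTmI {n k r : ℕ} {Γ : ICx S n k} {Θ : RCx S n r} {Φ : List (Fm S n k r)}
      {σ : Ty S.ty n} {φ : Fm S n (k + 1) r} :
      Prov P (scons σ Γ) Θ (Φ.map Fm.wkTm) φ → Prov P Γ Θ Φ (.allTm σ φ)
  | allTmE {n k r : ℕ} {Γ : ICx S n k} {Θ : RCx S n r} {Φ : List (Fm S n k r)}
      {σ : Ty S.ty n} {φ : Fm S n (k + 1) r} {t : Tm S n k} :
      Prov P Γ Θ Φ (.allTm σ φ) → HasType Γ.toCx t σ → Prov P Γ Θ Φ (φ.instTm t)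
  | allRlI {n k r : ℕ} {Γ : ICx S n k} {Θ : RCx S n r} {Φ : List (Fm S n k r)} {κ : Kind}
      {σ τ : Ty S.ty n} {φ : Fm S n k (r + 1)} :
      Prov P Γ (scons ⟨κ, σ, τ⟩ Θ) (Φ.map Fm.wkRl) φ → Prov P Γ Θ Φ (.allRl κ σ τ φ)
  | allRelE {n k r : ℕ} {Γ : ICx S n k} {Θ : RCx S n r} {Φ : List (Fm S n k r)}
      {σ τ : Ty S.ty n} {φ : Fm S n k (r + 1)} {ρ : Rl S n k r} :
      Prov P Γ Θ Φ (.allRl .rel σ τ φ) → WfRl P Γ Θ ρ σ τ → Prov P Γ Θ Φ (φ.instRl ρ)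
  | allAdmE {n k r : ℕ} {Γ : ICx S n k} {Θ : RCx S n r} {Φ : List (Fm S n k r)}
      {σ τ : Ty S.ty n} {φ : Fm S n k (r + 1)} {ρ : Rl S n k r} :
      Prov P Γ Θ Φ (.allRl .adm σ τ φ) → Adm P Γ Θ ρ σ τ → Prov P Γ Θ Φ (φ.instRl ρ)
  -- existential quantification
  | exTyI {n k r : ℕ} {Γ : ICx S n k} {Θ : RCx S n r} {Φ : List (Fm S n k r)}
      {φ : Fm S (n + 1) k r} (σ : Ty S.ty n) :
      WfFm P Γ.wkTy Θ.wkTy φ → Prov P Γ Θ Φ (φ.instTy σ) → Prov P Γ Θ Φ (.exTy φ)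
  | exTyE {n k r : ℕ} {Γ : ICx S n k} {Θ : RCx S n r} {Φ : List (Fm S n k r)}
      {φ : Fm S (n + 1) k r} {ψ : Fm S n k r} :
      Prov P Γ Θ Φ (.exTy φ) → WfFm P Γ Θ ψ →
      Prov P Γ.wkTy Θ.wkTy (φ :: Φ.map Fm.wkTy) ψ.wkTy → Prov P Γ Θ Φ ψ
  | exTmI {n k r : ℕ} {Γ : ICx S n k} {Θ : RCx S n r} {Φ : List (Fm S n k r)}
      {σ : Ty S.ty n} {φ : Fm S n (k + 1) r} {t : Tm S n k} :
      WfFm P (scons σ Γ) Θ φ → HasType Γ.toCx t σ → Prov P Γ Θ Φ (φ.instTm t) →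
      Prov P Γ Θ Φ (.exTm σ φ)
  | exTmE {n k r : ℕ} {Γ : ICx S n k} {Θ : RCx S n r} {Φ : List (Fm S n k r)}
      {σ : Ty S.ty n} {φ : Fm S n (k + 1) r} {ψ : Fm S n k r} :
      Prov P Γ Θ Φ (.exTm σ φ) → WfFm P Γ Θ ψ →
      Prov P (scons σ Γ) Θ (φ :: Φ.map Fm.wkTm) ψ.wkTm → Prov P Γ Θ Φ ψ
  | exRelI {n k r : ℕ} {Γ : ICx S n k} {Θ : RCx S n r} {Φ : List (Fm S n k r)}
      {σ τ : Ty S.ty n} {φ : Fm S n k (r + 1)} {ρ : Rl S n k r} :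
      WfFm P Γ (scons ⟨.rel, σ, τ⟩ Θ) φ → WfRl P Γ Θ ρ σ τ → Prov P Γ Θ Φ (φ.instRl ρ) →
      Prov P Γ Θ Φ (.exRl .rel σ τ φ)
  | exAdmI {n k r : ℕ} {Γ : ICx S n k} {Θ : RCx S n r} {Φ : List (Fm S n k r)}
      {σ τ : Ty S.ty n} {φ : Fm S n k (r + 1)} {ρ : Rl S n k r} :
      WfFm P Γ (scons ⟨.adm, σ, τ⟩ Θ) φ → Adm P Γ Θ ρ σ τ → Prov P Γ Θ Φ (φ.instRl ρ) →
      Prov P Γ Θ Φ (.exRl .adm σ τ φ)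
  | exRlE {n k r : ℕ} {Γ : ICx S n k} {Θ : RCx S n r} {Φ : List (Fm S n k r)} {κ : Kind}
      {σ τ : Ty S.ty n} {φ : Fm S n k (r + 1)} {ψ : Fm S n k r} :
      Prov P Γ Θ Φ (.exRl κ σ τ φ) → WfFm P Γ Θ ψ →
      Prov P Γ (scons ⟨κ, σ, τ⟩ Θ) (φ :: Φ.map Fm.wkRl) ψ.wkRl → Prov P Γ Θ Φ ψ
  /-- the substitution rules for term, relation, admissible relation and type variables, in
  simultaneous form (this includes weakening of the contexts) -/
  | subst {n m k l r q : ℕ} {Γ : ICx S n k} {Θ : RCx S n r} {Φ : List (Fm S n k r)}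
      {φ : Fm S n k r} {Γ' : ICx S m l} {Θ' : RCx S m q} (s : Fin n → Ty S.ty m)
      {e : Fin k → Tm S m l} {d : Fin r → Rl S m l q} :
      Prov P Γ Θ Φ φ →
      (∀ i, HasType Γ'.toCx (e i) ((Γ i).sub s)) →
      (∀ i, WfRl P Γ' Θ' (d i) ((Θ i).dom.sub s) ((Θ i).cod.sub s)) →
      (∀ i, (Θ i).kind = .adm → Adm P Γ' Θ' (d i) ((Θ i).dom.sub s) ((Θ i).cod.sub s)) →
      Prov P Γ' Θ' (Φ.map (Fm.sub s e d)) (φ.sub s e d)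
  -- internal equality
  | ofExtEq {n k r : ℕ} {Γ : ICx S n k} {Θ : RCx S n r} {Φ : List (Fm S n k r)}
      {σ : Ty S.ty n} {t u : Tm S n k} :
      ExtEq Γ.toCx t u σ → Prov P Γ Θ Φ (.eq σ t u)
  | symm {n k r : ℕ} {Γ : ICx S n k} {Θ : RCx S n r} {Φ : List (Fm S n k r)}
      {σ : Ty S.ty n} {t u : Tm S n k} :
      Prov P Γ Θ Φ (.eq σ t u) → Prov P Γ Θ Φ (.eq σ u t)
  | trans {n k r : ℕ} {Γ : ICx S n k} {Θ : RCx S n r} {Φ : List (Fm S n k r)}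
      {σ : Ty S.ty n} {t u v : Tm S n k} :
      Prov P Γ Θ Φ (.eq σ t u) → Prov P Γ Θ Φ (.eq σ u v) → Prov P Γ Θ Φ (.eq σ t v)
  /-- the substitution axiom: `R(x, y) ∧ x = x' ∧ y = y' ⊃ R(x', y')` -/
  | substAx {n k r : ℕ} {Γ : ICx S n k} {Θ : RCx S n r} {Φ : List (Fm S n k r)}
      {σ τ : Ty S.ty n} {ρ : Rl S n k r} {t t' u u' : Tm S n k} :
      WfRl P Γ Θ ρ σ τ → Prov P Γ Θ Φ (.rel ρ t u) → Prov P Γ Θ Φ (.eq σ t t') →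
      Prov P Γ Θ Φ (.eq τ u u') → Prov P Γ Θ Φ (.rel ρ t' u')
  -- definable relations
  | defRel {n k r : ℕ} {Γ : ICx S n k} {Θ : RCx S n r} {Φ : List (Fm S n k r)}
      {σ τ : Ty S.ty n} {φ : Fm S n (k + 2) r} {t u : Tm S n k} :
      WfFm P (scons τ (scons σ Γ)) Θ φ → HasType Γ.toCx t σ → HasType Γ.toCx u τ →
      Prov P Γ Θ Φ (.iff (.rel (.abs σ τ φ) t u) (φ.instTm₂ t u))
  -- relational interpretation of types
  | interpVar {n k r m : ℕ} {Γ : ICx S n k} {Θ : RCx S n r} {Φ : List (Fm S n k r)}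
      {τ τ' : Fin m → Ty S.ty n} {ρ : Fin m → Rl S n k r} (i : Fin m) :
      (∀ i, Adm P Γ Θ (ρ i) (τ i) (τ' i)) →
      Prov P Γ Θ Φ (Rl.equiv (τ i) (τ' i) (.interp m (.var i) ρ) (ρ i))
  | interpLolli {n k r m : ℕ} {Γ : ICx S n k} {Θ : RCx S n r} {Φ : List (Fm S n k r)}
      {τ τ' : Fin m → Ty S.ty n} {ρ : Fin m → Rl S n k r} (σ σ' : Ty S.ty m) :
      (∀ i, Adm P Γ Θ (ρ i) (τ i) (τ' i)) →
      Prov P Γ Θ Φ (Rl.equiv ((Ty.lolli σ σ').sub τ) ((Ty.lolli σ σ').sub τ')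
        (.interp m (.lolli σ σ') ρ)
        (Rl.lolli (σ.sub τ) (σ.sub τ') (σ'.sub τ) (σ'.sub τ')
          (.interp m σ ρ) (.interp m σ' ρ)))
  | interpTensor {n k r m : ℕ} {Γ : ICx S n k} {Θ : RCx S n r} {Φ : List (Fm S n k r)}
      {τ τ' : Fin m → Ty S.ty n} {ρ : Fin m → Rl S n k r} (σ σ' : Ty S.ty m) :
      (∀ i, Adm P Γ Θ (ρ i) (τ i) (τ' i)) →
      Prov P Γ Θ Φ (Rl.equiv ((Ty.tensor σ σ').sub τ) ((Ty.tensor σ σ').sub τ')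
        (.interp m (.tensor σ σ') ρ)
        (Rl.tensor (σ.sub τ) (σ.sub τ') (σ'.sub τ) (σ'.sub τ')
          (.interp m σ ρ) (.interp m σ' ρ)))
  | interpUnit {n k r m : ℕ} {Γ : ICx S n k} {Θ : RCx S n r} {Φ : List (Fm S n k r)}
      {τ τ' : Fin m → Ty S.ty n} {ρ : Fin m → Rl S n k r} :
      (∀ i, Adm P Γ Θ (ρ i) (τ i) (τ' i)) →
      Prov P Γ Θ Φ (Rl.equiv .unit .unit (.interp m .unit ρ) Rl.unit)
  | interpAll {n k r m : ℕ} {Γ : ICx S n k} {Θ : RCx S n r} {Φ : List (Fm S n k r)}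
      {τ τ' : Fin m → Ty S.ty n} {ρ : Fin m → Rl S n k r} (σ : Ty S.ty (m + 1)) :
      (∀ i, Adm P Γ Θ (ρ i) (τ i) (τ' i)) →
      Prov P Γ Θ Φ (Rl.equiv ((Ty.all σ).sub τ) ((Ty.all σ).sub τ')
        (.interp m (.all σ) ρ)
        (Rl.all (σ.sub (Ty.lift τ)) (σ.sub (Ty.lift τ'))
          (.interp (m + 1) σ (scons (.var 0) (fun i => (ρ i).wkAdm)))))
  | interpBang {n k r m : ℕ} {Γ : ICx S n k} {Θ : RCx S n r} {Φ : List (Fm S n k r)}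
      {τ τ' : Fin m → Ty S.ty n} {ρ : Fin m → Rl S n k r} (σ : Ty S.ty m) :
      (∀ i, Adm P Γ Θ (ρ i) (τ i) (τ' i)) →
      Prov P Γ Θ Φ (Rl.equiv ((Ty.bang σ).sub τ) ((Ty.bang σ).sub τ')
        (.interp m (.bang σ) ρ)
        (Rl.bang (σ.sub τ) (σ.sub τ') (.interp m σ ρ)))
  /-- With named type variables, exchange and weakening of the kind context `α₁, …, αₘ` of `σ`
  do not change the expression `σ[ρ₁/α₁, …, ρₘ/αₘ]`, except that the relations for variables
  that do not occur are dropped.  With de Bruijn indices this is a rule. -/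
  | interpRen {n k r m m' : ℕ} {Γ : ICx S n k} {Θ : RCx S n r} {Φ : List (Fm S n k r)}
      {τ τ' : Fin m → Ty S.ty n} {ρ : Fin m → Rl S n k r} (σ : Ty S.ty m')
      (f : Fin m' → Fin m) :
      Function.Injective f → (∀ i, Adm P Γ Θ (ρ i) (τ i) (τ' i)) →
      Prov P Γ Θ Φ (Rl.equiv ((σ.ren f).sub τ) ((σ.ren f).sub τ')
        (.interp m (σ.ren f) ρ) (.interp m' σ (fun i => ρ (f i))))
  /-- parametricity of the fixed point combinator -/
  | fixRel {n k r : ℕ} {Γ : ICx S n k} {Θ : RCx S n r} {Φ : List (Fm S n k r)} :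
      Prov P Γ Θ Φ (.rel (.interp 0 Ty.fixTy Fin.elim0) .fix .fix)
  /-- extensionality scheme for terms: `(∀ x : σ. t x =_τ u x) ⊃ t =_{σ ⊸ τ} u` -/
  | extTm {n k r : ℕ} {Γ : ICx S n k} {Θ : RCx S n r} {Φ : List (Fm S n k r)}
      {σ τ : Ty S.ty n} {t u : Tm S n k} :
      P.extensionality →
      HasType Γ.toCx t (.lolli σ τ) → HasType Γ.toCx u (.lolli σ τ) →
      Prov P Γ Θ Φ (.imp
        (.allTm σ (.eq τ (.app t.wk (.var 0)) (.app u.wk (.var 0))))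
        (.eq (.lolli σ τ) t u))
  /-- extensionality scheme for types: `(∀ α. t α =_τ u α) ⊃ t =_{∏ α. τ} u` -/
  | extTy {n k r : ℕ} {Γ : ICx S n k} {Θ : RCx S n r} {Φ : List (Fm S n k r)}
      {τ : Ty S.ty (n + 1)} {t u : Tm S n k} :
      P.extensionality →
      HasType Γ.toCx t (.all τ) → HasType Γ.toCx u (.all τ) →
      Prov P Γ Θ Φ (.imp
        (.allTy (.eq τ (.tapp t.wkTy (.var 0)) (.tapp u.wkTy (.var 0))))
        (.eq (.all τ) t u))
  /-- identity extension scheme `∀ α₁, …, αₘ. σ[eq_{α₁}, …, eq_{αₘ}] ≡ eq_σ`, in instantiated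
  form -/
  | idExt {n k r m : ℕ} {Γ : ICx S n k} {Θ : RCx S n r} {Φ : List (Fm S n k r)}
      (σ : Ty S.ty m) (τ : Fin m → Ty S.ty n) :
      P.identityExtension →
      Prov P Γ Θ Φ (Rl.equiv (σ.sub τ) (σ.sub τ)
        (.interp m σ (fun i => Rl.eqRel (τ i))) (Rl.eqRel (σ.sub τ)))

end

/-! ### Types as functors -/

/-- The body of the functorial action.  For a type `σ` in `m` variables, families of types `A`,
`B`, and for each variable `i` a term `e i`, which is of type `A i ⊸ B i` if `i` occurs
positively and of type `B i ⊸ A i` if `i` occurs negatively in `σ`, this is a term of type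
`σ(A) ⊸ σ(B)`.  Bound type variables and closed types are acted upon by the identity. -/
def act : {m n k : ℕ} → Ty S.ty m → (Fin m → Ty S.ty n) → (Fin m → Ty S.ty n) →
    (Fin m → Tm S n k) → Tm S n k
  | _, _, _, .var i, _, _, e => e i
  | _, _, _, .con K args, A, _, _ => Tm.idTm ((Ty.con K args).sub A)
  | _, _, _, .unit, _, _, _ => Tm.idTm .unit
  -- `λ° z. let x ⊗ y be z in σ(e) x ⊗ τ(e) y`
  | _, _, _, .tensor σ τ, A, B, e =>
      .lam (.tensor (σ.sub A) (τ.sub A))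
        (.letTens (σ.sub A) (τ.sub A) (.var 0)
          (.tens (.app (act σ A B (fun i => (e i).wk.wk.wk)) (.var 1))
            (.app (act τ A B (fun i => (e i).wk.wk.wk)) (.var 0))))
  -- `λ° h. τ(e) ∘ h ∘ σ(e)`
  | _, _, _, .lolli σ τ, A, B, e =>
      .lam (.lolli (σ.sub A) (τ.sub A))
        (Tm.comp (σ.sub B) (act τ A B (fun i => (e i).wk))
          (Tm.comp (σ.sub B) (.var 0) (act σ B A (fun i => (e i).wk))))
  -- `λ° x. let !y be x in !(σ(e) y)`
  | _, _, _, .bang σ, A, B, e =>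
      .lam (.bang (σ.sub A))
        (.letBang (σ.sub A) (.var 0)
          (.bang (.app (act σ A B (fun i => (e i).wk.wk)) (.var 0))))
  -- `λ° z. Λ ω. σ(e) (z ω)`
  | _, _, _, .all σ, A, B, e =>
      .lam (.all (σ.sub (Ty.lift A)))
        (.tlam (.app
          (act σ (Ty.lift A) (Ty.lift B)
            (scons (Tm.idTm (.var 0)) (fun i => (e i).wk.wkTy)))
          (.tapp (.var 0) (.var 0))))

/-- For `σ(α, β)` (with `α` the variable `0` and `β` the variable `1`), the polymorphic term
`M_σ : ∏ α, β, α', β'. (α' ⊸ α) → (β ⊸ β') → σ(α, β) ⊸ σ(α', β')`. -/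
def functorTm (σ : Ty S.ty 2) : Tm S 0 0 :=
  .tlam (.tlam (.tlam (.tlam
    (Tm.ilam (.lolli (.var 1) (.var 3))
      (Tm.ilam (.lolli (.var 2) (.var 0))
        (act σ ![.var 3, .var 2] ![.var 1, .var 0] ![.var 1, .var 0]))))))

/-- `σ(α, β)` for types `α` and `β`. -/
abbrev Ty.at₂ {n : ℕ} (σ : Ty S.ty 2) (α β : Ty S.ty n) : Ty S.ty n := σ.sub ![α, β]

/-- For `f : α' ⊸ α` and `g : β ⊸ β'`, the term
`σ(f, g) = M_σ α β α' β' !f !g : σ(α, β) ⊸ σ(α', β')`. -/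
def mapTm {n k : ℕ} (σ : Ty S.ty 2) (α β α' β' : Ty S.ty n) (f g : Tm S n k) : Tm S n k :=
  .app (.app (.tapp (.tapp (.tapp (.tapp (functorTm σ).ofClosed α) β) α') β') (.bang f))
    (.bang g)

/-! ### The categories of linear functions and dialgebras -/

/-- Representatives of morphisms `σ ⊸ τ` of the category of types in `n` type variables and
linear functions. -/
def Hom {n : ℕ} (σ τ : Ty S.ty n) (f : Tm S n 0) : Prop :=
  HasType (Fin.elim0 : Cx S n 0) f (.lolli σ τ)

/-- Equality of morphisms `σ ⊸ τ`: provable internal equality. -/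
def HomEq (P : Schemes) {n : ℕ} (σ τ : Ty S.ty n) (f g : Tm S n 0) : Prop :=
  Prov P (Fin.elim0 : ICx S n 0) (Fin.elim0 : RCx S n 0) [] (.eq (.lolli σ τ) f g)

/-- `(τ, τ', f, f')` is a dialgebra for `σ`. -/
structure IsDialgebra {n : ℕ} (σ : Ty S.ty 2) (τ τ' : Ty S.ty n) (f f' : Tm S n 0) : Prop where
  hom : Hom (σ.at₂ τ' τ) τ f
  hom' : Hom τ' (σ.at₂ τ τ') f'

/-- `(h, h')` is a morphism of dialgebras from `(τ₀, τ₀', f₀, f₀')` to `(τ₁, τ₁', f₁, f₁')`. -/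
structure IsDialgebraHom (P : Schemes) {n : ℕ} (σ : Ty S.ty 2) (τ₀ τ₀' : Ty S.ty n)
    (f₀ f₀' : Tm S n 0) (τ₁ τ₁' : Ty S.ty n) (f₁ f₁' : Tm S n 0) (h h' : Tm S n 0) : Prop where
  hom : Hom τ₀ τ₁ h
  hom' : Hom τ₁' τ₀' h'
  comm : HomEq P (σ.at₂ τ₀' τ₀) τ₁
    (Tm.comp (σ.at₂ τ₀' τ₀) h f₀)
    (Tm.comp (σ.at₂ τ₀' τ₀) f₁ (mapTm σ τ₀' τ₀ τ₁' τ₁ h' h))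
  comm' : HomEq P τ₁' (σ.at₂ τ₀ τ₀')
    (Tm.comp τ₁' f₀' h')
    (Tm.comp τ₁' (mapTm σ τ₁ τ₁' τ₀ τ₀' h h') f₁')

/-- `(τ, τ', f, f')` is an initial dialgebra for `σ` in `n` type variables, up to internal
equality. -/
structure IsInitialDialgebra (P : Schemes) {n : ℕ} (σ : Ty S.ty 2) (τ τ' : Ty S.ty n)
    (f f' : Tm S n 0) : Prop where
  dialgebra : IsDialgebra σ τ τ' f f'
  existsHom : ∀ (τ₀ τ₀' : Ty S.ty n) (g g' : Tm S n 0), IsDialgebra σ τ₀ τ₀' g g' →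
    ∃ h h', IsDialgebraHom P σ τ τ' f f' τ₀ τ₀' g g' h h'
  unique : ∀ (τ₀ τ₀' : Ty S.ty n) (g g' : Tm S n 0), IsDialgebra σ τ₀ τ₀' g g' →
    ∀ h h' k k', IsDialgebraHom P σ τ τ' f f' τ₀ τ₀' g g' h h' →
      IsDialgebraHom P σ τ τ' f f' τ₀ τ₀' g g' k k' →
      HomEq P τ τ₀ h k ∧ HomEq P τ₀' τ' h' k'

/-- `f : σ ⊸ τ` and `g : τ ⊸ σ` are mutually inverse, up to internal equality. -/
structure IsInversePair (P : Schemes) {n : ℕ} (σ τ : Ty S.ty n) (f g : Tm S n 0) : Prop where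
  hom : Hom σ τ f
  hom' : Hom τ σ g
  left_inv : HomEq P σ σ (Tm.comp σ g f) (Tm.idTm σ)
  right_inv : HomEq P τ τ (Tm.comp τ f g) (Tm.idTm τ)

end LAPL

/-!
# Recursive types as initial dialgebras in Linear Abadi–Plotkin logic

The recursive type is the covariant half of an impredicative encoding of an initial dialgebra on a
*pair* of types, which the fixed point combinator allows to be folded onto the diagonal.

**The pair of types.**  Let `R = ∏ α, β. (σ(β, α) ⊸ α) → (β ⊸ σ(α, β)) → α` (`algTy`), and let
`R' = ∏ γ. K(γ) ⊸ γ` (`coalgTy`) be the colimit of the second components of all dialgebras, where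
`K(γ) = ∏ α, β. (σ(β, α) ⊸ α) → (β ⊸ σ(α, β)) → β ⊸ γ` (`coconeTy`) is the type of cocones.  For a
dialgebra `(A, B, f, g)`, evaluation is a map `foldTm : R ⊸ A` and injection a map
`unfoldTm : B ⊸ R'`.  Structure maps `algTm : σ(R', R) ⊸ R` and `coalgTm : R' ⊸ σ(R, R')` are
defined by applying `σ` to these, and make evaluation and injection a morphism of dialgebras
(`foldTm_comm`, `unfoldTm_comm`).

**Parametricity.**  The functorial action of `σ` is a closed polymorphic term, so by identity
extension it is related to itself (`mapTm_rel`).  Applied to graphs of functions, which are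
admissible, this shows that `σ` preserves composition (`mapTm_comp_app`) and that, for a morphism
`(h, h')` of dialgebras, the structure maps respect the graph of `h` and the opposite of the graph
of `h'` (`DialgPair.maps_alg`, `DialgPair.maps_coalg`).  Hence elements of `R` and cocones, being
parametric, are natural with respect to morphisms of dialgebras (`DialgPair.algTy_naturality`,
`DialgPair.coconeTy_naturality`).  It follows that evaluation and injection at `(R, R')` are
identities (`foldTm_self`, `unfoldTm_self`), so that every morphism out of `(R, R')` consists of
evaluation and injection (`DialgPair.eq_foldTm`, `DialgPair.eq_unfoldTm`): the dialgebra on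
`(R, R')` is initial (`isInit_self`).

**The diagonal.**  The rest is an argument about a functor of mixed variance on a category
(`MixedFunctor.IsInit.diagonal`), here the category of types and provable-equality classes of
linear functions.  By Lambek's lemma the structure maps have inverses; these form a dialgebra on
`(R', R)`, and the morphism to it has two equal components `u : R ⊸ R'`.  With the combinator `Y`
one obtains `w : R' ⊸ R` such that `w = algTm ∘ σ(w, w) ∘ coalgTm`.  Then `(w ∘ u, u ∘ w)` is an
endomorphism of the initial dialgebra, hence trivial, and transport along `u` and `w` yields an
initial dialgebra on `(R, R)`.
-/

namespace LAPL

/-! ### Renaming and substitution -/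

section Fin

variable {A : Type*} {n m k : ℕ}

@[simp] theorem scons_zero (a : A) (f : Fin n → A) : scons a f 0 = a := rfl

@[simp] theorem scons_succ (a : A) (f : Fin n → A) (i : Fin n) : scons a f i.succ = f i := rfl

@[simp] theorem scons_one (a : A) (f : Fin (n + 1) → A) : scons a f 1 = f 0 := rfl

@[simp] theorem scons_two (a : A) (f : Fin (n + 2) → A) : scons a f 2 = f 1 := rfl

@[simp] theorem scons_three (a : A) (f : Fin (n + 3) → A) : scons a f 3 = f 2 := rfl

theorem funext_scons {B : Fin (n + 1) → Sort*} {f g : ∀ i, B i} (h0 : f 0 = g 0)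
    (hs : ∀ i : Fin n, f i.succ = g i.succ) : f = g :=
  funext (Fin.cases h0 hs)

@[simp] theorem scons_var_succ (f : Fin (n + 1) → A) : scons (f 0) (fun i => f i.succ) = f :=
  funext_scons rfl fun _ => rfl

@[simp] theorem liftR_zero (f : Fin m → Fin n) : liftR f 0 = 0 := rfl

@[simp] theorem liftR_succ (f : Fin m → Fin n) (i : Fin m) : liftR f i.succ = (f i).succ := rfl

@[simp] theorem liftR_one (f : Fin (m + 1) → Fin n) : liftR f 1 = (f 0).succ := rfl

@[simp] theorem liftR_two (f : Fin (m + 2) → Fin n) : liftR f 2 = (f 1).succ := rfl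

@[simp] theorem liftR_id : liftR (id : Fin n → Fin n) = id :=
  funext_scons rfl fun _ => rfl

theorem liftR_comp (g : Fin m → Fin k) (f : Fin n → Fin m) :
    liftR (fun i => g (f i)) = fun i => liftR g (liftR f i) :=
  funext_scons rfl fun _ => rfl

theorem liftR_injective {f : Fin m → Fin n} (hf : Function.Injective f) :
    Function.Injective (liftR f) := by
  intro i j
  refine Fin.cases ?_ (fun i => ?_) i <;> refine Fin.cases ?_ (fun j => ?_) j
  · simp
  · intro h; simp [liftR, Fin.ext_iff] at h
  · intro h; simp [liftR, Fin.ext_iff] at h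
  · intro h; simp only [liftR_succ, Fin.succ_inj] at h; rw [hf h]

end Fin

namespace Ty

variable {T : TySig.{u}}

theorem ren_ren {n m k : ℕ} (f : Fin n → Fin m) (g : Fin m → Fin k) (σ : Ty T n) :
    (σ.ren f).ren g = σ.ren (fun i => g (f i)) := by
  induction σ generalizing m k <;> simp only [*, ren, liftR_comp]

@[simp] theorem ren_id {n : ℕ} (σ : Ty T n) : σ.ren id = σ := by
  induction σ <;> simp only [*, ren, id, liftR_id]

theorem lift_comp_ren {n m k : ℕ} (f : Fin n → Fin m) (s : Fin m → Ty T k) :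
    (fun i => lift s (liftR f i)) = lift (fun i => s (f i)) :=
  funext_scons rfl fun _ => rfl

theorem sub_ren {n m k : ℕ} (f : Fin n → Fin m) (s : Fin m → Ty T k) (σ : Ty T n) :
    (σ.ren f).sub s = σ.sub (fun i => s (f i)) := by
  induction σ generalizing m k <;> simp only [*, ren, sub, lift_comp_ren]

theorem lift_ren {n m k : ℕ} (s : Fin n → Ty T m) (f : Fin m → Fin k) :
    (fun i => (lift s i).ren (liftR f)) = lift (fun i => (s i).ren f) :=
  funext_scons rfl fun i => by simp [lift, ren_ren]

theorem ren_sub {n m k : ℕ} (s : Fin n → Ty T m) (f : Fin m → Fin k) (σ : Ty T n) :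
    (σ.sub s).ren f = σ.sub (fun i => (s i).ren f) := by
  induction σ generalizing m k <;> simp only [*, ren, sub, lift_ren]

theorem lift_sub {n m k : ℕ} (s : Fin n → Ty T m) (t : Fin m → Ty T k) :
    (fun i => (lift s i).sub (lift t)) = lift (fun i => (s i).sub t) :=
  funext_scons rfl fun i => by simp [lift, sub_ren, ren_sub]

theorem sub_sub {n m k : ℕ} (s : Fin n → Ty T m) (t : Fin m → Ty T k) (σ : Ty T n) :
    (σ.sub s).sub t = σ.sub (fun i => (s i).sub t) := by
  induction σ generalizing m k <;> simp only [*, sub, lift_sub]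

@[simp] theorem lift_var {n : ℕ} : lift (var : Fin n → Ty T n) = var :=
  funext_scons rfl fun _ => rfl

@[simp] theorem sub_var {n : ℕ} (σ : Ty T n) : σ.sub var = σ := by
  induction σ <;> simp only [*, sub, lift_var]

@[simp] theorem lift_zero {n m : ℕ} (s : Fin n → Ty T m) : lift s 0 = var 0 := rfl

@[simp] theorem lift_succ {n m : ℕ} (s : Fin n → Ty T m) (i : Fin n) :
    lift s i.succ = (s i).wk := rfl

@[simp] theorem lift_one {n m : ℕ} (s : Fin (n + 1) → Ty T m) : lift s 1 = (s 0).wk := rfl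

@[simp] theorem lift_two {n m : ℕ} (s : Fin (n + 2) → Ty T m) : lift s 2 = (s 1).wk := rfl

@[simp] theorem lift_three {n m : ℕ} (s : Fin (n + 3) → Ty T m) : lift s 3 = (s 2).wk := rfl

theorem lift_var_ren {n m : ℕ} (f : Fin n → Fin m) :
    lift (fun i => (var (f i) : Ty T m)) = fun i => var (liftR f i) :=
  funext_scons rfl fun _ => rfl

theorem ren_eq_sub {n m : ℕ} (f : Fin n → Fin m) (σ : Ty T n) :
    σ.ren f = σ.sub (fun i => var (f i)) := by
  induction σ generalizing m <;> simp only [*, ren, sub, lift_var_ren]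

theorem sub_vars {n m : ℕ} (f : Fin n → Fin m) (σ : Ty T n) :
    σ.sub (fun i => var (f i)) = σ.ren f := (ren_eq_sub f σ).symm

/-- Substitutions that agree on the variables that occur have the same effect. -/
theorem sub_congr {n m : ℕ} {s t : Fin n → Ty T m} {σ : Ty T n}
    (h : ∀ i p, Occurs p i σ → s i = t i) : σ.sub s = σ.sub t := by
  induction σ generalizing m with
  | var i => exact h i true ⟨rfl, rfl⟩
  | con K args ih =>
    simp only [sub, con.injEq, heq_eq_eq, true_and]
    exact funext fun a => ih a fun i p hp => h i p ⟨a, p, hp⟩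
  | unit => rfl
  | tensor σ τ ih₁ ih₂ =>
    simp only [sub]
    rw [ih₁ fun i p hp => h i p (Or.inl hp), ih₂ fun i p hp => h i p (Or.inr hp)]
  | lolli σ τ ih₁ ih₂ =>
    simp only [sub]
    rw [ih₁ fun i p hp => h i (!p) (Or.inl (by simpa using hp)),
      ih₂ fun i p hp => h i p (Or.inr hp)]
  | bang σ ih => simp only [sub]; rw [ih fun i p hp => h i p hp]
  | all σ ih =>
    simp only [sub]
    rw [ih (s := lift s) (t := lift t) (Fin.cases (fun _ _ => rfl) fun i p hp => by
      simp [h i p hp])]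

end Ty

namespace Tm

variable {S : Sig.{u}}

theorem ren_ren {n m l k k' k'' : ℕ} (f : Fin n → Fin m) (g : Fin k → Fin k')
    (f' : Fin m → Fin l) (g' : Fin k' → Fin k'') (t : Tm S n k) :
    (t.ren f g).ren f' g' = t.ren (fun i => f' (f i)) (fun i => g' (g i)) := by
  induction t generalizing m l k' k'' <;> simp only [*, ren, liftR_comp, Ty.ren_ren]

@[simp] theorem ren_id {n k : ℕ} (t : Tm S n k) : t.ren id id = t := by
  induction t <;> simp only [*, ren, id, liftR_id, Ty.ren_id]

theorem lift_comp_ren {n k k' l : ℕ} (g : Fin k → Fin k') (e : Fin k' → Tm S n l) :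
    (fun i => lift e (liftR g i)) = lift (fun i => e (g i)) :=
  funext_scons rfl fun _ => rfl

theorem sub_ren {n m l k k' k'' : ℕ} (f : Fin n → Fin m) (g : Fin k → Fin k')
    (s : Fin m → Ty S.ty l) (e : Fin k' → Tm S l k'') (t : Tm S n k) :
    (t.ren f g).sub s e = t.sub (fun i => s (f i)) (fun i => e (g i)) := by
  induction t generalizing m l k' k'' <;>
    simp only [*, ren, sub, lift_comp_ren, Ty.sub_ren, Ty.lift_comp_ren]

theorem lift_ren {n m k k' k'' : ℕ} (e : Fin k → Tm S n k') (f : Fin n → Fin m)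
    (g : Fin k' → Fin k'') :
    (fun i => (lift e i).ren f (liftR g)) = lift (fun i => (e i).ren f g) :=
  funext_scons rfl fun i => by simp [lift, ren_ren]

theorem ren_sub {n m l k k' k'' : ℕ} (s : Fin n → Ty S.ty m) (e : Fin k → Tm S m k')
    (f : Fin m → Fin l) (g : Fin k' → Fin k'') (t : Tm S n k) :
    (t.sub s e).ren f g = t.sub (fun i => (s i).ren f) (fun i => (e i).ren f g) := by
  induction t generalizing m l k' k'' <;>
    simp only [*, ren, sub, lift_ren, Ty.ren_sub, Ty.lift_ren, ren_ren, liftR_succ, id]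

theorem lift_sub {n m k k' k'' : ℕ} (e : Fin k → Tm S n k') (s : Fin n → Ty S.ty m)
    (e' : Fin k' → Tm S m k'') :
    (fun i => (lift e i).sub s (lift e')) = lift (fun i => (e i).sub s e') :=
  funext_scons rfl fun i => by simp [lift, sub_ren, ren_sub]

theorem sub_sub {n m l k k' k'' : ℕ} (s : Fin n → Ty S.ty m) (e : Fin k → Tm S m k')
    (s' : Fin m → Ty S.ty l) (e' : Fin k' → Tm S l k'') (t : Tm S n k) :
    (t.sub s e).sub s' e' = t.sub (fun i => (s i).sub s') (fun i => (e i).sub s' e') := by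
  induction t generalizing m l k' k'' <;>
    simp only [*, sub, lift_sub, Ty.sub_sub, Ty.lift_sub, ren_sub, sub_ren, Ty.lift_succ, id]

@[simp] theorem lift_var {n k : ℕ} : lift (var : Fin k → Tm S n k) = var :=
  funext_scons rfl fun _ => rfl

@[simp] theorem sub_var {n k : ℕ} (t : Tm S n k) : t.sub Ty.var var = t := by
  induction t <;> simp only [*, sub, ren, id, lift_var, Ty.lift_var, Ty.sub_var]

@[simp] theorem lift_zero {n k l : ℕ} (e : Fin k → Tm S n l) : lift e 0 = var 0 := rfl

@[simp] theorem lift_succ {n k l : ℕ} (e : Fin k → Tm S n l) (i : Fin k) :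
    lift e i.succ = (e i).wk := rfl

@[simp] theorem lift_one {n k l : ℕ} (e : Fin (k + 1) → Tm S n l) : lift e 1 = (e 0).wk := rfl

@[simp] theorem lift_two {n k l : ℕ} (e : Fin (k + 2) → Tm S n l) : lift e 2 = (e 1).wk := rfl

@[simp] theorem lift_three {n k l : ℕ} (e : Fin (k + 3) → Tm S n l) :
    lift e 3 = (e 2).wk := rfl

theorem lift_var_ren {n k l : ℕ} (g : Fin k → Fin l) :
    lift (fun i => (var (g i) : Tm S n l)) = fun i => var (liftR g i) :=
  funext_scons rfl fun _ => rfl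

theorem ren_eq_sub {n m k l : ℕ} (f : Fin n → Fin m) (g : Fin k → Fin l) (t : Tm S n k) :
    t.ren f g = t.sub (fun i => Ty.var (f i)) (fun i => var (g i)) := by
  induction t generalizing m l <;>
    simp only [*, ren, sub, lift_var_ren, Ty.lift_var_ren, Ty.ren_eq_sub, id]

theorem sub_vars {n m k l : ℕ} (f : Fin n → Fin m) (g : Fin k → Fin l) (t : Tm S n k) :
    t.sub (fun i => Ty.var (f i)) (fun i => var (g i)) = t.ren f g := (ren_eq_sub f g t).symm

theorem comp_sub {n m k l : ℕ} (s : Fin n → Ty S.ty m) (e : Fin k → Tm S m l)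
    (ω : Ty S.ty n) (g f : Tm S n k) :
    (comp ω g f).sub s e = comp (ω.sub s) (g.sub s e) (f.sub s e) := by
  simp [comp, sub, sub_ren, ren_sub]

theorem comp_ren {n m k l : ℕ} (s : Fin n → Fin m) (e : Fin k → Fin l)
    (ω : Ty S.ty n) (g f : Tm S n k) :
    (comp ω g f).ren s e = comp (ω.ren s) (g.ren s e) (f.ren s e) := by
  simp [comp, ren, ren_ren]

theorem ilam_sub {n m k l : ℕ} (s : Fin n → Ty S.ty m) (e : Fin k → Tm S m l)
    (σ : Ty S.ty n) (t : Tm S n (k + 1)) :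
    (ilam σ t).sub s e = ilam (σ.sub s) (t.sub s (lift e)) := by
  simp only [ilam, sub, Ty.sub, sub_ren, ren_sub, lift_zero]
  congr 4
  · simp
  · exact funext_scons rfl fun i => by simp [ren_ren]

theorem ilam_ren {n m k l : ℕ} (f : Fin n → Fin m) (g : Fin k → Fin l)
    (σ : Ty S.ty n) (t : Tm S n (k + 1)) :
    (ilam σ t).ren f g = ilam (σ.ren f) (t.ren f (liftR g)) := by
  simp only [ilam, ren, Ty.ren, ren_ren, liftR_zero]
  congr 4
  exact funext_scons rfl fun i => by simp

end Tm


end LAPL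

namespace LAPL

variable {S : Sig.{u}}

/-! ### Renaming and substitution in formulas and relations -/

/-- Simultaneous induction on formulas and definable relations. -/
theorem Fm.Rl_induction {p : ∀ {n k r}, Fm S n k r → Prop} {q : ∀ {n k r}, Rl S n k r → Prop}
    (eq : ∀ {n k r} (σ : Ty S.ty n) (t u : Tm S n k), p (.eq σ t u : Fm S n k r))
    (rel : ∀ {n k r} (ρ : Rl S n k r) (t u : Tm S n k), q ρ → p (.rel ρ t u))
    (imp : ∀ {n k r} (φ ψ : Fm S n k r), p φ → p ψ → p (.imp φ ψ))
    (bot : ∀ {n k r}, p (.bot : Fm S n k r))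
    (top : ∀ {n k r}, p (.top : Fm S n k r))
    (and : ∀ {n k r} (φ ψ : Fm S n k r), p φ → p ψ → p (.and φ ψ))
    (or : ∀ {n k r} (φ ψ : Fm S n k r), p φ → p ψ → p (.or φ ψ))
    (allTy : ∀ {n k r} (φ : Fm S (n + 1) k r), p φ → p (.allTy φ))
    (allTm : ∀ {n k r} σ (φ : Fm S n (k + 1) r), p φ → p (.allTm σ φ))
    (allRl : ∀ {n k r} κ σ τ (φ : Fm S n k (r + 1)), p φ → p (.allRl κ σ τ φ))
    (exTy : ∀ {n k r} (φ : Fm S (n + 1) k r), p φ → p (.exTy φ))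
    (exTm : ∀ {n k r} σ (φ : Fm S n (k + 1) r), p φ → p (.exTm σ φ))
    (exRl : ∀ {n k r} κ σ τ (φ : Fm S n k (r + 1)), p φ → p (.exRl κ σ τ φ))
    (var : ∀ {n k r} (i : Fin r), q (.var i : Rl S n k r))
    (abs : ∀ {n k r} σ τ (φ : Fm S n (k + 2) r), p φ → q (.abs σ τ φ))
    (interp : ∀ {n k r} m σ (ρ : Fin m → Rl S n k r), (∀ i, q (ρ i)) → q (.interp m σ ρ)) :
    (∀ {n k r} (φ : Fm S n k r), p φ) ∧ ∀ {n k r} (ρ : Rl S n k r), q ρ :=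
  ⟨fun φ => Fm.rec (motive_1 := fun _ _ _ => p) (motive_2 := fun _ _ _ => q)
      eq rel imp bot top and or allTy allTm allRl exTy exTm exRl var abs interp φ,
    fun ρ => Rl.rec (motive_1 := fun _ _ _ => p) (motive_2 := fun _ _ _ => q)
      eq rel imp bot top and or allTy allTm allRl exTy exTm exRl var abs interp ρ⟩

theorem Fm.Rl_ren_ren :
    (∀ {n k r} (φ : Fm S n k r) {m l k' k'' r' r'' : ℕ} (f : Fin n → Fin m) (g : Fin k → Fin k')
      (h : Fin r → Fin r') (f' : Fin m → Fin l) (g' : Fin k' → Fin k'') (h' : Fin r' → Fin r''),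
      (φ.ren f g h).ren f' g' h' =
        φ.ren (fun i => f' (f i)) (fun i => g' (g i)) (fun i => h' (h i))) ∧
    ∀ {n k r} (ρ : Rl S n k r) {m l k' k'' r' r'' : ℕ} (f : Fin n → Fin m) (g : Fin k → Fin k')
      (h : Fin r → Fin r') (f' : Fin m → Fin l) (g' : Fin k' → Fin k'') (h' : Fin r' → Fin r''),
      (ρ.ren f g h).ren f' g' h' =
        ρ.ren (fun i => f' (f i)) (fun i => g' (g i)) (fun i => h' (h i)) := by
  apply Fm.Rl_induction <;> intros <;>
    simp only [*, Fm.ren, Rl.ren, liftR_comp, Ty.ren_ren, Tm.ren_ren]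

theorem Rl.ren_ren {n k r m l k' k'' r' r'' : ℕ} (f : Fin n → Fin m) (g : Fin k → Fin k')
    (h : Fin r → Fin r') (f' : Fin m → Fin l) (g' : Fin k' → Fin k'') (h' : Fin r' → Fin r'')
    (ρ : Rl S n k r) : (ρ.ren f g h).ren f' g' h' =
      ρ.ren (fun i => f' (f i)) (fun i => g' (g i)) (fun i => h' (h i)) :=
  Fm.Rl_ren_ren.2 ρ f g h f' g' h'

theorem Fm.Rl_ren_id :
    (∀ {n k r} (φ : Fm S n k r), φ.ren id id id = φ) ∧
    ∀ {n k r} (ρ : Rl S n k r), ρ.ren id id id = ρ := by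
  apply Fm.Rl_induction <;> intros <;>
    simp only [*, Fm.ren, Rl.ren, id, liftR_id, Ty.ren_id, Tm.ren_id]

@[simp] theorem Rl.ren_id {n k r : ℕ} (ρ : Rl S n k r) : ρ.ren id id id = ρ := Fm.Rl_ren_id.2 ρ

theorem Rl.lift_comp_ren {n k r r' q : ℕ} (h : Fin r → Fin r') (d : Fin r' → Rl S n k q) :
    (fun i => Rl.lift d (liftR h i)) = Rl.lift (fun i => d (h i)) :=
  funext_scons rfl fun _ => rfl

theorem Fm.Rl_sub_ren :
    (∀ {n k r} (φ : Fm S n k r) {m l k' k'' r' r'' : ℕ} (f : Fin n → Fin m) (g : Fin k → Fin k')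
      (h : Fin r → Fin r') (s : Fin m → Ty S.ty l) (e : Fin k' → Tm S l k'')
      (d : Fin r' → Rl S l k'' r''),
      (φ.ren f g h).sub s e d =
        φ.sub (fun i => s (f i)) (fun i => e (g i)) (fun i => d (h i))) ∧
    ∀ {n k r} (ρ : Rl S n k r) {m l k' k'' r' r'' : ℕ} (f : Fin n → Fin m) (g : Fin k → Fin k')
      (h : Fin r → Fin r') (s : Fin m → Ty S.ty l) (e : Fin k' → Tm S l k'')
      (d : Fin r' → Rl S l k'' r''),
      (ρ.ren f g h).sub s e d =
        ρ.sub (fun i => s (f i)) (fun i => e (g i)) (fun i => d (h i)) := by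
  apply Fm.Rl_induction <;> intros <;>
    simp only [*, Fm.ren, Rl.ren, Fm.sub, Rl.sub, Rl.lift_comp_ren, Tm.lift_comp_ren,
      Ty.lift_comp_ren, Ty.sub_ren, Tm.sub_ren]

theorem Rl.sub_ren {n k r m l k' k'' r' r'' : ℕ} (f : Fin n → Fin m) (g : Fin k → Fin k')
    (h : Fin r → Fin r') (s : Fin m → Ty S.ty l) (e : Fin k' → Tm S l k'')
    (d : Fin r' → Rl S l k'' r'') (ρ : Rl S n k r) :
    (ρ.ren f g h).sub s e d =
      ρ.sub (fun i => s (f i)) (fun i => e (g i)) (fun i => d (h i)) :=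
  Fm.Rl_sub_ren.2 ρ f g h s e d

theorem Rl.lift_ren {n m k k' r q q' : ℕ} (d : Fin r → Rl S n k q) (f : Fin n → Fin m)
    (g : Fin k → Fin k') (h : Fin q → Fin q') :
    (fun i => (Rl.lift d i).ren f g (liftR h)) = Rl.lift (fun i => (d i).ren f g h) :=
  funext_scons rfl fun i => by simp [Rl.lift, Rl.ren_ren]

theorem Fm.Rl_ren_sub :
    (∀ {n k r} (φ : Fm S n k r) {m l k' k'' r' r'' : ℕ} (s : Fin n → Ty S.ty m)
      (e : Fin k → Tm S m k') (d : Fin r → Rl S m k' r') (f : Fin m → Fin l)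
      (g : Fin k' → Fin k'') (h : Fin r' → Fin r''),
      (φ.sub s e d).ren f g h = φ.sub (fun i => (s i).ren f) (fun i => (e i).ren f g)
        (fun i => (d i).ren f g h)) ∧
    ∀ {n k r} (ρ : Rl S n k r) {m l k' k'' r' r'' : ℕ} (s : Fin n → Ty S.ty m)
      (e : Fin k → Tm S m k') (d : Fin r → Rl S m k' r') (f : Fin m → Fin l)
      (g : Fin k' → Fin k'') (h : Fin r' → Fin r''),
      (ρ.sub s e d).ren f g h = ρ.sub (fun i => (s i).ren f) (fun i => (e i).ren f g)
        (fun i => (d i).ren f g h) := by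
  apply Fm.Rl_induction <;> intros <;>
    simp only [*, Fm.ren, Rl.ren, Fm.sub, Rl.sub, Rl.lift_ren, Tm.lift_ren,
      Ty.lift_ren, Ty.ren_sub, Tm.ren_sub, Tm.ren_ren, Rl.ren_ren, liftR_succ, id]

theorem Rl.ren_sub {n k r m l k' k'' r' r'' : ℕ} (s : Fin n → Ty S.ty m)
    (e : Fin k → Tm S m k') (d : Fin r → Rl S m k' r') (f : Fin m → Fin l)
    (g : Fin k' → Fin k'') (h : Fin r' → Fin r'') (ρ : Rl S n k r) :
    (ρ.sub s e d).ren f g h = ρ.sub (fun i => (s i).ren f) (fun i => (e i).ren f g)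
        (fun i => (d i).ren f g h) :=
  Fm.Rl_ren_sub.2 ρ s e d f g h

theorem Rl.lift_sub {n m k k' r q q' : ℕ} (d : Fin r → Rl S n k q) (s : Fin n → Ty S.ty m)
    (e : Fin k → Tm S m k') (d' : Fin q → Rl S m k' q') :
    (fun i => (Rl.lift d i).sub s e (Rl.lift d')) = Rl.lift (fun i => (d i).sub s e d') :=
  funext_scons rfl fun i => by simp [Rl.lift, Rl.sub_ren, Rl.ren_sub]

theorem Fm.Rl_sub_sub :
    (∀ {n k r} (φ : Fm S n k r) {m l k' k'' r' r'' : ℕ} (s : Fin n → Ty S.ty m)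
      (e : Fin k → Tm S m k') (d : Fin r → Rl S m k' r') (s' : Fin m → Ty S.ty l)
      (e' : Fin k' → Tm S l k'') (d' : Fin r' → Rl S l k'' r''),
      (φ.sub s e d).sub s' e' d' = φ.sub (fun i => (s i).sub s') (fun i => (e i).sub s' e')
        (fun i => (d i).sub s' e' d')) ∧
    ∀ {n k r} (ρ : Rl S n k r) {m l k' k'' r' r'' : ℕ} (s : Fin n → Ty S.ty m)
      (e : Fin k → Tm S m k') (d : Fin r → Rl S m k' r') (s' : Fin m → Ty S.ty l)
      (e' : Fin k' → Tm S l k'') (d' : Fin r' → Rl S l k'' r''),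
      (ρ.sub s e d).sub s' e' d' = ρ.sub (fun i => (s i).sub s') (fun i => (e i).sub s' e')
        (fun i => (d i).sub s' e' d') := by
  apply Fm.Rl_induction <;> intros <;>
    simp only [*, Fm.sub, Rl.sub, Rl.lift_sub, Tm.lift_sub, Ty.lift_sub, Ty.sub_sub,
      Tm.sub_sub, Tm.ren_sub, Tm.sub_ren, Rl.ren_sub, Rl.sub_ren, Ty.lift_succ, Tm.lift_succ,
      id, Ty.ren_id]

theorem Fm.sub_sub {n k r m l k' k'' r' r'' : ℕ} (s : Fin n → Ty S.ty m)
    (e : Fin k → Tm S m k') (d : Fin r → Rl S m k' r') (s' : Fin m → Ty S.ty l)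
    (e' : Fin k' → Tm S l k'') (d' : Fin r' → Rl S l k'' r'') (φ : Fm S n k r) :
    (φ.sub s e d).sub s' e' d' = φ.sub (fun i => (s i).sub s') (fun i => (e i).sub s' e')
        (fun i => (d i).sub s' e' d') :=
  Fm.Rl_sub_sub.1 φ s e d s' e' d'

theorem Rl.lift_var_ren {n k r q : ℕ} (h : Fin r → Fin q) :
    Rl.lift (fun i => (.var (h i) : Rl S n k q)) = fun i => .var (liftR h i) :=
  funext_scons rfl fun _ => rfl

theorem Fm.Rl_sub_vars :
    (∀ {n k r} (φ : Fm S n k r) {m l q : ℕ} (f : Fin n → Fin m) (g : Fin k → Fin l)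
      (h : Fin r → Fin q), φ.sub (fun i => Ty.var (f i)) (fun i => Tm.var (g i))
        (fun i => Rl.var (h i)) = φ.ren f g h) ∧
    ∀ {n k r} (ρ : Rl S n k r) {m l q : ℕ} (f : Fin n → Fin m) (g : Fin k → Fin l)
      (h : Fin r → Fin q), ρ.sub (fun i => Ty.var (f i)) (fun i => Tm.var (g i))
        (fun i => Rl.var (h i)) = ρ.ren f g h := by
  apply Fm.Rl_induction <;> intros <;>
    simp only [*, Fm.ren, Rl.ren, Fm.sub, Rl.sub, Rl.lift_var_ren, Tm.lift_var_ren,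
      Ty.lift_var_ren, Ty.sub_vars, Tm.sub_vars, Tm.ren, id]

theorem Fm.sub_vars {n k r m l q : ℕ} (f : Fin n → Fin m) (g : Fin k → Fin l)
    (h : Fin r → Fin q) (φ : Fm S n k r) : φ.sub (fun i => Ty.var (f i))
      (fun i => Tm.var (g i)) (fun i => Rl.var (h i)) = φ.ren f g h :=
  Fm.Rl_sub_vars.1 φ f g h

theorem Rl.sub_vars {n k r m l q : ℕ} (f : Fin n → Fin m) (g : Fin k → Fin l)
    (h : Fin r → Fin q) (ρ : Rl S n k r) : ρ.sub (fun i => Ty.var (f i))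
      (fun i => Tm.var (g i)) (fun i => Rl.var (h i)) = ρ.ren f g h :=
  Fm.Rl_sub_vars.2 ρ f g h

@[simp] theorem Rl.sub_var {n k r : ℕ} (ρ : Rl S n k r) :
    ρ.sub Ty.var Tm.var Rl.var = ρ :=
  (Rl.sub_vars id id id ρ).trans (Rl.ren_id ρ)

end LAPL

namespace LAPL

/-! ### Typing -/

variable {S : Sig.{u}}

namespace Entry

variable {T : TySig.{u}} {n m l : ℕ}

/-- Renaming of the type variables of a context entry. -/
def ren (f : Fin n → Fin m) : Entry T n → Entry T m
  | unr σ => unr (σ.ren f)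
  | lin σ => lin (σ.ren f)
  | off => off

theorem ren_ren (f : Fin n → Fin m) (g : Fin m → Fin l) (E : Entry T n) :
    (E.ren f).ren g = E.ren (fun i => g (f i)) := by
  cases E <;> simp [ren, Ty.ren_ren]

@[simp] theorem ren_id (E : Entry T n) : E.ren id = E := by
  cases E <;> simp [ren]

theorem wkTy_eq (E : Entry T n) : E.wkTy = E.ren Fin.succ := by cases E <;> rfl

theorem NotLin.ren {E : Entry T n} (h : E.NotLin) (f : Fin n → Fin m) : (E.ren f).NotLin := by
  cases E <;> simp_all [Entry.ren, NotLin]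

theorem Split.ren {E E₁ E₂ : Entry T n} (h : Split E E₁ E₂) (f : Fin n → Fin m) :
    Split (E.ren f) (E₁.ren f) (E₂.ren f) := by
  cases h <;> constructor

theorem Split.self {E : Entry T n} (h : E.NotLin) : Split E E E := by
  cases E
  · exact .unr _
  · exact h.elim
  · exact .off

end Entry

section Contexts

variable {n m k l : ℕ}

theorem Cx.Split.self {Γ : Cx S n k} (h : Γ.NoLin) : Γ.Split Γ Γ :=
  fun i => Entry.Split.self (h i)

theorem Cx.Split.symm {Γ Γ₁ Γ₂ : Cx S n k} (h : Γ.Split Γ₁ Γ₂) : Γ.Split Γ₂ Γ₁ := fun i => by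
  have := h i
  cases h₁ : Γ₁ i <;> cases h₂ : Γ₂ i <;> rw [h₁, h₂] at this <;> revert this <;>
    generalize Γ i = E <;> intro this <;> cases this <;> constructor

/-- A context can be split into its intuitionistic zone and itself. -/
theorem Cx.exists_split (Γ : Cx S n k) : ∃ Γ' : Cx S n k, Γ'.NoLin ∧ Γ.Split Γ' Γ := by
  refine ⟨fun i => match Γ i with | .unr σ => .unr σ | _ => .off, fun i => ?_, fun i => ?_⟩
  · dsimp only; split <;> trivial
  · dsimp only; cases Γ i <;> constructor

theorem Cx.Split.scons {Γ Γ₁ Γ₂ : Cx S n k} {E E₁ E₂ : Entry S.ty n} (hE : E.Split E₁ E₂)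
    (h : Γ.Split Γ₁ Γ₂) : Cx.Split (S := S) (scons E Γ) (scons E₁ Γ₁) (scons E₂ Γ₂) :=
  Fin.cases hE h

theorem Cx.NoLin.scons {Γ : Cx S n k} {E : Entry S.ty n} (hE : E.NotLin) (h : Γ.NoLin) :
    Cx.NoLin (S := S) (scons E Γ) :=
  Fin.cases hE h

theorem Cx.NoLin.off {Γ : Cx S n k} (h : Γ.NoLin) :
    Cx.NoLin (S := S) (LAPL.scons Entry.off Γ) :=
  h.scons trivial

theorem Cx.NoLin.unr {Γ : Cx S n k} {σ : Ty S.ty n} (h : Γ.NoLin) :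
    Cx.NoLin (S := S) (LAPL.scons (Entry.unr σ) Γ) :=
  h.scons trivial

theorem Cx.NoLin.wkTy {Γ : Cx S n k} (h : Γ.NoLin) : Γ.wkTy.NoLin := fun i => by
  show Entry.NotLin (Entry.wkTy _)
  rw [Entry.wkTy_eq]
  exact (h i).ren _

theorem Cx.wkTy_scons (Γ : Cx S n k) (E : Entry S.ty n) :
    Cx.wkTy (S := S) (scons E Γ) = scons E.wkTy Γ.wkTy :=
  funext_scons rfl fun _ => rfl

theorem ICx.toCx_noLin (Γ : ICx S n k) : Γ.toCx.NoLin := fun _ => trivial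

theorem ICx.toCx_scons (Γ : ICx S n k) (σ : Ty S.ty n) :
    ICx.toCx (S := S) (scons σ Γ) = scons (Entry.unr σ) Γ.toCx :=
  funext_scons rfl fun _ => rfl

theorem ICx.wkTy_scons (Γ : ICx S n k) (σ : Ty S.ty n) :
    ICx.wkTy (S := S) (scons σ Γ) = scons σ.wk Γ.wkTy :=
  funext_scons rfl fun _ => rfl

/-- `Γ'` contains a renamed copy of `Γ`, and no linear variables besides. -/
structure Cx.IsRen (f : Fin n → Fin m) (g : Fin k → Fin l) (Γ : Cx S n k) (Γ' : Cx S m l) :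
    Prop where
  inj : Function.Injective g
  map : ∀ i, Γ' (g i) = (Γ i).ren f
  notLin : ∀ j, (∀ i, g i ≠ j) → (Γ' j).NotLin

namespace Cx.IsRen

variable {f : Fin n → Fin m} {g : Fin k → Fin l} {Γ : Cx S n k} {Γ' : Cx S m l}

theorem noLin_except (h : IsRen f g Γ Γ') {P : Fin k → Prop} (hΓ : ∀ i, P i → (Γ i).NotLin)
    (j : Fin l) (hj : ∀ i, g i = j → P i) : (Γ' j).NotLin := by
  by_cases hi : ∃ i, g i = j
  · obtain ⟨i, rfl⟩ := hi
    rw [h.map]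
    exact (hΓ i (hj i rfl)).ren f
  · exact h.notLin j (by simpa using hi)

theorem noLin (h : IsRen f g Γ Γ') (hΓ : Γ.NoLin) : Γ'.NoLin :=
  fun j => h.noLin_except (P := fun _ => True) (fun i _ => hΓ i) j fun _ _ => trivial

theorem lift (h : IsRen f g Γ Γ') (E : Entry S.ty n) :
    IsRen (S := S) f (liftR g) (scons E Γ) (scons (E.ren f) Γ') where
  inj := liftR_injective h.inj
  map := Fin.cases rfl h.map
  notLin := Fin.cases (fun h0 => (h0 0 rfl).elim) fun j hj => h.notLin j fun i hi =>
    hj i.succ (by rw [liftR_succ, hi])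

theorem liftTy (h : IsRen f g Γ Γ') : IsRen (liftR f) g Γ.wkTy Γ'.wkTy where
  inj := h.inj
  map i := by
    show (Γ' (g i)).wkTy = ((Γ i).wkTy).ren _
    rw [Entry.wkTy_eq, Entry.wkTy_eq, h.map, Entry.ren_ren, Entry.ren_ren]
    rfl
  notLin j hj := by
    show (Entry.wkTy _).NotLin
    rw [Entry.wkTy_eq]
    exact (h.notLin j hj).ren _

/-- A splitting of `Γ` extends to `Γ'`: the variables outside the image of `g`, not being linear, go
to both parts. -/
theorem split (h : IsRen f g Γ Γ') {Γ₁ Γ₂ : Cx S n k} (hs : Γ.Split Γ₁ Γ₂) :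
    ∃ Γ₁' Γ₂', Γ'.Split Γ₁' Γ₂' ∧ IsRen f g Γ₁ Γ₁' ∧ IsRen f g Γ₂ Γ₂' := by
  classical
  let X (Δ : Cx S n k) : Cx S m l := fun j =>
    if hj : ∃ i, g i = j then (Δ hj.choose).ren f else Γ' j
  have hX (Δ : Cx S n k) (i : Fin k) : X Δ (g i) = (Δ i).ren f := by
    have hi : ∃ i', g i' = g i := ⟨i, rfl⟩
    simp only [X, dif_pos hi, h.inj hi.choose_spec]
  have hX' (Δ : Cx S n k) (j : Fin l) (hj : ∀ i, g i ≠ j) : X Δ j = Γ' j :=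
    dif_neg (by simpa using hj)
  refine ⟨X Γ₁, X Γ₂, fun j => ?_, ⟨h.inj, hX _, fun j hj => ?_⟩,
    ⟨h.inj, hX _, fun j hj => ?_⟩⟩
  · by_cases hj : ∃ i, g i = j
    · obtain ⟨i, rfl⟩ := hj
      rw [hX, hX, h.map]
      exact (hs i).ren f
    · rw [hX' _ j (by simpa using hj), hX' _ j (by simpa using hj)]
      exact .self (h.notLin j (by simpa using hj))
  · rw [hX' _ j hj]; exact h.notLin j hj
  · rw [hX' _ j hj]; exact h.notLin j hj

theorem wk (Γ : Cx S n k) {E : Entry S.ty n} (hE : E.NotLin) :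
    IsRen (S := S) id Fin.succ Γ (scons E Γ) where
  inj := Fin.succ_injective _
  map _ := by simp
  notLin := Fin.cases (fun _ => hE) fun j hj => (hj j rfl).elim

theorem wkTy (Γ : Cx S n k) : IsRen Fin.succ id Γ Γ.wkTy where
  inj := Function.injective_id
  map _ := Entry.wkTy_eq _
  notLin j hj := (hj j rfl).elim

end Cx.IsRen

end Contexts

theorem Ty.ren_inst {T : TySig.{u}} {n m : ℕ} (f : Fin n → Fin m) (σ : Ty T (n + 1))
    (τ : Ty T n) : (σ.inst τ).ren f = (σ.ren (liftR f)).inst (τ.ren f) := by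
  rw [Ty.inst, Ty.inst, Ty.ren_sub, Ty.sub_ren]
  congr 1
  exact funext_scons rfl fun _ => rfl

@[simp] theorem Ty.ofClosed_ren {T : TySig.{u}} {n m : ℕ} (f : Fin n → Fin m) (σ : Ty T 0) :
    (ofClosed σ : Ty T n).ren f = ofClosed σ := by
  rw [Ty.ofClosed, Ty.ren_ren]
  exact congrArg (Ty.ren · σ) (Subsingleton.elim _ _)

@[simp] theorem Ty.ofClosed_sub {T : TySig.{u}} {n m : ℕ} (s : Fin n → Ty T m) (σ : Ty T 0) :
    (ofClosed σ : Ty T n).sub s = ofClosed σ := by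
  rw [Ty.ofClosed, Ty.sub_ren, Ty.ofClosed, Ty.ren_eq_sub]
  exact congrArg (Ty.sub · σ) (Subsingleton.elim _ _)

namespace HasType

theorem cast {n k : ℕ} {Γ : Cx S n k} {t : Tm S n k} {σ τ : Ty S.ty n} (h : HasType Γ t σ)
    (e : σ = τ) : HasType Γ t τ := e ▸ h

/-- Renaming and weakening by non-linear variables. -/
theorem ren {n m k l : ℕ} {f : Fin n → Fin m} {g : Fin k → Fin l} {Γ : Cx S n k}
    {Γ' : Cx S m l} {t : Tm S n k} {σ : Ty S.ty n} (ht : HasType Γ t σ)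
    (h : Cx.IsRen f g Γ Γ') : HasType Γ' (t.ren f g) (σ.ren f) := by
  induction ht generalizing m l with
  | star hΓ => exact .star (h.noLin hΓ)
  | fix hΓ => exact .fix (h.noLin hΓ)
  | con c hΓ => exact (HasType.con c (h.noLin hΓ)).cast (Ty.ofClosed_ren _ _).symm
  | ivar i hΓ hi => exact .ivar _ (h.noLin hΓ) (by rw [h.map, hi]; rfl)
  | lvar i hΓ hi =>
    exact .lvar _ (fun j hj => h.noLin_except hΓ j (by rintro i' rfl rfl; exact hj rfl))
      (by rw [h.map, hi]; rfl)
  | app hs _ _ ih₁ ih₂ =>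
    obtain ⟨_, _, hs', h₁, h₂⟩ := h.split hs
    exact .app hs' (ih₁ h₁) (ih₂ h₂)
  | lam _ ih => exact .lam (ih (h.lift _))
  | tens hs _ _ ih₁ ih₂ =>
    obtain ⟨_, _, hs', h₁, h₂⟩ := h.split hs
    exact .tens hs' (ih₁ h₁) (ih₂ h₂)
  | bang hΓ _ ih => exact .bang (h.noLin hΓ) (ih h)
  | tlam _ ih => exact .tlam (ih h.liftTy)
  | tapp τ _ ih => exact (HasType.tapp _ (ih h)).cast (Ty.ren_inst _ _ _).symm
  | letTens hs _ _ ih₁ ih₂ =>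
    obtain ⟨_, _, hs', h₁, h₂⟩ := h.split hs
    exact .letTens hs' (ih₁ h₁) (ih₂ ((h₂.lift _).lift _))
  | letBang hs _ _ ih₁ ih₂ =>
    obtain ⟨_, _, hs', h₁, h₂⟩ := h.split hs
    exact .letBang hs' (ih₁ h₁) (ih₂ (h₂.lift _))
  | letStar hs _ _ ih₁ ih₂ =>
    obtain ⟨_, _, hs', h₁, h₂⟩ := h.split hs
    exact .letStar hs' (ih₁ h₁) (ih₂ h₂)

variable {n k : ℕ} {Γ : Cx S n k}

theorem wk {t : Tm S n k} {σ : Ty S.ty n} (ht : HasType Γ t σ) {E : Entry S.ty n}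
    (hE : E.NotLin) : HasType (S := S) (scons E Γ) t.wk σ :=
  (ht.ren (Cx.IsRen.wk Γ hE)).cast (Ty.ren_id σ)

theorem wkOff {t : Tm S n k} {σ : Ty S.ty n} (ht : HasType Γ t σ) :
    HasType (S := S) (scons Entry.off Γ) t.wk σ := ht.wk trivial

theorem wkUnr {t : Tm S n k} {σ : Ty S.ty n} (ht : HasType Γ t σ) {τ : Ty S.ty n} :
    HasType (S := S) (scons (Entry.unr τ) Γ) t.wk σ := ht.wk trivial

theorem wkTy {t : Tm S n k} {σ : Ty S.ty n} (ht : HasType Γ t σ) :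
    HasType Γ.wkTy t.wkTy σ.wk := ht.ren (Cx.IsRen.wkTy Γ)

theorem app' (hΓ : Γ.NoLin) {σ τ : Ty S.ty n} {t u : Tm S n k}
    (ht : HasType Γ t (.lolli σ τ)) (hu : HasType Γ u σ) : HasType Γ (.app t u) τ :=
  .app (.self hΓ) ht hu

/-- The argument of the application takes the most recent, linear variable. -/
theorem appR (hΓ : Γ.NoLin) {ω σ τ : Ty S.ty n} {t u : Tm S n (k + 1)}
    (ht : HasType (S := S) (scons .off Γ) t (.lolli σ τ))
    (hu : HasType (S := S) (scons (.lin ω) Γ) u σ) :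
    HasType (S := S) (scons (.lin ω) Γ) (.app t u) τ :=
  .app (.scons (.right _) (.self hΓ)) ht hu

/-- The function of the application takes the most recent, linear variable. -/
theorem appL (hΓ : Γ.NoLin) {ω σ τ : Ty S.ty n} {t u : Tm S n (k + 1)}
    (ht : HasType (S := S) (scons (.lin ω) Γ) t (.lolli σ τ))
    (hu : HasType (S := S) (scons .off Γ) u σ) :
    HasType (S := S) (scons (.lin ω) Γ) (.app t u) τ :=
  .app (.scons (.left _) (.self hΓ)) ht hu

theorem lvar0 (hΓ : Γ.NoLin) {σ : Ty S.ty n} :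
    HasType (S := S) (scons (.lin σ) Γ) (.var 0) σ :=
  .lvar 0 (Fin.cases (fun h => (h rfl).elim) fun j _ => hΓ j) rfl

theorem ivar0 (hΓ : Γ.NoLin) {σ : Ty S.ty n} :
    HasType (S := S) (scons (.unr σ) Γ) (.var 0) σ :=
  .ivar 0 hΓ.unr rfl

theorem idTm (hΓ : Γ.NoLin) (σ : Ty S.ty n) : HasType Γ (Tm.idTm σ) (.lolli σ σ) :=
  .lam (.lvar0 hΓ)

/-- Composition, with the linear context divided between the two functions. -/
theorem comp_split {Γ₁ Γ₂ : Cx S n k} (hs : Γ.Split Γ₁ Γ₂) {σ τ ω : Ty S.ty n} {g f : Tm S n k}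
    (hg : HasType Γ₁ g (.lolli τ ω)) (hf : HasType Γ₂ f (.lolli σ τ)) :
    HasType Γ (Tm.comp σ g f) (.lolli σ ω) := by
  obtain ⟨Γ₀, h₀, hs'⟩ := Γ₂.exists_split
  exact .lam (.app (.scons (.right _) hs) hg.wkOff
    (.app (.scons (.right _) hs'.symm) hf.wkOff (.lvar0 h₀)))

theorem comp (hΓ : Γ.NoLin) {σ τ ω : Ty S.ty n} {g f : Tm S n k}
    (hg : HasType Γ g (.lolli τ ω)) (hf : HasType Γ f (.lolli σ τ)) :
    HasType Γ (Tm.comp σ g f) (.lolli σ ω) := comp_split (.self hΓ) hg hf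

/-- Typing of the intuitionistic abstraction, also below linear variables. -/
theorem ilam {σ τ : Ty S.ty n} {t : Tm S n (k + 1)}
    (ht : HasType (S := S) (scons (.unr σ) Γ) t τ) : HasType Γ (Tm.ilam σ t) (.arrow σ τ) := by
  obtain ⟨Γ', hΓ', hs⟩ := Γ.exists_split
  refine .lam (.letBang (.scons (.left _) hs) (.lvar0 hΓ') ?_)
  exact (ht.ren ((Cx.IsRen.wk Γ (E := .off) trivial).lift _)).cast (Ty.ren_id _) |> fun h => by
    simpa [Entry.ren] using h

end HasType

end LAPL

namespace LAPL

/-! ### The functorial action -/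

variable {S : Sig.{u}}

theorem act_sub {m n n' k k' : ℕ} (σ : Ty S.ty m) (A B : Fin m → Ty S.ty n)
    (e : Fin m → Tm S n k) (s : Fin n → Ty S.ty n') (ε : Fin k → Tm S n' k') :
    (act σ A B e).sub s ε = act σ (fun i => (A i).sub s) (fun i => (B i).sub s)
      (fun i => (e i).sub s ε) := by
  induction σ generalizing n n' k k' with
  | var i => rfl
  | con K args ih => simp only [act, Tm.sub, Ty.sub, Ty.sub_sub]; rfl
  | unit => rfl
  | tensor σ τ ih₁ ih₂ =>
    simp [act, Tm.sub, Ty.sub, Ty.sub_sub, ih₁, ih₂, Tm.sub_ren, Tm.ren_sub, Tm.ren_ren,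
      Tm.ren]
  | lolli σ τ ih₁ ih₂ =>
    simp [act, Tm.sub, Tm.comp_sub, Ty.sub, Ty.sub_sub, ih₁, ih₂, Tm.sub_ren, Tm.ren_sub]
  | bang σ ih =>
    simp [act, Tm.sub, Ty.sub, Ty.sub_sub, ih, Tm.sub_ren, Tm.ren_sub, Tm.ren_ren]
  | all σ ih =>
    simp only [act, Tm.sub, Ty.sub, Ty.sub_sub, ih, Ty.lift_sub, Tm.lift_zero, Ty.lift_zero]
    congr 4
    exact funext_scons rfl fun i => by
      simp [Tm.sub_ren, Tm.ren_sub, Tm.ren_ren]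

theorem act_ren {m n n' k k' : ℕ} (σ : Ty S.ty m) (A B : Fin m → Ty S.ty n)
    (e : Fin m → Tm S n k) (f : Fin n → Fin n') (g : Fin k → Fin k') :
    (act σ A B e).ren f g = act σ (fun i => (A i).ren f) (fun i => (B i).ren f)
      (fun i => (e i).ren f g) := by
  simp only [Tm.ren_eq_sub, act_sub, Ty.ren_eq_sub]

/-- The functorial action is well typed if every `e i` has the types that the occurrences of the
variable `i` ask for.  Variables of both polarities have to be acted upon at a single type. -/
theorem act_hasType {m n k : ℕ} (σ : Ty S.ty m) (A B : Fin m → Ty S.ty n)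
    (e : Fin m → Tm S n k) {Γ : Cx S n k} (hΓ : Γ.NoLin)
    (hp : ∀ i, Ty.Occurs true i σ → HasType Γ (e i) (.lolli (A i) (B i)))
    (hn : ∀ i, Ty.Occurs false i σ → HasType Γ (e i) (.lolli (B i) (A i)))
    (hb : ∀ i, Ty.Occurs true i σ → Ty.Occurs false i σ → A i = B i) :
    HasType Γ (act σ A B e) (.lolli (σ.sub A) (σ.sub B)) := by
  induction σ generalizing n k with
  | var i => exact hp i ⟨rfl, rfl⟩
  | con K args ih =>
    have : (Ty.con K args).sub A = (Ty.con K args).sub B :=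
      Ty.sub_congr fun i p ⟨a, h⟩ => hb i ⟨a, h⟩ ⟨a, h⟩
    rw [← this]
    exact .idTm hΓ _
  | unit => exact .idTm hΓ _
  | tensor σ τ ih₁ ih₂ =>
    have hΓ' := hΓ.off.off.off
    refine .lam (.letTens (.scons (.left _) (.self hΓ)) (.lvar0 hΓ) (.tens
      (.scons (.right _) (.scons (.left _) (.self hΓ.off))) (.app
        (.scons .off (.scons (.right _) (.self hΓ.off))) (ih₁ _ _ _ hΓ'
          (fun i hi => (hp i (.inl hi)).wkOff.wkOff.wkOff)
          (fun i hi => (hn i (.inl hi)).wkOff.wkOff.wkOff)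
          (fun i hi hi' => hb i (.inl hi) (.inl hi')))
        (HasType.lvar0 hΓ.off).wkOff)
      (.appR hΓ.off.off (ih₂ _ _ _ hΓ'
          (fun i hi => (hp i (.inr hi)).wkOff.wkOff.wkOff)
          (fun i hi => (hn i (.inr hi)).wkOff.wkOff.wkOff)
          (fun i hi hi' => hb i (.inr hi) (.inr hi')))
        (.lvar0 hΓ.off.off))))
  | lolli σ τ ih₁ ih₂ =>
    have h₁ := ih₁ B A (fun i => (e i).wk) hΓ.off
      (fun i hi => (hn i (.inl hi)).wkOff) (fun i hi => (hp i (.inl hi)).wkOff)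
      (fun i hi hi' => (hb i (.inl hi') (.inl hi)).symm)
    have h₂ := ih₂ A B (fun i => (e i).wk) hΓ.off
      (fun i hi => (hp i (.inr hi)).wkOff) (fun i hi => (hn i (.inr hi)).wkOff)
      (fun i hi hi' => hb i (.inr hi) (.inr hi'))
    exact .lam (.comp_split (.scons (.right _) (.self hΓ)) h₂
      (.comp_split (.scons (.left _) (.self hΓ)) (.lvar0 hΓ) h₁))
  | bang σ ih =>
    have hΓ' := hΓ.off.unr (σ := σ.sub A)
    exact .lam (.letBang (.scons (.left _) (.self hΓ)) (.lvar0 hΓ) (.bang hΓ' (.app' hΓ'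
      (ih _ _ _ hΓ' (fun i hi => (hp i hi).wkOff.wkUnr) (fun i hi => (hn i hi).wkOff.wkUnr) hb)
      (.ivar0 hΓ.off))))
  | all σ ih =>
    refine .lam (.tlam ?_)
    rw [Cx.wkTy_scons]
    refine .appR hΓ.wkTy (ih _ _ _ hΓ.wkTy.off ?_ ?_ ?_) ?_
    · refine Fin.cases (fun _ => .idTm hΓ.wkTy.off _) fun i hi => ?_
      have := (hp i hi).wkOff.wkTy
      rwa [Cx.wkTy_scons] at this
    · refine Fin.cases (fun _ => .idTm hΓ.wkTy.off _) fun i hi => ?_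
      have := (hn i hi).wkOff.wkTy
      rwa [Cx.wkTy_scons] at this
    · refine Fin.cases (fun _ _ => rfl) fun i hi hi' => ?_
      simp only [Ty.lift_succ, hb i hi hi']
    · refine (HasType.tapp _ (.lvar0 hΓ.wkTy)).cast ?_
      rw [Ty.inst, Ty.sub_ren]
      conv_rhs => rw [← Ty.sub_var (Ty.sub _ _)]
      congr 1
      exact funext_scons rfl fun _ => rfl

namespace ExtEq

variable {n k : ℕ} {Γ : Cx S n k}

theorem app' (hΓ : Γ.NoLin) {σ τ : Ty S.ty n} {t t' u u' : Tm S n k}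
    (ht : ExtEq Γ t t' (.lolli σ τ)) (hu : ExtEq Γ u u' σ) :
    ExtEq Γ (.app t u) (.app t' u') τ := .app (.self hΓ) ht hu

theorem beta (hΓ : Γ.NoLin) {σ τ : Ty S.ty n} {t : Tm S n (k + 1)} {u : Tm S n k}
    (ht : HasType (S := S) (scons (.lin σ) Γ) t τ) (hu : HasType Γ u σ) :
    ExtEq Γ (.app (.lam σ t) u) (t.inst u) τ := .betaTm (.self hΓ) ht hu

/-- The `β` rule for intuitionistic abstraction. -/
theorem ibeta (hΓ : Γ.NoLin) {σ τ : Ty S.ty n} {t : Tm S n (k + 1)} {u : Tm S n k}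
    (ht : HasType (S := S) (scons (.unr σ) Γ) t τ) (hu : HasType Γ u σ) :
    ExtEq Γ (.app (Tm.ilam σ t) (.bang u)) (t.inst u) τ := by
  have hb : HasType (S := S) (scons (.lin (.bang σ)) Γ)
      (.letBang σ (.var 0) (Tm.ren id (liftR Fin.succ) t)) τ := by
    refine .letBang (.scons (.left _) (.self hΓ)) (.lvar0 hΓ) ?_
    simpa [Entry.ren] using ht.ren ((Cx.IsRen.wk Γ (E := .off) trivial).lift _)
  refine (ExtEq.beta hΓ hb (.bang hΓ hu)).trans ?_
  have e : Tm.inst (.letBang σ (.var 0) (Tm.ren id (liftR Fin.succ) t)) (.bang u) =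
      .letBang σ (.bang u) t := by
    simp only [Tm.inst, Tm.sub, Tm.sub_ren, scons_zero, Ty.sub_var]
    congr 1
    conv_rhs => rw [← Tm.sub_var t]
    congr 1
    exact funext_scons rfl fun _ => rfl
  rw [e]
  exact .betaBang (.self hΓ) hΓ hu ht

/-- The `β` rule for the identity, whose argument need not be intuitionistic. -/
theorem idTm_app {σ : Ty S.ty n} {u : Tm S n k} (hu : HasType Γ u σ) :
    ExtEq Γ (.app (Tm.idTm σ) u) u σ := by
  obtain ⟨Γ', hΓ', hs⟩ := Γ.exists_split
  exact .betaTm hs (.lvar0 hΓ') hu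

theorem comp_idTm {σ τ : Ty S.ty n} {f : Tm S n k} (hf : HasType Γ f (.lolli σ τ)) :
    ExtEq Γ (Tm.comp σ f (Tm.idTm σ)) f (.lolli σ τ) := by
  obtain ⟨Γ', hΓ', hs⟩ := Γ.exists_split
  refine .trans (.lam (.app (.scons (.right _) hs.symm) (.refl hf.wkOff) ?_)) (.etaTm hf)
  simpa [Tm.ren] using idTm_app (HasType.lvar0 hΓ')

theorem idTm_comp {σ τ : Ty S.ty n} {f : Tm S n k} (hf : HasType Γ f (.lolli σ τ)) :
    ExtEq Γ (Tm.comp σ (Tm.idTm τ) f) f (.lolli σ τ) := by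
  obtain ⟨Γ', hΓ', hs⟩ := Γ.exists_split
  refine .trans (.lam ?_) (.etaTm hf)
  have h : HasType (S := S) (scons (.lin σ) Γ) (.app f.wk (.var 0)) τ :=
    .app (.scons (.right _) hs.symm) hf.wkOff (.lvar0 hΓ')
  simpa [Tm.ren] using idTm_app h

theorem comp_congr {Γ₁ Γ₂ : Cx S n k} (hs : Γ.Split Γ₁ Γ₂) {σ τ ω : Ty S.ty n}
    {g g' f f' : Tm S n k}
    (hg : ExtEq (S := S) (scons .off Γ₁) g.wk g'.wk (.lolli τ ω))
    (hf : ExtEq (S := S) (scons .off Γ₂) f.wk f'.wk (.lolli σ τ)) :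
    ExtEq Γ (Tm.comp σ g f) (Tm.comp σ g' f') (.lolli σ ω) := by
  obtain ⟨Γ₀, h₀, hs'⟩ := Γ₂.exists_split
  exact .lam (.app (.scons (.right _) hs) hg
    (.app (.scons (.right _) hs'.symm) hf (.refl (.lvar0 h₀))))

end ExtEq

/-- The functorial action preserves identities. -/
theorem act_idTm {m n k : ℕ} (σ : Ty S.ty m) (A : Fin m → Ty S.ty n) {Γ : Cx S n k}
    (hΓ : Γ.NoLin) :
    ExtEq Γ (act σ A A (fun i => Tm.idTm (A i))) (Tm.idTm (σ.sub A))
      (.lolli (σ.sub A) (σ.sub A)) := by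
  induction σ generalizing n k with
  | var i => exact .refl (.idTm hΓ _)
  | con K args ih => exact .refl (.idTm hΓ _)
  | unit => exact .refl (.idTm hΓ _)
  | tensor σ τ ih₁ ih₂ =>
    have hΓ' := hΓ.off.off.off
    have h₁ := ih₁ A hΓ'
    have h₂ := ih₂ A hΓ'
    have v₁ : HasType (S := S) (scons .off (scons (.lin (σ.sub A)) (scons .off Γ))) (.var 1)
      (σ.sub A) := (HasType.lvar0 hΓ.off).wkOff
    have v₂ : HasType (S := S) (scons (.lin (τ.sub A)) (scons .off (scons .off Γ))) (.var 0)
      (τ.sub A) := .lvar0 hΓ.off.off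
    simp only [act, Tm.ren, Ty.ren_id, liftR_zero]
    refine .trans (.lam (.letTens (.scons (.left _) (.self hΓ)) (.refl (.lvar0 hΓ)) (.tens
      (.scons (.right _) (.scons (.left _) (.self hΓ.off)))
      (.trans (.app (.scons .off (.scons (.right _) (.self hΓ.off))) h₁ (.refl v₁))
        (.idTm_app v₁))
      (.trans (.app (.scons (.right _) (.self hΓ.off.off)) h₂ (.refl v₂))
        (.idTm_app v₂))))) ?_
    exact .lam (.etaTens (.lvar0 hΓ))
  | lolli σ τ ih₁ ih₂ =>
    have v : HasType (S := S) (scons (.lin (.lolli (σ.sub A) (τ.sub A))) Γ) (.var 0)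
      (.lolli (σ.sub A) (τ.sub A)) := .lvar0 hΓ
    simp only [act, Tm.ren, Ty.ren_id, liftR_zero]
    refine .lam (.trans (.trans (.comp_congr (τ := τ.sub A)
      (.scons (.right _) (.self hΓ)) ?_ ?_)
      (.idTm_comp (.comp_split (.scons (.left _) (.self hΓ)) v (.idTm hΓ.off _)))) (.comp_idTm v))
    · have := ih₂ A hΓ.off.off
      simpa [act_ren, Tm.ren] using this
    · rw [Tm.wk, Tm.wk, Tm.comp_ren, Tm.comp_ren, Ty.ren_id]
      refine .comp_congr (.scons .off (.scons (.left _) (.self hΓ))) (.refl v.wkOff.wkOff) ?_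
      have := ih₁ A hΓ.off.off.off
      simpa [act_ren, Tm.ren] using this
  | bang σ ih =>
    have hΓ' := hΓ.off.unr (σ := σ.sub A)
    have v : HasType (S := S) (scons (.unr (σ.sub A)) (scons .off Γ)) (.var 0) (σ.sub A) :=
      .ivar0 hΓ.off
    simp only [act, Tm.ren, Ty.ren_id, liftR_zero]
    refine .trans (.lam (.letBang (.scons (.left _) (.self hΓ)) (.refl (.lvar0 hΓ)) (.bang hΓ'
      (.trans (.app' hΓ' (ih A hΓ') (.refl v)) (.idTm_app v))))) ?_
    exact .lam (.etaBang (.lvar0 hΓ))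
  | all σ ih =>
    have h := ih (Ty.lift A) hΓ.wkTy.off
    have v : HasType (S := S) (scons (.lin (.all (σ.sub (Ty.lift A)))) Γ) (.var 0)
      (.all (σ.sub (Ty.lift A))) := .lvar0 hΓ
    have v' : HasType (Cx.wkTy (S := S) (scons (.lin (.all (σ.sub (Ty.lift A)))) Γ))
        (.tapp (.var 0) (.var 0)) (σ.sub (Ty.lift A)) := by
      refine (HasType.tapp _ v.wkTy).cast ?_
      rw [Ty.inst, Ty.sub_ren]
      conv_rhs => rw [← Ty.sub_var (Ty.sub _ _)]
      congr 1
      exact funext_scons rfl fun _ => rfl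
    have e : (scons (Tm.idTm (.var 0)) fun i => (Tm.idTm (A i)).wk.wkTy :
        Fin _ → Tm S (n + 1) (k + 1)) = fun i => Tm.idTm (Ty.lift A i) :=
      funext_scons rfl fun i => by simp [Tm.ren]
    simp only [act, e]
    refine .lam (.trans (.tlam (.trans ?_ (.idTm_app v'))) (.etaTy v))
    rw [Cx.wkTy_scons] at v' ⊢
    exact .app (.scons (.right _) (.self hΓ.wkTy)) h (.refl v')

/-! ### The polymorphic functorial action -/

section Vec

variable {T : TySig.{u}} {n m k l : ℕ}

theorem Ty.vec₂_sub (A B : Ty T n) (s : Fin n → Ty T m) :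
    (fun i => (![A, B] i).sub s) = ![A.sub s, B.sub s] :=
  funext (Fin.forall_fin_two.2 ⟨rfl, rfl⟩)

theorem Ty.vec₂_ren (A B : Ty T n) (f : Fin n → Fin m) :
    (fun i => (![A, B] i).ren f) = ![A.ren f, B.ren f] :=
  funext (Fin.forall_fin_two.2 ⟨rfl, rfl⟩)

theorem Tm.vec₂_sub (t u : Tm S n k) (s : Fin n → Ty S.ty m) (e : Fin k → Tm S m l) :
    (fun i => (![t, u] i).sub s e) = ![t.sub s e, u.sub s e] :=
  funext (Fin.forall_fin_two.2 ⟨rfl, rfl⟩)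

end Vec

/-- The type `σ` is contravariant in its first and covariant in its second variable. -/
structure Ty.Mixed (σ : Ty S.ty 2) : Prop where
  neg : σ.OnlyNegative 0
  pos : σ.OnlyPositive 1

variable {n k m l : ℕ} (σ : Ty S.ty 2)

/-- The functorial action of `σ` at given types, as a function of the two linear functions. -/
def functorBody (A B C D : Ty S.ty n) : Tm S n k :=
  Tm.ilam (.lolli C A) (Tm.ilam (.lolli B D) (act σ ![A, B] ![C, D] ![.var 1, .var 0]))

/-- The type of `functorBody`. -/
def functorBodyTy (A B C D : Ty S.ty n) : Ty S.ty n :=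
  .arrow (.lolli C A) (.arrow (.lolli B D) (.lolli (σ.at₂ A B) (σ.at₂ C D)))

theorem functorBody_sub (A B C D : Ty S.ty n) (s : Fin n → Ty S.ty m) (e : Fin k → Tm S m l) :
    (functorBody σ A B C D).sub s e =
      functorBody σ (A.sub s) (B.sub s) (C.sub s) (D.sub s) := by
  simp [functorBody, Tm.ilam_sub, act_sub, Ty.sub, Tm.sub, Tm.ren, Ty.vec₂_sub, Tm.vec₂_sub]

theorem functorBody_ren (A B C D : Ty S.ty n) (s : Fin n → Fin m) (e : Fin k → Fin l) :
    (functorBody σ A B C D).ren s e =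
      functorBody σ (A.ren s) (B.ren s) (C.ren s) (D.ren s) := by
  simp only [Tm.ren_eq_sub, Ty.ren_eq_sub, functorBody_sub]

theorem functorBodyTy_sub (A B C D : Ty S.ty n) (s : Fin n → Ty S.ty m) :
    (functorBodyTy σ A B C D).sub s =
      functorBodyTy σ (A.sub s) (B.sub s) (C.sub s) (D.sub s) := by
  simp [functorBodyTy, Ty.sub, Ty.sub_sub, Ty.vec₂_sub]

theorem functorTm_ofClosed : ((functorTm σ).ofClosed : Tm S n k) =
    .tlam (.tlam (.tlam (.tlam (functorBody σ (.var 3) (.var 2) (.var 1) (.var 0))))) := by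
  have : functorTm σ =
    .tlam (.tlam (.tlam (.tlam (functorBody σ (.var 3) (.var 2) (.var 1) (.var 0))))) := rfl
  simp [this, Tm.ofClosed, Tm.ren, functorBody_ren, Ty.ren]
  rfl

theorem functorTm_ofClosed_sub (s : Fin n → Ty S.ty m) (e : Fin k → Tm S m l) :
    ((functorTm σ).ofClosed : Tm S n k).sub s e = (functorTm σ).ofClosed := by
  simp [functorTm_ofClosed, Tm.sub, functorBody_sub, Ty.sub, Ty.ren]
  rfl

theorem mapTm_sub (A B C D : Ty S.ty n) (f g : Tm S n k) (s : Fin n → Ty S.ty m)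
    (e : Fin k → Tm S m l) : (mapTm σ A B C D f g).sub s e =
      mapTm σ (A.sub s) (B.sub s) (C.sub s) (D.sub s) (f.sub s e) (g.sub s e) := by
  simp only [mapTm, Tm.sub, functorTm_ofClosed_sub]

theorem mapTm_ren (A B C D : Ty S.ty n) (f g : Tm S n k) (s : Fin n → Fin m)
    (e : Fin k → Fin l) : (mapTm σ A B C D f g).ren s e =
      mapTm σ (A.ren s) (B.ren s) (C.ren s) (D.ren s) (f.ren s e) (g.ren s e) := by
  simp only [Tm.ren_eq_sub, Ty.ren_eq_sub, mapTm_sub]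

/-- The closed type of `functorTm`. -/
def functorTy : Ty S.ty 0 :=
  .all (.all (.all (.all (functorBodyTy σ (.var 3) (.var 2) (.var 1) (.var 0)))))

variable {σ}

theorem functorAct_hasType (hσ : σ.Mixed) {Γ : Cx S n k} (hΓ : Γ.NoLin) {A B C D : Ty S.ty n}
    {f g : Tm S n k} (hf : HasType Γ f (.lolli C A)) (hg : HasType Γ g (.lolli B D)) :
    HasType Γ (act σ ![A, B] ![C, D] ![f, g]) (.lolli (σ.at₂ A B) (σ.at₂ C D)) :=
  act_hasType σ _ _ _ hΓ
    (Fin.forall_fin_two.2 ⟨fun h => (hσ.neg h).elim, fun _ => hg⟩)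
    (Fin.forall_fin_two.2 ⟨fun _ => hf, fun h => (hσ.pos h).elim⟩)
    (Fin.forall_fin_two.2 ⟨fun h => (hσ.neg h).elim, fun _ h => (hσ.pos h).elim⟩)

theorem functorBody_hasType (hσ : σ.Mixed) {Γ : Cx S n k} (hΓ : Γ.NoLin) (A B C D : Ty S.ty n) :
    HasType Γ (functorBody σ A B C D) (functorBodyTy σ A B C D) :=
  .ilam (.ilam (functorAct_hasType hσ hΓ.unr.unr (HasType.ivar0 hΓ).wkUnr (.ivar0 hΓ.unr)))

theorem functorTm_hasType (hσ : σ.Mixed) {Γ : Cx S n k} (hΓ : Γ.NoLin) :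
    HasType Γ (functorTm σ).ofClosed (functorTy σ).ofClosed := by
  rw [functorTm_ofClosed, Ty.ofClosed, Ty.ren_eq_sub]
  simp only [functorTy, Ty.sub, functorBodyTy_sub, Ty.lift_zero, Ty.lift_one, Ty.lift_two,
    Ty.lift_three, Ty.ren]
  exact .tlam (.tlam (.tlam (.tlam (functorBody_hasType hσ hΓ.wkTy.wkTy.wkTy.wkTy _ _ _ _))))

/-- Instantiation of the functorial action at types. -/
theorem functorTm_tapp (hσ : σ.Mixed) {Γ : Cx S n k} (hΓ : Γ.NoLin) (A B C D : Ty S.ty n) :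
    ExtEq Γ (.tapp (.tapp (.tapp (.tapp (functorTm σ).ofClosed A) B) C) D)
      (functorBody σ A B C D) (functorBodyTy σ A B C D) := by
  have h₄ : ExtEq Γ (.tapp (functorTm σ).ofClosed A)
      (.tlam (.tlam (.tlam (functorBody σ A.wk.wk.wk (.var 2) (.var 1) (.var 0)))))
      (.all (.all (.all (functorBodyTy σ A.wk.wk.wk (.var 2) (.var 1) (.var 0))))) := by
    have := ExtEq.betaTy A (Γ := Γ) (.tlam (.tlam (.tlam
      (functorBody_hasType hσ hΓ.wkTy.wkTy.wkTy.wkTy (.var 3) (.var 2) (.var 1) (.var 0)))))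
    rw [functorTm_ofClosed]
    simpa [Tm.instTy, Tm.sub, functorBody_sub, Ty.inst, Ty.sub, functorBodyTy_sub, Ty.ren]
      using this
  have h₃ : ExtEq Γ (.tapp (.tapp (functorTm σ).ofClosed A) B)
      (.tlam (.tlam (functorBody σ A.wk.wk B.wk.wk (.var 1) (.var 0))))
      (.all (.all (functorBodyTy σ A.wk.wk B.wk.wk (.var 1) (.var 0)))) := by
    have := (ExtEq.tapp B h₄).trans (ExtEq.betaTy B (Γ := Γ) (.tlam (.tlam
      (functorBody_hasType hσ hΓ.wkTy.wkTy.wkTy A.wk.wk.wk (.var 2) (.var 1) (.var 0)))))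
    simpa [Tm.instTy, Tm.sub, functorBody_sub, Ty.inst, Ty.sub, functorBodyTy_sub, Ty.ren,
      Ty.sub_ren, Ty.sub_vars, Ty.ren_ren] using this
  have h₂ : ExtEq Γ (.tapp (.tapp (.tapp (functorTm σ).ofClosed A) B) C)
      (.tlam (functorBody σ A.wk B.wk C.wk (.var 0)))
      (.all (functorBodyTy σ A.wk B.wk C.wk (.var 0))) := by
    have := (ExtEq.tapp C h₃).trans (ExtEq.betaTy C (Γ := Γ) (.tlam
      (functorBody_hasType hσ hΓ.wkTy.wkTy A.wk.wk B.wk.wk (.var 1) (.var 0))))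
    simpa [Tm.instTy, Tm.sub, functorBody_sub, Ty.inst, Ty.sub, functorBodyTy_sub, Ty.ren,
      Ty.sub_ren, Ty.sub_vars, Ty.ren_ren] using this
  have := (ExtEq.tapp D h₂).trans (ExtEq.betaTy D (Γ := Γ)
      (functorBody_hasType hσ hΓ.wkTy A.wk B.wk C.wk (.var 0)))
  simpa [Tm.instTy, Tm.sub, functorBody_sub, Ty.inst, Ty.sub, functorBodyTy_sub, Ty.ren,
      Ty.sub_ren, Ty.sub_vars, Ty.ren_ren] using this

theorem functorTm_tapp_hasType (hσ : σ.Mixed) {Γ : Cx S n k} (hΓ : Γ.NoLin)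
    (A B C D : Ty S.ty n) :
    HasType Γ (.tapp (.tapp (.tapp (.tapp (functorTm σ).ofClosed A) B) C) D)
      (functorBodyTy σ A B C D) := by
  have h := functorTm_hasType hσ hΓ
  rw [Ty.ofClosed, Ty.ren_eq_sub] at h
  have := HasType.tapp D (HasType.tapp C (HasType.tapp B (HasType.tapp A h)))
  simpa [Ty.inst, Ty.sub, functorBodyTy_sub, Ty.ren, Ty.sub_ren, Ty.sub_vars, Ty.ren_ren,
    functorTy] using this

theorem mapTm_hasType (hσ : σ.Mixed) {Γ : Cx S n k} (hΓ : Γ.NoLin) {A B C D : Ty S.ty n}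
    {f g : Tm S n k} (hf : HasType Γ f (.lolli C A)) (hg : HasType Γ g (.lolli B D)) :
    HasType Γ (mapTm σ A B C D f g) (.lolli (σ.at₂ A B) (σ.at₂ C D)) :=
  .app' hΓ (.app' hΓ (functorTm_tapp_hasType hσ hΓ A B C D) (.bang hΓ hf)) (.bang hΓ hg)

theorem mapTm_eq_act (hσ : σ.Mixed) {Γ : Cx S n k} (hΓ : Γ.NoLin) {A B C D : Ty S.ty n}
    {f g : Tm S n k} (hf : HasType Γ f (.lolli C A)) (hg : HasType Γ g (.lolli B D)) :
    ExtEq Γ (mapTm σ A B C D f g) (act σ ![A, B] ![C, D] ![f, g])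
      (.lolli (σ.at₂ A B) (σ.at₂ C D)) := by
  have h₁ := ExtEq.ibeta hΓ (HasType.ilam (σ := .lolli B D) (functorAct_hasType hσ
    (hΓ.unr (σ := .lolli C A)).unr (A := A) (HasType.ivar0 hΓ).wkUnr (.ivar0 hΓ.unr))) hf
  have e₁ : Tm.inst (Tm.ilam (.lolli B D) (act σ ![A, B] ![C, D] ![.var 1, .var 0])) f =
      Tm.ilam (.lolli B D) (act σ ![A, B] ![C, D] ![f.wk, .var 0]) := by
    simp [Tm.inst, Tm.ilam_sub, act_sub, Ty.sub, Tm.sub, Tm.vec₂_sub]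
  rw [show (.var 1 : Tm S n (k + 2)) = .var (Fin.succ 0) from rfl] at e₁
  have h₂ := ExtEq.ibeta hΓ (functorAct_hasType hσ (hΓ.unr (σ := .lolli B D)) (A := A)
    hf.wkUnr (.ivar0 hΓ)) hg
  have e₂ : Tm.inst (act σ ![A, B] ![C, D] ![f.wk, .var 0]) g =
      act σ ![A, B] ![C, D] ![f, g] := by
    simp [Tm.inst, act_sub, Tm.sub, Tm.sub_ren, Tm.vec₂_sub]
  refine .trans (.app' hΓ (.trans (.app' hΓ (functorTm_tapp hσ hΓ A B C D)
    (.refl (.bang hΓ hf))) h₁) (.refl (.bang hΓ hg))) ?_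
  rw [← e₂]
  exact e₁ ▸ h₂

theorem mapTm_idTm (hσ : σ.Mixed) {Γ : Cx S n k} (hΓ : Γ.NoLin) (A B : Ty S.ty n) :
    ExtEq Γ (mapTm σ A B A B (Tm.idTm A) (Tm.idTm B)) (Tm.idTm (σ.at₂ A B))
      (.lolli (σ.at₂ A B) (σ.at₂ A B)) := by
  refine (mapTm_eq_act hσ hΓ (.idTm hΓ A) (.idTm hΓ B)).trans ?_
  have e : (![Tm.idTm A, Tm.idTm B] : Fin 2 → Tm S n k) = fun i => Tm.idTm (![A, B] i) :=
    funext (Fin.forall_fin_two.2 ⟨rfl, rfl⟩)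
  rw [e]
  exact act_idTm σ ![A, B] hΓ

end LAPL

namespace LAPL

/-! ### Derived rules of the logic -/

variable {S : Sig.{u}}

theorem Rl.ren_eq_sub {n k r m l q : ℕ} (f : Fin n → Fin m) (g : Fin k → Fin l)
    (h : Fin r → Fin q) (ρ : Rl S n k r) : ρ.ren f g h = ρ.sub (fun i => Ty.var (f i))
      (fun i => Tm.var (g i)) (fun i => Rl.var (h i)) := (Rl.sub_vars f g h ρ).symm

theorem Rl.sub_sub {n k r m l k' k'' r' r'' : ℕ} (s : Fin n → Ty S.ty m)
    (e : Fin k → Tm S m k') (d : Fin r → Rl S m k' r') (s' : Fin m → Ty S.ty l)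
    (e' : Fin k' → Tm S l k'') (d' : Fin r' → Rl S l k'' r'') (ρ : Rl S n k r) :
    (ρ.sub s e d).sub s' e' d' = ρ.sub (fun i => (s i).sub s') (fun i => (e i).sub s' e')
        (fun i => (d i).sub s' e' d') :=
  Fm.Rl_sub_sub.2 ρ s e d s' e' d'

/-- Renaming of the type variables of a declaration. -/
def RlDecl.ren {n m : ℕ} (f : Fin n → Fin m) (D : RlDecl S n) : RlDecl S m :=
  ⟨D.kind, D.dom.ren f, D.cod.ren f⟩

/-- `f`, `g`, `h` rename the variables of the contexts `Γ` and `Θ` into those of `Γ'` and `Θ'`. -/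
structure IsRen {n m k l r q : ℕ} (f : Fin n → Fin m) (g : Fin k → Fin l) (h : Fin r → Fin q)
    (Γ : ICx S n k) (Θ : RCx S n r) (Γ' : ICx S m l) (Θ' : RCx S m q) : Prop where
  inj : Function.Injective g
  tm : ∀ i, Γ' (g i) = (Γ i).ren f
  rl : ∀ i, Θ' (h i) = (Θ i).ren f

namespace IsRen

variable {n m k l r q : ℕ} {f : Fin n → Fin m} {g : Fin k → Fin l} {h : Fin r → Fin q}
    {Γ : ICx S n k} {Θ : RCx S n r} {Γ' : ICx S m l} {Θ' : RCx S m q}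

theorem toCx (H : IsRen f g h Γ Θ Γ' Θ') : Cx.IsRen f g Γ.toCx Γ'.toCx where
  inj := H.inj
  map i := by rw [ICx.toCx, H.tm]; rfl
  notLin _ _ := trivial

theorem comp {n' k' r' : ℕ} {f' : Fin m → Fin n'} {g' : Fin l → Fin k'} {h' : Fin q → Fin r'}
    {Γ'' : ICx S n' k'} {Θ'' : RCx S n' r'} (H : IsRen f g h Γ Θ Γ' Θ')
    (H' : IsRen f' g' h' Γ' Θ' Γ'' Θ'') :
    IsRen (fun i => f' (f i)) (fun i => g' (g i)) (fun i => h' (h i)) Γ Θ Γ'' Θ'' where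
  inj := H'.inj.comp H.inj
  tm i := by rw [H'.tm, H.tm, Ty.ren_ren]
  rl i := by rw [H'.rl, H.rl]; simp [RlDecl.ren, Ty.ren_ren]

theorem id (Γ : ICx S n k) (Θ : RCx S n r) : IsRen id id id Γ Θ Γ Θ where
  inj := Function.injective_id
  tm _ := by simp
  rl _ := by simp [RlDecl.ren]

theorem wkTm (Γ : ICx S n k) (Θ : RCx S n r) (σ : Ty S.ty n) :
    IsRen (S := S) _root_.id Fin.succ _root_.id Γ Θ (scons σ Γ) Θ where
  inj := Fin.succ_injective _
  tm _ := by simp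
  rl _ := by simp [RlDecl.ren]

theorem wkTy (Γ : ICx S n k) (Θ : RCx S n r) :
    IsRen Fin.succ _root_.id _root_.id Γ Θ Γ.wkTy Θ.wkTy where
  inj := Function.injective_id
  tm _ := rfl
  rl _ := rfl

theorem wkRl (Γ : ICx S n k) (Θ : RCx S n r) (D : RlDecl S n) :
    IsRen (S := S) _root_.id _root_.id Fin.succ Γ Θ Γ (scons D Θ) where
  inj := Function.injective_id
  tm _ := by simp
  rl _ := by simp [RlDecl.ren]

end IsRen

variable {P : Schemes} {n k r : ℕ} {Γ : ICx S n k} {Θ : RCx S n r} {Φ : List (Fm S n k r)}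

theorem HasType.ivar' (Γ : ICx S n k) (i : Fin k) : HasType Γ.toCx (.var i) (Γ i) :=
  .ivar i (ICx.toCx_noLin Γ) rfl

theorem HasType.iapp {σ τ : Ty S.ty n} {t u : Tm S n k} (ht : HasType Γ.toCx t (.lolli σ τ))
    (hu : HasType Γ.toCx u σ) : HasType Γ.toCx (.app t u) τ := .app' (ICx.toCx_noLin Γ) ht hu

theorem HasType.ibang {σ : Ty S.ty n} {t : Tm S n k} (ht : HasType Γ.toCx t σ) :
    HasType Γ.toCx (.bang t) (.bang σ) := .bang (ICx.toCx_noLin Γ) ht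

theorem HasType.iren {m l q : ℕ} {f : Fin n → Fin m} {g : Fin k → Fin l} {h : Fin r → Fin q}
    {Γ' : ICx S m l} {Θ' : RCx S m q} {t : Tm S n k} {σ : Ty S.ty n}
    (ht : HasType Γ.toCx t σ) (H : IsRen f g h Γ Θ Γ' Θ') :
    HasType Γ'.toCx (t.ren f g) (σ.ren f) := ht.ren H.toCx

theorem HasType.iwk {t : Tm S n k} {σ : Ty S.ty n} (ht : HasType Γ.toCx t σ) (τ : Ty S.ty n) :
    HasType (ICx.toCx (S := S) (scons τ Γ)) t.wk σ :=
  (ht.iren (IsRen.wkTm Γ (Fin.elim0 : RCx S n 0) τ)).cast (Ty.ren_id σ)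

theorem HasType.iwkTy {t : Tm S n k} {σ : Ty S.ty n} (ht : HasType Γ.toCx t σ) :
    HasType (ICx.toCx (S := S) Γ.wkTy) t.wkTy σ.wk := ht.wkTy

/-- Admissibility in a form that is visibly stable under renaming. -/
structure StableAdm (P : Schemes) (Γ : ICx S n k) (Θ : RCx S n r) (ρ : Rl S n k r)
    (σ τ : Ty S.ty n) : Prop where
  ren_adm : ∀ {m l q : ℕ} (f : Fin n → Fin m) (g : Fin k → Fin l) (h : Fin r → Fin q)
    (Γ' : ICx S m l) (Θ' : RCx S m q), IsRen f g h Γ Θ Γ' Θ' → Adm P Γ' Θ' (ρ.ren f g h) (σ.ren f) (τ.ren f)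

namespace StableAdm

variable {ρ : Rl S n k r} {σ τ : Ty S.ty n}

theorem adm (hρ : StableAdm P Γ Θ ρ σ τ) : Adm P Γ Θ ρ σ τ := by
  simpa using hρ.ren_adm id id id Γ Θ (IsRen.id Γ Θ)

theorem wf (hρ : StableAdm P Γ Θ ρ σ τ) : WfRl P Γ Θ ρ σ τ := .ofAdm hρ.adm

theorem ren {m l q : ℕ} {f : Fin n → Fin m} {g : Fin k → Fin l} {h : Fin r → Fin q}
    {Γ' : ICx S m l} {Θ' : RCx S m q} (hρ : StableAdm P Γ Θ ρ σ τ)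
    (H : IsRen f g h Γ Θ Γ' Θ') : StableAdm P Γ' Θ' (ρ.ren f g h) (σ.ren f) (τ.ren f) :=
  ⟨fun f' g' h' Γ'' Θ'' H' => by
    simpa only [Rl.ren_ren, Ty.ren_ren] using hρ.ren_adm _ _ _ Γ'' Θ'' (H.comp H')⟩

theorem wkTm (hρ : StableAdm P Γ Θ ρ σ τ) (ω : Ty S.ty n) :
    StableAdm (S := S) P (scons ω Γ) Θ ρ.wkTm σ τ := by
  have := hρ.ren (IsRen.wkTm Γ Θ ω)
  rwa [Ty.ren_id, Ty.ren_id] at this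

theorem wkTy (hρ : StableAdm P Γ Θ ρ σ τ) :
    StableAdm (S := S) P Γ.wkTy Θ.wkTy ρ.wkTy σ.wk τ.wk := hρ.ren (IsRen.wkTy Γ Θ)

theorem wkRl (hρ : StableAdm P Γ Θ ρ σ τ) (D : RlDecl S n) :
    StableAdm (S := S) P Γ (scons D Θ) ρ.wkRl σ τ := by
  have := hρ.ren (IsRen.wkRl Γ Θ D)
  rwa [Ty.ren_id, Ty.ren_id] at this

theorem var {i : Fin r} (hi : Θ i = ⟨.adm, σ, τ⟩) : StableAdm P Γ Θ (.var i) σ τ :=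
  ⟨fun f g h Γ' Θ' H => .var (h i) (by rw [H.rl, hi]; rfl)⟩

theorem interp {m : ℕ} (σ : Ty S.ty m) {τ τ' : Fin m → Ty S.ty n} {ρ : Fin m → Rl S n k r}
    (hρ : ∀ i, StableAdm P Γ Θ (ρ i) (τ i) (τ' i)) :
    StableAdm P Γ Θ (.interp m σ ρ) (σ.sub τ) (σ.sub τ') := ⟨fun f g h Γ' Θ' H => by
  rw [Ty.ren_sub, Ty.ren_sub]
  exact .interp σ fun i => (hρ i).ren_adm f g h Γ' Θ' H⟩

end StableAdm

theorem Rl.eqRel_ren {m l q : ℕ} (f : Fin n → Fin m) (g : Fin k → Fin l) (h : Fin r → Fin q)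
    (σ : Ty S.ty n) : (Rl.eqRel σ : Rl S n k r).ren f g h = Rl.eqRel (σ.ren f) := by
  simp [Rl.eqRel, Rl.graph, Rl.ren, Fm.ren, Tm.ren]

theorem Rl.eqRel_sub {m l q : ℕ} (s : Fin n → Ty S.ty m) (e : Fin k → Tm S m l)
    (d : Fin r → Rl S m l q) (σ : Ty S.ty n) :
    (Rl.eqRel σ : Rl S n k r).sub s e d = Rl.eqRel (σ.sub s) := by
  simp [Rl.eqRel, Rl.graph, Rl.sub, Fm.sub, Tm.sub, Tm.ren]

theorem StableAdm.eqRel (σ : Ty S.ty n) : StableAdm P Γ Θ (Rl.eqRel σ) σ σ :=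
  ⟨fun f g h Γ' Θ' _ => by rw [Rl.eqRel_ren]; exact .eqRel _⟩

/-- The relation `(x : σ, y : τ). f x =_ω g y`.  Graphs of functions and their opposites are of
this form. -/
def Rl.pull (σ τ ω : Ty S.ty n) (f g : Tm S n k) : Rl S n k r :=
  .abs σ τ (.rel (Rl.eqRel ω : Rl S n k r).wkTm.wkTm (.app f.wk.wk (.var 1))
    (.app g.wk.wk (.var 0)))

theorem Rl.pull_ren {m l q : ℕ} (f : Fin n → Fin m) (g : Fin k → Fin l) (h : Fin r → Fin q)
    (σ τ ω : Ty S.ty n) (t u : Tm S n k) : (Rl.pull σ τ ω t u : Rl S n k r).ren f g h =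
      Rl.pull (σ.ren f) (τ.ren f) (ω.ren f) (t.ren f g) (u.ren f g) := by
  simp [Rl.pull, Rl.ren, Fm.ren, Tm.ren, Rl.eqRel_ren, Tm.ren_ren]

theorem StableAdm.pull {σ τ ω : Ty S.ty n} {f g : Tm S n k}
    (hf : HasType Γ.toCx f (.lolli σ ω)) (hg : HasType Γ.toCx g (.lolli τ ω)) :
    StableAdm P Γ Θ (Rl.pull σ τ ω f g) σ τ := ⟨fun _ _ _ Γ' Θ' H => by
  rw [Rl.pull_ren]
  exact .reindex (.eqRel _) (hf.iren H) (hg.iren H)⟩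

namespace Prov

/-- Renaming and weakening of the contexts. -/
theorem ren {m l q : ℕ} {f : Fin n → Fin m} {g : Fin k → Fin l} {h : Fin r → Fin q}
    {Γ' : ICx S m l} {Θ' : RCx S m q} {φ : Fm S n k r} (hφ : Prov P Γ Θ Φ φ)
    (H : IsRen f g h Γ Θ Γ' Θ') : Prov P Γ' Θ' (Φ.map (Fm.ren f g h)) (φ.ren f g h) := by
  have := Prov.subst (fun i => Ty.var (f i)) (e := fun i => Tm.var (g i))
    (d := fun i => Rl.var (h i)) (Γ' := Γ') (Θ' := Θ') hφ
    (fun i => by rw [Ty.sub_vars, ← H.tm]; exact .ivar' Γ' _)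
    (fun i => by
      rw [Ty.sub_vars, Ty.sub_vars]
      have := H.rl i
      rcases hk : Θ i with ⟨_ | _, σ, τ⟩ <;> rw [hk] at this
      · exact .var _ this
      · exact .ofAdm (.var _ this))
    (fun i hi => by
      rw [Ty.sub_vars, Ty.sub_vars]
      refine .var _ ?_
      rw [H.rl, ← hi]; rfl)
  rw [Fm.sub_vars] at this
  convert this using 2
  exact funext fun φ => (Fm.sub_vars f g h φ).symm

theorem cut {φ ψ : Fm S n k r} (hφ : Prov P Γ Θ Φ φ) (w : WfFm P Γ Θ φ)
    (hψ : Prov P Γ Θ (φ :: Φ) ψ) : Prov P Γ Θ Φ ψ := .impE (.impI w hψ) hφ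

theorem head {φ : Fm S n k r} (w : WfFm P Γ Θ φ) : Prov P Γ Θ (φ :: Φ) φ :=
  .hyp w (.head _)

theorem rfl' {σ : Ty S.ty n} {t : Tm S n k} (ht : HasType Γ.toCx t σ) :
    Prov P Γ Θ Φ (.eq σ t t) := .ofExtEq (.refl ht)

theorem iff_mp {φ ψ : Fm S n k r} (h : Prov P Γ Θ Φ (φ.iff ψ)) :
    Prov P Γ Θ Φ φ ↔ Prov P Γ Θ Φ ψ := ⟨(andE₁ h).impE, (andE₂ h).impE⟩

theorem rel_abs {σ τ : Ty S.ty n} {φ : Fm S n (k + 2) r} {t u : Tm S n k}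
    (w : WfFm (S := S) P (scons τ (scons σ Γ)) Θ φ) (ht : HasType Γ.toCx t σ)
    (hu : HasType Γ.toCx u τ) :
    Prov P Γ Θ Φ (.rel (.abs σ τ φ) t u) ↔ Prov P Γ Θ Φ (φ.instTm₂ t u) :=
  (defRel w ht hu).iff_mp

/-- Elimination of two nested universal quantifiers over terms. -/
theorem allTm₂E {σ τ : Ty S.ty n} {φ : Fm S n (k + 2) r} {t u : Tm S n k}
    (h : Prov P Γ Θ Φ (.allTm σ (.allTm τ φ))) (ht : HasType Γ.toCx t σ)
    (hu : HasType Γ.toCx u τ) : Prov P Γ Θ Φ (φ.instTm₂ t u) := by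
  have h₁ := Prov.allTmE h ht
  simp only [Fm.instTm, Fm.sub, Ty.sub_var] at h₁
  have h₂ := Prov.allTmE h₁ hu
  rw [Fm.instTm, Fm.sub_sub] at h₂
  have e : (fun i => (Tm.lift (scons t Tm.var) i).sub Ty.var (scons u Tm.var)) =
      scons u (scons t Tm.var) :=
    funext_scons rfl (Fin.cases (by simp [Tm.sub_ren]) fun i => by
      simp [Tm.sub_ren, Tm.sub])
  rw [e] at h₂
  simpa only [Ty.sub_var, Rl.sub_ren, Rl.sub, id] using h₂

/-- Elimination of `∀ α, β, R : Adm(α, β)`. -/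
theorem allAdmE' {φ : Fm S (n + 2) k (r + 1)} {ρ : Rl S n k r} {A B : Ty S.ty n}
    (h : Prov P Γ Θ Φ (Rl.allAdm φ)) (hρ : Adm P Γ Θ ρ A B) :
    Prov P Γ Θ Φ (φ.sub (scons B (scons A Ty.var)) Tm.var (scons ρ Rl.var)) := by
  have h₁ := Prov.allTyE A h
  simp only [Fm.instTy, Fm.sub] at h₁
  have h₂ := Prov.allTyE B h₁
  simp only [Fm.instTy, Fm.sub] at h₂
  have eA : ((Ty.var 1).sub (Ty.lift (scons A Ty.var))).sub (scons B Ty.var) = A := by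
    simp [Ty.sub, Ty.sub_ren]
  have eB : ((Ty.var 0).sub (Ty.lift (scons A Ty.var))).sub (scons B Ty.var) = B := by
    simp [Ty.sub]
  rw [eA, eB] at h₂
  have h₃ := Prov.allAdmE h₂ hρ
  rw [Fm.instRl, Fm.sub_sub, Fm.sub_sub] at h₃
  convert h₃ using 2
  · refine funext_scons ?_ (Fin.cases ?_ fun i => ?_) <;> simp [Ty.sub, Ty.sub_ren]
  · exact funext fun i => by simp [Tm.sub, Tm.ren]
  · refine funext_scons ?_ fun i => ?_ <;> simp [Rl.lift, Rl.sub, Rl.ren]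

theorem rel_equiv {σ τ : Ty S.ty n} {ρ ρ' : Rl S n k r} {t u : Tm S n k}
    (h : Prov P Γ Θ Φ (Rl.equiv σ τ ρ ρ')) (ht : HasType Γ.toCx t σ)
    (hu : HasType Γ.toCx u τ) : Prov P Γ Θ Φ (.rel ρ t u) ↔ Prov P Γ Θ Φ (.rel ρ' t u) := by
  have := allTm₂E h ht hu
  refine (iff_mp (φ := .rel ρ t u) (ψ := .rel ρ' t u) ?_)
  simpa [Fm.instTm₂, Fm.iff, Fm.sub, Rl.sub_ren, Tm.sub] using this

end Prov

end LAPL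

namespace LAPL

variable {S : Sig.{u}} {P : Schemes} {n k r : ℕ} {Γ : ICx S n k} {Θ : RCx S n r}
  {Φ : List (Fm S n k r)}

namespace Prov

/-! ### Internal equality -/

theorem rel_eqRel {σ : Ty S.ty n} {t u : Tm S n k} (ht : HasType Γ.toCx t σ)
    (hu : HasType Γ.toCx u σ) :
    Prov P Γ Θ Φ (.rel (Rl.eqRel σ) t u) ↔ Prov P Γ Θ Φ (.eq σ t u) := by
  have w : WfFm (S := S) P (scons σ (scons σ Γ)) Θ
      (.eq σ (.app (Tm.idTm σ : Tm S n k).wk.wk (.var 1)) (.var 0)) :=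
    .eq ((((HasType.idTm (ICx.toCx_noLin Γ) σ).iwk σ).iwk σ).iapp (.ivar' _ 1)) (.ivar' _ 0)
  have hb : Prov P Γ Θ Φ (.eq σ (.app (Tm.idTm σ) t) t) := .ofExtEq (.idTm_app ht)
  have e : Fm.instTm₂ (.eq σ (.app (Tm.idTm σ : Tm S n k).wk.wk (.var 1)) (.var 0) :
      Fm S n (k + 2) r) t u = .eq σ (.app (Tm.idTm σ) t) u := by
    simp [Fm.instTm₂, Fm.sub, Tm.sub, Tm.ren]
  rw [Rl.eqRel, Rl.graph, rel_abs w ht hu, e]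
  exact ⟨fun h => hb.symm.trans h, fun h => hb.trans h⟩

theorem rel_pull {σ τ ω : Ty S.ty n} {f g t u : Tm S n k} (hf : HasType Γ.toCx f (.lolli σ ω))
    (hg : HasType Γ.toCx g (.lolli τ ω)) (ht : HasType Γ.toCx t σ) (hu : HasType Γ.toCx u τ) :
    Prov P Γ Θ Φ (.rel (Rl.pull σ τ ω f g) t u) ↔
      Prov P Γ Θ Φ (.eq ω (.app f t) (.app g u)) := by
  rw [← rel_eqRel (hf.iapp ht) (hg.iapp hu), Rl.pull, rel_abs _ ht hu]
  · simp [Fm.instTm₂, Fm.sub, Tm.sub, Rl.eqRel_ren, Rl.eqRel_sub, Tm.sub_ren]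
  · have e : (Rl.eqRel ω : Rl S n k r).wkTm.wkTm = Rl.eqRel ω := by simp [Rl.eqRel_ren]
    rw [e]
    exact .rel (StableAdm.eqRel ω).wf (((hf.iwk σ).iwk τ).iapp (.ivar' _ 1))
      (((hg.iwk σ).iwk τ).iapp (.ivar' _ 0))

/-- Internal equality is a congruence. -/
theorem congr {σ τ : Ty S.ty n} (c : Tm S n (k + 1)) {t u : Tm S n k}
    (hc : HasType (ICx.toCx (S := S) (scons σ Γ)) c τ) (hct : HasType Γ.toCx (c.inst t) τ)
    (ht : HasType Γ.toCx t σ) (hu : HasType Γ.toCx u σ) (h : Prov P Γ Θ Φ (.eq σ t u)) :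
    Prov P Γ Θ Φ (.eq τ (c.inst t) (c.inst u)) := by
  have w : WfFm (S := S) P (scons σ (scons σ Γ)) Θ
      (.eq τ (c.inst t).wk.wk (c.ren id (liftR Fin.succ))) := by
    refine .eq ((hct.iwk σ).iwk σ) ?_
    rw [ICx.toCx_scons] at hc ⊢
    have := hc.ren ((IsRen.wkTm Γ Θ σ).toCx.lift (.unr σ))
    simpa [Entry.ren] using this
  have e (u : Tm S n k) : Fm.instTm₂ (.eq τ (c.inst t).wk.wk (c.ren id (liftR Fin.succ)) :
      Fm S n (k + 2) r) t u = .eq τ (c.inst t) (c.inst u) := by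
    have : (fun i => (scons u (scons t Tm.var) : Fin (k + 2) → Tm S n k) (liftR Fin.succ i)) =
      scons u Tm.var := funext_scons rfl fun i => rfl
    simp only [Fm.instTm₂, Fm.sub, Tm.sub_ren, Ty.sub_var, this]
    congr 1
    exact Tm.sub_var _
  have h₁ := (rel_abs (Φ := Φ) w ht ht).2 (by rw [e]; exact .rfl' hct)
  have h₂ := Prov.substAx (.abs w) h₁ (.rfl' ht) h
  rw [← e]
  exact (rel_abs w ht hu).1 h₂

theorem app_congr {σ τ : Ty S.ty n} {f g t u : Tm S n k} (hf : HasType Γ.toCx f (.lolli σ τ))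
    (hg : HasType Γ.toCx g (.lolli σ τ)) (ht : HasType Γ.toCx t σ) (hu : HasType Γ.toCx u σ)
    (h : Prov P Γ Θ Φ (.eq (.lolli σ τ) f g)) (h' : Prov P Γ Θ Φ (.eq σ t u)) :
    Prov P Γ Θ Φ (.eq τ (.app f t) (.app g u)) := by
  have e₁ (f : Tm S n k) : Tm.inst (.app (.var 0) t.wk) f = .app f t := by
    simp [Tm.inst, Tm.sub, Tm.sub_ren]
  have e₂ (t : Tm S n k) : Tm.inst (.app g.wk (.var 0)) t = .app g t := by
    simp [Tm.inst, Tm.sub, Tm.sub_ren]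
  have h₁ := congr (.app (.var 0) t.wk) ((HasType.ivar' _ 0).iapp (ht.iwk _))
    (by rw [e₁]; exact hf.iapp ht) hf hg h
  have h₂ := congr (.app g.wk (.var 0)) ((hg.iwk _).iapp (.ivar' _ 0))
    (by rw [e₂]; exact hg.iapp ht) ht hu h'
  rw [e₁, e₁] at h₁
  rw [e₂, e₂] at h₂
  exact h₁.trans h₂

theorem bang_congr {σ : Ty S.ty n} {t u : Tm S n k} (ht : HasType Γ.toCx t σ)
    (hu : HasType Γ.toCx u σ) (h : Prov P Γ Θ Φ (.eq σ t u)) :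
    Prov P Γ Θ Φ (.eq (.bang σ) (.bang t) (.bang u)) := by
  simpa [Tm.inst, Tm.sub] using congr (.bang (.var 0)) (HasType.ibang (.ivar' _ 0))
    (by simpa [Tm.inst, Tm.sub] using ht.ibang) ht hu h

theorem tapp_congr {σ : Ty S.ty (n + 1)} {t u : Tm S n k} (A : Ty S.ty n)
    (ht : HasType Γ.toCx t (.all σ)) (hu : HasType Γ.toCx u (.all σ))
    (h : Prov P Γ Θ Φ (.eq (.all σ) t u)) :
    Prov P Γ Θ Φ (.eq (σ.inst A) (.tapp t A) (.tapp u A)) := by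
  simpa [Tm.inst, Tm.sub] using congr (.tapp (.var 0) A) (.tapp A (.ivar' (scons (.all σ) Γ) 0))
    (by simpa [Tm.inst, Tm.sub] using HasType.tapp A ht) ht hu h

/-! ### Extensionality -/

theorem ext (hx : P.extensionality) {σ τ : Ty S.ty n} {t u : Tm S n k}
    (ht : HasType Γ.toCx t (.lolli σ τ)) (hu : HasType Γ.toCx u (.lolli σ τ))
    (h : Prov (S := S) P (scons σ Γ) Θ (Φ.map Fm.wkTm)
      (.eq τ (.app t.wk (.var 0)) (.app u.wk (.var 0)))) :
    Prov P Γ Θ Φ (.eq (.lolli σ τ) t u) := (extTm hx ht hu).impE (.allTmI h)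

theorem ext_all (hx : P.extensionality) {σ : Ty S.ty (n + 1)} {t u : Tm S n k}
    (ht : HasType Γ.toCx t (.all σ)) (hu : HasType Γ.toCx u (.all σ))
    (h : Prov P Γ.wkTy Θ.wkTy (Φ.map Fm.wkTy)
      (.eq σ (.tapp t.wkTy (.var 0)) (.tapp u.wkTy (.var 0)))) :
    Prov P Γ Θ Φ (.eq (.all σ) t u) := (extTy hx ht hu).impE (.allTyI h)

end Prov

/-! ### Relations between functions -/

section Lolli

variable {σ τ σ' τ' : Ty S.ty n} {ρ ρ' : Rl S n k r}

theorem WfFm.lolliBody (hρ : StableAdm P Γ Θ ρ σ τ) (hρ' : StableAdm P Γ Θ ρ' σ' τ') :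
    WfFm (S := S) P (scons (.lolli τ τ') (scons (.lolli σ σ') Γ)) Θ
      (.allTm σ (.allTm τ (.imp
        (.rel ρ.wkTm.wkTm.wkTm.wkTm (.var 1) (.var 0))
        (.rel ρ'.wkTm.wkTm.wkTm.wkTm (.app (.var 3) (.var 1)) (.app (.var 2) (.var 0)))))) :=
  .allTm (.allTm (.imp
    (.rel ((((hρ.wkTm _).wkTm _).wkTm _).wkTm _).wf (.ivar' _ 1) (.ivar' _ 0))
    (.rel ((((hρ'.wkTm _).wkTm _).wkTm _).wkTm _).wf
      (.iapp (.ivar' _ 3) (.ivar' _ 1)) (.iapp (.ivar' _ 2) (.ivar' _ 0)))))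

theorem Rl.lolliBody_inst (f g : Tm S n k) :
    Fm.instTm₂ (.allTm σ (.allTm τ (.imp
        (.rel ρ.wkTm.wkTm.wkTm.wkTm (.var 1) (.var 0))
        (.rel ρ'.wkTm.wkTm.wkTm.wkTm (.app (.var 3) (.var 1)) (.app (.var 2) (.var 0)))))) f g =
      .allTm σ (.allTm τ (.imp (.rel ρ.wkTm.wkTm (.var 1) (.var 0))
        (.rel ρ'.wkTm.wkTm (.app f.wk.wk (.var 1)) (.app g.wk.wk (.var 0))))) := by
  simp [Fm.instTm₂, Fm.sub, Tm.sub, Ty.sub, Rl.sub_sub, Rl.ren_eq_sub, Rl.sub, Tm.ren]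

/-- Related functions map related arguments to related values. -/
theorem Prov.lolliE (hρ : StableAdm P Γ Θ ρ σ τ) (hρ' : StableAdm P Γ Θ ρ' σ' τ')
    {f g t u : Tm S n k} (hf : HasType Γ.toCx f (.lolli σ σ'))
    (hg : HasType Γ.toCx g (.lolli τ τ')) (ht : HasType Γ.toCx t σ) (hu : HasType Γ.toCx u τ)
    (h : Prov P Γ Θ Φ (.rel (Rl.lolli σ τ σ' τ' ρ ρ') f g))
    (h' : Prov P Γ Θ Φ (.rel ρ t u)) : Prov P Γ Θ Φ (.rel ρ' (.app f t) (.app g u)) := by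
  rw [Rl.lolli, Prov.rel_abs (.lolliBody hρ hρ') hf hg, Rl.lolliBody_inst] at h
  have := Prov.allTm₂E h ht hu
  simp only [Fm.instTm₂, Fm.sub, Rl.sub_ren, Tm.sub, Tm.sub_ren, scons_zero, scons_one,
    scons_succ, id] at this
  exact this.impE (by simpa using h') |> fun h => by simpa using h

theorem Prov.lolliI (hρ : StableAdm P Γ Θ ρ σ τ) (hρ' : StableAdm P Γ Θ ρ' σ' τ')
    {f g : Tm S n k} (hf : HasType Γ.toCx f (.lolli σ σ'))
    (hg : HasType Γ.toCx g (.lolli τ τ'))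
    (h : Prov (S := S) P (scons τ (scons σ Γ)) Θ
      (.rel ρ.wkTm.wkTm (.var 1) (.var 0) :: (Φ.map Fm.wkTm).map Fm.wkTm)
      (.rel ρ'.wkTm.wkTm (.app f.wk.wk (.var 1)) (.app g.wk.wk (.var 0)))) :
    Prov P Γ Θ Φ (.rel (Rl.lolli σ τ σ' τ' ρ ρ') f g) := by
  rw [Rl.lolli, Prov.rel_abs (.lolliBody hρ hρ') hf hg, Rl.lolliBody_inst]
  exact .allTmI (.allTmI (.impI
    (.rel ((hρ.wkTm _).wkTm _).wf (.ivar' _ 1) (.ivar' _ 0)) h))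

theorem WfFm.arrowBody (hρ : StableAdm P Γ Θ ρ σ τ) (hρ' : StableAdm P Γ Θ ρ' σ' τ') :
    WfFm (S := S) P (scons (.arrow τ τ') (scons (.arrow σ σ') Γ)) Θ
      (.allTm σ (.allTm τ (.imp
        (.rel ρ.wkTm.wkTm.wkTm.wkTm (.var 1) (.var 0))
        (.rel ρ'.wkTm.wkTm.wkTm.wkTm (.app (.var 3) (.bang (.var 1)))
          (.app (.var 2) (.bang (.var 0))))))) :=
  .allTm (.allTm (.imp
    (.rel ((((hρ.wkTm _).wkTm _).wkTm _).wkTm _).wf (.ivar' _ 1) (.ivar' _ 0))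
    (.rel ((((hρ'.wkTm _).wkTm _).wkTm _).wkTm _).wf
      (.iapp (.ivar' _ 3) (.ibang (.ivar' _ 1))) (.iapp (.ivar' _ 2) (.ibang (.ivar' _ 0))))))

theorem Rl.arrowBody_inst (f g : Tm S n k) :
    Fm.instTm₂ (.allTm σ (.allTm τ (.imp
        (.rel ρ.wkTm.wkTm.wkTm.wkTm (.var 1) (.var 0))
        (.rel ρ'.wkTm.wkTm.wkTm.wkTm (.app (.var 3) (.bang (.var 1)))
          (.app (.var 2) (.bang (.var 0))))))) f g =
      .allTm σ (.allTm τ (.imp (.rel ρ.wkTm.wkTm (.var 1) (.var 0))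
        (.rel ρ'.wkTm.wkTm (.app f.wk.wk (.bang (.var 1))) (.app g.wk.wk (.bang (.var 0)))))) := by
  simp [Fm.instTm₂, Fm.sub, Tm.sub, Ty.sub, Rl.sub_sub, Rl.ren_eq_sub, Rl.sub, Tm.ren]

theorem Prov.arrowE (hρ : StableAdm P Γ Θ ρ σ τ) (hρ' : StableAdm P Γ Θ ρ' σ' τ')
    {f g t u : Tm S n k} (hf : HasType Γ.toCx f (.arrow σ σ'))
    (hg : HasType Γ.toCx g (.arrow τ τ')) (ht : HasType Γ.toCx t σ) (hu : HasType Γ.toCx u τ)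
    (h : Prov P Γ Θ Φ (.rel (Rl.arrow σ τ σ' τ' ρ ρ') f g))
    (h' : Prov P Γ Θ Φ (.rel ρ t u)) :
    Prov P Γ Θ Φ (.rel ρ' (.app f (.bang t)) (.app g (.bang u))) := by
  rw [Rl.arrow, Prov.rel_abs (.arrowBody hρ hρ') hf hg, Rl.arrowBody_inst] at h
  have := Prov.allTm₂E h ht hu
  simp only [Fm.instTm₂, Fm.sub, Rl.sub_ren, Tm.sub, Tm.sub_ren, scons_zero, scons_one,
    scons_succ, id] at this
  exact this.impE (by simpa using h') |> fun h => by simpa using h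

theorem Prov.arrowI (hρ : StableAdm P Γ Θ ρ σ τ) (hρ' : StableAdm P Γ Θ ρ' σ' τ')
    {f g : Tm S n k} (hf : HasType Γ.toCx f (.arrow σ σ'))
    (hg : HasType Γ.toCx g (.arrow τ τ'))
    (h : Prov (S := S) P (scons τ (scons σ Γ)) Θ
      (.rel ρ.wkTm.wkTm (.var 1) (.var 0) :: (Φ.map Fm.wkTm).map Fm.wkTm)
      (.rel ρ'.wkTm.wkTm (.app f.wk.wk (.bang (.var 1))) (.app g.wk.wk (.bang (.var 0))))) :
    Prov P Γ Θ Φ (.rel (Rl.arrow σ τ σ' τ' ρ ρ') f g) := by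
  rw [Rl.arrow, Prov.rel_abs (.arrowBody hρ hρ') hf hg, Rl.arrowBody_inst]
  exact .allTmI (.allTmI (.impI
    (.rel ((hρ.wkTm _).wkTm _).wf (.ivar' _ 1) (.ivar' _ 0)) h))

theorem StableAdm.arrow_wf (hρ : StableAdm P Γ Θ ρ σ τ) (hρ' : StableAdm P Γ Θ ρ' σ' τ') :
    WfRl P Γ Θ (Rl.arrow σ τ σ' τ' ρ ρ') (.arrow σ σ') (.arrow τ τ') :=
  .abs (.arrowBody hρ hρ')

end Lolli

end LAPL

namespace LAPL

variable {S : Sig.{u}} {P : Schemes} {n k r : ℕ} {Γ : ICx S n k} {Θ : RCx S n r}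
  {Φ : List (Fm S n k r)}

/-! ### Relations at exponential and polymorphic types -/

theorem Rl.arrow_sub {m l q : ℕ} (σ τ σ' τ' : Ty S.ty n) (ρ ρ' : Rl S n k r)
    (s : Fin n → Ty S.ty m) (e : Fin k → Tm S m l) (d : Fin r → Rl S m l q) :
    (Rl.arrow σ τ σ' τ' ρ ρ').sub s e d = Rl.arrow (σ.sub s) (τ.sub s) (σ'.sub s) (τ'.sub s)
      (ρ.sub s e d) (ρ'.sub s e d) := by
  simp [Rl.arrow, Rl.sub, Fm.sub, Tm.sub, Ty.sub, Rl.sub_ren, Rl.ren_sub, Rl.ren_ren,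
    Tm.ren_ren, Tm.ren]
  rfl

section Bang

variable {σ τ : Ty S.ty n} {ρ : Rl S n k r}

theorem WfFm.bangBody (hρ : StableAdm P Γ Θ ρ σ τ) :
    WfFm (S := S) P (scons (.bang τ) (scons (.bang σ) Γ)) Θ (Rl.allAdm
      (.allTm (.arrow σ.wk.wk (.var 1)) (.allTm (.arrow τ.wk.wk (.var 0)) (.imp
      (.rel
        (Rl.arrow σ.wk.wk τ.wk.wk (.var 1) (.var 0) ρ.wkAdm.wkTm.wkTm.wkTm.wkTm (.var 0))
        (.var 1) (.var 0))
      (.rel (.var 0) (.app (.var 1) (.var 3)) (.app (.var 0) (.var 2))))))) := by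
  refine .allTy (.allTy (.allRl (.allTm (.allTm ?_))))
  simp only [ICx.wkTy_scons]
  have h := (hρ.wkTy.wkTy.wkRl ⟨.adm, .var 1, .var 0⟩)
  refine .imp (.rel (StableAdm.arrow_wf ((((h.wkTm _).wkTm _).wkTm _).wkTm _) (.var rfl))
    (.ivar' _ 1) (.ivar' _ 0)) (.rel (StableAdm.var rfl).wf (.iapp (.ivar' _ 1) (.ivar' _ 3))
      (.iapp (.ivar' _ 0) (.ivar' _ 2)))

theorem Rl.bangBody_inst (t u : Tm S n k) :
    Fm.instTm₂ (Rl.allAdm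
      (.allTm (.arrow σ.wk.wk (.var 1)) (.allTm (.arrow τ.wk.wk (.var 0)) (.imp
      (.rel
        (Rl.arrow σ.wk.wk τ.wk.wk (.var 1) (.var 0) ρ.wkAdm.wkTm.wkTm.wkTm.wkTm (.var 0))
        (.var 1) (.var 0))
      (.rel (.var 0) (.app (.var 1) (.var 3)) (.app (.var 0) (.var 2))))))) t u =
    Rl.allAdm
      (.allTm (.arrow σ.wk.wk (.var 1)) (.allTm (.arrow τ.wk.wk (.var 0)) (.imp
      (.rel
        (Rl.arrow σ.wk.wk τ.wk.wk (.var 1) (.var 0) ρ.wkAdm.wkTm.wkTm (.var 0))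
        (.var 1) (.var 0))
      (.rel (.var 0) (.app (.var 1) t.wkTy.wkTy.wk.wk) (.app (.var 0) u.wkTy.wkTy.wk.wk))))) := by
  simp [Fm.instTm₂, Rl.allAdm, Fm.sub, Tm.sub, Ty.sub, Rl.ren_eq_sub, Rl.sub_sub, Rl.sub,
    Tm.ren, Rl.arrow_sub, Rl.lift, Ty.ren_ren, Ty.ren]

theorem Prov.bangI (hρ : StableAdm P Γ Θ ρ σ τ) {t u : Tm S n k} (ht : HasType Γ.toCx t σ)
    (hu : HasType Γ.toCx u τ) (h : Prov P Γ Θ Φ (.rel ρ t u)) :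
    Prov P Γ Θ Φ (.rel (Rl.bang σ τ ρ) (.bang t) (.bang u)) := by
  refine h.cut (.rel hρ.wf ht hu) ?_
  rw [Rl.bang, Prov.rel_abs (.bangBody hρ) ht.ibang hu.ibang, Rl.bangBody_inst]
  have h' := ((hρ.wkTy.wkTy.wkRl ⟨.adm, .var 1, .var 0⟩).wkTm (.arrow σ.wk.wk (.var 1))).wkTm
    (.arrow τ.wk.wk (.var 0))
  have t' := (ht.iwkTy.iwkTy.iwk (.arrow σ.wk.wk (.var 1))).iwk (.arrow τ.wk.wk (.var 0))
  have u' := (hu.iwkTy.iwkTy.iwk (.arrow σ.wk.wk (.var 1))).iwk (.arrow τ.wk.wk (.var 0))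
  have w := (h'.arrow_wf (.var (i := 0) rfl))
  refine .allTyI (.allTyI (.allRlI (.allTmI (.allTmI (.impI
    (.rel w (.ivar' _ 1) (.ivar' _ 0)) ?_)))))
  exact Prov.arrowE h' (.var rfl) (.ivar' _ 1) (.ivar' _ 0) t' u'
    (.head (.rel w (.ivar' _ 1) (.ivar' _ 0)))
    (.hyp (.rel h'.wf t' u') (by simp [Fm.ren]))

/-- Elimination of the relation `!ρ` along two functions that map `ρ` into an admissible
relation. -/
theorem Prov.bangE (hρ : StableAdm P Γ Θ ρ σ τ) {A B : Ty S.ty n} {R : Rl S n k r}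
    (hR : StableAdm P Γ Θ R A B) {t u f g : Tm S n k} (ht : HasType Γ.toCx t (.bang σ))
    (hu : HasType Γ.toCx u (.bang τ)) (hf : HasType Γ.toCx f (.arrow σ A))
    (hg : HasType Γ.toCx g (.arrow τ B)) (h : Prov P Γ Θ Φ (.rel (Rl.bang σ τ ρ) t u))
    (h' : Prov P Γ Θ Φ (.rel (Rl.arrow σ τ A B ρ R) f g)) :
    Prov P Γ Θ Φ (.rel R (.app f t) (.app g u)) := by
  rw [Rl.bang, Prov.rel_abs (.bangBody hρ) ht hu, Rl.bangBody_inst] at h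
  have h₁ := h.allAdmE' hR.adm
  simp only [Fm.sub, Ty.sub, Ty.sub_ren, scons_succ, Ty.sub_var, scons_one, scons_zero] at h₁
  have h₂ := h₁.allTm₂E hf hg
  simp only [Fm.instTm₂, Fm.sub, Rl.arrow_sub, Tm.sub, Ty.sub_ren, scons_succ, Ty.sub_var,
    scons_one, scons_zero, Rl.sub_ren, Rl.sub_sub, Tm.sub_ren, Ty.sub, Tm.lift_one, Tm.lift_zero,
    Tm.lift_succ, Rl.sub, id] at h₂
  refine .impE (φ := .rel (Rl.arrow σ τ A B ρ R) f g) (ψ := .rel R (.app f t) (.app g u)) ?_ h'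
  simpa [Tm.sub_sub, Tm.sub, Tm.ren, Rl.sub] using h₂

end Bang

section All

variable {σ τ : Ty S.ty (n + 1)} {ρ : Rl S (n + 2) k (r + 1)}

theorem WfFm.allBody
    (hρ : StableAdm (S := S) P Γ.wkTy.wkTy (scons ⟨.adm, .var 1, .var 0⟩ Θ.wkTy.wkTy) ρ
      (σ.sub (scons (.var 1) (fun i => .var i.succ.succ)))
      (τ.sub (scons (.var 0) (fun i => .var i.succ.succ)))) :
    WfFm (S := S) P (scons (.all τ) (scons (.all σ) Γ)) Θ (Rl.allAdm
      (.rel ρ.wkTm.wkTm (.tapp (.var 1) (.var 1)) (.tapp (.var 0) (.var 0)))) := by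
  refine .allTy (.allTy (.allRl ?_))
  simp only [ICx.wkTy_scons]
  refine .rel ((hρ.wkTm _).wkTm _).wf ((HasType.tapp _ (.ivar' _ 1)).cast ?_)
    ((HasType.tapp _ (.ivar' _ 0)).cast ?_)
  · rw [Ty.inst, Ty.sub_ren, Ty.sub_ren]
    congr 1
    exact funext_scons rfl fun i => rfl
  · rw [Ty.inst, Ty.sub_ren, Ty.sub_ren]
    congr 1
    exact funext_scons rfl fun i => rfl

theorem Prov.allE {A B : Ty S.ty n} {R : Rl S n k r}
    (hρ : StableAdm (S := S) P Γ.wkTy.wkTy (scons ⟨.adm, .var 1, .var 0⟩ Θ.wkTy.wkTy) ρ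
      (σ.sub (scons (.var 1) (fun i => .var i.succ.succ)))
      (τ.sub (scons (.var 0) (fun i => .var i.succ.succ))))
    (hR : StableAdm P Γ Θ R A B) {t u : Tm S n k} (ht : HasType Γ.toCx t (.all σ))
    (hu : HasType Γ.toCx u (.all τ)) (h : Prov P Γ Θ Φ (.rel (Rl.all σ τ ρ) t u)) :
    Prov P Γ Θ Φ (.rel (ρ.sub (scons B (scons A Ty.var)) Tm.var (scons R Rl.var))
      (.tapp t A) (.tapp u B)) := by
  rw [Rl.all, Prov.rel_abs (.allBody hρ) ht hu] at h
  have h₁ : Prov P Γ Θ Φ (Rl.allAdm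
      (.rel ρ (.tapp t.wkTy.wkTy (.var 1)) (.tapp u.wkTy.wkTy (.var 0)))) := by
    simpa [Fm.instTm₂, Rl.allAdm, Fm.sub, Tm.sub, Ty.sub, Ty.ren, Rl.sub_ren, Rl.sub, Tm.ren,
      Rl.lift, Rl.ren] using h
  simpa [Fm.sub, Tm.sub, Ty.sub, Ty.ren, Tm.sub_ren] using h₁.allAdmE' hR.adm

end All

/-! ### Relational interpretation of types -/

section Interp

variable {m : ℕ} {τ τ' : Fin m → Ty S.ty n} {ρ : Fin m → Rl S n k r}

theorem stable_adm (hρ : ∀ i, StableAdm P Γ Θ (ρ i) (τ i) (τ' i)) (i : Fin m) :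
    Adm P Γ Θ (ρ i) (τ i) (τ' i) := (hρ i).adm

namespace Prov

theorem interp_var (hρ : ∀ i, StableAdm P Γ Θ (ρ i) (τ i) (τ' i))
    (i : Fin m) {t u : Tm S n k} (ht : HasType Γ.toCx t (τ i))
    (hu : HasType Γ.toCx u (τ' i)) :
    Prov P Γ Θ Φ (.rel (.interp m (.var i) ρ) t u) ↔ Prov P Γ Θ Φ (.rel (ρ i) t u) :=
  rel_equiv (interpVar i (stable_adm hρ)) ht hu

theorem interp_ren (hρ : ∀ i, StableAdm P Γ Θ (ρ i) (τ i) (τ' i))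
    {m' : ℕ} (σ : Ty S.ty m') {f : Fin m' → Fin m} (hf : Function.Injective f)
    {t u : Tm S n k} (ht : HasType Γ.toCx t ((σ.ren f).sub τ))
    (hu : HasType Γ.toCx u ((σ.ren f).sub τ')) :
    Prov P Γ Θ Φ (.rel (.interp m (σ.ren f) ρ) t u) ↔
      Prov P Γ Θ Φ (.rel (.interp m' σ (fun i => ρ (f i))) t u) :=
  rel_equiv (interpRen σ f hf (stable_adm hρ)) ht hu

theorem interp_lolli (hρ : ∀ i, StableAdm P Γ Θ (ρ i) (τ i) (τ' i))
    (σ σ' : Ty S.ty m) {t u : Tm S n k}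
    (ht : HasType Γ.toCx t ((Ty.lolli σ σ').sub τ))
    (hu : HasType Γ.toCx u ((Ty.lolli σ σ').sub τ')) :
    Prov P Γ Θ Φ (.rel (.interp m (.lolli σ σ') ρ) t u) ↔
      Prov P Γ Θ Φ (.rel (Rl.lolli (σ.sub τ) (σ.sub τ') (σ'.sub τ) (σ'.sub τ')
          (.interp m σ ρ) (.interp m σ' ρ)) t u) :=
  rel_equiv (interpLolli σ σ' (stable_adm hρ)) ht hu

theorem interp_bang (hρ : ∀ i, StableAdm P Γ Θ (ρ i) (τ i) (τ' i))
    (σ : Ty S.ty m) {t u : Tm S n k}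
    (ht : HasType Γ.toCx t ((Ty.bang σ).sub τ)) (hu : HasType Γ.toCx u ((Ty.bang σ).sub τ')) :
    Prov P Γ Θ Φ (.rel (.interp m (.bang σ) ρ) t u) ↔
      Prov P Γ Θ Φ (.rel (Rl.bang (σ.sub τ) (σ.sub τ') (.interp m σ ρ)) t u) :=
  rel_equiv (interpBang σ (stable_adm hρ)) ht hu

theorem interp_lolliE (hρ : ∀ i, StableAdm P Γ Θ (ρ i) (τ i) (τ' i))
    {σ σ' : Ty S.ty m} {f g t u : Tm S n k}
    (hf : HasType Γ.toCx f ((Ty.lolli σ σ').sub τ))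
    (hg : HasType Γ.toCx g ((Ty.lolli σ σ').sub τ')) (ht : HasType Γ.toCx t (σ.sub τ))
    (hu : HasType Γ.toCx u (σ.sub τ')) (h : Prov P Γ Θ Φ (.rel (.interp m (.lolli σ σ') ρ) f g))
    (h' : Prov P Γ Θ Φ (.rel (.interp m σ ρ) t u)) :
    Prov P Γ Θ Φ (.rel (.interp m σ' ρ) (.app f t) (.app g u)) :=
  lolliE (.interp σ hρ) (.interp σ' hρ) hf hg ht hu ((interp_lolli hρ σ σ' hf hg).1 h) h'

theorem interp_bangI (hρ : ∀ i, StableAdm P Γ Θ (ρ i) (τ i) (τ' i))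
    {σ : Ty S.ty m} {t u : Tm S n k} (ht : HasType Γ.toCx t (σ.sub τ))
    (hu : HasType Γ.toCx u (σ.sub τ')) (h : Prov P Γ Θ Φ (.rel (.interp m σ ρ) t u)) :
    Prov P Γ Θ Φ (.rel (.interp m (.bang σ) ρ) (.bang t) (.bang u)) :=
  (interp_bang hρ σ ht.ibang hu.ibang).2 (bangI (.interp σ hρ) ht hu h)

/-- Elimination at an intuitionistic function type. -/
theorem interp_arrowE (hρ : ∀ i, StableAdm P Γ Θ (ρ i) (τ i) (τ' i))
    {σ σ' : Ty S.ty m} {f g t u : Tm S n k}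
    (hf : HasType Γ.toCx f ((Ty.arrow σ σ').sub τ))
    (hg : HasType Γ.toCx g ((Ty.arrow σ σ').sub τ')) (ht : HasType Γ.toCx t (σ.sub τ))
    (hu : HasType Γ.toCx u (σ.sub τ')) (h : Prov P Γ Θ Φ (.rel (.interp m (.arrow σ σ') ρ) f g))
    (h' : Prov P Γ Θ Φ (.rel (.interp m σ ρ) t u)) :
    Prov P Γ Θ Φ (.rel (.interp m σ' ρ) (.app f (.bang t)) (.app g (.bang u))) :=
  interp_lolliE hρ hf hg ht.ibang hu.ibang h (interp_bangI hρ ht hu h')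

/-- Instantiation of related polymorphic terms at related types. -/
theorem interp_allE (hρ : ∀ i, StableAdm P Γ Θ (ρ i) (τ i) (τ' i))
    {σ : Ty S.ty (m + 1)} {A B : Ty S.ty n} {R : Rl S n k r}
    (hR : StableAdm P Γ Θ R A B) {t u : Tm S n k} (ht : HasType Γ.toCx t ((Ty.all σ).sub τ))
    (hu : HasType Γ.toCx u ((Ty.all σ).sub τ'))
    (h : Prov P Γ Θ Φ (.rel (.interp m (.all σ) ρ) t u)) :
    Prov P Γ Θ Φ (.rel (.interp (m + 1) σ (scons R ρ)) (.tapp t A) (.tapp u B)) := by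
  have h₁ := (rel_equiv (interpAll σ (stable_adm hρ)) ht hu).1 h
  have hs : StableAdm (S := S) P Γ.wkTy.wkTy (scons ⟨.adm, .var 1, .var 0⟩ Θ.wkTy.wkTy)
      (.interp (m + 1) σ (scons (.var 0) (fun i => (ρ i).wkAdm)))
      (σ.sub (scons (.var 1) (fun i => (τ i).wk.wk)))
      (σ.sub (scons (.var 0) (fun i => (τ' i).wk.wk))) :=
    .interp σ (Fin.cases (.var rfl) fun i => (hρ i).wkTy.wkTy.wkRl _)
  have h₂ := allE (σ := σ.sub (Ty.lift τ)) (τ := σ.sub (Ty.lift τ')) (by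
    rw [Ty.sub_sub, Ty.sub_sub]
    convert hs using 2
    · exact funext_scons rfl fun i => by
        simp [Ty.sub_ren, Ty.ren_ren, Ty.sub_vars (fun i : Fin _ => i.succ.succ)]
    · exact funext_scons rfl fun i => by
        simp [Ty.sub_ren, Ty.ren_ren, Ty.sub_vars (fun i : Fin _ => i.succ.succ)]) hR ht hu h₁
  convert h₂ using 2
  rw [Rl.sub]
  congr 1
  exact funext_scons rfl fun i => by simp [Rl.sub_ren]

end Prov

end Interp

namespace Prov

/-- Identity extension. -/
theorem interp_eq (hid : P.identityExtension) {m : ℕ} (σ : Ty S.ty m) (τ : Fin m → Ty S.ty n)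
    {t u : Tm S n k} (ht : HasType Γ.toCx t (σ.sub τ)) (hu : HasType Γ.toCx u (σ.sub τ)) :
    Prov P Γ Θ Φ (.rel (.interp m σ (fun i => Rl.eqRel (τ i))) t u) ↔
      Prov P Γ Θ Φ (.eq (σ.sub τ) t u) := by
  rw [rel_equiv (idExt σ τ hid) ht hu, rel_eqRel ht hu]

/-- Extensionality for functions on a type `!σ`: it is enough to consider arguments `!x`.
By identity extension every argument is related to itself by the relation `!eq`, which is eliminated
by `bangE`. -/
theorem ext_bang (hx : P.extensionality) (hid : P.identityExtension) {σ τ : Ty S.ty n}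
    {t u : Tm S n k} (ht : HasType Γ.toCx t (.arrow σ τ)) (hu : HasType Γ.toCx u (.arrow σ τ))
    (h : Prov (S := S) P (scons σ Γ) Θ (Φ.map Fm.wkTm)
      (.eq τ (.app t.wk (.bang (.var 0))) (.app u.wk (.bang (.var 0))))) :
    Prov P Γ Θ Φ (.eq (.arrow σ τ) t u) := by
  have w : WfFm (S := S) P (scons σ Γ) Θ
      (.eq τ (.app t.wk (.bang (.var 0))) (.app u.wk (.bang (.var 0)))) :=
    .eq ((ht.iwk σ).iapp (HasType.ivar' _ 0).ibang) ((hu.iwk σ).iapp (HasType.ivar' _ 0).ibang)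
  refine (Prov.allTmI h).cut (.allTm w) (.ext hx ht hu ?_)
  let Γ' : ICx S n (k + 1) := scons (.bang σ) Γ
  have t' := ht.iwk (.bang σ)
  have u' := hu.iwk (.bang σ)
  have hy : HasType Γ'.toCx (.var 0) (.bang σ) := .ivar' Γ' 0
  have hρ : ∀ i : Fin 1, StableAdm P Γ' Θ (Rl.eqRel (![σ] i)) (![σ] i) (![σ] i) :=
    fun i => .eqRel _
  have hb : HasType Γ'.toCx (.var 0) ((Ty.bang (.var 0)).sub ![σ]) := hy
  have hr : StableAdm P Γ' Θ (Rl.interp 1 (.var 0) fun i => Rl.eqRel (![σ] i)) σ σ :=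
    .interp (.var 0) hρ
  rw [← rel_eqRel (t'.iapp hy) (u'.iapp hy)]
  refine bangE hr (.eqRel τ) hy hy t' u'
    ((interp_bang hρ (.var 0) hb hb).1
      ((interp_eq hid (.bang (.var 0)) ![σ] hb hb).2 (.rfl' hb)))
    (arrowI hr (.eqRel τ) t' u' ?_)
  let Γ'' : ICx S n (k + 3) := scons σ (scons σ Γ')
  have hx₁ : HasType Γ''.toCx (.var 1) σ := .ivar' Γ'' 1
  have hx₀ : HasType Γ''.toCx (.var 0) σ := .ivar' Γ'' 0
  have t'' := (t'.iwk σ).iwk σ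
  have u'' := (u'.iwk σ).iwk σ
  have hr' := (hr.wkTm σ).wkTm σ
  simp only [Rl.eqRel_ren, Ty.ren_id, List.map_cons]
  rw [rel_eqRel (t''.iapp hx₁.ibang) (u''.iapp hx₀.ibang)]
  refine .trans (app_congr t'' t'' hx₁.ibang hx₀.ibang (.rfl' t'') (bang_congr hx₁ hx₀ ?_)) ?_
  · simp only [Rl.ren, Rl.eqRel_ren, Ty.ren_id]
    exact (interp_eq hid (.var 0) ![σ] hx₁ hx₀).1 (.head (by
      have := WfFm.rel hr'.wf hx₁ hx₀
      simpa only [Rl.ren, Rl.eqRel_ren, Ty.ren_id] using this))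
  · have t₃ := (t''.iwk σ).iapp (HasType.ivar' (scons σ Γ'') 0).ibang
    have u₃ := (u''.iwk σ).iapp (HasType.ivar' (scons σ Γ'') 0).ibang
    have := Prov.allTmE (P := P) (Θ := Θ)
      (Φ := Fm.rel (Rl.interp 1 (.var 0) fun i => Rl.eqRel (![σ] i)).wkTm.wkTm (.var 1) (.var 0) :: List.map Fm.wkTm (List.map Fm.wkTm (List.map Fm.wkTm
        (Fm.allTm σ (.eq τ (.app t.wk (.bang (.var 0))) (.app u.wk (.bang (.var 0)))) :: Φ))))
      (.hyp (.allTm (.eq t₃ u₃)) (.tail _ (by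
        simp [Fm.ren, Tm.ren, Tm.ren_ren]
        exact .head _))) hx₀
    simpa [Fm.sub, Tm.sub, Tm.sub_ren, Tm.sub_sub, Tm.ren_eq_sub] using this

end Prov

end LAPL

namespace LAPL

variable {S : Sig.{u}} {P : Schemes} {n k r : ℕ} {Γ : ICx S n k} {Θ : RCx S n r}
  {Φ : List (Fm S n k r)}

/-! ### Parametricity of the functorial action -/

theorem HasType.tapp_sub {m : ℕ} {σ : Ty S.ty (m + 1)} {τ : Fin m → Ty S.ty n} {Δ : Cx S n k}
    {t : Tm S n k} (A : Ty S.ty n) (ht : HasType Δ t ((Ty.all σ).sub τ)) :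
    HasType Δ (.tapp t A) (σ.sub (scons A τ)) := by
  refine (HasType.tapp A ht).cast ?_
  rw [Ty.inst, Ty.sub_sub]
  congr 1
  exact funext_scons rfl fun i => by simp [Ty.sub_ren]

theorem Ty.at₂_vars (σ : Ty S.ty 2) {m : ℕ} (i j : Fin m) :
    σ.at₂ (.var i) (.var j) = σ.ren ![i, j] := by
  rw [Ty.ren_eq_sub, Ty.at₂]
  congr 1
  exact funext (Fin.forall_fin_two.2 ⟨rfl, rfl⟩)

theorem injective_vec₂ {m : ℕ} {i j : Fin m} (h : i ≠ j) : Function.Injective ![i, j] := by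
  intro a b
  fin_cases a <;> fin_cases b <;> simp [h, h.symm]

/-- The pair `(f, g)` of terms of types `A ⊸ A'` and `B ⊸ B'` maps `ρ`-related arguments to
`ρ'`-related values, under the hypotheses `Φ` and any further ones. -/
def Maps (P : Schemes) (Γ : ICx S n k) (Θ : RCx S n r) (Φ : List (Fm S n k r))
    (A B : Ty S.ty n) (ρ ρ' : Rl S n k r) (f g : Tm S n k) : Prop :=
  ∀ Ψ, (Φ.map Fm.wkTm).map Fm.wkTm ⊆ Ψ →
    Prov (S := S) P (scons B (scons A Γ)) Θ Ψ (.rel ρ.wkTm.wkTm (.var 1) (.var 0)) →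
    Prov (S := S) P (scons B (scons A Γ)) Θ Ψ
      (.rel ρ'.wkTm.wkTm (.app f.wk.wk (.var 1)) (.app g.wk.wk (.var 0)))

theorem StableAdm.scons {m : ℕ} {τ τ' : Fin m → Ty S.ty n} {ρ : Fin m → Rl S n k r}
    {A B : Ty S.ty n} {R : Rl S n k r} (hR : StableAdm P Γ Θ R A B)
    (hρ : ∀ i, StableAdm P Γ Θ (ρ i) (τ i) (τ' i)) (i : Fin (m + 1)) :
    StableAdm P Γ Θ ((scons R ρ : Fin (m + 1) → Rl S n k r) i)
      ((scons A τ : Fin (m + 1) → Ty S.ty n) i) ((scons B τ' : Fin (m + 1) → Ty S.ty n) i) := by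
  induction i using Fin.cases with
  | zero => exact hR
  | succ i => exact hρ i

namespace Prov

section

variable {m : ℕ} {τ τ' : Fin m → Ty S.ty n} {ρ : Fin m → Rl S n k r}

theorem interp_lolliI (hρ : ∀ i, StableAdm P Γ Θ (ρ i) (τ i) (τ' i)) {σ σ' : Ty S.ty m}
    {f g : Tm S n k} (hf : HasType Γ.toCx f ((Ty.lolli σ σ').sub τ))
    (hg : HasType Γ.toCx g ((Ty.lolli σ σ').sub τ'))
    (h : Maps P Γ Θ Φ (σ.sub τ) (σ.sub τ') (.interp m σ ρ) (.interp m σ' ρ) f g) :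
    Prov P Γ Θ Φ (.rel (.interp m (.lolli σ σ') ρ) f g) :=
  (interp_lolli hρ σ σ' hf hg).2 (lolliI (.interp σ hρ) (.interp σ' hρ) hf hg
    (h _ (List.subset_cons_self _ _) (.head (.rel
      (((StableAdm.interp σ hρ).wkTm _).wkTm _).wf (.ivar' _ 1) (.ivar' _ 0)))))

theorem interp_lolliI_var (hρ : ∀ i, StableAdm P Γ Θ (ρ i) (τ i) (τ' i)) (i j : Fin m)
    {f g : Tm S n k} (hf : HasType Γ.toCx f (.lolli (τ i) (τ j)))
    (hg : HasType Γ.toCx g (.lolli (τ' i) (τ' j)))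
    (h : Maps P Γ Θ Φ (τ i) (τ' i) (ρ i) (ρ j) f g) :
    Prov P Γ Θ Φ (.rel (.interp m (.lolli (.var i) (.var j)) ρ) f g) :=
  interp_lolliI hρ hf hg fun Ψ hΨ hxy => by
    have hρ' := fun l => ((hρ l).wkTm (τ i)).wkTm (τ' i)
    refine (interp_var hρ' j (((hf.iwk _).iwk _).iapp (.ivar' _ 1))
      (((hg.iwk _).iwk _).iapp (.ivar' _ 0))).2 (h Ψ hΨ ?_)
    exact (interp_var hρ' i (.ivar' _ 1) (.ivar' _ 0)).1 hxy

/-- Closed types are interpreted as equality, whatever the relations for the variables. -/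
theorem interp_ofClosed (hid : P.identityExtension)
    (hρ : ∀ i, StableAdm P Γ Θ (ρ i) (τ i) (τ' i)) (σ : Ty S.ty 0) {t u : Tm S n k}
    (ht : HasType Γ.toCx t σ.ofClosed) (hu : HasType Γ.toCx u σ.ofClosed) :
    Prov P Γ Θ Φ (.rel (.interp m σ.ofClosed ρ) t u) ↔ Prov P Γ Θ Φ (.eq σ.ofClosed t u) := by
  have e : σ.sub (Fin.elim0 : Fin 0 → Ty S.ty n) = σ.ofClosed := by
    rw [Ty.ofClosed, Ty.ren_eq_sub]
    congr 1
    exact Subsingleton.elim _ _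
  have h := interp_eq (Γ := Γ) (Θ := Θ) (Φ := Φ) hid σ Fin.elim0 (ht.cast e.symm)
    (hu.cast e.symm)
  rw [e] at h
  rw [← h, Ty.ofClosed, interp_ren hρ σ (fun i => i.elim0) (ht.cast (Ty.ofClosed_sub _ _).symm)
    (hu.cast (Ty.ofClosed_sub _ _).symm)]
  rw [show (fun i : Fin 0 => ρ (i.elim0)) = fun i : Fin 0 => Rl.eqRel (i.elim0) from
    Subsingleton.elim _ _]

theorem at₂_vars_sub (σ : Ty S.ty 2) (i j : Fin m) (τ : Fin m → Ty S.ty n) :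
    (σ.at₂ (.var i) (.var j)).sub τ = σ.at₂ (τ i) (τ j) := by
  simp only [Ty.at₂, Ty.sub_sub, Ty.vec₂_sub, Ty.sub]

theorem interp_at₂ (hρ : ∀ i, StableAdm P Γ Θ (ρ i) (τ i) (τ' i)) (σ : Ty S.ty 2) {i j : Fin m}
    (hij : i ≠ j) {t u : Tm S n k} (ht : HasType Γ.toCx t (σ.at₂ (τ i) (τ j)))
    (hu : HasType Γ.toCx u (σ.at₂ (τ' i) (τ' j))) :
    Prov P Γ Θ Φ (.rel (.interp m (σ.at₂ (.var i) (.var j)) ρ) t u) ↔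
      Prov P Γ Θ Φ (.rel (.interp 2 σ ![ρ i, ρ j]) t u) := by
  rw [← at₂_vars_sub] at ht hu
  rw [Ty.at₂_vars] at ht hu ⊢
  rw [interp_ren hρ σ (injective_vec₂ hij) ht hu]
  have : (fun l => ρ (![i, j] l)) = ![ρ i, ρ j] := funext (Fin.forall_fin_two.2 ⟨rfl, rfl⟩)
  rw [this]

end

variable {σ : Ty S.ty 2} {A A' B B' C C' D D' : Ty S.ty n} {ρA ρB ρC ρD : Rl S n k r}
  {f f' g g' x x' : Tm S n k}

theorem stable_vec₂ (hA : StableAdm P Γ Θ ρA A A') (hB : StableAdm P Γ Θ ρB B B') :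
    ∀ i, StableAdm P Γ Θ (![ρA, ρB] i) (![A, B] i) (![A', B'] i) :=
  Fin.forall_fin_two.2 ⟨hA, hB⟩

/-- Parametricity of the functorial action: it is given by a closed polymorphic term, which is
related to itself by identity extension at its closed type. -/
theorem mapTm_rel (hid : P.identityExtension) (hσ : σ.Mixed) (hA : StableAdm P Γ Θ ρA A A')
    (hB : StableAdm P Γ Θ ρB B B') (hC : StableAdm P Γ Θ ρC C C')
    (hD : StableAdm P Γ Θ ρD D D') (hf : HasType Γ.toCx f (.lolli C A))
    (hf' : HasType Γ.toCx f' (.lolli C' A')) (hg : HasType Γ.toCx g (.lolli B D))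
    (hg' : HasType Γ.toCx g' (.lolli B' D')) (hx : HasType Γ.toCx x (σ.at₂ A B))
    (hx' : HasType Γ.toCx x' (σ.at₂ A' B')) (hff : Maps P Γ Θ Φ C C' ρC ρA f f')
    (hgg : Maps P Γ Θ Φ B B' ρB ρD g g')
    (hxx : Prov P Γ Θ Φ (.rel (.interp 2 σ ![ρA, ρB]) x x')) :
    Prov P Γ Θ Φ (.rel (.interp 2 σ ![ρC, ρD]) (.app (mapTm σ A B C D f g) x)
      (.app (mapTm σ A' B' C' D' f' g') x')) := by
  have h₀ : ∀ i, StableAdm P Γ Θ (Fin.elim0 i : Rl S n k r) (Fin.elim0 i : Ty S.ty n)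
    (Fin.elim0 i : Ty S.ty n) := fun i => i.elim0
  have h₁ := hA.scons h₀
  have h₂ := hB.scons h₁
  have h₃ := hC.scons h₂
  have h₄ := hD.scons h₃
  have ht : ∀ s : Fin 0 → Ty S.ty n, HasType Γ.toCx (functorTm σ).ofClosed
      ((functorTy σ).sub s) := fun s =>
    (functorTm_hasType hσ (ICx.toCx_noLin Γ)).cast (by
      rw [Ty.ofClosed, Ty.ren_eq_sub]; congr 1; exact Subsingleton.elim _ _)
  have hM : Prov P Γ Θ Φ (.rel (.interp 0 (functorTy σ) Fin.elim0) (functorTm σ).ofClosed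
      (functorTm σ).ofClosed) := by
    have := (interp_eq (Γ := Γ) (Θ := Θ) (Φ := Φ) hid (functorTy σ) Fin.elim0 (ht _) (ht _)).2
      (.rfl' (ht _))
    convert this using 2
    congr 1
    exact Subsingleton.elim _ _
  have m₁ := interp_allE h₀ hA (ht _) (ht _) hM
  have m₂ := interp_allE h₁ hB (.tapp_sub A (ht _)) (.tapp_sub A' (ht _)) m₁
  have m₃ := interp_allE h₂ hC (.tapp_sub B (.tapp_sub A (ht _)))
    (.tapp_sub B' (.tapp_sub A' (ht _))) m₂
  have m₄ := interp_allE h₃ hD (.tapp_sub C (.tapp_sub B (.tapp_sub A (ht _))))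
    (.tapp_sub C' (.tapp_sub B' (.tapp_sub A' (ht _)))) m₃
  have t₄ := HasType.tapp_sub D (.tapp_sub C (.tapp_sub B (.tapp_sub A (ht Fin.elim0))))
  have t₄' := HasType.tapp_sub D' (.tapp_sub C' (.tapp_sub B' (.tapp_sub A' (ht Fin.elim0))))
  have m₅ := interp_arrowE h₄ t₄ t₄' hf hf' m₄ (interp_lolliI_var h₄ 1 3 hf hf' hff)
  have t₅ := t₄.iapp (HasType.ibang hf)
  have t₅' := t₄'.iapp (HasType.ibang hf')
  have m₆ := interp_arrowE h₄ t₅ t₅' hg hg' m₅ (interp_lolliI_var h₄ 2 0 hg hg' hgg)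
  have t₆ := t₅.iapp (HasType.ibang hg)
  have t₆' := t₅'.iapp (HasType.ibang hg')
  have ex := at₂_vars_sub σ 3 2 (scons D (scons C (scons B (scons A Fin.elim0))))
  have ex' := at₂_vars_sub σ 3 2 (scons D' (scons C' (scons B' (scons A' Fin.elim0))))
  have m₇ := interp_lolliE h₄ t₆ t₆' (hx.cast ex.symm) (hx'.cast ex'.symm) m₆
    ((interp_at₂ h₄ σ (by decide) hx hx').2 hxx)
  exact (interp_at₂ h₄ σ (by decide) (.iapp (mapTm_hasType hσ (ICx.toCx_noLin Γ) hf hg) hx)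
    (.iapp (mapTm_hasType hσ (ICx.toCx_noLin Γ) hf' hg') hx')).1 m₇

end Prov

/-! ### Graphs -/

/-- The graph of `h : A ⊸ B`, as an admissible relation `Rel(A, B)`. -/
def Rl.fwd (A B : Ty S.ty n) (h : Tm S n k) : Rl S n k r := Rl.pull A B B h (Tm.idTm B)

/-- The opposite of the graph of `h : B ⊸ A`, as an admissible relation `Rel(A, B)`. -/
def Rl.bwd (A B : Ty S.ty n) (h : Tm S n k) : Rl S n k r := Rl.pull A B A (Tm.idTm A) h

theorem Rl.fwd_ren {m l q : ℕ} (f : Fin n → Fin m) (g : Fin k → Fin l) (h : Fin r → Fin q)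
    (A B : Ty S.ty n) (t : Tm S n k) : (Rl.fwd A B t : Rl S n k r).ren f g h =
      Rl.fwd (A.ren f) (B.ren f) (t.ren f g) := by
  simp [Rl.fwd, Rl.pull_ren, Tm.ren]

theorem Rl.bwd_ren {m l q : ℕ} (f : Fin n → Fin m) (g : Fin k → Fin l) (h : Fin r → Fin q)
    (A B : Ty S.ty n) (t : Tm S n k) : (Rl.bwd A B t : Rl S n k r).ren f g h =
      Rl.bwd (A.ren f) (B.ren f) (t.ren f g) := by
  simp [Rl.bwd, Rl.pull_ren, Tm.ren]

theorem StableAdm.fwd {A B : Ty S.ty n} {h : Tm S n k} (hh : HasType Γ.toCx h (.lolli A B)) :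
    StableAdm P Γ Θ (Rl.fwd A B h) A B := .pull hh (.idTm (ICx.toCx_noLin Γ) B)

theorem StableAdm.bwd {A B : Ty S.ty n} {h : Tm S n k} (hh : HasType Γ.toCx h (.lolli B A)) :
    StableAdm P Γ Θ (Rl.bwd A B h) A B := .pull (.idTm (ICx.toCx_noLin Γ) A) hh

theorem HasType.icomp {A B C : Ty S.ty n} {g f : Tm S n k} (hg : HasType Γ.toCx g (.lolli B C))
    (hf : HasType Γ.toCx f (.lolli A B)) : HasType Γ.toCx (Tm.comp A g f) (.lolli A C) :=
  .comp (ICx.toCx_noLin Γ) hg hf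

theorem ExtEq.comp_app {A B C : Ty S.ty n} {g f x : Tm S n k}
    (hg : HasType Γ.toCx g (.lolli B C)) (hf : HasType Γ.toCx f (.lolli A B))
    (hx : HasType Γ.toCx x A) :
    ExtEq Γ.toCx (.app (Tm.comp A g f) x) (.app g (.app f x)) C := by
  have hΓ := ICx.toCx_noLin Γ
  have := ExtEq.beta hΓ (.appR hΓ hg.wkOff (.appR hΓ hf.wkOff (.lvar0 hΓ))) hx
  simpa [Tm.inst, Tm.sub, Tm.sub_ren, Tm.comp] using this

namespace Prov

theorem comp_app {A B C : Ty S.ty n} {g f x : Tm S n k}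
    (hg : HasType Γ.toCx g (.lolli B C)) (hf : HasType Γ.toCx f (.lolli A B))
    (hx : HasType Γ.toCx x A) :
    Prov P Γ Θ Φ (.eq C (.app (Tm.comp A g f) x) (.app g (.app f x))) :=
  .ofExtEq (.comp_app hg hf hx)

theorem idTm_app {A : Ty S.ty n} {x : Tm S n k} (hx : HasType Γ.toCx x A) :
    Prov P Γ Θ Φ (.eq A (.app (Tm.idTm A) x) x) := .ofExtEq (.idTm_app hx)

theorem rel_fwd {A B : Ty S.ty n} {h t u : Tm S n k} (hh : HasType Γ.toCx h (.lolli A B))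
    (ht : HasType Γ.toCx t A) (hu : HasType Γ.toCx u B) :
    Prov P Γ Θ Φ (.rel (Rl.fwd A B h) t u) ↔ Prov P Γ Θ Φ (.eq B (.app h t) u) := by
  rw [Rl.fwd, rel_pull hh (.idTm (ICx.toCx_noLin Γ) B) ht hu]
  exact ⟨fun h => h.trans (idTm_app hu), fun h => h.trans (idTm_app hu).symm⟩

theorem rel_bwd {A B : Ty S.ty n} {h t u : Tm S n k} (hh : HasType Γ.toCx h (.lolli B A))
    (ht : HasType Γ.toCx t A) (hu : HasType Γ.toCx u B) :
    Prov P Γ Θ Φ (.rel (Rl.bwd A B h) t u) ↔ Prov P Γ Θ Φ (.eq A t (.app h u)) := by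
  rw [Rl.bwd, rel_pull (.idTm (ICx.toCx_noLin Γ) A) hh ht hu]
  exact ⟨fun h => (idTm_app ht).symm.trans h, fun h => (idTm_app ht).trans h⟩

theorem app_congr_right {A B : Ty S.ty n} {h t u : Tm S n k}
    (hh : HasType Γ.toCx h (.lolli A B)) (ht : HasType Γ.toCx t A) (hu : HasType Γ.toCx u A)
    (e : Prov P Γ Θ Φ (.eq A t u)) : Prov P Γ Θ Φ (.eq B (.app h t) (.app h u)) :=
  app_congr hh hh ht hu (.rfl' hh) e

theorem app_congr_left {A B : Ty S.ty n} {f g t : Tm S n k}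
    (hf : HasType Γ.toCx f (.lolli A B)) (hg : HasType Γ.toCx g (.lolli A B))
    (ht : HasType Γ.toCx t A) (e : Prov P Γ Θ Φ (.eq (.lolli A B) f g)) :
    Prov P Γ Θ Φ (.eq B (.app f t) (.app g t)) := app_congr hf hg ht ht e (.rfl' ht)

end Prov

section Maps

variable {A B C : Ty S.ty n} {f g : Tm S n k}

theorem maps_eqRel_bwd (hf : HasType Γ.toCx f (.lolli B A)) :
    Maps P Γ Θ Φ B B (Rl.eqRel B) (Rl.bwd A B f) f (Tm.idTm B) := fun Ψ _ h => by
  have x₁ : HasType (ICx.toCx (S := S) (scons B (scons B Γ))) (.var 1) B := .ivar' _ 1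
  have x₀ : HasType (ICx.toCx (S := S) (scons B (scons B Γ))) (.var 0) B := .ivar' _ 0
  have f' := (hf.iwk B).iwk B
  have i := HasType.idTm (ICx.toCx_noLin (S := S) (scons B (scons B Γ))) B
  simp only [Rl.eqRel_ren, Rl.bwd_ren, Ty.ren_id, Tm.ren, liftR_zero] at h ⊢
  rw [Prov.rel_eqRel x₁ x₀] at h
  rw [Prov.rel_bwd f' (f'.iapp x₁) (i.iapp x₀)]
  exact Prov.app_congr_right f' x₁ (i.iapp x₀) (h.trans (Prov.idTm_app x₀).symm)

theorem maps_fwd_eqRel (hf : HasType Γ.toCx f (.lolli A B)) :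
    Maps P Γ Θ Φ A B (Rl.fwd A B f) (Rl.eqRel B) f (Tm.idTm B) := fun Ψ _ h => by
  have x₁ : HasType (ICx.toCx (S := S) (scons B (scons A Γ))) (.var 1) A := .ivar' _ 1
  have x₀ : HasType (ICx.toCx (S := S) (scons B (scons A Γ))) (.var 0) B := .ivar' _ 0
  have f' := (hf.iwk A).iwk B
  have i := HasType.idTm (ICx.toCx_noLin (S := S) (scons B (scons A Γ))) B
  simp only [Rl.eqRel_ren, Rl.fwd_ren, Ty.ren_id, Tm.ren, liftR_zero] at h ⊢
  rw [Prov.rel_fwd f' x₁ x₀] at h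
  rw [Prov.rel_eqRel (f'.iapp x₁) (i.iapp x₀)]
  exact h.trans (Prov.idTm_app x₀).symm

theorem maps_eqRel_fwd (hf : HasType Γ.toCx f (.lolli A B)) (hg : HasType Γ.toCx g (.lolli B C)) :
    Maps P Γ Θ Φ A A (Rl.eqRel A) (Rl.fwd B C g) f (Tm.comp A g f) := fun Ψ _ h => by
  have x₁ : HasType (ICx.toCx (S := S) (scons A (scons A Γ))) (.var 1) A := .ivar' _ 1
  have x₀ : HasType (ICx.toCx (S := S) (scons A (scons A Γ))) (.var 0) A := .ivar' _ 0
  have f' := (hf.iwk A).iwk A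
  have g' := (hg.iwk A).iwk A
  simp only [Rl.eqRel_ren, Rl.fwd_ren, Ty.ren_id, Tm.comp_ren] at h ⊢
  rw [Prov.rel_eqRel x₁ x₀] at h
  rw [Prov.rel_fwd g' (f'.iapp x₁) ((g'.icomp f').iapp x₀)]
  exact (Prov.app_congr_right g' (f'.iapp x₁) (f'.iapp x₀)
    (Prov.app_congr_right f' x₁ x₀ h)).trans (Prov.comp_app g' f' x₀).symm

theorem maps_bwd_eqRel (hf : HasType Γ.toCx f (.lolli A B)) (hg : HasType Γ.toCx g (.lolli C A)) :
    Maps P Γ Θ Φ A C (Rl.bwd A C g) (Rl.eqRel B) f (Tm.comp C f g) := fun Ψ _ h => by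
  have x₁ : HasType (ICx.toCx (S := S) (scons C (scons A Γ))) (.var 1) A := .ivar' _ 1
  have x₀ : HasType (ICx.toCx (S := S) (scons C (scons A Γ))) (.var 0) C := .ivar' _ 0
  have f' := (hf.iwk A).iwk C
  have g' := (hg.iwk A).iwk C
  simp only [Rl.eqRel_ren, Rl.bwd_ren, Ty.ren_id, Tm.comp_ren] at h ⊢
  rw [Prov.rel_bwd g' x₁ x₀] at h
  rw [Prov.rel_eqRel (f'.iapp x₁) ((f'.icomp g').iapp x₀)]
  exact (Prov.app_congr_right f' x₁ (g'.iapp x₀) h).trans (Prov.comp_app f' g' x₀).symm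

end Maps

section Graph

variable {σ : Ty S.ty 2} {A A' B B' : Ty S.ty n} {h h' x y : Tm S n k}

namespace Prov

theorem interp_eq₂ (hid : P.identityExtension) (hx : HasType Γ.toCx x (σ.at₂ A B))
    (hy : HasType Γ.toCx y (σ.at₂ A B)) :
    Prov P Γ Θ Φ (.rel (.interp 2 σ ![Rl.eqRel A, Rl.eqRel B]) x y) ↔
      Prov P Γ Θ Φ (.eq (σ.at₂ A B) x y) := by
  rw [← interp_eq hid σ ![A, B] hx hy]
  have : (![Rl.eqRel A, Rl.eqRel B] : Fin 2 → Rl S n k r) = fun i => Rl.eqRel (![A, B] i) :=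
    funext (Fin.forall_fin_two.2 ⟨rfl, rfl⟩)
  rw [this]

theorem mapTm_idTm_app (hσ : σ.Mixed) (hx : HasType Γ.toCx x (σ.at₂ A B)) :
    Prov P Γ Θ Φ (.eq (σ.at₂ A B) (.app (mapTm σ A B A B (Tm.idTm A) (Tm.idTm B)) x) x) := by
  have hΓ := ICx.toCx_noLin Γ
  exact .ofExtEq (.trans (.app' hΓ (mapTm_idTm hσ hΓ A B) (.refl hx)) (.idTm_app hx))

/-- Terms that are related in `σ[h'ᵒᵖ, h]` are mapped to each other by `σ(h', h)`. -/
theorem mapTm_eq_of_rel (hid : P.identityExtension) (hσ : σ.Mixed)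
    (hh : HasType Γ.toCx h (.lolli A A')) (hh' : HasType Γ.toCx h' (.lolli B' B))
    (hx : HasType Γ.toCx x (σ.at₂ B A)) (hy : HasType Γ.toCx y (σ.at₂ B' A'))
    (hxy : Prov P Γ Θ Φ (.rel (.interp 2 σ ![Rl.bwd B B' h', Rl.fwd A A' h]) x y)) :
    Prov P Γ Θ Φ (.eq (σ.at₂ B' A') (.app (mapTm σ B A B' A' h' h) x) y) := by
  have hΓ := ICx.toCx_noLin Γ
  have m := mapTm_rel hid hσ (.bwd hh') (.fwd hh) (.eqRel B') (.eqRel A') hh' (.idTm hΓ _) hh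
    (.idTm hΓ _) hx hy (maps_eqRel_bwd hh') (maps_fwd_eqRel hh) hxy
  rw [interp_eq₂ hid ((mapTm_hasType hσ hΓ hh' hh).iapp hx)
    ((mapTm_hasType hσ hΓ (.idTm hΓ _) (.idTm hΓ _)).iapp hy)] at m
  exact m.trans (mapTm_idTm_app hσ hy)

/-- `σ(h, h') x` and `x` are related in `σ[h, h'ᵒᵖ]`. -/
theorem mapTm_rel_self (hid : P.identityExtension) (hσ : σ.Mixed)
    (hh : HasType Γ.toCx h (.lolli A A')) (hh' : HasType Γ.toCx h' (.lolli B' B))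
    (hx : HasType Γ.toCx x (σ.at₂ A' B')) :
    Prov P Γ Θ Φ (.rel (.interp 2 σ ![Rl.fwd A A' h, Rl.bwd B B' h'])
      (.app (mapTm σ A' B' A B h h') x) x) := by
  have hΓ := ICx.toCx_noLin Γ
  have m := mapTm_rel (Θ := Θ) (Φ := Φ) hid hσ (.eqRel A') (.eqRel B') (.fwd hh) (.bwd hh') hh
    (.idTm hΓ _) hh' (.idTm hΓ _) hx hx (maps_fwd_eqRel hh) (maps_eqRel_bwd hh')
    ((interp_eq₂ hid hx hx).2 (.rfl' hx))
  exact .substAx (StableAdm.interp σ (stable_vec₂ (.fwd hh) (.bwd hh'))).wf m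
    (.rfl' ((mapTm_hasType hσ hΓ hh hh').iapp hx)) (mapTm_idTm_app hσ hx)

/-- The functorial action preserves composition. -/
theorem mapTm_comp_app (hid : P.identityExtension) (hσ : σ.Mixed) {C C' D D' : Ty S.ty n}
    {f f' g g' : Tm S n k} (hf : HasType Γ.toCx f (.lolli C A))
    (hg : HasType Γ.toCx g (.lolli B D)) (hf' : HasType Γ.toCx f' (.lolli C' C))
    (hg' : HasType Γ.toCx g' (.lolli D D')) (hx : HasType Γ.toCx x (σ.at₂ A B)) :
    Prov P Γ Θ Φ (.eq (σ.at₂ C' D')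
      (.app (mapTm σ C D C' D' f' g') (.app (mapTm σ A B C D f g) x))
      (.app (mapTm σ A B C' D' (Tm.comp C' f f') (Tm.comp B g' g)) x)) := by
  have hΓ := ICx.toCx_noLin Γ
  refine mapTm_eq_of_rel hid hσ hg' hf' ((mapTm_hasType hσ hΓ hf hg).iapp hx)
    ((mapTm_hasType hσ hΓ (hf.icomp hf') (hg'.icomp hg)).iapp hx) ?_
  exact mapTm_rel hid hσ (.eqRel A) (.eqRel B) (.bwd hf') (.fwd hg') hf (hf.icomp hf') hg
    (hg'.icomp hg) hx hx (maps_bwd_eqRel hf hf') (maps_eqRel_fwd hg hg')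
    ((interp_eq₂ hid hx hx).2 (.rfl' hx))

end Prov

end Graph

end LAPL

namespace LAPL

variable {S : Sig.{u}} {P : Schemes} {n k r m l : ℕ} {Γ : ICx S n k} {Θ : RCx S n r}
  {Φ : List (Fm S n k r)}

/-! ### Polymorphic functions on dialgebra structures -/

/-- The type `(σ(B, A) ⊸ A) → (B ⊸ σ(A, B)) → T` of functions of a dialgebra structure on the
pair `A`, `B`. -/
def dialgTy (σ : Ty S.ty 2) (A B T : Ty S.ty n) : Ty S.ty n :=
  .arrow (.lolli (σ.at₂ B A) A) (.arrow (.lolli B (σ.at₂ A B)) T)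

/-- The type `∏ α, β. (σ(β, α) ⊸ α) → (β ⊸ σ(α, β)) → T`; in `T`, the variable `α` has index `1`
and `β` has index `0`. -/
def polyTy (σ : Ty S.ty 2) (T : Ty S.ty (n + 2)) : Ty S.ty n :=
  .all (.all (dialgTy σ (.var 1) (.var 0) T))

/-- The value `d A B !f !g` of a polymorphic function at a dialgebra. -/
def dialgApp (d : Tm S n k) (A B : Ty S.ty n) (f g : Tm S n k) : Tm S n k :=
  .app (.app (.tapp (.tapp d A) B) (.bang f)) (.bang g)

/-- The polymorphic function `Λ α, β. λ f, g. t` on dialgebras; in `t`, the variable `f` has index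
`1` and `g` has index `0`. -/
def dialgLam (σ : Ty S.ty 2) (t : Tm S (n + 2) (k + 2)) : Tm S n k :=
  .tlam (.tlam (Tm.ilam (.lolli (σ.at₂ (.var 0) (.var 1)) (.var 1))
    (Tm.ilam (.lolli (.var 0) (σ.at₂ (.var 1) (.var 0))) t)))

variable (σ : Ty S.ty 2)

theorem dialgTy_sub (A B T : Ty S.ty n) (s : Fin n → Ty S.ty m) :
    (dialgTy σ A B T).sub s = dialgTy σ (A.sub s) (B.sub s) (T.sub s) := by
  simp [dialgTy, Ty.sub, Ty.sub_sub, Ty.vec₂_sub]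

theorem polyTy_sub (T : Ty S.ty (n + 2)) (s : Fin n → Ty S.ty m) :
    (polyTy σ T).sub s = polyTy σ (T.sub (Ty.lift (Ty.lift s))) := by
  simp [polyTy, Ty.sub, dialgTy_sub, Ty.ren]

theorem dialgApp_sub (d : Tm S n k) (A B : Ty S.ty n) (f g : Tm S n k) (s : Fin n → Ty S.ty m)
    (e : Fin k → Tm S m l) : (dialgApp d A B f g).sub s e =
      dialgApp (d.sub s e) (A.sub s) (B.sub s) (f.sub s e) (g.sub s e) := by
  simp [dialgApp, Tm.sub]

theorem dialgApp_ren (d : Tm S n k) (A B : Ty S.ty n) (f g : Tm S n k) (s : Fin n → Fin m)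
    (e : Fin k → Fin l) : (dialgApp d A B f g).ren s e =
      dialgApp (d.ren s e) (A.ren s) (B.ren s) (f.ren s e) (g.ren s e) := by
  simp [dialgApp, Tm.ren]

theorem dialgLam_sub (t : Tm S (n + 2) (k + 2)) (s : Fin n → Ty S.ty m) (e : Fin k → Tm S m l) :
    (dialgLam σ t).sub s e = dialgLam σ (t.sub (Ty.lift (Ty.lift s))
      (Tm.lift (Tm.lift (fun i => (e i).wkTy.wkTy)))) := by
  simp [dialgLam, Tm.sub, Tm.ilam_sub, Ty.sub, Ty.sub_sub, Ty.vec₂_sub, Ty.ren]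

variable {σ}

theorem HasType.dialgApp {Δ Δ' : Cx S n k} (hs : Δ.Split Δ Δ') (hΔ : Δ'.NoLin)
    {T : Ty S.ty (n + 2)} {A B : Ty S.ty n} {d f g : Tm S n k} (hd : HasType Δ d (polyTy σ T))
    (hf : HasType Δ' f (.lolli (σ.at₂ B A) A)) (hg : HasType Δ' g (.lolli B (σ.at₂ A B))) :
    HasType Δ (dialgApp d A B f g) (T.sub (scons B (scons A Ty.var))) := by
  have h := HasType.tapp B (HasType.tapp A hd)
  have h' : HasType Δ (.tapp (.tapp d A) B) (dialgTy σ A B (T.sub (scons B (scons A Ty.var)))) := by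
    have e : (fun i => (Ty.lift (scons A Ty.var) i).sub (scons B Ty.var)) =
      scons B (scons A Ty.var) := by
      refine funext_scons rfl (Fin.cases ?_ fun i => ?_) <;> simp [Ty.sub_ren, Ty.sub]
    simpa [Ty.inst, dialgTy_sub, Ty.sub, Ty.sub_ren, Ty.sub_sub, e] using h
  exact .app hs (.app hs h' (.bang hΔ hf)) (.bang hΔ hg)

theorem HasType.dialgLam {Δ : Cx S n k} {T : Ty S.ty (n + 2)} {t : Tm S (n + 2) (k + 2)}
    (ht : HasType (S := S) (scons (.unr (.lolli (.var 0) (σ.at₂ (.var 1) (.var 0))))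
      (scons (.unr (.lolli (σ.at₂ (.var 0) (.var 1)) (.var 1))) Δ.wkTy.wkTy)) t T) :
    HasType Δ (dialgLam σ t) (polyTy σ T) :=
  .tlam (.tlam (.ilam (.ilam ht)))

theorem Ty.ren_liftR_inst (τ : Ty S.ty (n + 1)) : (τ.ren (liftR Fin.succ)).inst (.var 0) = τ := by
  have e : (fun i => (scons (.var 0) Ty.var : Fin (n + 2) → Ty S.ty (n + 1))
      (liftR Fin.succ i)) = Ty.var := funext_scons rfl fun i => rfl
  rw [Ty.inst, Ty.sub_ren, e, Ty.sub_var]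

theorem HasType.tapp_wk {τ : Ty S.ty (n + 1)} {t : Tm S n k} (ht : HasType Γ.toCx t (.all τ)) :
    HasType Γ.wkTy.toCx (.tapp t.wkTy (.var 0)) τ :=
  (HasType.tapp (.var 0) ht.iwkTy).cast (Ty.ren_liftR_inst τ)

namespace Prov

/-- The `β` rule for types, in generic form. -/
theorem tapp_tlam_var {τ : Ty S.ty (n + 1)} {t : Tm S (n + 1) k}
    (ht : HasType Γ.wkTy.toCx t τ) {Θ : RCx S (n + 1) r} {Φ : List (Fm S (n + 1) k r)} :
    Prov P Γ.wkTy Θ Φ (.eq τ (.tapp (.wkTy (.tlam t)) (.var 0)) t) := by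
  have h := ExtEq.betaTy (Γ := Γ.wkTy.toCx) (.var 0)
    (HasType.ren ht (Cx.IsRen.wkTy Γ.toCx).liftTy)
  have e₂ : (fun i => (scons (.var 0) Ty.var : Fin (n + 2) → Ty S.ty (n + 1))
      (liftR Fin.succ i)) = Ty.var := funext_scons rfl fun i => rfl
  refine .ofExtEq ?_
  rw [Ty.ren_liftR_inst, Tm.instTy, Tm.sub_ren, e₂] at h
  have e₃ : t.sub Ty.var (fun i => Tm.var (id i)) = t := Tm.sub_var t
  rwa [e₃] at h

/-- The `β` rule for intuitionistic abstraction, in generic form. -/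
theorem app_ilam_var {σ τ : Ty S.ty n} {t : Tm S n (k + 1)}
    (ht : HasType (ICx.toCx (S := S) (scons σ Γ)) t τ) {Φ : List (Fm S n (k + 1) r)} :
    Prov (S := S) P (scons σ Γ) Θ Φ (.eq τ (.app (.wk (Tm.ilam σ t)) (.bang (.var 0))) t) := by
  have ht' := ht
  rw [ICx.toCx_scons] at ht'
  have h := ht'.ren ((IsRen.wkTm Γ Θ σ).toCx.lift (.unr σ))
  simp only [Entry.ren, Ty.ren_id] at h
  have h' := ExtEq.ibeta (ICx.toCx_noLin (S := S) (scons σ Γ)) h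
    (HasType.ivar' (S := S) (scons σ Γ) 0)
  refine .ofExtEq ?_
  have e : (fun i => (scons (.var 0) Tm.var : Fin (k + 2) → Tm S n (k + 1))
      (liftR Fin.succ i)) = Tm.var := funext_scons rfl fun i => rfl
  have e' : (fun i => (Ty.var (id i) : Ty S.ty n)) = Ty.var := rfl
  simp only [Tm.inst, Tm.sub_ren, e, e', Tm.sub_var] at h'
  simpa [Tm.wk, Tm.ilam_ren] using h'

/-- The `β` rule for polymorphic functions on dialgebras. -/
theorem dialgApp_dialgLam {T : Ty S.ty (n + 2)} {t : Tm S (n + 2) (k + 2)}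
    (ht : HasType (ICx.toCx (S := S) (scons (.lolli (.var 0) (σ.at₂ (.var 1) (.var 0)))
      (scons (.lolli (σ.at₂ (.var 0) (.var 1)) (.var 1)) Γ.wkTy.wkTy))) t T)
    {A B : Ty S.ty n} {f g : Tm S n k} (hf : HasType Γ.toCx f (.lolli (σ.at₂ B A) A))
    (hg : HasType Γ.toCx g (.lolli B (σ.at₂ A B))) :
    Prov P Γ Θ Φ (.eq (T.sub (scons B (scons A Ty.var))) (dialgApp (dialgLam σ t) A B f g)
      (t.sub (scons B (scons A Ty.var)) (scons g (scons f Tm.var)))) := by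
  let F : Ty S.ty (n + 2) := .lolli (σ.at₂ (.var 0) (.var 1)) (.var 1)
  let G : Ty S.ty (n + 2) := .lolli (.var 0) (σ.at₂ (.var 1) (.var 0))
  have t₁ : HasType (ICx.toCx (S := S) (scons F Γ.wkTy.wkTy)) (Tm.ilam G t) (.arrow G T) := by
    refine .ilam ?_
    rwa [ICx.toCx_scons] at ht
  have t₂ : HasType Γ.wkTy.wkTy.toCx (Tm.ilam F (Tm.ilam G t)) (.arrow F (.arrow G T)) := by
    refine .ilam ?_
    rwa [ICx.toCx_scons] at t₁
  have t₃ : HasType Γ.wkTy.toCx (.tlam (Tm.ilam F (Tm.ilam G t))) (.all (.arrow F (.arrow G T))) :=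
    .tlam t₂
  have t₄ : HasType Γ.toCx (dialgLam σ t) (.all (.all (.arrow F (.arrow G T)))) := .tlam t₃
  have t₅ := t₄.tapp_wk.tapp_wk
  have h₁ := (tapp_tlam_var (P := P) (Θ := Θ.wkTy) (Φ := Φ.map Fm.wkTy) t₃).ren
    (IsRen.wkTy _ _)
  have h₂ := tapp_congr (.var 0) t₄.tapp_wk.iwkTy t₃.iwkTy h₁
  rw [Ty.ren_liftR_inst] at h₂
  have h₃ := (h₂.trans (tapp_tlam_var t₂)).ren (IsRen.wkTm _ _ F)
  rw [Fm.ren, Ty.ren_id] at h₃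
  have x₀ : HasType (ICx.toCx (S := S) (scons F Γ.wkTy.wkTy)) (.var 0) F := .ivar' _ 0
  have h₄ := (app_congr_left (t₅.iwk F) (t₂.iwk F) x₀.ibang h₃).trans (app_ilam_var (by
    exact t₁))
  have h₅ := h₄.ren (IsRen.wkTm _ _ G)
  rw [Fm.ren, Ty.ren_id] at h₅
  have y₀ : HasType (ICx.toCx (S := S) (scons G (scons F Γ.wkTy.wkTy))) (.var 0) G := .ivar' _ 0
  have h₆ := (app_congr_left (((t₅.iwk F).iapp x₀.ibang).iwk G) (t₁.iwk G) y₀.ibang h₅).trans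
    (app_ilam_var ht)
  have w : List.map (Fm.sub (scons B (scons A Ty.var)) (scons g (scons f Tm.var)) Rl.var)
      ((((Φ.map Fm.wkTy).map Fm.wkTy).map Fm.wkTm).map Fm.wkTm) = Φ := by
    simp only [List.map_map]
    refine (List.map_congr_left fun φ _ => ?_).trans (List.map_id _)
    simp only [Function.comp, Fm.wkTy, Fm.wkTm, ← Fm.sub_vars, Fm.sub_sub]
    exact (Fm.sub_vars id id id φ).trans (Fm.Rl_ren_id.1 φ)
  have h₇ := h₆.subst (Γ' := Γ) (Θ' := Θ) (scons B (scons A Ty.var))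
    (e := scons g (scons f Tm.var)) (d := Rl.var) ?_ ?_ ?_
  · have w' := h₇
    erw [w] at w'
    simpa [Fm.sub, Tm.sub, Tm.sub_ren, dialgApp, Tm.ren, Ty.sub, Ty.ren] using w'
  · refine Fin.cases ?_ (Fin.cases ?_ fun i => ?_)
    · simpa [G, Ty.sub, Ty.sub_sub, Ty.vec₂_sub] using hg
    · simpa [F, Ty.sub, Ty.sub_sub, Ty.vec₂_sub] using hf
    · simpa [ICx.wkTy, Ty.sub_ren] using HasType.ivar' Γ i
  · intro i
    rcases hi : Θ i with ⟨_ | _, C, D⟩ <;> simp [RCx.wkTy, hi, Ty.sub_ren]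
    · exact .var i hi
    · exact .ofAdm (.var i hi)
  · intro i
    rcases hi : Θ i with ⟨_ | _, C, D⟩ <;> simp [RCx.wkTy, hi, Ty.sub_ren]
    exact .var i hi

end Prov

end LAPL

namespace LAPL

variable {S : Sig.{u}} {P : Schemes} {n k r m l : ℕ} {Γ : ICx S n k} {Θ : RCx S n r}
  {Φ : List (Fm S n k r)}

/-! ### The candidate for an initial dialgebra on a pair of types -/

section Definitions

variable (σ : Ty S.ty 2)

/-- The type `∏ α, β. (σ(β, α) ⊸ α) → (β ⊸ σ(α, β)) → α`, the covariant component of an initial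
dialgebra. -/
def algTy : Ty S.ty n := polyTy σ (.var 1)

/-- The type `∏ α, β. (σ(β, α) ⊸ α) → (β ⊸ σ(α, β)) → β ⊸ C` of cocones with vertex `C`. -/
def coconeTy (C : Ty S.ty n) : Ty S.ty n := polyTy σ (.lolli (.var 0) C.wk.wk)

/-- The impredicative encoding `∏ γ. (∏ α, β. (σ(β, α) ⊸ α) → (β ⊸ σ(α, β)) → β ⊸ γ) ⊸ γ` of
the colimit of the second components of all dialgebras. -/
def coalgTy : Ty S.ty n := .all (.lolli (coconeTy σ (.var 0)) (.var 0))

/-- The function `algTy ⊸ A` that evaluates at the dialgebra `(A, B, f, g)`. -/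
def foldTm (A B : Ty S.ty n) (f g : Tm S n k) : Tm S n k :=
  .lam (algTy σ) (dialgApp (.var 0) A B f.wk g.wk)

/-- The injection `B ⊸ coalgTy` of the dialgebra `(A, B, f, g)`. -/
def unfoldTm (A B : Ty S.ty n) (f g : Tm S n k) : Tm S n k :=
  .lam B (.tlam (.lam (coconeTy σ (.var 0))
    (.app (dialgApp (.var 0) A.wk B.wk f.wk.wkTy.wk g.wk.wkTy.wk) (.var 1))))

/-- The structure map `σ(coalgTy, algTy) ⊸ algTy`. -/
def algTm : Tm S n k :=
  .lam (σ.at₂ (coalgTy σ) (algTy σ)) (dialgLam σ (.app (.var 1)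
    (.app (mapTm σ (coalgTy σ) (algTy σ) (.var 0) (.var 1)
      (unfoldTm σ (.var 1) (.var 0) (.var 1) (.var 0))
      (foldTm σ (.var 1) (.var 0) (.var 1) (.var 0))) (.var 2))))

/-- The cocone with vertex `σ(algTy, coalgTy)` that defines `coalgTm`. -/
def coalgCocone : Tm S n k :=
  dialgLam σ (.lam (.var 0)
    (.app (mapTm σ (.var 1) (.var 0) (algTy σ) (coalgTy σ)
      (foldTm σ (.var 1) (.var 0) (.var 2) (.var 1))
      (unfoldTm σ (.var 1) (.var 0) (.var 2) (.var 1))) (.app (.var 1) (.var 0))))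

/-- The structure map `coalgTy ⊸ σ(algTy, coalgTy)`. -/
def coalgTm : Tm S n k :=
  .lam (coalgTy σ) (.app (.tapp (.var 0) (σ.at₂ (algTy σ) (coalgTy σ))) (coalgCocone σ))

/-- The cocone with vertex `C` that is induced by `v : coalgTy ⊸ C`. -/
def inducedCocone (v : Tm S n k) : Tm S n k :=
  dialgLam σ (.lam (.var 0) (.app v.wkTy.wkTy.wk.wk.wk
    (.app (unfoldTm σ (.var 1) (.var 0) (.var 2) (.var 1)) (.var 0))))

end Definitions

section Substitution

variable (σ : Ty S.ty 2) (s : Fin n → Ty S.ty m) (e : Fin k → Tm S m l)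

@[simp] theorem algTy_sub : (algTy σ : Ty S.ty n).sub s = algTy σ := by
  simp [algTy, polyTy_sub, Ty.sub, Ty.ren]

@[simp] theorem coconeTy_sub (C : Ty S.ty n) :
    (coconeTy σ C).sub s = coconeTy σ (C.sub s) := by
  simp [coconeTy, polyTy_sub, Ty.sub, Ty.ren_sub, Ty.sub_ren]

@[simp] theorem coalgTy_sub : (coalgTy σ : Ty S.ty n).sub s = coalgTy σ := by
  simp [coalgTy, Ty.sub]

@[simp] theorem algTy_ren (f : Fin n → Fin m) : (algTy σ : Ty S.ty n).ren f = algTy σ := by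
  rw [Ty.ren_eq_sub, algTy_sub]

@[simp] theorem coconeTy_ren (f : Fin n → Fin m) (C : Ty S.ty n) :
    (coconeTy σ C).ren f = coconeTy σ (C.ren f) := by
  rw [Ty.ren_eq_sub, Ty.ren_eq_sub, coconeTy_sub]

@[simp] theorem coalgTy_ren (f : Fin n → Fin m) : (coalgTy σ : Ty S.ty n).ren f = coalgTy σ := by
  rw [Ty.ren_eq_sub, coalgTy_sub]

@[simp] theorem foldTm_sub (A B : Ty S.ty n) (f g : Tm S n k) : (foldTm σ A B f g).sub s e =
    foldTm σ (A.sub s) (B.sub s) (f.sub s e) (g.sub s e) := by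
  simp [foldTm, Tm.sub, dialgApp_sub, Tm.sub_ren, Tm.ren_sub]

@[simp] theorem unfoldTm_sub (A B : Ty S.ty n) (f g : Tm S n k) :
    (unfoldTm σ A B f g).sub s e =
      unfoldTm σ (A.sub s) (B.sub s) (f.sub s e) (g.sub s e) := by
  simp [unfoldTm, Tm.sub, dialgApp_sub, Tm.sub_ren, Tm.ren_sub, Tm.ren_ren, Ty.sub_ren,
    Ty.ren_sub, Tm.ren, Ty.sub]

@[simp] theorem foldTm_ren (A B : Ty S.ty n) (f g : Tm S n k) (s : Fin n → Fin m)
    (e : Fin k → Fin l) : (foldTm σ A B f g).ren s e =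
    foldTm σ (A.ren s) (B.ren s) (f.ren s e) (g.ren s e) := by
  simp only [Tm.ren_eq_sub, Ty.ren_eq_sub, foldTm_sub]

@[simp] theorem unfoldTm_ren (A B : Ty S.ty n) (f g : Tm S n k) (s : Fin n → Fin m)
    (e : Fin k → Fin l) : (unfoldTm σ A B f g).ren s e =
      unfoldTm σ (A.ren s) (B.ren s) (f.ren s e) (g.ren s e) := by
  simp only [Tm.ren_eq_sub, Ty.ren_eq_sub, unfoldTm_sub]

@[simp] theorem algTm_sub : (algTm σ : Tm S n k).sub s e = algTm σ := by
  simp [algTm, Tm.sub, dialgLam_sub, mapTm_sub, Ty.sub_sub, Ty.vec₂_sub, Ty.sub, Tm.ren, Ty.ren]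

@[simp] theorem coalgCocone_sub : (coalgCocone σ : Tm S n k).sub s e = coalgCocone σ := by
  simp [coalgCocone, Tm.sub, dialgLam_sub, mapTm_sub, Ty.sub, Tm.ren, Ty.ren]

@[simp] theorem coalgTm_sub : (coalgTm σ : Tm S n k).sub s e = coalgTm σ := by
  simp [coalgTm, Tm.sub, Ty.sub_sub, Ty.vec₂_sub]

@[simp] theorem algTm_ren (s : Fin n → Fin m) (e : Fin k → Fin l) :
    (algTm σ : Tm S n k).ren s e = algTm σ := by rw [Tm.ren_eq_sub, algTm_sub]

@[simp] theorem coalgTm_ren (s : Fin n → Fin m) (e : Fin k → Fin l) :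
    (coalgTm σ : Tm S n k).ren s e = coalgTm σ := by rw [Tm.ren_eq_sub, coalgTm_sub]

theorem inducedCocone_sub (v : Tm S n k) :
    (inducedCocone σ v).sub s e = inducedCocone σ (v.sub s e) := by
  simp [inducedCocone, Tm.sub, dialgLam_sub, Ty.sub, Tm.sub_ren, Tm.ren_sub, Tm.ren_ren,
    Tm.ren, Ty.ren]

end Substitution

end LAPL

namespace LAPL

variable {S : Sig.{u}} {P : Schemes} {n k r m l : ℕ} {Γ : ICx S n k} {Θ : RCx S n r}
  {Φ : List (Fm S n k r)} {σ : Ty S.ty 2}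

/-! ### Typing and computation rules of the candidate -/

theorem Ty.at₂_sub (σ : Ty S.ty 2) (A B : Ty S.ty n) (s : Fin n → Ty S.ty m) :
    (σ.at₂ A B).sub s = σ.at₂ (A.sub s) (B.sub s) := by
  rw [Ty.at₂, Ty.sub_sub, Ty.vec₂_sub]

theorem Ty.at₂_ren (σ : Ty S.ty 2) (A B : Ty S.ty n) (f : Fin n → Fin m) :
    (σ.at₂ A B).ren f = σ.at₂ (A.ren f) (B.ren f) := by
  rw [Ty.at₂, Ty.ren_sub, Ty.vec₂_ren]

namespace HasType

section

variable {Δ Δ' : Cx S n k} {A B C : Ty S.ty n} {f g d v : Tm S n k}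

theorem algApp (hs : Δ.Split Δ Δ') (hΔ : Δ'.NoLin) (hd : HasType Δ d (algTy σ))
    (hf : HasType Δ' f (.lolli (σ.at₂ B A) A)) (hg : HasType Δ' g (.lolli B (σ.at₂ A B))) :
    HasType Δ (LAPL.dialgApp d A B f g) A := dialgApp hs hΔ hd hf hg

theorem coconeApp (hs : Δ.Split Δ Δ') (hΔ : Δ'.NoLin) (hd : HasType Δ d (coconeTy σ C))
    (hf : HasType Δ' f (.lolli (σ.at₂ B A) A)) (hg : HasType Δ' g (.lolli B (σ.at₂ A B))) :
    HasType Δ (LAPL.dialgApp d A B f g) (.lolli B C) := by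
  simpa [Ty.sub, Ty.sub_ren] using dialgApp hs hΔ hd hf hg

theorem coalgApp (hd : HasType Δ d (coalgTy σ)) (C : Ty S.ty n) :
    HasType Δ (.tapp d C) (.lolli (coconeTy σ C) C) := by
  simpa [Ty.inst, Ty.sub] using HasType.tapp C hd

end

variable {Δ : Cx S n k} {A B C : Ty S.ty n} {f g v : Tm S n k}

theorem foldTm (hΔ : Δ.NoLin) (hf : HasType Δ f (.lolli (σ.at₂ B A) A))
    (hg : HasType Δ g (.lolli B (σ.at₂ A B))) :
    HasType Δ (foldTm σ A B f g) (.lolli (algTy σ) A) :=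
  .lam (.algApp (.scons (.left _) (.self hΔ)) hΔ.off (.lvar0 hΔ) hf.wkOff hg.wkOff)

theorem at₂_wkTy {t : Tm S n k} (σ : Ty S.ty 2) {A B C : Ty S.ty n}
    (ht : HasType Δ t (.lolli (σ.at₂ A B) C)) :
    HasType Δ.wkTy t.wkTy (.lolli (σ.at₂ A.wk B.wk) C.wk) := by
  simpa [Ty.ren, Ty.at₂_ren] using ht.wkTy

theorem at₂_wkTy' {t : Tm S n k} (σ : Ty S.ty 2) {A B C : Ty S.ty n}
    (ht : HasType Δ t (.lolli C (σ.at₂ A B))) :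
    HasType Δ.wkTy t.wkTy (.lolli C.wk (σ.at₂ A.wk B.wk)) := by
  simpa [Ty.ren, Ty.at₂_ren] using ht.wkTy

theorem unfoldTm (hΔ : Δ.NoLin) (hf : HasType Δ f (.lolli (σ.at₂ B A) A))
    (hg : HasType Δ g (.lolli B (σ.at₂ A B))) :
    HasType Δ (unfoldTm σ A B f g) (.lolli B (coalgTy σ)) := by
  have f' : HasType (S := S) (scons .off Δ.wkTy) f.wk.wkTy
      (.lolli (σ.at₂ B.wk A.wk) A.wk) := by
    simpa [Cx.wkTy_scons, Entry.wkTy] using at₂_wkTy σ hf.wkOff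
  have g' : HasType (S := S) (scons .off Δ.wkTy) g.wk.wkTy
      (.lolli B.wk (σ.at₂ A.wk B.wk)) := by
    simpa [Cx.wkTy_scons, Entry.wkTy] using at₂_wkTy' σ hg.wkOff
  refine .lam (.tlam (.lam ?_))
  rw [Cx.wkTy_scons]
  exact .app (.scons (.left _) (.scons (.right _) (.self hΔ.wkTy)))
    (.coconeApp (.scons (.left _) (.scons .off (.self hΔ.wkTy))) hΔ.wkTy.off.off
      (.lvar0 hΔ.wkTy.off) f'.wkOff g'.wkOff) (HasType.lvar0 hΔ.wkTy).wkOff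

theorem algTm (hσ : σ.Mixed) (hΔ : Δ.NoLin) :
    HasType Δ (algTm σ) (.lolli (σ.at₂ (coalgTy σ) (algTy σ)) (algTy σ)) := by
  refine .lam (.dialgLam ?_)
  rw [Cx.wkTy_scons, Cx.wkTy_scons]
  have h := hΔ.wkTy.wkTy
  have hf : HasType (S := S) (scons (.unr (.lolli (.var 0) (σ.at₂ (.var 1) (.var 0))))
      (scons (.unr (.lolli (σ.at₂ (.var 0) (.var 1)) (.var 1))) (scons .off Δ.wkTy.wkTy)))
      (.var 1) (.lolli (σ.at₂ (.var 0) (.var 1)) (.var 1)) := (HasType.ivar0 h.off).wkUnr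
  have hg : HasType (S := S) (scons (.unr (.lolli (.var 0) (σ.at₂ (.var 1) (.var 0))))
      (scons (.unr (.lolli (σ.at₂ (.var 0) (.var 1)) (.var 1))) (scons .off Δ.wkTy.wkTy)))
      (.var 0) (.lolli (.var 0) (σ.at₂ (.var 1) (.var 0))) := .ivar0 h.off.unr
  refine .app (.scons (.unr _) (.scons (.unr _) (.scons (.right _) (.self h)))) hf
    (.app (.scons (.unr _) (.scons (.unr _) (.scons (.right _) (.self h))))
      (mapTm_hasType hσ h.off.unr.unr (.unfoldTm h.off.unr.unr hf hg)
      (.foldTm h.off.unr.unr hf hg)) ?_)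
  have := (HasType.lvar0 h (σ := σ.at₂ (coalgTy σ) (algTy σ))).wkUnr
    (τ := .lolli (σ.at₂ (.var 0) (.var 1)) (.var 1)) |>.wkUnr
    (τ := .lolli (.var 0) (σ.at₂ (.var 1) (.var 0)))
  have e : (σ.at₂ (coalgTy σ) (algTy σ) : Ty S.ty n).wk.wk = σ.at₂ (coalgTy σ) (algTy σ) := by
    simp [Ty.at₂_ren]
  rw [e]
  exact this

theorem coalgCocone_body (hσ : σ.Mixed) (hΔ : Δ.NoLin) :
    HasType (S := S) (scons (.unr (.lolli (.var 0) (σ.at₂ (.var 1) (.var 0))))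
      (scons (.unr (.lolli (σ.at₂ (.var 0) (.var 1)) (.var 1))) Δ.wkTy.wkTy))
      (.lam (.var 0) (.app (mapTm σ (.var 1) (.var 0) (algTy σ) (coalgTy σ)
        (LAPL.foldTm σ (.var 1) (.var 0) (.var 2) (.var 1))
        (LAPL.unfoldTm σ (.var 1) (.var 0) (.var 2) (.var 1))) (.app (.var 1) (.var 0))))
      (.lolli (.var 0) (σ.at₂ (algTy σ) (coalgTy σ)).wk.wk) := by
  have h := hΔ.wkTy.wkTy
  have hf : HasType (S := S) (scons .off (scons (.unr (.lolli (.var 0) (σ.at₂ (.var 1) (.var 0))))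
      (scons (.unr (.lolli (σ.at₂ (.var 0) (.var 1)) (.var 1))) Δ.wkTy.wkTy)))
      (.var 2) (.lolli (σ.at₂ (.var 0) (.var 1)) (.var 1)) := (HasType.ivar0 h).wkUnr.wkOff
  have hg : HasType (S := S) (scons .off (scons (.unr (.lolli (.var 0) (σ.at₂ (.var 1) (.var 0))))
      (scons (.unr (.lolli (σ.at₂ (.var 0) (.var 1)) (.var 1))) Δ.wkTy.wkTy)))
      (.var 1) (.lolli (.var 0) (σ.at₂ (.var 1) (.var 0))) := (HasType.ivar0 h.unr).wkOff
  have hm := mapTm_hasType hσ h.unr.unr.off (.foldTm h.unr.unr.off hf hg)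
    (.unfoldTm h.unr.unr.off hf hg)
  refine .lam (.appR h.unr.unr (hm.cast ?_) (.appR h.unr.unr hg (.lvar0 h.unr.unr)))
  simp [Ty.at₂_ren]

theorem coalgCocone (hσ : σ.Mixed) (hΔ : Δ.NoLin) :
    HasType Δ (coalgCocone σ) (coconeTy σ (σ.at₂ (algTy σ) (coalgTy σ))) :=
  .dialgLam (.coalgCocone_body hσ hΔ)

theorem coalgTm (hσ : σ.Mixed) (hΔ : Δ.NoLin) :
    HasType Δ (coalgTm σ) (.lolli (coalgTy σ) (σ.at₂ (algTy σ) (coalgTy σ))) :=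
  .lam (.appL hΔ (.coalgApp (.lvar0 hΔ) _) (.coalgCocone hσ hΔ.off))

theorem inducedCocone_body (hΔ : Δ.NoLin) (hv : HasType Δ v (.lolli (coalgTy σ) C)) :
    HasType (S := S) (scons (.unr (.lolli (.var 0) (σ.at₂ (.var 1) (.var 0))))
      (scons (.unr (.lolli (σ.at₂ (.var 0) (.var 1)) (.var 1))) Δ.wkTy.wkTy))
      (.lam (.var 0) (.app v.wkTy.wkTy.wk.wk.wk
        (.app (LAPL.unfoldTm σ (.var 1) (.var 0) (.var 2) (.var 1)) (.var 0))))
      (.lolli (.var 0) C.wk.wk) := by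
  have h := hΔ.wkTy.wkTy
  have hf : HasType (S := S) (scons .off (scons (.unr (.lolli (.var 0) (σ.at₂ (.var 1) (.var 0))))
      (scons (.unr (.lolli (σ.at₂ (.var 0) (.var 1)) (.var 1))) Δ.wkTy.wkTy)))
      (.var 2) (.lolli (σ.at₂ (.var 0) (.var 1)) (.var 1)) := (HasType.ivar0 h).wkUnr.wkOff
  have hg : HasType (S := S) (scons .off (scons (.unr (.lolli (.var 0) (σ.at₂ (.var 1) (.var 0))))
      (scons (.unr (.lolli (σ.at₂ (.var 0) (.var 1)) (.var 1))) Δ.wkTy.wkTy)))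
      (.var 1) (.lolli (.var 0) (σ.at₂ (.var 1) (.var 0))) := (HasType.ivar0 h.unr).wkOff
  have hv' := hv.wkTy.wkTy
  simp only [Ty.ren, coalgTy_ren] at hv'
  exact .lam (.appR h.unr.unr hv'.wkUnr.wkUnr.wkOff
    (.appR h.unr.unr (.unfoldTm h.unr.unr.off hf hg) (.lvar0 h.unr.unr)))

theorem inducedCocone (hΔ : Δ.NoLin) (hv : HasType Δ v (.lolli (coalgTy σ) C)) :
    HasType Δ (inducedCocone σ v) (coconeTy σ C) := .dialgLam (.inducedCocone_body hΔ hv)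

end HasType

namespace Prov

variable {A B C : Ty S.ty n} {f g v b x y d : Tm S n k}

theorem foldTm_app (hf : HasType Γ.toCx f (.lolli (σ.at₂ B A) A))
    (hg : HasType Γ.toCx g (.lolli B (σ.at₂ A B))) (hx : HasType Γ.toCx x (algTy σ)) :
    Prov P Γ Θ Φ (.eq A (.app (foldTm σ A B f g) x) (dialgApp x A B f g)) := by
  have hΓ := ICx.toCx_noLin Γ
  have := ExtEq.beta hΓ (.algApp (.scons (.left _) (.self hΓ)) hΓ.off (.lvar0 hΓ) hf.wkOff
    hg.wkOff) hx
  refine .ofExtEq ?_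
  simpa [foldTm, Tm.inst, dialgApp_sub, Tm.sub, Tm.sub_ren] using this

theorem unfoldTm_app (hf : HasType Γ.toCx f (.lolli (σ.at₂ B A) A))
    (hg : HasType Γ.toCx g (.lolli B (σ.at₂ A B))) (hb : HasType Γ.toCx b B)
    (hd : HasType Γ.toCx d (coconeTy σ C)) :
    Prov P Γ Θ Φ (.eq C (.app (.tapp (.app (unfoldTm σ A B f g) b) C) d)
      (.app (dialgApp d A B f g) b)) := by
  have hΓ := ICx.toCx_noLin Γ
  have h₀ := HasType.unfoldTm hΓ hf hg
  rw [unfoldTm] at h₀ ⊢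
  cases h₀ with | lam h₀ =>
  have h₁ := ExtEq.beta hΓ h₀ hb
  have f₁ := HasType.at₂_wkTy σ hf
  have g₁ := HasType.at₂_wkTy' σ hg
  have hΓ₁ := hΓ.wkTy
  have b₁ := hb.wkTy
  have h₂ : HasType (S := S) (scons (.lin (coconeTy σ (.var 0))) Γ.toCx.wkTy)
      (.app (dialgApp (.var 0) A.wk B.wk f.wkTy.wk g.wkTy.wk) b.wkTy.wk) (.var 0) :=
    .appL hΓ₁ (.coconeApp (.scons (.left _) (.self hΓ₁)) hΓ₁.off (.lvar0 hΓ₁) f₁.wkOff g₁.wkOff)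
      b₁.wkOff
  have e₁ : Tm.inst (.tlam (.lam (coconeTy σ (.var 0))
      (.app (dialgApp (.var 0) A.wk B.wk f.wk.wkTy.wk g.wk.wkTy.wk) (.var 1)))) b =
      .tlam (.lam (coconeTy σ (.var 0))
        (.app (dialgApp (.var 0) A.wk B.wk f.wkTy.wk g.wkTy.wk) b.wkTy.wk)) := by
    simp [Tm.inst, Tm.sub, dialgApp_sub, Tm.sub_ren, Tm.ren_ren, Ty.sub_ren, Tm.ren, Ty.sub,
      Tm.sub_vars]
    simp only [Ty.ren_eq_sub]
  rw [e₁] at h₁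
  have h₃ := (ExtEq.tapp C h₁).trans (ExtEq.betaTy C (Γ := Γ.toCx) (.lam h₂))
  have e₂ : Tm.instTy (.lam (coconeTy σ (.var 0))
        (.app (dialgApp (.var 0) A.wk B.wk f.wkTy.wk g.wkTy.wk) b.wkTy.wk)) C =
      .lam (coconeTy σ C) (.app (dialgApp (.var 0) A B f.wk g.wk) b.wk) := by
    simp [Tm.instTy, Tm.sub, dialgApp_sub, Ty.sub_ren, Ty.sub, Tm.ren_eq_sub, Tm.sub_sub]
  have e₃ : (Ty.lolli (coconeTy σ (.var 0)) (.var 0)).inst C = .lolli (coconeTy σ C) C := by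
    simp [Ty.inst, Ty.sub]
  rw [e₂, e₃] at h₃
  have h₄ := ExtEq.beta hΓ (.appL hΓ (.coconeApp (.scons (.left _) (.self hΓ)) hΓ.off
    (.lvar0 hΓ) hf.wkOff hg.wkOff) hb.wkOff) hd
  refine .ofExtEq ((ExtEq.app' hΓ h₃ (.refl hd)).trans ?_)
  simpa [Tm.inst, Tm.sub, dialgApp_sub, Tm.sub_ren] using h₄

theorem dialgApp_congr {T : Ty S.ty (n + 2)} {d d' : Tm S n k} (hd : HasType Γ.toCx d (polyTy σ T))
    (hd' : HasType Γ.toCx d' (polyTy σ T)) (hf : HasType Γ.toCx f (.lolli (σ.at₂ B A) A))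
    (hg : HasType Γ.toCx g (.lolli B (σ.at₂ A B))) (h : Prov P Γ Θ Φ (.eq (polyTy σ T) d d')) :
    Prov P Γ Θ Φ (.eq (T.sub (scons B (scons A Ty.var))) (dialgApp d A B f g)
      (dialgApp d' A B f g)) := by
  have hΓ := ICx.toCx_noLin Γ
  let c : Tm S n (k + 1) := dialgApp (.var 0) A B f.wk g.wk
  have hc : HasType (ICx.toCx (S := S) (scons (polyTy σ T) Γ)) c
      (T.sub (scons B (scons A Ty.var))) :=
    .dialgApp (.self (ICx.toCx_noLin _)) (ICx.toCx_noLin _) (.ivar' (scons (polyTy σ T) Γ) 0)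
      (hf.iwk _) (hg.iwk _)
  have e (d : Tm S n k) : c.inst d = dialgApp d A B f g := by
    simp [c, Tm.inst, dialgApp_sub, Tm.sub, Tm.sub_ren]
  have := congr c hc (by rw [e]; exact .dialgApp (.self hΓ) hΓ hd hf hg) hd hd' h
  rwa [e, e] at this

theorem dialgApp_algTm (hσ : σ.Mixed) (hf : HasType Γ.toCx f (.lolli (σ.at₂ B A) A))
    (hg : HasType Γ.toCx g (.lolli B (σ.at₂ A B)))
    (hx : HasType Γ.toCx x (σ.at₂ (coalgTy σ) (algTy σ))) :
    Prov P Γ Θ Φ (.eq A (dialgApp (.app (algTm σ) x) A B f g)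
      (.app f (.app (mapTm σ (coalgTy σ) (algTy σ) B A (unfoldTm σ A B f g) (foldTm σ A B f g))
        x))) := by
  have hΓ := ICx.toCx_noLin Γ
  have h₀ := HasType.algTm hσ hΓ
  have h₀' := h₀
  rw [algTm] at h₀'
  cases h₀' with | lam h₀' =>
  have h₁ := ExtEq.beta hΓ h₀' hx
  let F : Ty S.ty (n + 2) := .lolli (σ.at₂ (.var 0) (.var 1)) (.var 1)
  let G : Ty S.ty (n + 2) := .lolli (.var 0) (σ.at₂ (.var 1) (.var 0))
  let Δ : ICx S (n + 2) (k + 2) := scons G (scons F Γ.wkTy.wkTy)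
  have hf₂ : HasType Δ.toCx (.var 1) F := .ivar' Δ 1
  have hg₂ : HasType Δ.toCx (.var 0) G := .ivar' Δ 0
  have hx₂ := (hx.iwkTy.iwkTy.iwk F).iwk G
  simp only [Ty.at₂_ren, coalgTy_ren, algTy_ren] at hx₂
  have hΔ := ICx.toCx_noLin Δ
  have h₂ : HasType Δ.toCx (.app (.var 1) (.app (mapTm σ (coalgTy σ) (algTy σ) (.var 0) (.var 1)
      (unfoldTm σ (.var 1) (.var 0) (.var 1) (.var 0))
      (foldTm σ (.var 1) (.var 0) (.var 1) (.var 0))) x.wkTy.wkTy.wk.wk)) (.var 1) :=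
    hf₂.iapp ((mapTm_hasType hσ hΔ (.unfoldTm hΔ hf₂ hg₂) (.foldTm hΔ hf₂ hg₂)).iapp hx₂)
  have e₁ : Tm.inst (dialgLam σ (.app (.var 1)
      (.app (mapTm σ (coalgTy σ) (algTy σ) (.var 0) (.var 1)
      (unfoldTm σ (.var 1) (.var 0) (.var 1) (.var 0))
      (foldTm σ (.var 1) (.var 0) (.var 1) (.var 0))) (.var 2)))) x = dialgLam σ (.app (.var 1)
      (.app (mapTm σ (coalgTy σ) (algTy σ) (.var 0) (.var 1)
      (unfoldTm σ (.var 1) (.var 0) (.var 1) (.var 0))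
      (foldTm σ (.var 1) (.var 0) (.var 1) (.var 0))) x.wkTy.wkTy.wk.wk)) := by
    simp [Tm.inst, Tm.sub, dialgLam_sub, mapTm_sub, Ty.sub, Tm.ren_ren, Tm.ren]
  rw [e₁] at h₁
  have h₃ := dialgApp_dialgLam (P := P) (Θ := Θ) (Φ := Φ) (Γ := Γ) h₂ hf hg
  have h₄ := dialgApp_congr (P := P) (Θ := Θ) (Φ := Φ) (h₀.iapp hx) (.dialgLam (by
    rwa [ICx.toCx_scons, ICx.toCx_scons] at h₂)) hf hg (.ofExtEq h₁)
  have h₅ := h₄.trans h₃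
  simpa [Tm.sub, Ty.sub, mapTm_sub, Tm.sub_ren] using h₅

theorem coalgTm_app (hσ : σ.Mixed) (hy : HasType Γ.toCx y (coalgTy σ)) :
    Prov P Γ Θ Φ (.eq (σ.at₂ (algTy σ) (coalgTy σ)) (.app (coalgTm σ) y)
      (.app (.tapp y (σ.at₂ (algTy σ) (coalgTy σ))) (coalgCocone σ))) := by
  have hΓ := ICx.toCx_noLin Γ
  have := ExtEq.beta hΓ (.appL hΓ (.coalgApp (.lvar0 hΓ) (σ.at₂ (algTy σ) (coalgTy σ)))
    (.coalgCocone hσ hΓ.off)) hy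
  refine .ofExtEq ?_
  simpa [coalgTm, Tm.inst, Tm.sub, Ty.at₂_sub] using this

theorem coalgCocone_app (hσ : σ.Mixed) (hf : HasType Γ.toCx f (.lolli (σ.at₂ B A) A))
    (hg : HasType Γ.toCx g (.lolli B (σ.at₂ A B))) (hb : HasType Γ.toCx b B) :
    Prov P Γ Θ Φ (.eq (σ.at₂ (algTy σ) (coalgTy σ)) (.app (dialgApp (coalgCocone σ) A B f g) b)
      (.app (mapTm σ A B (algTy σ) (coalgTy σ) (foldTm σ A B f g) (unfoldTm σ A B f g))
        (.app g b))) := by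
  have hΓ := ICx.toCx_noLin Γ
  have h₀ := HasType.coalgCocone hσ hΓ
  rw [coalgCocone] at h₀ ⊢
  have h₁ := dialgApp_dialgLam (P := P) (Θ := Θ) (Φ := Φ) (by
    rw [ICx.toCx_scons, ICx.toCx_scons]
    exact .coalgCocone_body hσ hΓ) hf hg
  have hp := HasType.foldTm hΓ hf hg
  have hq := HasType.unfoldTm hΓ hf hg
  have hm := mapTm_hasType hσ hΓ hp hq
  have h₂ := ExtEq.beta hΓ (.appR hΓ hm.wkOff (.appR hΓ hg.wkOff (.lvar0 hΓ))) hb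
  have h₃ := app_congr_left (P := P) (Θ := Θ) (Φ := Φ) (.coconeApp (.self hΓ) hΓ h₀ hf hg)
    (.lam (.appR hΓ hm.wkOff (.appR hΓ hg.wkOff (.lvar0 hΓ)))) hb (by
    simpa [Tm.sub, Ty.sub, mapTm_sub, mapTm_ren, Tm.sub_ren, Ty.at₂_sub, Ty.at₂_ren, Tm.ren]
      using h₁)
  refine h₃.trans (.ofExtEq ?_)
  simpa [Tm.inst, Tm.sub, Tm.sub_ren] using h₂

theorem inducedCocone_app (hv : HasType Γ.toCx v (.lolli (coalgTy σ) C))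
    (hf : HasType Γ.toCx f (.lolli (σ.at₂ B A) A))
    (hg : HasType Γ.toCx g (.lolli B (σ.at₂ A B))) (hb : HasType Γ.toCx b B) :
    Prov P Γ Θ Φ (.eq C (.app (dialgApp (inducedCocone σ v) A B f g) b)
      (.app v (.app (unfoldTm σ A B f g) b))) := by
  have hΓ := ICx.toCx_noLin Γ
  have h₀ := HasType.inducedCocone hΓ hv
  rw [inducedCocone] at h₀ ⊢
  have h₁ := dialgApp_dialgLam (P := P) (Θ := Θ) (Φ := Φ) (by
    rw [ICx.toCx_scons, ICx.toCx_scons]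
    exact .inducedCocone_body hΓ hv) hf hg
  have hq := HasType.unfoldTm hΓ hf hg
  have h₂ := ExtEq.beta hΓ (.appR hΓ hv.wkOff (.appR hΓ hq.wkOff (.lvar0 hΓ))) hb
  have h₃ := app_congr_left (P := P) (Θ := Θ) (Φ := Φ) (.coconeApp (.self hΓ) hΓ h₀ hf hg)
    (.lam (.appR hΓ hv.wkOff (.appR hΓ hq.wkOff (.lvar0 hΓ)))) hb (by
    simp [Tm.sub, Ty.sub, Tm.sub_ren, Ty.sub_ren, Tm.ren] at h₁
    simpa [Tm.ren_eq_sub] using h₁)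
  refine h₃.trans (.ofExtEq ?_)
  simpa [Tm.inst, Tm.sub, Tm.sub_ren] using h₂

end Prov

end LAPL

namespace LAPL

variable {S : Sig.{u}} {P : Schemes} {n k r m l : ℕ} {Γ : ICx S n k} {Θ : RCx S n r}
  {Φ : List (Fm S n k r)} {σ : Ty S.ty 2}

/-! ### Parametricity for morphisms of dialgebras -/

/-- `(A, B, f, g)` is a dialgebra for `σ` in the context `Γ`. -/
structure Dialg (Γ : ICx S n k) (σ : Ty S.ty 2) (A B : Ty S.ty n) (f g : Tm S n k) : Prop where
  alg : HasType Γ.toCx f (.lolli (σ.at₂ B A) A)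
  coalg : HasType Γ.toCx g (.lolli B (σ.at₂ A B))

/-- The equation `h ∘ f = f₁ ∘ σ(h', h)`. -/
def algFm (σ : Ty S.ty 2) (A B A₁ B₁ : Ty S.ty n) (f f₁ h h' : Tm S n k) : Fm S n k r :=
  .eq (.lolli (σ.at₂ B A) A₁) (Tm.comp (σ.at₂ B A) h f)
    (Tm.comp (σ.at₂ B A) f₁ (mapTm σ B A B₁ A₁ h' h))

/-- The equation `g ∘ h' = σ(h, h') ∘ g₁`. -/
def coalgFm (σ : Ty S.ty 2) (A B A₁ B₁ : Ty S.ty n) (g g₁ h h' : Tm S n k) : Fm S n k r :=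
  .eq (.lolli B₁ (σ.at₂ A B)) (Tm.comp B₁ g h')
    (Tm.comp B₁ (mapTm σ A₁ B₁ A B h h') g₁)

/-- `(h, h')` is a pair of terms `A ⊸ A₁` and `B₁ ⊸ B` between dialgebras.  The equations of a
morphism, `algFm` and `coalgFm`, are kept apart from the typing. -/
structure DialgPair (Γ : ICx S n k) (σ : Ty S.ty 2) (A B : Ty S.ty n) (f g : Tm S n k)
    (A₁ B₁ : Ty S.ty n) (f₁ g₁ h h' : Tm S n k) : Prop where
  dom : Dialg Γ σ A B f g
  cod : Dialg Γ σ A₁ B₁ f₁ g₁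
  hom : HasType Γ.toCx h (.lolli A A₁)
  hom' : HasType Γ.toCx h' (.lolli B₁ B)

variable {A B A₁ B₁ : Ty S.ty n} {f g f₁ g₁ h h' : Tm S n k}

theorem algFm_ren {q : ℕ} (s : Fin n → Fin m) (e : Fin k → Fin l) (d : Fin r → Fin q) :
    (algFm σ A B A₁ B₁ f f₁ h h' : Fm S n k r).ren s e d = algFm σ (A.ren s) (B.ren s)
      (A₁.ren s) (B₁.ren s) (f.ren s e) (f₁.ren s e) (h.ren s e) (h'.ren s e) := by
  simp [algFm, Fm.ren, Ty.ren, Ty.at₂_ren, Tm.comp_ren, mapTm_ren]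

theorem coalgFm_ren {q : ℕ} (s : Fin n → Fin m) (e : Fin k → Fin l) (d : Fin r → Fin q) :
    (coalgFm σ A B A₁ B₁ g g₁ h h' : Fm S n k r).ren s e d = coalgFm σ (A.ren s) (B.ren s)
      (A₁.ren s) (B₁.ren s) (g.ren s e) (g₁.ren s e) (h.ren s e) (h'.ren s e) := by
  simp [coalgFm, Fm.ren, Ty.ren, Ty.at₂_ren, Tm.comp_ren, mapTm_ren]

theorem algFm_wk : (algFm σ A B A₁ B₁ f f₁ h h' : Fm S n k r).wkTm =
    algFm σ A B A₁ B₁ f.wk f₁.wk h.wk h'.wk := by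
  simp [algFm_ren]

theorem coalgFm_wk : (coalgFm σ A B A₁ B₁ g g₁ h h' : Fm S n k r).wkTm =
    coalgFm σ A B A₁ B₁ g.wk g₁.wk h.wk h'.wk := by
  simp [coalgFm_ren]

theorem Dialg.wk (hD : Dialg Γ σ A B f g) (ω : Ty S.ty n) :
    Dialg (S := S) (scons ω Γ) σ A B f.wk g.wk := ⟨hD.alg.iwk ω, hD.coalg.iwk ω⟩

theorem Dialg.wkTy (hD : Dialg Γ σ A B f g) :
    Dialg (S := S) Γ.wkTy σ A.wk B.wk f.wkTy g.wkTy :=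
  ⟨by simpa [Ty.ren, Ty.at₂_ren] using hD.alg.iwkTy,
    by simpa [Ty.ren, Ty.at₂_ren] using hD.coalg.iwkTy⟩

namespace DialgPair

theorem wk (D : DialgPair Γ σ A B f g A₁ B₁ f₁ g₁ h h')
    (ω : Ty S.ty n) :
    DialgPair (S := S) (scons ω Γ) σ A B f.wk g.wk A₁ B₁ f₁.wk g₁.wk h.wk h'.wk :=
  ⟨D.dom.wk ω, D.cod.wk ω, D.hom.iwk ω, D.hom'.iwk ω⟩

theorem wkTy (D : DialgPair Γ σ A B f g A₁ B₁ f₁ g₁ h h') :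
    DialgPair (S := S) Γ.wkTy σ A.wk B.wk f.wkTy g.wkTy A₁.wk B₁.wk f₁.wkTy g₁.wkTy h.wkTy
      h'.wkTy :=
  ⟨D.dom.wkTy, D.cod.wkTy, D.hom.iwkTy, D.hom'.iwkTy⟩

theorem map (D : DialgPair Γ σ A B f g A₁ B₁ f₁ g₁ h h')
    (hσ : σ.Mixed) : HasType Γ.toCx (mapTm σ B A B₁ A₁ h' h)
    (.lolli (σ.at₂ B A) (σ.at₂ B₁ A₁)) := mapTm_hasType hσ (ICx.toCx_noLin Γ) D.hom' D.hom

theorem map' (D : DialgPair Γ σ A B f g A₁ B₁ f₁ g₁ h h')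
    (hσ : σ.Mixed) : HasType Γ.toCx (mapTm σ A₁ B₁ A B h h')
    (.lolli (σ.at₂ A₁ B₁) (σ.at₂ A B)) := mapTm_hasType hσ (ICx.toCx_noLin Γ) D.hom D.hom'

theorem wf_algFm (D : DialgPair Γ σ A B f g A₁ B₁ f₁ g₁ h h')
    (hσ : σ.Mixed) : WfFm P Γ Θ (algFm σ A B A₁ B₁ f f₁ h h') :=
  .eq (D.hom.icomp D.dom.alg) (D.cod.alg.icomp (D.map hσ))

theorem wf_coalgFm (D : DialgPair Γ σ A B f g A₁ B₁ f₁ g₁ h h')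
    (hσ : σ.Mixed) : WfFm P Γ Θ (coalgFm σ A B A₁ B₁ g g₁ h h') :=
  .eq (D.dom.coalg.icomp D.hom') ((D.map' hσ).icomp D.cod.coalg)

theorem alg_app (D : DialgPair Γ σ A B f g A₁ B₁ f₁ g₁ h h')
    (hσ : σ.Mixed) (e : Prov P Γ Θ Φ (algFm σ A B A₁ B₁ f f₁ h h'))
    {x : Tm S n k} (hx : HasType Γ.toCx x (σ.at₂ B A)) :
    Prov P Γ Θ Φ (.eq A₁ (.app h (.app f x)) (.app f₁ (.app (mapTm σ B A B₁ A₁ h' h) x))) :=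
  (Prov.comp_app D.hom D.dom.alg hx).symm.trans <|
    (Prov.app_congr_left (D.hom.icomp D.dom.alg) (D.cod.alg.icomp (D.map hσ)) hx e).trans
      (Prov.comp_app D.cod.alg (D.map hσ) hx)

theorem coalg_app (D : DialgPair Γ σ A B f g A₁ B₁ f₁ g₁ h h')
    (hσ : σ.Mixed) (e : Prov P Γ Θ Φ (coalgFm σ A B A₁ B₁ g g₁ h h'))
    {x : Tm S n k} (hx : HasType Γ.toCx x B₁) :
    Prov P Γ Θ Φ (.eq (σ.at₂ A B) (.app g (.app h' x))
      (.app (mapTm σ A₁ B₁ A B h h') (.app g₁ x))) :=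
  (Prov.comp_app D.dom.coalg D.hom' hx).symm.trans <|
    (Prov.app_congr_left (D.dom.coalg.icomp D.hom') ((D.map' hσ).icomp D.cod.coalg) hx e).trans
      (Prov.comp_app (D.map' hσ) D.cod.coalg hx)

/-- By the equation `algFm`, the structure maps `f` and `f₁` take arguments related in `σ[h'ᵒᵖ, h]`
to values related by the graph of `h`. -/
theorem maps_alg (D : DialgPair Γ σ A B f g A₁ B₁ f₁ g₁ h h')
    (hid : P.identityExtension) (hσ : σ.Mixed)
    (e : algFm σ A B A₁ B₁ f f₁ h h' ∈ Φ) :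
    Maps P Γ Θ Φ (σ.at₂ B A) (σ.at₂ B₁ A₁)
      (.interp 2 σ ![Rl.bwd B B₁ h', Rl.fwd A A₁ h]) (Rl.fwd A A₁ h) f f₁ := fun Ψ hΨ hxy => by
  have D' := (D.wk (σ.at₂ B A)).wk (σ.at₂ B₁ A₁)
  have hx : HasType (ICx.toCx (S := S) (scons (σ.at₂ B₁ A₁) (scons (σ.at₂ B A) Γ))) (.var 1)
    (σ.at₂ B A) := .ivar' _ 1
  have hy : HasType (ICx.toCx (S := S) (scons (σ.at₂ B₁ A₁) (scons (σ.at₂ B A) Γ))) (.var 0)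
    (σ.at₂ B₁ A₁) := .ivar' _ 0
  have e' : algFm σ A B A₁ B₁ f.wk.wk f₁.wk.wk h.wk.wk h'.wk.wk ∈ Ψ := by
    rw [← algFm_wk, ← algFm_wk]
    exact hΨ (List.mem_map_of_mem (List.mem_map_of_mem e))
  have v : (fun i => (![Rl.bwd B B₁ h', Rl.fwd A A₁ h] i : Rl S n k r).wkTm.wkTm) =
      ![Rl.bwd B B₁ h'.wk.wk, Rl.fwd A A₁ h.wk.wk] :=
    funext (Fin.forall_fin_two.2 ⟨by simp [Rl.bwd_ren], by simp [Rl.fwd_ren]⟩)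
  simp only [Rl.ren, v, Rl.fwd_ren, Ty.ren_id] at hxy ⊢
  rw [Prov.rel_fwd D'.hom (D'.dom.alg.iapp hx) (D'.cod.alg.iapp hy)]
  exact (D'.alg_app hσ (.hyp (D'.wf_algFm hσ) e') hx).trans
    (Prov.app_congr_right D'.cod.alg ((D'.map hσ).iapp hx) hy
      (Prov.mapTm_eq_of_rel hid hσ D'.hom D'.hom' hx hy hxy))

/-- By the equation `coalgFm`, the structure maps `g` and `g₁` take arguments related by the opposite
of the graph of `h'` to values related in `σ[h, h'ᵒᵖ]`. -/
theorem maps_coalg (D : DialgPair Γ σ A B f g A₁ B₁ f₁ g₁ h h')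
    (hid : P.identityExtension) (hσ : σ.Mixed)
    (e : coalgFm σ A B A₁ B₁ g g₁ h h' ∈ Φ) :
    Maps P Γ Θ Φ B B₁ (Rl.bwd B B₁ h')
      (.interp 2 σ ![Rl.fwd A A₁ h, Rl.bwd B B₁ h']) g g₁ := fun Ψ hΨ hxy => by
  have D' := (D.wk B).wk B₁
  have hx : HasType (ICx.toCx (S := S) (scons B₁ (scons B Γ))) (.var 1) B := .ivar' _ 1
  have hy : HasType (ICx.toCx (S := S) (scons B₁ (scons B Γ))) (.var 0) B₁ := .ivar' _ 0
  have e' : coalgFm σ A B A₁ B₁ g.wk.wk g₁.wk.wk h.wk.wk h'.wk.wk ∈ Ψ := by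
    rw [← coalgFm_wk, ← coalgFm_wk]
    exact hΨ (List.mem_map_of_mem (List.mem_map_of_mem e))
  have v : (fun i => (![Rl.fwd A A₁ h, Rl.bwd B B₁ h'] i : Rl S n k r).wkTm.wkTm) =
      ![Rl.fwd A A₁ h.wk.wk, Rl.bwd B B₁ h'.wk.wk] :=
    funext (Fin.forall_fin_two.2 ⟨by simp [Rl.fwd_ren], by simp [Rl.bwd_ren]⟩)
  simp only [Rl.ren, v, Rl.bwd_ren, Ty.ren_id] at hxy ⊢
  rw [Prov.rel_bwd D'.hom' hx hy] at hxy
  have gy := D'.cod.coalg.iapp hy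
  refine .substAx (StableAdm.interp σ (Prov.stable_vec₂ (.fwd D'.hom) (.bwd D'.hom'))).wf
    (Prov.mapTm_rel_self hid hσ D'.hom D'.hom' gy) ?_ (.rfl' gy)
  exact (D'.coalg_app hσ (.hyp (D'.wf_coalgFm hσ) e') hy).symm.trans
    (Prov.app_congr_right D'.dom.coalg (D'.hom'.iapp hy) hx hxy.symm)

/-- Related polymorphic functions have related values at the two dialgebras, in the interpretation
of the two type variables by the graph of `h` and the opposite of the graph of `h'`. -/
theorem dialgApp_rel (D : DialgPair Γ σ A B f g A₁ B₁ f₁ g₁ h h')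
    (hid : P.identityExtension) (hσ : σ.Mixed)
    {τ τ' : Fin m → Ty S.ty n} {ρ : Fin m → Rl S n k r}
    (hρ : ∀ i, StableAdm P Γ Θ (ρ i) (τ i) (τ' i)) {T : Ty S.ty (m + 2)} {d d' : Tm S n k}
    (hd : HasType Γ.toCx d ((polyTy σ T).sub τ)) (hd' : HasType Γ.toCx d' ((polyTy σ T).sub τ'))
    (hdd : Prov P Γ Θ Φ (.rel (.interp m (polyTy σ T) ρ) d d'))
    (e : Prov P Γ Θ Φ (algFm σ A B A₁ B₁ f f₁ h h'))
    (e' : Prov P Γ Θ Φ (coalgFm σ A B A₁ B₁ g g₁ h h')) :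
    Prov P Γ Θ Φ (.rel (.interp (m + 2) T (scons (Rl.bwd B B₁ h') (scons (Rl.fwd A A₁ h) ρ)))
      (dialgApp d A B f g) (dialgApp d' A₁ B₁ f₁ g₁)) := by
  have hA : StableAdm P Γ Θ (Rl.fwd A A₁ h) A A₁ := .fwd D.hom
  have hB : StableAdm P Γ Θ (Rl.bwd B B₁ h') B B₁ := .bwd D.hom'
  have hρ₁ := hA.scons hρ
  have hρ₂ := hB.scons hρ₁
  have m₁ := Prov.interp_allE hρ hA hd hd' hdd
  have t₁ := HasType.tapp_sub A hd
  have t₁' := HasType.tapp_sub A₁ hd'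
  have m₂ := Prov.interp_allE hρ₁ hB t₁ t₁' m₁
  have t₂ := HasType.tapp_sub B t₁
  have t₂' := HasType.tapp_sub B₁ t₁'
  have ef : (Ty.lolli (σ.at₂ (.var 0) (.var 1)) (.var 1)).sub (scons B (scons A τ)) =
    .lolli (σ.at₂ B A) A := by simp [Ty.sub, Ty.at₂_sub]
  have ef' : (Ty.lolli (σ.at₂ (.var 0) (.var 1)) (.var 1)).sub (scons B₁ (scons A₁ τ')) =
    .lolli (σ.at₂ B₁ A₁) A₁ := by simp [Ty.sub, Ty.at₂_sub]
  have eg : (Ty.lolli (.var 0) (σ.at₂ (.var 1) (.var 0))).sub (scons B (scons A τ)) =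
    .lolli B (σ.at₂ A B) := by simp [Ty.sub, Ty.at₂_sub]
  have eg' : (Ty.lolli (.var 0) (σ.at₂ (.var 1) (.var 0))).sub (scons B₁ (scons A₁ τ')) =
    .lolli B₁ (σ.at₂ A₁ B₁) := by simp [Ty.sub, Ty.at₂_sub]
  have hf := D.dom.alg.cast ef.symm
  have hf' := D.cod.alg.cast ef'.symm
  have hg := D.dom.coalg.cast eg.symm
  have hg' := D.cod.coalg.cast eg'.symm
  have ea : (σ.at₂ (.var 0) (.var 1)).sub (scons B (scons A τ)) = σ.at₂ B A :=
    Prov.at₂_vars_sub ..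
  have ea' : (σ.at₂ (.var 0) (.var 1)).sub (scons B₁ (scons A₁ τ')) = σ.at₂ B₁ A₁ :=
    Prov.at₂_vars_sub ..
  have hff : Prov P Γ Θ Φ (.rel (.interp (m + 2) (.lolli (σ.at₂ (.var 0) (.var 1)) (.var 1))
      (scons (Rl.bwd B B₁ h') (scons (Rl.fwd A A₁ h) ρ))) f f₁) := by
    refine e.cut (D.wf_algFm hσ) (Prov.interp_lolliI hρ₂ hf hf' fun Ψ hΨ hxy => ?_)
    have hρ' := fun l => ((hρ₂ l).wkTm (σ.at₂ B A)).wkTm (σ.at₂ B₁ A₁)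
    have hx : HasType (ICx.toCx (S := S) (scons (σ.at₂ B₁ A₁) (scons (σ.at₂ B A) Γ))) (.var 1)
      (σ.at₂ B A) := .ivar' _ 1
    have hy : HasType (ICx.toCx (S := S) (scons (σ.at₂ B₁ A₁) (scons (σ.at₂ B A) Γ))) (.var 0)
      (σ.at₂ B₁ A₁) := .ivar' _ 0
    have D' := (D.wk (σ.at₂ B A)).wk (σ.at₂ B₁ A₁)
    rw [ea, ea'] at hxy ⊢
    refine (Prov.interp_var hρ' 1 (D'.dom.alg.iapp hx) (D'.cod.alg.iapp hy)).2
      (D.maps_alg hid hσ (.head _) Ψ hΨ ?_)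
    have := (Prov.interp_at₂ hρ' σ (i := 0) (j := 1) (by simp) hx hy).1 hxy
    convert this using 2
    change Rl.interp 2 σ _ = Rl.interp 2 σ _
    congr 1
    exact funext (Fin.forall_fin_two.2 ⟨rfl, rfl⟩)
  have hgg : Prov P Γ Θ Φ (.rel (.interp (m + 2) (.lolli (.var 0) (σ.at₂ (.var 1) (.var 0)))
      (scons (Rl.bwd B B₁ h') (scons (Rl.fwd A A₁ h) ρ))) g g₁) := by
    refine e'.cut (D.wf_coalgFm hσ) (Prov.interp_lolliI hρ₂ hg hg' fun Ψ hΨ hxy => ?_)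
    have hρ' := fun l => ((hρ₂ l).wkTm B).wkTm B₁
    have hx : HasType (ICx.toCx (S := S) (scons B₁ (scons B Γ))) (.var 1) B := .ivar' _ 1
    have hy : HasType (ICx.toCx (S := S) (scons B₁ (scons B Γ))) (.var 0) B₁ := .ivar' _ 0
    have D' := (D.wk B).wk B₁
    have := D.maps_coalg hid hσ (.head _) Ψ hΨ ((Prov.interp_var hρ' 0 hx hy).1 hxy)
    refine (Prov.interp_at₂ hρ' σ (i := 1) (j := 0) (by simp) (D'.dom.coalg.iapp hx)
      (D'.cod.coalg.iapp hy)).2 ?_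
    convert this using 2
    change Rl.interp 2 σ _ = Rl.interp 2 σ _
    congr 1
    exact funext (Fin.forall_fin_two.2 ⟨rfl, rfl⟩)
  have m₃ := Prov.interp_arrowE hρ₂ t₂ t₂' hf hf' m₂ hff
  exact Prov.interp_arrowE hρ₂ (t₂.iapp hf.ibang) (t₂'.iapp hf'.ibang) hg hg' m₃ hgg

end DialgPair

end LAPL

namespace LAPL

variable {S : Sig.{u}} {P : Schemes} {n k r m l : ℕ} {Γ : ICx S n k} {Θ : RCx S n r}
  {Φ : List (Fm S n k r)} {σ : Ty S.ty 2}

/-! ### Naturality of evaluation and of cocones -/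

namespace DialgPair

variable {A B A₁ B₁ C : Ty S.ty n} {f g f₁ g₁ h h' d x : Tm S n k}

/-- Evaluation at dialgebras is compatible with morphisms of dialgebras. -/
theorem algTy_naturality (D : DialgPair Γ σ A B f g A₁ B₁ f₁ g₁ h h')
    (hid : P.identityExtension) (hσ : σ.Mixed) (hd : HasType Γ.toCx d (algTy σ))
    (e : Prov P Γ Θ Φ (algFm σ A B A₁ B₁ f f₁ h h'))
    (e' : Prov P Γ Θ Φ (coalgFm σ A B A₁ B₁ g g₁ h h')) :
    Prov P Γ Θ Φ (.eq A₁ (.app h (dialgApp d A B f g)) (dialgApp d A₁ B₁ f₁ g₁)) := by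
  have hρ : ∀ i, StableAdm P Γ Θ (Rl.eqRel (Fin.elim0 i : Ty S.ty n)) (Fin.elim0 i : Ty S.ty n)
    (Fin.elim0 i : Ty S.ty n) := fun i => i.elim0
  have hd' : HasType Γ.toCx d ((algTy σ : Ty S.ty 0).sub Fin.elim0) :=
    hd.cast (algTy_sub σ _).symm
  have hdd := (Prov.interp_eq (Θ := Θ) (Φ := Φ) hid (algTy σ) Fin.elim0 hd' hd').2 (.rfl' hd')
  have hΓ := ICx.toCx_noLin Γ
  have t := HasType.algApp (.self hΓ) hΓ hd D.dom.alg D.dom.coalg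
  have t₁ := HasType.algApp (.self hΓ) hΓ hd D.cod.alg D.cod.coalg
  rw [← Prov.rel_fwd D.hom t t₁]
  have hA : StableAdm P Γ Θ (Rl.fwd A A₁ h) A A₁ := .fwd D.hom
  have hB : StableAdm P Γ Θ (Rl.bwd B B₁ h') B B₁ := .bwd D.hom'
  exact (Prov.interp_var (hB.scons (hA.scons hρ)) 1 t t₁).1
    (D.dialgApp_rel hid hσ hρ hd' hd' hdd e e')

/-- Cocones are compatible with morphisms of dialgebras. -/
theorem coconeTy_naturality (D : DialgPair Γ σ A B f g A₁ B₁ f₁ g₁ h h')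
    (hid : P.identityExtension) (hσ : σ.Mixed) (hd : HasType Γ.toCx d (coconeTy σ C))
    (hx : HasType Γ.toCx x B₁)
    (e : Prov P Γ Θ Φ (algFm σ A B A₁ B₁ f f₁ h h'))
    (e' : Prov P Γ Θ Φ (coalgFm σ A B A₁ B₁ g g₁ h h')) :
    Prov P Γ Θ Φ (.eq C (.app (dialgApp d A B f g) (.app h' x))
      (.app (dialgApp d A₁ B₁ f₁ g₁) x)) := by
  have hρ : ∀ i, StableAdm P Γ Θ (Rl.eqRel (![C] i)) (![C] i) (![C] i) := fun i => .eqRel _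
  have hd' : HasType Γ.toCx d ((coconeTy σ (.var 0)).sub ![C]) := hd.cast (by simp [Ty.sub])
  have hdd := (Prov.interp_eq (Θ := Θ) (Φ := Φ) hid (coconeTy σ (.var 0)) ![C] hd' hd').2
    (.rfl' hd')
  have hΓ := ICx.toCx_noLin Γ
  have t := HasType.coconeApp (.self hΓ) hΓ hd D.dom.alg D.dom.coalg
  have t₁ := HasType.coconeApp (.self hΓ) hΓ hd D.cod.alg D.cod.coalg
  have hA : StableAdm P Γ Θ (Rl.fwd A A₁ h) A A₁ := .fwd D.hom
  have hB : StableAdm P Γ Θ (Rl.bwd B B₁ h') B B₁ := .bwd D.hom'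
  have hρ₂ := hB.scons (hA.scons hρ)
  have y := D.hom'.iapp hx
  have m := Prov.interp_lolliE hρ₂ (σ := .var 0) (σ' := .var 2) t t₁ y hx
    (D.dialgApp_rel hid hσ hρ hd' hd' hdd e e')
    ((Prov.interp_var hρ₂ 0 y hx).2 ((Prov.rel_bwd D.hom' y hx).2 (.rfl' y)))
  exact (Prov.rel_eqRel (t.iapp y) (t₁.iapp hx)).1
    ((Prov.interp_var hρ₂ 2 (t.iapp y) (t₁.iapp hx)).1 m)

end DialgPair

/-! ### Evaluation as a morphism of dialgebras -/

/-- The pair of terms from the candidate to an arbitrary dialgebra. -/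
theorem Dialg.foldTm_unfoldTm {A B : Ty S.ty n} {f g : Tm S n k} (hσ : σ.Mixed)
    (D : Dialg Γ σ A B f g) : DialgPair Γ σ (algTy σ) (coalgTy σ) (algTm σ) (coalgTm σ) A B f g
      (foldTm σ A B f g) (unfoldTm σ A B f g) :=
  have hΓ := ICx.toCx_noLin Γ
  ⟨⟨.algTm hσ hΓ, .coalgTm hσ hΓ⟩, D, .foldTm hΓ D.alg D.coalg, .unfoldTm hΓ D.alg D.coalg⟩

theorem Dialg.self (hσ : σ.Mixed) :
    Dialg Γ σ (algTy σ) (coalgTy σ) (algTm σ) (coalgTm σ) :=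
  ⟨.algTm hσ (ICx.toCx_noLin Γ), .coalgTm hσ (ICx.toCx_noLin Γ)⟩

namespace Prov

variable {A B C : Ty S.ty n} {f g d d' v x y : Tm S n k}

/-- The first equation of a morphism of dialgebras, by the `β` rules for `algTm`. -/
theorem foldTm_comm (hx : P.extensionality) (hσ : σ.Mixed) (D : Dialg Γ σ A B f g) :
    Prov P Γ Θ Φ (algFm σ (algTy σ) (coalgTy σ) A B (algTm σ) f (foldTm σ A B f g)
      (unfoldTm σ A B f g)) := by
  have E := D.foldTm_unfoldTm hσ
  refine .ext hx (E.hom.icomp E.dom.alg) (E.cod.alg.icomp (E.map hσ)) ?_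
  have E' := E.wk (σ.at₂ (coalgTy σ) (algTy σ))
  have D' := D.wk (σ.at₂ (coalgTy σ) (algTy σ))
  have x₀ : HasType (ICx.toCx (S := S) (scons (σ.at₂ (coalgTy σ) (algTy σ)) Γ)) (.var 0)
    (σ.at₂ (coalgTy σ) (algTy σ)) := .ivar' _ 0
  simp only [Tm.comp_ren, Ty.ren_id, mapTm_ren]
  refine (comp_app E'.hom E'.dom.alg x₀).trans (.trans ?_
    (comp_app E'.cod.alg (E'.map hσ) x₀).symm)
  have ax := E'.dom.alg.iapp x₀
  simp only [algTm_ren, foldTm_ren, unfoldTm_ren, Ty.ren_id] at ax ⊢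
  exact (foldTm_app D'.alg D'.coalg ax).trans (dialgApp_algTm hσ D'.alg D'.coalg x₀)

/-- Extensionality for polymorphic functions on dialgebras. -/
theorem dialg_ext (hx : P.extensionality) (hid : P.identityExtension) {T : Ty S.ty (n + 2)}
    (hd : HasType Γ.toCx d (polyTy σ T)) (hd' : HasType Γ.toCx d' (polyTy σ T))
    (h : ∀ Ψ, Prov (S := S) P (scons (.lolli (.var 0) (σ.at₂ (.var 1) (.var 0)))
      (scons (.lolli (σ.at₂ (.var 0) (.var 1)) (.var 1)) Γ.wkTy.wkTy)) Θ.wkTy.wkTy Ψ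
      (.eq T (dialgApp d.wkTy.wkTy.wk.wk (.var 1) (.var 0) (.var 1) (.var 0))
        (dialgApp d'.wkTy.wkTy.wk.wk (.var 1) (.var 0) (.var 1) (.var 0)))) :
    Prov P Γ Θ Φ (.eq (polyTy σ T) d d') := by
  have t₁ := hd.tapp_wk.tapp_wk
  have t₁' := hd'.tapp_wk.tapp_wk
  let F : Ty S.ty (n + 2) := .lolli (σ.at₂ (.var 0) (.var 1)) (.var 1)
  have x₀ : HasType (ICx.toCx (S := S) (scons F Γ.wkTy.wkTy)) (.var 0) F := .ivar' _ 0
  exact .ext_all hx hd hd' (.ext_all hx hd.tapp_wk hd'.tapp_wk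
    (.ext_bang hx hid t₁ t₁' (.ext_bang hx hid ((t₁.iwk F).iapp x₀.ibang)
      ((t₁'.iwk F).iapp x₀.ibang) (h _))))

/-- Elements of `coalgTy` are equal if they agree on every cocone. -/
theorem coalg_ext (hx : P.extensionality) (hx' : HasType Γ.toCx x (coalgTy σ))
    (hy : HasType Γ.toCx y (coalgTy σ))
    (h : Prov (S := S) P (scons (coconeTy σ (.var 0)) Γ.wkTy) Θ.wkTy
      ((Φ.map Fm.wkTy).map Fm.wkTm) (.eq (.var 0) (.app (.tapp x.wkTy.wk (.var 0)) (.var 0))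
        (.app (.tapp y.wkTy.wk (.var 0)) (.var 0)))) :
    Prov P Γ Θ Φ (.eq (coalgTy σ) x y) :=
  .ext_all hx hx' hy (.ext hx hx'.tapp_wk hy.tapp_wk h)

end Prov

end LAPL

namespace LAPL

variable {S : Sig.{u}} {P : Schemes} {n k r m l : ℕ} {Γ : ICx S n k} {Θ : RCx S n r}
  {Φ : List (Fm S n k r)} {σ : Ty S.ty 2}

/-! ### Evaluation and injection at the candidate itself -/

namespace Prov

variable {A B C : Ty S.ty n} {f g d d' v x y : Tm S n k}

/-- The second equation of a morphism of dialgebras, by the `β` rules for `coalgTm`. -/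
theorem unfoldTm_comm (hx : P.extensionality) (hσ : σ.Mixed) (D : Dialg Γ σ A B f g) :
    Prov P Γ Θ Φ (coalgFm σ (algTy σ) (coalgTy σ) A B (coalgTm σ) g (foldTm σ A B f g)
      (unfoldTm σ A B f g)) := by
  have E := D.foldTm_unfoldTm hσ
  refine .ext hx (E.dom.coalg.icomp E.hom') ((E.map' hσ).icomp E.cod.coalg) ?_
  have E' := E.wk B
  have D' := D.wk B
  have x₀ : HasType (ICx.toCx (S := S) (scons B Γ)) (.var 0) B := .ivar' _ 0
  simp only [Tm.comp_ren, Ty.ren_id, mapTm_ren]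
  refine (comp_app E'.dom.coalg E'.hom' x₀).trans (.trans ?_
    (comp_app (E'.map' hσ) E'.cod.coalg x₀).symm)
  have qx := E'.hom'.iapp x₀
  simp only [coalgTm_ren, foldTm_ren, unfoldTm_ren, Ty.ren_id] at qx ⊢
  exact (coalgTm_app hσ qx).trans ((unfoldTm_app D'.alg D'.coalg x₀
    (.coalgCocone hσ (ICx.toCx_noLin _))).trans (coalgCocone_app hσ D'.alg D'.coalg x₀))

/-- Evaluation at the candidate itself is the identity, by naturality of evaluation along the
morphisms from the candidate to arbitrary dialgebras. -/
theorem foldTm_self (hx : P.extensionality) (hid : P.identityExtension) (hσ : σ.Mixed) :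
    Prov P Γ Θ Φ (.eq (.lolli (algTy σ) (algTy σ))
      (foldTm σ (algTy σ) (coalgTy σ) (algTm σ) (coalgTm σ)) (Tm.idTm (algTy σ))) := by
  have D := Dialg.self (Γ := Γ) hσ
  have E := D.foldTm_unfoldTm hσ
  refine .ext hx E.hom (.idTm (ICx.toCx_noLin Γ) _) ?_
  let Γ₁ : ICx S n (k + 1) := scons (algTy σ) Γ
  have D' := Dialg.self (Γ := Γ₁) hσ
  have hΓ := ICx.toCx_noLin Γ₁
  have x₀ : HasType Γ₁.toCx (.var 0) (algTy σ) := .ivar' Γ₁ 0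
  simp only [foldTm_ren, algTy_ren, coalgTy_ren, algTm_ren, coalgTm_ren, Tm.ren, liftR_zero]
  refine (foldTm_app D'.alg D'.coalg x₀).trans (.trans ?_ (idTm_app x₀).symm)
  have t₀ := HasType.algApp (.self hΓ) hΓ x₀ D'.alg D'.coalg
  refine dialg_ext hx hid t₀ x₀ fun Ψ => ?_
  let G : Ty S.ty (n + 2) := .lolli (.var 0) (σ.at₂ (.var 1) (.var 0))
  let F : Ty S.ty (n + 2) := .lolli (σ.at₂ (.var 0) (.var 1)) (.var 1)
  let Γ₂ : ICx S (n + 2) (k + 3) := scons G (scons F Γ₁.wkTy.wkTy)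
  have D₂ : Dialg Γ₂ σ (.var 1) (.var 0) (.var 1) (.var 0) := ⟨.ivar' Γ₂ 1, .ivar' Γ₂ 0⟩
  have x₂ : HasType Γ₂.toCx (.var 2) (algTy σ) :=
    (HasType.ivar' Γ₂ 2).cast (by simp [Γ₂, Γ₁, ICx.wkTy])
  have D₃ := Dialg.self (Γ := Γ₂) hσ
  have hΓ₂ := ICx.toCx_noLin Γ₂
  have t₂ := HasType.algApp (.self hΓ₂) hΓ₂ x₂ D₃.alg D₃.coalg
  have := (D₂.foldTm_unfoldTm hσ).algTy_naturality (Θ := Θ.wkTy.wkTy) (Φ := Ψ) hid hσ x₂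
    (foldTm_comm hx hσ D₂) (unfoldTm_comm hx hσ D₂)
  simpa [dialgApp_ren, Tm.ren] using (foldTm_app D₂.alg D₂.coalg t₂).symm.trans this

/-- Every cocone is induced by its component at `(algTy, coalgTy)`. -/
theorem inducedCocone_eq (hx : P.extensionality) (hid : P.identityExtension) (hσ : σ.Mixed)
    (hd : HasType Γ.toCx d (coconeTy σ C)) :
    Prov P Γ Θ Φ (.eq (coconeTy σ C)
      (inducedCocone σ (dialgApp d (algTy σ) (coalgTy σ) (algTm σ) (coalgTm σ))) d) := by
  have D := Dialg.self (Γ := Γ) hσ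
  have hΓ := ICx.toCx_noLin Γ
  have hv := HasType.coconeApp (.self hΓ) hΓ hd D.alg D.coalg
  refine dialg_ext hx hid (.inducedCocone hΓ hv) hd fun Ψ => ?_
  let G : Ty S.ty (n + 2) := .lolli (.var 0) (σ.at₂ (.var 1) (.var 0))
  let F : Ty S.ty (n + 2) := .lolli (σ.at₂ (.var 0) (.var 1)) (.var 1)
  let Γ₂ : ICx S (n + 2) (k + 2) := scons G (scons F Γ.wkTy.wkTy)
  have D₂ : Dialg Γ₂ σ (.var 1) (.var 0) (.var 1) (.var 0) := ⟨.ivar' Γ₂ 1, .ivar' Γ₂ 0⟩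
  have hd₂ : HasType Γ₂.toCx d.wkTy.wkTy.wk.wk (coconeTy σ C.wk.wk) :=
    ((hd.iwkTy.iwkTy.iwk F).iwk G).cast (by simp)
  have hΓ₂ := ICx.toCx_noLin Γ₂
  have D₃ := Dialg.self (Γ := Γ₂) hσ
  have hv₂ := HasType.coconeApp (.self hΓ₂) hΓ₂ hd₂ D₃.alg D₃.coalg
  have hI := HasType.inducedCocone hΓ₂ hv₂
  have e : (inducedCocone σ (dialgApp d (algTy σ) (coalgTy σ) (algTm σ) (coalgTm σ)) :
      Tm S n k).wkTy.wkTy.wk.wk = inducedCocone σ (dialgApp d.wkTy.wkTy.wk.wk (algTy σ)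
        (coalgTy σ) (algTm σ) (coalgTm σ)) := by
    simp [Tm.ren_eq_sub, inducedCocone_sub, dialgApp_sub]
  rw [e]
  refine .ext hx (.coconeApp (.self hΓ₂) hΓ₂ hI D₂.alg D₂.coalg)
    (.coconeApp (.self hΓ₂) hΓ₂ hd₂ D₂.alg D₂.coalg) ?_
  let Γ₃ : ICx S (n + 2) (k + 3) := scons (.var 0) Γ₂
  have hd₃ := hd₂.iwk (.var 0)
  have hv₃ := hv₂.iwk (.var 0)
  have D₄ := D₂.wk (.var 0)
  have x₀ : HasType Γ₃.toCx (.var 0) (.var 0) := .ivar' Γ₃ 0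
  have i₁ := inducedCocone_app (P := P) (Θ := Θ.wkTy.wkTy) (Φ := Ψ.map Fm.wkTm) hv₃ D₄.alg
    D₄.coalg x₀
  have i₂ := (D₄.foldTm_unfoldTm hσ).coconeTy_naturality (Θ := Θ.wkTy.wkTy)
    (Φ := Ψ.map Fm.wkTm) hid hσ hd₃ x₀ (foldTm_comm hx hσ D₄) (unfoldTm_comm hx hσ D₄)
  have e' (v : Tm S (n + 2) (k + 2)) : (inducedCocone σ v).wk = inducedCocone σ v.wk := by
    simp [Tm.ren_eq_sub, inducedCocone_sub]
  simp only [dialgApp_ren, algTy_ren, coalgTy_ren, algTm_ren, coalgTm_ren, Ty.ren_id, e'] at i₁ i₂ ⊢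
  exact i₁.trans i₂

end Prov

/-- The polymorphic function that takes `v : coalgTy ⊸ γ` to the cocone that it induces. -/
def inducedCoconeFun (σ : Ty S.ty 2) : Tm S n k :=
  .tlam (Tm.ilam (.lolli (coalgTy σ) (.var 0)) (inducedCocone σ (.var 0)))

/-- The closed type of `inducedCoconeFun`. -/
def inducedCoconeFunTy (σ : Ty S.ty 2) : Ty S.ty n :=
  .all (.arrow (.lolli (coalgTy σ) (.var 0)) (coconeTy σ (.var 0)))

theorem HasType.inducedCoconeFun {Δ : Cx S n k} (hΔ : Δ.NoLin) :
    HasType Δ (inducedCoconeFun σ) (inducedCoconeFunTy σ) :=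
  .tlam (.ilam (.inducedCocone hΔ.wkTy.unr (.ivar0 hΔ.wkTy)))

namespace Prov

variable {A B C : Ty S.ty n} {f g d d' v x y : Tm S n k}

theorem inducedCoconeFun_app (hv : HasType Γ.toCx v (.lolli (coalgTy σ) C)) :
    Prov P Γ Θ Φ (.eq (coconeTy σ C) (.app (.tapp (inducedCoconeFun σ) C) (.bang v))
      (inducedCocone σ v)) := by
  have hΓ := ICx.toCx_noLin Γ
  have h₁ := ExtEq.betaTy C (Γ := Γ.toCx) (HasType.ilam (HasType.inducedCocone hΓ.wkTy.unr
    (HasType.ivar0 (σ := .lolli (coalgTy σ) (.var 0)) hΓ.wkTy)))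
  have h₂ := ExtEq.ibeta hΓ (HasType.inducedCocone hΓ.unr
    (HasType.ivar0 (σ := .lolli (coalgTy σ) C) hΓ)) hv
  simp only [Tm.instTy, Tm.ilam_sub, Ty.sub, Ty.inst, coalgTy_sub, coconeTy_sub, inducedCocone_sub,
    Tm.sub, Tm.lift_zero, scons_zero, Tm.inst] at h₁ h₂
  exact .ofExtEq ((ExtEq.app' hΓ h₁ (.refl hv.ibang)).trans h₂)

/-- Parametricity of `y` along the graph of `v`: applying `v` to the value of `y` at the cocone of
all injections gives the value of `y` at the cocone induced by `v`. -/
theorem inducedCocone_naturality (hid : P.identityExtension)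
    (hv : HasType Γ.toCx v (.lolli (coalgTy σ) C)) (hy : HasType Γ.toCx y (coalgTy σ)) :
    Prov P Γ Θ Φ (.eq C
      (.app v (.app (.tapp y (coalgTy σ)) (inducedCocone σ (Tm.idTm (coalgTy σ)))))
      (.app (.tapp y C) (inducedCocone σ v))) := by
  have hΓ := ICx.toCx_noLin Γ
  have hi := HasType.idTm hΓ (coalgTy σ)
  have h₀ : ∀ i, StableAdm P Γ Θ (Rl.eqRel (Fin.elim0 i : Ty S.ty n)) (Fin.elim0 i : Ty S.ty n)
    (Fin.elim0 i : Ty S.ty n) := fun i => i.elim0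
  have hR : StableAdm P Γ Θ (Rl.fwd (coalgTy σ) C v) (coalgTy σ) C := .fwd hv
  have h₁ := hR.scons h₀
  have hN : HasType Γ.toCx (inducedCoconeFun σ)
      ((inducedCoconeFunTy σ : Ty S.ty 0).sub Fin.elim0) :=
    (HasType.inducedCoconeFun hΓ).cast (by simp [inducedCoconeFunTy, Ty.sub])
  have hy' : HasType Γ.toCx y ((coalgTy σ : Ty S.ty 0).sub Fin.elim0) :=
    hy.cast (coalgTy_sub σ _).symm
  have mN := interp_allE h₀ hR hN hN ((interp_eq (Θ := Θ) (Φ := Φ) hid _ _ hN hN).2 (.rfl' hN))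
  have my := interp_allE h₀ hR hy' hy' ((interp_eq (Θ := Θ) (Φ := Φ) hid _ _ hy' hy').2 (.rfl' hy'))
  have hvv : Prov P Γ Θ Φ (.rel (.interp 1 (.lolli (coalgTy σ) (.var 0))
      (scons (Rl.fwd (coalgTy σ) C v) fun i => Rl.eqRel (Fin.elim0 i)))
      (Tm.idTm (coalgTy σ)) v) := by
    refine interp_lolliI h₁ (hi.cast (by simp [Ty.sub])) (hv.cast (by simp [Ty.sub]))
      fun Ψ _ hxy => ?_
    rw [coalgTy_sub, coalgTy_sub] at hxy ⊢
    let Γ₂ : ICx S n (k + 2) := scons (coalgTy σ) (scons (coalgTy σ) Γ)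
    have x₁ : HasType Γ₂.toCx (.var 1) (coalgTy σ) := .ivar' Γ₂ 1
    have x₀ : HasType Γ₂.toCx (.var 0) (coalgTy σ) := .ivar' Γ₂ 0
    have hv₂ : HasType Γ₂.toCx v.wk.wk (.lolli (coalgTy σ) C) := (hv.iwk _).iwk _
    have hi₂ := HasType.idTm (ICx.toCx_noLin Γ₂) (coalgTy σ)
    have h₂ := fun i => ((h₁ i).wkTm (coalgTy σ)).wkTm (coalgTy σ)
    have c {j : ℕ} : (coalgTy σ : Ty S.ty 0).ofClosed = (coalgTy σ : Ty S.ty j) :=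
      coalgTy_ren σ _
    have hc := interp_ofClosed (Θ := Θ) (Φ := Ψ) hid h₂ (coalgTy σ) (x₁.cast c.symm)
      (x₀.cast c.symm)
    simp only [Ty.ofClosed, coalgTy_ren] at hc
    have hxy' := hc.1 hxy
    simp only [Tm.ren, Ty.ren_id, liftR_zero]
    refine (interp_var h₂ 0 (hi₂.iapp x₁) (hv₂.iapp x₀)).2 ?_
    simp only [scons_zero, Rl.fwd_ren, Ty.ren_id]
    rw [rel_fwd hv₂ (hi₂.iapp x₁) (hv₂.iapp x₀)]
    exact app_congr_right hv₂ (hi₂.iapp x₁) x₀ ((idTm_app x₁).trans hxy')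
  have ci : (Ty.lolli (coalgTy σ) (.var 0)).sub (scons (coalgTy σ) Fin.elim0) =
    (.lolli (coalgTy σ) (coalgTy σ) : Ty S.ty n) := by simp [Ty.sub]
  have cv : (Ty.lolli (coalgTy σ) (.var 0)).sub (scons C Fin.elim0) =
    (.lolli (coalgTy σ) C : Ty S.ty n) := by simp [Ty.sub]
  have tN := HasType.tapp_sub (coalgTy σ) hN
  have tN' := HasType.tapp_sub C hN
  have ty := HasType.tapp_sub (coalgTy σ) hy'
  have ty' := HasType.tapp_sub C hy'
  have m := interp_arrowE h₁ tN tN' (hi.cast ci.symm) (hv.cast cv.symm) mN hvv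
  have tI := tN.iapp (hi.cast ci.symm).ibang
  have tI' := tN'.iapp (hv.cast cv.symm).ibang
  have m' := interp_lolliE h₁ ty ty' tI tI' my m
  have m₂ := (rel_fwd hv (ty.iapp tI) (ty'.iapp tI')).1
    ((interp_var h₁ 0 (ty.iapp tI) (ty'.iapp tI')).1 m')
  have hy₁ := HasType.coalgApp hy (coalgTy σ)
  have hN₁ : HasType Γ.toCx (.app (.tapp (inducedCoconeFun σ) (coalgTy σ))
      (.bang (Tm.idTm (coalgTy σ)))) (coconeTy σ (coalgTy σ)) := tI.cast (by simp [Ty.sub])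
  have hN₂ : HasType Γ.toCx (.app (.tapp (inducedCoconeFun σ) C) (.bang v)) (coconeTy σ C) :=
    tI'.cast (by simp [Ty.sub])
  have I₁ := HasType.inducedCocone hΓ hi
  have e₁ := app_congr_right hv (hy₁.iapp I₁) (hy₁.iapp hN₁) (app_congr_right hy₁ I₁ hN₁
    (inducedCoconeFun_app (P := P) (Θ := Θ) (Φ := Φ) hi).symm)
  exact e₁.trans (.trans m₂ (app_congr_right (HasType.coalgApp hy C) hN₂ (.inducedCocone hΓ hv)
    (inducedCoconeFun_app hv)))

/-- The injection of the candidate itself is the identity: it has a section, on whose image it is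
idempotent. -/
theorem unfoldTm_self (hx : P.extensionality) (hid : P.identityExtension) (hσ : σ.Mixed) :
    Prov P Γ Θ Φ (.eq (.lolli (coalgTy σ) (coalgTy σ))
      (unfoldTm σ (algTy σ) (coalgTy σ) (algTm σ) (coalgTm σ)) (Tm.idTm (coalgTy σ))) := by
  have D := Dialg.self (Γ := Γ) hσ
  have E := D.foldTm_unfoldTm hσ
  refine .ext hx E.hom' (.idTm (ICx.toCx_noLin Γ) _) ?_
  let Γ₁ : ICx S n (k + 1) := scons (coalgTy σ) Γ
  have hΓ := ICx.toCx_noLin Γ₁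
  have y : HasType Γ₁.toCx (.var 0) (coalgTy σ) := .ivar' Γ₁ 0
  have D₁ := Dialg.self (Γ := Γ₁) hσ
  have hq := HasType.unfoldTm hΓ D₁.alg D₁.coalg
  let s : Tm S n (k + 1) := .app (.tapp (.var 0) (coalgTy σ))
    (inducedCocone σ (Tm.idTm (coalgTy σ)))
  have hs : HasType Γ₁.toCx s (coalgTy σ) := (HasType.coalgApp y (coalgTy σ)).iapp
    (.inducedCocone hΓ (.idTm hΓ _))
  simp only [unfoldTm_ren, algTy_ren, coalgTy_ren, algTm_ren, coalgTm_ren, Tm.ren, liftR_zero]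
  refine .trans ?_ (idTm_app y).symm
  -- by `inducedCocone_naturality`, the injection `q` and the section `s` satisfy `q s = y`
  have h₁ : Prov P Γ₁ Θ (Φ.map Fm.wkTm) (.eq (coalgTy σ) (.app (unfoldTm σ (algTy σ) (coalgTy σ)
      (algTm σ) (coalgTm σ)) s) (.var 0)) := by
    refine coalg_ext hx (hq.iapp hs) y ?_
    generalize ((Φ.map Fm.wkTm).map Fm.wkTy).map Fm.wkTm = Ψ
    let Γ₂ : ICx S (n + 1) (k + 2) := scons (coconeTy σ (.var 0)) Γ₁.wkTy
    have hΓ₂ := ICx.toCx_noLin Γ₂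
    have D₂ := Dialg.self (Γ := Γ₂) hσ
    have d : HasType Γ₂.toCx (.var 0) (coconeTy σ (.var 0)) := .ivar' Γ₂ 0
    have y₂ : HasType Γ₂.toCx (.var 1) (coalgTy σ) :=
      (HasType.ivar' Γ₂ 1).cast (by simp [Γ₂, Γ₁, ICx.wkTy])
    have hs₂ : HasType Γ₂.toCx (.app (.tapp (.var 1) (coalgTy σ))
        (inducedCocone σ (Tm.idTm (coalgTy σ)))) (coalgTy σ) :=
      (HasType.coalgApp y₂ (coalgTy σ)).iapp (.inducedCocone hΓ₂ (.idTm hΓ₂ _))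
    have hv := HasType.coconeApp (.self hΓ₂) hΓ₂ d D₂.alg D₂.coalg
    have i₁ := unfoldTm_app (P := P) (Θ := Θ.wkTy) (Φ := Ψ) D₂.alg D₂.coalg hs₂ d
    have i₂ := inducedCocone_naturality (P := P) (Θ := Θ.wkTy) (Φ := Ψ) hid hv y₂
    have i₃ := app_congr_right (HasType.coalgApp y₂ (.var 0)) (.inducedCocone hΓ₂ hv) d
      (inducedCocone_eq (P := P) (Θ := Θ.wkTy) (Φ := Ψ) hx hid hσ d)
    have e : s.wkTy.wk = .app (.tapp (.var 1) (coalgTy σ))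
        (inducedCocone σ (Tm.idTm (coalgTy σ))) := by
      simp [s, Tm.ren_eq_sub, inducedCocone_sub, Tm.sub]
    have := i₁.trans (i₂.trans i₃)
    simp only [Tm.ren, unfoldTm_ren, algTy_ren, coalgTy_ren, algTm_ren, coalgTm_ren, e]
    exact this
  -- by naturality of cocones along the morphism `(foldTm, q)`, also `q (q s) = q s`
  have h₂ : Prov P Γ₁ Θ (Φ.map Fm.wkTm) (.eq (coalgTy σ)
      (.app (unfoldTm σ (algTy σ) (coalgTy σ) (algTm σ) (coalgTm σ))
        (.app (unfoldTm σ (algTy σ) (coalgTy σ) (algTm σ) (coalgTm σ)) s))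
      (.app (unfoldTm σ (algTy σ) (coalgTy σ) (algTm σ) (coalgTm σ)) s)) := by
    refine coalg_ext hx (hq.iapp (hq.iapp hs)) (hq.iapp hs) ?_
    generalize ((Φ.map Fm.wkTm).map Fm.wkTy).map Fm.wkTm = Ψ
    let Γ₂ : ICx S (n + 1) (k + 2) := scons (coconeTy σ (.var 0)) Γ₁.wkTy
    have hΓ₂ := ICx.toCx_noLin Γ₂
    have D₂ := Dialg.self (Γ := Γ₂) hσ
    have d : HasType Γ₂.toCx (.var 0) (coconeTy σ (.var 0)) := .ivar' Γ₂ 0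
    have hs₂ : HasType Γ₂.toCx s.wkTy.wk (coalgTy σ) :=
      (hs.iwkTy.iwk (coconeTy σ (.var 0))).cast (by simp)
    have hq₂ := HasType.unfoldTm hΓ₂ D₂.alg D₂.coalg
    have i₁ := unfoldTm_app (P := P) (Θ := Θ.wkTy) (Φ := Ψ) D₂.alg D₂.coalg (hq₂.iapp hs₂) d
    have i₂ := unfoldTm_app (P := P) (Θ := Θ.wkTy) (Φ := Ψ) D₂.alg D₂.coalg hs₂ d
    have i₃ := (D₂.foldTm_unfoldTm hσ).coconeTy_naturality (Θ := Θ.wkTy) (Φ := Ψ) hid hσ d hs₂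
      (foldTm_comm hx hσ D₂) (unfoldTm_comm hx hσ D₂)
    simp only [Tm.ren, unfoldTm_ren, algTy_ren, coalgTy_ren, algTm_ren, coalgTm_ren]
    exact i₁.trans (i₃.trans i₂.symm)
  exact (app_congr_right hq y (hq.iapp hs) h₁.symm).trans (h₂.trans h₁)

end Prov

end LAPL

namespace LAPL

/-! ### Dialgebras in a category -/

section Abstract

open CategoryTheory

universe v w

/-- A functor of two variables, contravariant in the first one and covariant in the second one. -/
structure MixedFunctor (C : Type w) [Category.{v} C] where
  obj : C → C → C
  map {A B A' B' : C} : (A' ⟶ A) → (B ⟶ B') → (obj A B ⟶ obj A' B')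
  map_id (A B : C) : map (𝟙 A) (𝟙 B) = 𝟙 (obj A B)
  map_comp {A B A' B' A'' B'' : C} (f : A' ⟶ A) (g : B ⟶ B') (f' : A'' ⟶ A') (g' : B' ⟶ B'') :
    map f g ≫ map f' g' = map (f' ≫ f) (g ≫ g')

namespace MixedFunctor

attribute [simp] map_id

variable {C : Type w} [Category.{v} C] (F : MixedFunctor C)

/-- `(h, h')` is a morphism from the dialgebra `(A, B, f, g)` to `(A₁, B₁, f₁, g₁)`. -/
def IsMor {A B A₁ B₁ : C} (f : F.obj B A ⟶ A) (g : B ⟶ F.obj A B) (f₁ : F.obj B₁ A₁ ⟶ A₁)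
    (g₁ : B₁ ⟶ F.obj A₁ B₁) (h : A ⟶ A₁) (h' : B₁ ⟶ B) : Prop :=
  f ≫ h = F.map h' h ≫ f₁ ∧ h' ≫ g = g₁ ≫ F.map h h'

/-- The dialgebra `(A, B, f, g)` is initial. -/
def IsInit {A B : C} (f : F.obj B A ⟶ A) (g : B ⟶ F.obj A B) : Prop :=
  ∀ (A₁ B₁ : C) (f₁ : F.obj B₁ A₁ ⟶ A₁) (g₁ : B₁ ⟶ F.obj A₁ B₁),
    (∃ h h', F.IsMor f g f₁ g₁ h h') ∧
    ∀ h h' k k', F.IsMor f g f₁ g₁ h h' → F.IsMor f g f₁ g₁ k k' → h = k ∧ h' = k'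

variable {F} {R R' : C} {a : F.obj R' R ⟶ R} {a' : R' ⟶ F.obj R R'}
  {c : R ⟶ F.obj R' R} {c' : F.obj R R' ⟶ R'} {u u' : R ⟶ R'} {w : R' ⟶ R}

theorem IsInit.endo_eq_id (H : F.IsInit a a') {h : R ⟶ R} {h' : R' ⟶ R'}
    (e : F.IsMor a a' a a' h h') : h = 𝟙 R ∧ h' = 𝟙 R' :=
  (H R R' a a').2 _ _ _ _ e ⟨by simp, by simp⟩

/-- Lambek's lemma: the structure maps of an initial dialgebra are isomorphisms. -/
theorem IsInit.lambek (H : F.IsInit a a') (e : F.IsMor a a' (F.map a' a) (F.map a a') c c') :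
    (a ≫ c = 𝟙 _ ∧ c ≫ a = 𝟙 _) ∧ a' ≫ c' = 𝟙 _ ∧ c' ≫ a' = 𝟙 _ := by
  have e₁ : a ≫ c = F.map (a' ≫ c') (c ≫ a) := by rw [e.1, F.map_comp]
  have e₂ : c' ≫ a' = F.map (c ≫ a) (a' ≫ c') := by rw [e.2, F.map_comp]
  obtain ⟨h₁, h₂⟩ := H.endo_eq_id (h := c ≫ a) (h' := a' ≫ c')
    ⟨by rw [← Category.assoc, e₁], by rw [Category.assoc, e₂]⟩
  rw [h₁, h₂, F.map_id] at e₁ e₂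
  exact ⟨⟨e₁, h₁⟩, h₂, e₂⟩

/-- If `(a, a')` has inverses `(c, c')`, then the two components of the morphism to the dialgebra
`(c', c)` are equal, since exchanging them gives another such morphism. -/
theorem IsInit.comparison_eq (H : F.IsInit a a') (hc : a ≫ c = 𝟙 _ ∧ c ≫ a = 𝟙 _)
    (hc' : a' ≫ c' = 𝟙 _ ∧ c' ≫ a' = 𝟙 _) (e : F.IsMor a a' c' c u u') : u' = u := by
  refine ((H _ _ _ _).2 u' u u u' ⟨?_, ?_⟩ e).1
  · calc a ≫ u' = a ≫ (u' ≫ a') ≫ c' := by rw [Category.assoc, hc'.1, Category.comp_id]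
      _ = _ := by rw [e.2, ← Category.assoc, ← Category.assoc, hc.1, Category.id_comp]
  · calc u ≫ a' = c ≫ (a ≫ u) ≫ a' := by
          rw [← Category.assoc, ← Category.assoc, hc.2, Category.id_comp]
      _ = _ := by rw [e.1, Category.assoc, hc'.2, Category.comp_id]

/-- An initial dialgebra on a pair of objects `R`, `R'`, together with a solution `w` of the
equation `w = a ∘ F(w, w) ∘ a'`, gives rise to an initial dialgebra on the pair `R`, `R`, whose
structure maps are inverse to each other.  The solution `w` is inverse to the comparison `u`, by
uniqueness of endomorphisms of the initial dialgebra. -/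
theorem IsInit.diagonal (H : F.IsInit a a') (e : F.IsMor a a' (F.map a' a) (F.map a a') c c')
    (eu : F.IsMor a a' c' c u u') (ew : w = a' ≫ F.map w w ≫ a) :
    ((F.map w (𝟙 R) ≫ a) ≫ c ≫ F.map u (𝟙 R) = 𝟙 _ ∧
      (c ≫ F.map u (𝟙 R)) ≫ F.map w (𝟙 R) ≫ a = 𝟙 _) ∧
    F.IsInit (F.map w (𝟙 R) ≫ a) (c ≫ F.map u (𝟙 R)) := by
  obtain ⟨hc, hc'⟩ := H.lambek e
  obtain rfl := H.comparison_eq hc hc' eu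
  have ua : u' ≫ a' = c ≫ F.map u' u' := eu.2
  obtain ⟨uw, wu⟩ : u' ≫ w = 𝟙 R ∧ w ≫ u' = 𝟙 R' := by
    have e₁ : u' ≫ w = c ≫ F.map (w ≫ u') (u' ≫ w) ≫ a := by
      conv_lhs => rw [ew]
      rw [← Category.assoc, ua, ← F.map_comp]
      simp only [Category.assoc]
    have e₂ : w ≫ u' = a' ≫ F.map (u' ≫ w) (w ≫ u') ≫ c' := by
      conv_lhs => rw [ew]
      rw [Category.assoc, Category.assoc, eu.1, ← F.map_comp]
      simp only [Category.assoc]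
    refine H.endo_eq_id ⟨?_, ?_⟩
    · conv_lhs => rw [e₁]
      rw [← Category.assoc, hc.1, Category.id_comp]
    · conv_lhs => rw [e₂]
      rw [Category.assoc, Category.assoc, hc'.2, Category.comp_id]
  have mwu : F.map w (𝟙 R) ≫ F.map u' (𝟙 R) = 𝟙 _ := by simp [F.map_comp, uw]
  have muw : F.map u' (𝟙 R) ≫ F.map w (𝟙 R) = 𝟙 _ := by simp [F.map_comp, wu]
  have wc : w ≫ c = a' ≫ F.map w w := by
    conv_lhs => rw [ew]
    rw [Category.assoc, Category.assoc, hc.1, Category.comp_id]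
  refine ⟨⟨?_, ?_⟩, fun A B f g => ⟨?_, fun h h' k k' hh hk => ?_⟩⟩
  · rw [Category.assoc, ← Category.assoc a, hc.1, Category.id_comp, mwu]
  · rw [Category.assoc, ← Category.assoc (F.map u' _), muw, Category.id_comp, hc.2]
  · obtain ⟨p, q, hp, hq⟩ := (H A B f g).1
    refine ⟨p, q ≫ w, ?_, ?_⟩
    · rw [Category.assoc, hp, ← Category.assoc, F.map_comp, Category.id_comp]
    · rw [Category.assoc, ← Category.assoc w, wc, Category.assoc, F.map_comp, uw,
        Category.comp_id, ← Category.assoc, hq, Category.assoc, F.map_comp, Category.id_comp]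
  · have key (h : R ⟶ A) (h' : B ⟶ R)
        (hh : F.IsMor (F.map w (𝟙 R) ≫ a) (c ≫ F.map u' (𝟙 R)) f g h h') :
        F.IsMor a a' f g h (h' ≫ u') := by
      obtain ⟨h₁, h₂⟩ := hh
      constructor
      · calc a ≫ h = F.map u' (𝟙 R) ≫ (F.map w (𝟙 R) ≫ a) ≫ h := by
              rw [← Category.assoc, ← Category.assoc, muw, Category.id_comp]
          _ = _ := by rw [h₁, ← Category.assoc, F.map_comp, Category.id_comp]
      · calc (h' ≫ u') ≫ a' = (h' ≫ c ≫ F.map u' (𝟙 R)) ≫ F.map (𝟙 R) u' := by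
              rw [Category.assoc, ua]
              simp [F.map_comp]
          _ = _ := by rw [h₂, Category.assoc, F.map_comp, Category.id_comp]
    obtain ⟨h₁, h₂⟩ := (H A B f g).2 _ _ _ _ (key h h' hh) (key k k' hk)
    refine ⟨h₁, ?_⟩
    rw [← Category.comp_id h', ← uw, ← Category.assoc, h₂, Category.assoc, uw, Category.comp_id]

end MixedFunctor

end Abstract

end LAPL

namespace LAPL

variable {S : Sig.{u}} {P : Schemes} {n k r m l : ℕ} {Γ : ICx S n k} {Θ : RCx S n r}
  {Φ : List (Fm S n k r)} {σ : Ty S.ty 2}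

/-! ### The category of types and linear functions -/

namespace Prov

variable {A B C D A' B' : Ty S.ty n} {f f' g g' h : Tm S n k}

theorem comp_congr (hg : HasType Γ.toCx g (.lolli B C)) (hg' : HasType Γ.toCx g' (.lolli B C))
    (hf : HasType Γ.toCx f (.lolli A B)) (hf' : HasType Γ.toCx f' (.lolli A B))
    (e : Prov P Γ Θ Φ (.eq (.lolli B C) g g')) (e' : Prov P Γ Θ Φ (.eq (.lolli A B) f f')) :
    Prov P Γ Θ Φ (.eq (.lolli A C) (Tm.comp A g f) (Tm.comp A g' f')) := by
  have e₁ (g : Tm S n k) : Tm.inst (Tm.comp A (.var 0) f.wk) g = Tm.comp A g f := by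
    simp [Tm.inst, Tm.sub, Tm.comp_sub, Tm.sub_ren]
  have e₂ (f : Tm S n k) : Tm.inst (Tm.comp A g'.wk (.var 0)) f = Tm.comp A g' f := by
    simp [Tm.inst, Tm.sub, Tm.comp_sub, Tm.sub_ren]
  have h₁ := congr (Tm.comp A (.var 0) f.wk) ((HasType.ivar' _ 0).icomp (hf.iwk _))
    (by rw [e₁]; exact hg.icomp hf) hg hg' e
  have h₂ := congr (Tm.comp A g'.wk (.var 0)) ((hg'.iwk _).icomp (.ivar' _ 0))
    (by rw [e₂]; exact hg'.icomp hf) hf hf' e'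
  rw [e₁, e₁] at h₁
  rw [e₂, e₂] at h₂
  exact h₁.trans h₂

theorem comp_assoc (hx : P.extensionality) (hf : HasType Γ.toCx f (.lolli A B))
    (hg : HasType Γ.toCx g (.lolli B C)) (hh : HasType Γ.toCx h (.lolli C D)) :
    Prov P Γ Θ Φ (.eq (.lolli A D) (Tm.comp A h (Tm.comp A g f))
      (Tm.comp A (Tm.comp B h g) f)) := by
  refine .ext hx (hh.icomp (hg.icomp hf)) ((hh.icomp hg).icomp hf) ?_
  have x₀ : HasType (ICx.toCx (S := S) (scons A Γ)) (.var 0) A := .ivar' _ 0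
  have hf' := hf.iwk A
  have hg' := hg.iwk A
  have hh' := hh.iwk A
  simp only [Tm.comp_ren, Ty.ren_id]
  refine (comp_app hh' (hg'.icomp hf') x₀).trans (.trans ?_
    (comp_app (hh'.icomp hg') hf' x₀).symm)
  exact (app_congr_right hh' ((hg'.icomp hf').iapp x₀) (hg'.iapp (hf'.iapp x₀))
    (comp_app hg' hf' x₀)).trans (comp_app hh' hg' (hf'.iapp x₀)).symm

theorem comp_idTm (hx : P.extensionality) (hf : HasType Γ.toCx f (.lolli A B)) :
    Prov P Γ Θ Φ (.eq (.lolli A B) (Tm.comp A f (Tm.idTm A)) f) := by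
  have hi := HasType.idTm (ICx.toCx_noLin Γ) A
  refine .ext hx (hf.icomp hi) hf ?_
  have x₀ : HasType (ICx.toCx (S := S) (scons A Γ)) (.var 0) A := .ivar' _ 0
  have hi' := hi.iwk A
  have hf' := hf.iwk A
  simp only [Tm.comp_ren, Ty.ren_id, Tm.ren, liftR_zero] at hi' ⊢
  exact (comp_app hf' hi' x₀).trans (app_congr_right hf' (hi'.iapp x₀) x₀ (idTm_app x₀))

theorem idTm_comp (hx : P.extensionality) (hf : HasType Γ.toCx f (.lolli A B)) :
    Prov P Γ Θ Φ (.eq (.lolli A B) (Tm.comp A (Tm.idTm B) f) f) := by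
  have hi := HasType.idTm (ICx.toCx_noLin Γ) B
  refine .ext hx (hi.icomp hf) hf ?_
  have x₀ : HasType (ICx.toCx (S := S) (scons A Γ)) (.var 0) A := .ivar' _ 0
  have hi' := hi.iwk A
  have hf' := hf.iwk A
  simp only [Tm.comp_ren, Ty.ren_id, Tm.ren, liftR_zero] at hi' ⊢
  exact (comp_app hi' hf' x₀).trans (idTm_app (hf'.iapp x₀))

theorem mapTm_congr (hσ : σ.Mixed) (hf : HasType Γ.toCx f (.lolli A' A))
    (hf' : HasType Γ.toCx f' (.lolli A' A)) (hg : HasType Γ.toCx g (.lolli B B'))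
    (hg' : HasType Γ.toCx g' (.lolli B B')) (e : Prov P Γ Θ Φ (.eq (.lolli A' A) f f'))
    (e' : Prov P Γ Θ Φ (.eq (.lolli B B') g g')) :
    Prov P Γ Θ Φ (.eq (.lolli (σ.at₂ A B) (σ.at₂ A' B')) (mapTm σ A B A' B' f g)
      (mapTm σ A B A' B' f' g')) := by
  have t := functorTm_tapp_hasType hσ (ICx.toCx_noLin Γ) A B A' B'
  exact app_congr (t.iapp hf.ibang) (t.iapp hf'.ibang) hg.ibang hg'.ibang
    (app_congr_right t hf.ibang hf'.ibang (bang_congr hf hf' e)) (bang_congr hg hg' e')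

theorem mapTm_idTm_eq (hσ : σ.Mixed) :
    Prov P Γ Θ Φ (.eq (.lolli (σ.at₂ A B) (σ.at₂ A B))
      (mapTm σ A B A B (Tm.idTm A) (Tm.idTm B)) (Tm.idTm (σ.at₂ A B))) :=
  .ofExtEq (mapTm_idTm hσ (ICx.toCx_noLin Γ) A B)

theorem mapTm_comp (hx : P.extensionality) (hid : P.identityExtension) (hσ : σ.Mixed)
    {A'' B'' : Ty S.ty n} (hf : HasType Γ.toCx f (.lolli A' A))
    (hg : HasType Γ.toCx g (.lolli B B')) (hf' : HasType Γ.toCx f' (.lolli A'' A'))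
    (hg' : HasType Γ.toCx g' (.lolli B' B'')) :
    Prov P Γ Θ Φ (.eq (.lolli (σ.at₂ A B) (σ.at₂ A'' B''))
      (Tm.comp (σ.at₂ A B) (mapTm σ A' B' A'' B'' f' g') (mapTm σ A B A' B' f g))
      (mapTm σ A B A'' B'' (Tm.comp A'' f f') (Tm.comp B g' g))) := by
  have hΓ := ICx.toCx_noLin Γ
  have m := mapTm_hasType hσ hΓ hf hg
  have m' := mapTm_hasType hσ hΓ hf' hg'
  refine .ext hx (m'.icomp m) (mapTm_hasType hσ hΓ (hf.icomp hf') (hg'.icomp hg)) ?_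
  have x₀ : HasType (ICx.toCx (S := S) (scons (σ.at₂ A B) Γ)) (.var 0) (σ.at₂ A B) := .ivar' _ 0
  have k := m.iwk (σ.at₂ A B)
  have k' := m'.iwk (σ.at₂ A B)
  simp only [Tm.comp_ren, Ty.ren_id, mapTm_ren] at k k' ⊢
  exact (comp_app k' k x₀).trans (mapTm_comp_app hid hσ (hf.iwk _) (hg.iwk _) (hf'.iwk _)
    (hg'.iwk _) x₀)

end Prov

theorem hom_iff {A B : Ty S.ty n} {f : Tm S n 0} :
    Hom A B f ↔ HasType (ICx.toCx (S := S) (Fin.elim0 : ICx S n 0)) f (.lolli A B) := by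
  have : ICx.toCx (S := S) (Fin.elim0 : ICx S n 0) = (Fin.elim0 : Cx S n 0) :=
    Subsingleton.elim _ _
  rw [this, Hom]

/-- Provable equality of closed linear functions. -/
def homSetoid (P : Schemes) (A B : Ty S.ty n) : Setoid {f : Tm S n 0 // Hom A B f} where
  r f g := HomEq P A B f.1 g.1
  iseqv := ⟨fun f => .rfl' (hom_iff.1 f.2), .symm, .trans⟩

/-- Closed linear functions up to provable equality. -/
def HomClass (P : Schemes) (A B : Ty S.ty n) : Type u := Quotient (homSetoid P A B)

namespace HomClass

variable {A B C D A' B' : Ty S.ty n} {f f' g : Tm S n 0}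

/-- The class of a closed linear function. -/
def mk (P : Schemes) (hf : Hom A B f) : HomClass P A B := Quotient.mk (homSetoid P A B) ⟨f, hf⟩

theorem mk_eq_mk {hf : Hom A B f} {hf' : Hom A B f'} :
    mk P hf = mk P hf' ↔ HomEq P A B f f' := Quotient.eq (r := homSetoid P A B)

theorem exists_mk (F : HomClass P A B) : ∃ (f : Tm S n 0) (hf : Hom A B f), mk P hf = F :=
  Quotient.inductionOn F fun f => ⟨f.1, f.2, rfl⟩

theorem hom_comp (hf : Hom A B f) (hg : Hom B C g) : Hom A C (Tm.comp A g f) :=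
  hom_iff.2 ((hom_iff.1 hg).icomp (hom_iff.1 hf))

theorem hom_id (A : Ty S.ty n) : Hom A A (Tm.idTm A) :=
  hom_iff.2 (.idTm (ICx.toCx_noLin (S := S) _) A)

theorem hom_map (hσ : σ.Mixed) (hf : Hom A' A f) (hg : Hom B B' g) :
    Hom (σ.at₂ A B) (σ.at₂ A' B') (mapTm σ A B A' B' f g) :=
  hom_iff.2 (mapTm_hasType hσ (ICx.toCx_noLin _) (hom_iff.1 hf) (hom_iff.1 hg))

/-- Composition, in diagrammatic order. -/
def comp (F : HomClass P A B) (G : HomClass P B C) : HomClass P A C :=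
  Quotient.map₂ (fun f g => ⟨Tm.comp A g.1 f.1, hom_comp f.2 g.2⟩)
    (fun f f' e g g' e' => .comp_congr (hom_iff.1 g.2) (hom_iff.1 g'.2) (hom_iff.1 f.2)
      (hom_iff.1 f'.2) e' e) F G

/-- The functorial action of a type. -/
def map (hσ : σ.Mixed) (F : HomClass P A' A) (G : HomClass P B B') :
    HomClass P (σ.at₂ A B) (σ.at₂ A' B') :=
  Quotient.map₂ (fun f g => ⟨mapTm σ A B A' B' f.1 g.1, hom_map hσ f.2 g.2⟩)
    (fun f f' e g g' e' => .mapTm_congr hσ (hom_iff.1 f.2) (hom_iff.1 f'.2) (hom_iff.1 g.2)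
      (hom_iff.1 g'.2) e e') F G

end HomClass

section Category

open CategoryTheory

/-- The objects of the category of types in `n` type variables and linear functions. -/
structure LinType (S : Sig.{u}) {P : Schemes} (hx : P.extensionality) (n : ℕ) : Type u where
  ty : Ty S.ty n

variable {hx : P.extensionality}

instance : Category (LinType S hx n) where
  Hom A B := HomClass P A.ty B.ty
  id A := .mk P (HomClass.hom_id A.ty)
  comp := HomClass.comp
  id_comp F := by
    obtain ⟨f, hf, rfl⟩ := F.exists_mk
    exact HomClass.mk_eq_mk.2 (.comp_idTm hx (hom_iff.1 hf))
  comp_id F := by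
    obtain ⟨f, hf, rfl⟩ := F.exists_mk
    exact HomClass.mk_eq_mk.2 (.idTm_comp hx (hom_iff.1 hf))
  assoc F G H := by
    obtain ⟨f, hf, rfl⟩ := F.exists_mk
    obtain ⟨g, hg, rfl⟩ := G.exists_mk
    obtain ⟨h, hh, rfl⟩ := H.exists_mk
    exact HomClass.mk_eq_mk.2 (.comp_assoc hx (hom_iff.1 hf) (hom_iff.1 hg) (hom_iff.1 hh))

/-- The functorial action of a type `σ(α, β)`. -/
def typeFunctor (hx : P.extensionality) (hid : P.identityExtension) (hσ : σ.Mixed) (n : ℕ) :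
    MixedFunctor (LinType S hx n) where
  obj A B := ⟨σ.at₂ A.ty B.ty⟩
  map := HomClass.map hσ
  map_id _ _ := HomClass.mk_eq_mk.2 (.mapTm_idTm_eq hσ)
  map_comp F G F' G' := by
    obtain ⟨f, hf, rfl⟩ := F.exists_mk
    obtain ⟨g, hg, rfl⟩ := G.exists_mk
    obtain ⟨f', hf', rfl⟩ := F'.exists_mk
    obtain ⟨g', hg', rfl⟩ := G'.exists_mk
    exact HomClass.mk_eq_mk.2 (.mapTm_comp hx hid hσ (hom_iff.1 hf) (hom_iff.1 hg)
      (hom_iff.1 hf') (hom_iff.1 hg'))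

variable {A B A₁ B₁ : Ty S.ty n} {f g f₁ g₁ h h' : Tm S n 0}

/-- Morphisms of dialgebras for the functor `typeFunctor` are morphisms of dialgebras for `σ` up to
provable equality. -/
theorem isMor_iff (hx : P.extensionality) (hid : P.identityExtension) (hσ : σ.Mixed)
    (D : IsDialgebra σ A B f g) (D₁ : IsDialgebra σ A₁ B₁ f₁ g₁) (hh : Hom A A₁ h)
    (hh' : Hom B₁ B h') :
    (typeFunctor hx hid hσ n).IsMor (A := ⟨A⟩) (B := ⟨B⟩) (A₁ := ⟨A₁⟩) (B₁ := ⟨B₁⟩)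
      (.mk P D.hom) (.mk P D.hom') (.mk P D₁.hom) (.mk P D₁.hom') (.mk P hh) (.mk P hh') ↔
    IsDialgebraHom P σ A B f g A₁ B₁ f₁ g₁ h h' :=
  (and_congr HomClass.mk_eq_mk HomClass.mk_eq_mk).trans
    ⟨fun e => ⟨hh, hh', e.1, e.2⟩, fun e => ⟨e.comm, e.comm'⟩⟩

theorem isInitialDialgebra (hx : P.extensionality) (hid : P.identityExtension) (hσ : σ.Mixed)
    (D : IsDialgebra σ A B f g) (H : (typeFunctor hx hid hσ n).IsInit (A := ⟨A⟩) (B := ⟨B⟩)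
      (.mk P D.hom) (.mk P D.hom')) : IsInitialDialgebra P σ A B f g where
  dialgebra := D
  existsHom A₁ B₁ f₁ g₁ D₁ := by
    obtain ⟨F, F', e⟩ := (H ⟨A₁⟩ ⟨B₁⟩ (.mk P D₁.hom) (.mk P D₁.hom')).1
    obtain ⟨h, hh, rfl⟩ := F.exists_mk
    obtain ⟨h', hh', rfl⟩ := F'.exists_mk
    exact ⟨h, h', (isMor_iff hx hid hσ D D₁ hh hh').1 e⟩
  unique A₁ B₁ f₁ g₁ D₁ h h' k k' e e' :=
    ((H ⟨A₁⟩ ⟨B₁⟩ (.mk P D₁.hom) (.mk P D₁.hom')).2 _ _ _ _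
      ((isMor_iff hx hid hσ D D₁ e.hom e.hom').2 e)
      ((isMor_iff hx hid hσ D D₁ e'.hom e'.hom').2 e')).imp
      HomClass.mk_eq_mk.1 HomClass.mk_eq_mk.1

end Category

end LAPL

namespace LAPL

variable {S : Sig.{u}} {P : Schemes} {n k r m l : ℕ} {Γ : ICx S n k} {Θ : RCx S n r}
  {Φ : List (Fm S n k r)} {σ : Ty S.ty 2}

/-! ### Initiality of the pair of types -/

namespace DialgPair

variable {A B : Ty S.ty n} {f g h h' : Tm S n k}

/-- The covariant component of a morphism from the candidate is evaluation: by naturality, its value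
at `x` is the value of `x` at the target, because `x` is its own value at the candidate. -/
theorem eq_foldTm (D : DialgPair Γ σ (algTy σ) (coalgTy σ) (algTm σ) (coalgTm σ) A B f g h h')
    (hx : P.extensionality) (hid : P.identityExtension) (hσ : σ.Mixed)
    (e : Prov P Γ Θ Φ (algFm σ (algTy σ) (coalgTy σ) A B (algTm σ) f h h'))
    (e' : Prov P Γ Θ Φ (coalgFm σ (algTy σ) (coalgTy σ) A B (coalgTm σ) g h h')) :
    Prov P Γ Θ Φ (.eq (.lolli (algTy σ) A) h (foldTm σ A B f g)) := by
  have E := D.cod.foldTm_unfoldTm hσ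
  refine .ext hx D.hom E.hom ?_
  let Γ₁ : ICx S n (k + 1) := scons (algTy σ) Γ
  have hΓ := ICx.toCx_noLin Γ₁
  have x₀ : HasType Γ₁.toCx (.var 0) (algTy σ) := .ivar' Γ₁ 0
  have D₁ := D.wk (algTy σ)
  have e₁ := e.ren (IsRen.wkTm Γ Θ (algTy σ))
  have e₁' := e'.ren (IsRen.wkTm Γ Θ (algTy σ))
  rw [algFm_ren] at e₁
  rw [coalgFm_ren] at e₁'
  simp only [algTm_ren, coalgTm_ren, algTy_ren, coalgTy_ren, Ty.ren_id] at e₁ e₁' D₁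
  have t := HasType.algApp (.self hΓ) hΓ x₀ D₁.dom.alg D₁.dom.coalg
  have hp := (Dialg.self (Γ := Γ₁) hσ).foldTm_unfoldTm hσ
  have i₁ := D₁.algTy_naturality hid hσ x₀ e₁ e₁'
  have i₂ := (Prov.foldTm_app (P := P) (Θ := Θ) (Φ := Φ.map Fm.wkTm) hp.cod.alg hp.cod.coalg
    x₀).symm.trans ((Prov.app_congr_left hp.hom (.idTm hΓ _) x₀ (Prov.foldTm_self hx hid hσ)).trans
      (Prov.idTm_app x₀))
  simp only [foldTm_ren, Ty.ren_id]
  exact (Prov.app_congr_right D₁.hom x₀ t i₂.symm).trans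
    (i₁.trans (Prov.foldTm_app D₁.cod.alg D₁.cod.coalg x₀).symm)

/-- The contravariant component of a morphism from the candidate is the injection, since `h' b` is
its own injection and cocones are natural. -/
theorem eq_unfoldTm (D : DialgPair Γ σ (algTy σ) (coalgTy σ) (algTm σ) (coalgTm σ) A B f g h h')
    (hx : P.extensionality) (hid : P.identityExtension) (hσ : σ.Mixed)
    (e : Prov P Γ Θ Φ (algFm σ (algTy σ) (coalgTy σ) A B (algTm σ) f h h'))
    (e' : Prov P Γ Θ Φ (coalgFm σ (algTy σ) (coalgTy σ) A B (coalgTm σ) g h h')) :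
    Prov P Γ Θ Φ (.eq (.lolli B (coalgTy σ)) h' (unfoldTm σ A B f g)) := by
  have E := D.cod.foldTm_unfoldTm hσ
  refine .ext hx D.hom' E.hom' ?_
  let Γ₁ : ICx S n (k + 1) := scons B Γ
  have hΓ := ICx.toCx_noLin Γ₁
  have b₀ : HasType Γ₁.toCx (.var 0) B := .ivar' Γ₁ 0
  have D₁ := D.wk B
  have hq := (Dialg.self (Γ := Γ₁) hσ).foldTm_unfoldTm hσ
  have hb := D₁.hom'.iapp b₀
  refine ((Prov.idTm_app hb).symm.trans (Prov.app_congr_left hq.hom' (.idTm hΓ _) hb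
    (Prov.unfoldTm_self hx hid hσ)).symm).trans ?_
  have E₁ := D₁.cod.foldTm_unfoldTm hσ
  have q₁ := E₁.hom'.iapp b₀
  simp only [unfoldTm_ren, Ty.ren_id]
  refine .coalg_ext hx (hq.hom'.iapp hb) q₁ ?_
  let Γ₂ : ICx S (n + 1) (k + 2) := scons (coconeTy σ (.var 0)) Γ₁.wkTy
  have d : HasType Γ₂.toCx (.var 0) (coconeTy σ (.var 0)) := .ivar' Γ₂ 0
  have D₂ := D₁.wkTy.wk (coconeTy σ (.var 0))
  have b₂ : HasType Γ₂.toCx (.var 1) B.wk := .ivar' Γ₂ 1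
  have e₂ := ((e.ren (IsRen.wkTm Γ Θ B)).ren (IsRen.wkTy Γ₁ Θ)).ren
    (IsRen.wkTm Γ₁.wkTy Θ.wkTy (coconeTy σ (.var 0)))
  have e₂' := ((e'.ren (IsRen.wkTm Γ Θ B)).ren (IsRen.wkTy Γ₁ Θ)).ren
    (IsRen.wkTm Γ₁.wkTy Θ.wkTy (coconeTy σ (.var 0)))
  have E₂ := Dialg.self (Γ := Γ₂) hσ
  have hb₂ := D₂.hom'.iapp b₂
  simp only [algFm_ren, coalgFm_ren, algTm_ren, coalgTm_ren, algTy_ren, coalgTy_ren, Ty.ren_id]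
    at e₂ e₂' D₂ hb₂
  have i₁ := D₂.coconeTy_naturality hid hσ d b₂ e₂ e₂'
  have i₂ := Prov.unfoldTm_app (P := P) (Θ := Θ.wkTy)
    (Φ := ((Φ.map Fm.wkTm).map Fm.wkTy).map Fm.wkTm) E₂.alg E₂.coalg hb₂ d
  have i₃ := Prov.unfoldTm_app (P := P) (Θ := Θ.wkTy)
    (Φ := ((Φ.map Fm.wkTm).map Fm.wkTy).map Fm.wkTm) D₂.cod.alg D₂.cod.coalg b₂ d
  simp only [Tm.ren, unfoldTm_ren, algTm_ren, coalgTm_ren, algTy_ren, coalgTy_ren, Ty.ren_id]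
  exact i₂.trans (i₁.trans i₃.symm)

end DialgPair

theorem isDialgebra_iff {A B : Ty S.ty n} {f g : Tm S n 0} :
    IsDialgebra σ A B f g ↔ Dialg (Fin.elim0 : ICx S n 0) σ A B f g :=
  ⟨fun D => ⟨hom_iff.1 D.hom, hom_iff.1 D.hom'⟩, fun D => ⟨hom_iff.2 D.alg, hom_iff.2 D.coalg⟩⟩

theorem isDialgebra_self (hσ : σ.Mixed) :
    IsDialgebra (n := n) σ (algTy σ) (coalgTy σ) (algTm σ) (coalgTm σ) :=
  isDialgebra_iff.2 (.self hσ)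

theorem isDialgebraHom_foldTm (hx : P.extensionality) (hσ : σ.Mixed) {A B : Ty S.ty n}
    {f g : Tm S n 0} (D : IsDialgebra σ A B f g) :
    IsDialgebraHom P σ (algTy σ) (coalgTy σ) (algTm σ) (coalgTm σ) A B f g
      (foldTm σ A B f g) (unfoldTm σ A B f g) :=
  have E := isDialgebra_iff.1 D
  ⟨hom_iff.2 (E.foldTm_unfoldTm hσ).hom, hom_iff.2 (E.foldTm_unfoldTm hσ).hom',
    .foldTm_comm hx hσ E, .unfoldTm_comm hx hσ E⟩

theorem isInit_self (hx : P.extensionality) (hid : P.identityExtension) (hσ : σ.Mixed) :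
    (typeFunctor hx hid hσ n).IsInit (A := ⟨algTy σ⟩) (B := ⟨coalgTy σ⟩)
      (.mk P (isDialgebra_self hσ).hom) (.mk P (isDialgebra_self hσ).hom') := by
  have I := isDialgebra_self (n := n) hσ
  intro ⟨A⟩ ⟨B⟩ F G
  obtain ⟨f, hf, rfl⟩ := HomClass.exists_mk F
  obtain ⟨g, hg, rfl⟩ := HomClass.exists_mk G
  have D : IsDialgebra σ A B f g := ⟨hf, hg⟩
  have E := isDialgebraHom_foldTm hx hσ D
  have key (H : HomClass P (algTy σ) A) (H' : HomClass P B (coalgTy σ))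
      (e : (typeFunctor hx hid hσ n).IsMor (A := ⟨algTy σ⟩) (B := ⟨coalgTy σ⟩) (A₁ := ⟨A⟩)
        (B₁ := ⟨B⟩) (.mk P I.hom) (.mk P I.hom') (.mk P hf) (.mk P hg) H H') :
      H = .mk P E.hom ∧ H' = .mk P E.hom' := by
    obtain ⟨h, hh, rfl⟩ := H.exists_mk
    obtain ⟨h', hh', rfl⟩ := H'.exists_mk
    have e' := (isMor_iff hx hid hσ I D hh hh').1 e
    have DP : DialgPair _ σ _ _ _ _ _ _ _ _ h h' :=
      ⟨isDialgebra_iff.1 I, isDialgebra_iff.1 D, hom_iff.1 hh, hom_iff.1 hh'⟩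
    exact ⟨HomClass.mk_eq_mk.2 (DP.eq_foldTm hx hid hσ e'.comm e'.comm'),
      HomClass.mk_eq_mk.2 (DP.eq_unfoldTm hx hid hσ e'.comm e'.comm')⟩
  refine ⟨⟨.mk P E.hom, .mk P E.hom', (isMor_iff hx hid hσ I D E.hom E.hom').2 E⟩, ?_⟩
  intro h h' k k' e e'
  exact ⟨(key h h' e).1.trans (key k k' e').1.symm, (key h h' e).2.trans (key k k' e').2.symm⟩

/-! ### The recursive type -/

section Definitions

variable (σ : Ty S.ty 2)

/-- The inverse `algTy ⊸ σ(coalgTy, algTy)` of `algTm`. -/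
def algInvTm : Tm S n k :=
  foldTm σ (σ.at₂ (coalgTy σ) (algTy σ)) (σ.at₂ (algTy σ) (coalgTy σ))
    (mapTm σ (σ.at₂ (algTy σ) (coalgTy σ)) (σ.at₂ (coalgTy σ) (algTy σ)) (coalgTy σ) (algTy σ)
      (coalgTm σ) (algTm σ))
    (mapTm σ (algTy σ) (coalgTy σ) (σ.at₂ (coalgTy σ) (algTy σ)) (σ.at₂ (algTy σ) (coalgTy σ))
      (algTm σ) (coalgTm σ))

/-- The inverse `σ(algTy, coalgTy) ⊸ coalgTy` of `coalgTm`. -/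
def coalgInvTm : Tm S n k :=
  unfoldTm σ (σ.at₂ (coalgTy σ) (algTy σ)) (σ.at₂ (algTy σ) (coalgTy σ))
    (mapTm σ (σ.at₂ (algTy σ) (coalgTy σ)) (σ.at₂ (coalgTy σ) (algTy σ)) (coalgTy σ) (algTy σ)
      (coalgTm σ) (algTm σ))
    (mapTm σ (algTy σ) (coalgTy σ) (σ.at₂ (coalgTy σ) (algTy σ)) (σ.at₂ (algTy σ) (coalgTy σ))
      (algTm σ) (coalgTm σ))

/-- The comparison `algTy ⊸ coalgTy`, a component of the morphism from the candidate to the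
dialgebra on `coalgTy`, `algTy` that the inverses of its structure maps form. -/
def comparisonTm : Tm S n k := foldTm σ (coalgTy σ) (algTy σ) (coalgInvTm σ) (algInvTm σ)

/-- The functional `w ↦ algTm ∘ σ(w, w) ∘ coalgTm` on `coalgTy ⊸ algTy`. -/
def comparisonStep : Tm S n k :=
  Tm.ilam (.lolli (coalgTy σ) (algTy σ)) (Tm.comp (coalgTy σ)
    (Tm.comp (σ.at₂ (algTy σ) (coalgTy σ)) (algTm σ)
      (mapTm σ (algTy σ) (coalgTy σ) (coalgTy σ) (algTy σ) (.var 0) (.var 0))) (coalgTm σ))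

/-- The fixed point `coalgTy ⊸ algTy` of `comparisonStep`. -/
def comparisonInvTm : Tm S n k :=
  .app (.tapp .fix (.lolli (coalgTy σ) (algTy σ))) (.bang (comparisonStep σ))

/-- The isomorphism `σ(algTy, algTy) ⊸ algTy`. -/
def recTm : Tm S n k :=
  Tm.comp (σ.at₂ (algTy σ) (algTy σ)) (algTm σ)
    (mapTm σ (algTy σ) (algTy σ) (coalgTy σ) (algTy σ) (comparisonInvTm σ) (Tm.idTm (algTy σ)))

/-- The inverse `algTy ⊸ σ(algTy, algTy)` of `recTm`. -/
def recInvTm : Tm S n k :=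
  Tm.comp (algTy σ)
    (mapTm σ (coalgTy σ) (algTy σ) (algTy σ) (algTy σ) (comparisonTm σ) (Tm.idTm (algTy σ)))
    (algInvTm σ)

theorem recTm_ren (s : Fin n → Fin m) (e : Fin k → Fin l) :
    (recTm σ : Tm S n k).ren s e = recTm σ := by
  simp [recTm, comparisonInvTm, comparisonStep, Tm.comp_ren, Tm.ilam_ren, Tm.ren, mapTm_ren,
    Ty.at₂_ren, Ty.ren]

theorem recInvTm_ren (s : Fin n → Fin m) (e : Fin k → Fin l) :
    (recInvTm σ : Tm S n k).ren s e = recInvTm σ := by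
  simp [recInvTm, comparisonTm, coalgInvTm, algInvTm, Tm.comp_ren, Tm.ren, mapTm_ren, Ty.at₂_ren]

end Definitions

theorem HasType.comparisonStep_body (hσ : σ.Mixed) :
    HasType (ICx.toCx (S := S) (scons (.lolli (coalgTy σ) (algTy σ)) Γ)) (Tm.comp (coalgTy σ)
      (Tm.comp (σ.at₂ (algTy σ) (coalgTy σ)) (LAPL.algTm σ)
        (mapTm σ (algTy σ) (coalgTy σ) (coalgTy σ) (algTy σ) (.var 0) (.var 0))) (LAPL.coalgTm σ))
      (.lolli (coalgTy σ) (algTy σ)) :=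
  have h := ICx.toCx_noLin (S := S) (scons (.lolli (coalgTy σ) (algTy σ)) Γ)
  have x₀ := HasType.ivar' (S := S) (scons (.lolli (coalgTy σ) (algTy σ)) Γ) 0
  (HasType.icomp (.algTm hσ h) (mapTm_hasType hσ h x₀ x₀)).icomp (.coalgTm hσ h)

theorem HasType.comparisonStep (hσ : σ.Mixed) : HasType Γ.toCx (LAPL.comparisonStep σ)
    (.arrow (.lolli (coalgTy σ) (algTy σ)) (.lolli (coalgTy σ) (algTy σ))) :=
  .ilam (by
    have h := HasType.comparisonStep_body (Γ := Γ) hσ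
    rwa [ICx.toCx_scons] at h)

theorem HasType.comparisonInvTm (hσ : σ.Mixed) :
    HasType Γ.toCx (LAPL.comparisonInvTm σ) (.lolli (coalgTy σ) (algTy σ)) :=
  .iapp ((HasType.tapp _ (.fix (ICx.toCx_noLin Γ))).cast (by simp [Ty.inst, Ty.sub]))
    (HasType.comparisonStep hσ).ibang

theorem Prov.comparisonInvTm_eq (hσ : σ.Mixed) :
    Prov P Γ Θ Φ (.eq (.lolli (coalgTy σ) (algTy σ)) (comparisonInvTm σ)
      (Tm.comp (coalgTy σ) (Tm.comp (σ.at₂ (algTy σ) (coalgTy σ)) (algTm σ)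
        (mapTm σ (algTy σ) (coalgTy σ) (coalgTy σ) (algTy σ) (comparisonInvTm σ)
          (comparisonInvTm σ))) (coalgTm σ))) := by
  have hΓ := ICx.toCx_noLin Γ
  have hb := HasType.comparisonStep_body (Γ := Γ) hσ
  rw [ICx.toCx_scons] at hb
  have h₁ := ExtEq.fix hΓ (HasType.comparisonStep (Γ := Γ) hσ)
  have h₂ := ExtEq.ibeta hΓ hb (.comparisonInvTm hσ)
  have h₃ := h₁.symm.trans h₂
  refine .ofExtEq ?_
  simp only [Tm.inst, Tm.comp_sub, mapTm_sub, Tm.sub, Ty.at₂_sub, scons_zero, algTm_sub,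
    coalgTm_sub, algTy_sub, coalgTy_sub] at h₃
  exact h₃

/-- The dialgebra in which `algInvTm` and `coalgInvTm` are the components of the morphism from the
candidate. -/
theorem isDialgebra_lambek (hσ : σ.Mixed) :
    IsDialgebra (n := n) σ (σ.at₂ (coalgTy σ) (algTy σ)) (σ.at₂ (algTy σ) (coalgTy σ))
      (mapTm σ (σ.at₂ (algTy σ) (coalgTy σ)) (σ.at₂ (coalgTy σ) (algTy σ)) (coalgTy σ) (algTy σ)
        (coalgTm σ) (algTm σ))
      (mapTm σ (algTy σ) (coalgTy σ) (σ.at₂ (coalgTy σ) (algTy σ)) (σ.at₂ (algTy σ) (coalgTy σ))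
        (algTm σ) (coalgTm σ)) :=
  have I := isDialgebra_self (n := n) hσ
  ⟨HomClass.hom_map hσ I.hom' I.hom, HomClass.hom_map hσ I.hom I.hom'⟩

/-- The dialgebra on `algTy` and `algTy` is initial, and its structure maps are inverse to each
other. -/
theorem recTm_spec (hx : P.extensionality) (hid : P.identityExtension) (hσ : σ.Mixed) (n : ℕ) :
    IsInversePair P (n := n) (σ.at₂ (algTy σ) (algTy σ)) (algTy σ) (recTm σ) (recInvTm σ) ∧
      IsInitialDialgebra P (n := n) σ (algTy σ) (algTy σ) (recTm σ) (recInvTm σ) := by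
  have I := isDialgebra_self (n := n) hσ
  have D := isDialgebra_lambek (n := n) hσ
  have E := isDialgebraHom_foldTm hx hσ D
  have D' : IsDialgebra σ (coalgTy σ) (algTy σ) (coalgInvTm σ) (algInvTm σ) := ⟨E.hom', E.hom⟩
  have E' := isDialgebraHom_foldTm hx hσ D'
  have hw : Hom (n := n) (coalgTy σ) (algTy σ) (comparisonInvTm σ) :=
    hom_iff.2 (.comparisonInvTm hσ)
  have H := (isInit_self (n := n) hx hid hσ).diagonal ((isMor_iff hx hid hσ I D E.hom E.hom').2 E)
    ((isMor_iff hx hid hσ I D' E'.hom E'.hom').2 E') (w := HomClass.mk P hw)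
    (HomClass.mk_eq_mk.2 (.comparisonInvTm_eq hσ))
  have hi : Hom (n := n) (σ.at₂ (algTy σ) (algTy σ)) (algTy σ) (recTm σ) :=
    HomClass.hom_comp (HomClass.hom_map hσ hw (HomClass.hom_id _)) I.hom
  have hj : Hom (n := n) (algTy σ) (σ.at₂ (algTy σ) (algTy σ)) (recInvTm σ) :=
    HomClass.hom_comp E.hom (HomClass.hom_map hσ E'.hom (HomClass.hom_id _))
  exact ⟨⟨hi, hj, HomClass.mk_eq_mk.1 H.1.1, HomClass.mk_eq_mk.1 H.1.2⟩,
    isInitialDialgebra hx hid hσ ⟨hi, hj⟩ H.2⟩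

end LAPL

/-- Assuming extensionality and identity extension, for every inductively constructed type
`σ(α, β)` in which `α` occurs only negatively and `β` only positively there are a closed type
`rec` and an isomorphism `i : σ(rec, rec) ⊸ rec` such that `(rec, rec, i, i⁻¹)` is an initial
dialgebra for `σ` up to internal equality, in every kind context. -/
theorem mainTheorem1 (S : LAPL.Sig.{u}) (P : LAPL.Schemes)
    (hext : P.extensionality) (hid : P.identityExtension)
    (σ : LAPL.Ty S.ty 2) (hσ : σ.IndConstructed)
    (hα : σ.OnlyNegative 0) (hβ : σ.OnlyPositive 1) :
    ∃ (rec : LAPL.Ty S.ty 0) (i iinv : LAPL.Tm S 0 0),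
      LAPL.IsInversePair P (σ.at₂ rec rec) rec i iinv ∧
      ∀ n : ℕ, LAPL.IsInitialDialgebra P (n := n) σ rec.ofClosed rec.ofClosed
        i.ofClosed iinv.ofClosed := by
  have hσ' : σ.Mixed := ⟨hα, hβ⟩
  refine ⟨LAPL.algTy σ, LAPL.recTm σ, LAPL.recInvTm σ, ?_, fun n => ?_⟩
  · exact (LAPL.recTm_spec hext hid hσ' 0).1
  · have h := (LAPL.recTm_spec hext hid hσ' n).2
    rwa [← LAPL.algTy_ren σ Fin.elim0, ← LAPL.recTm_ren σ Fin.elim0 Fin.elim0,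
      ← LAPL.recInvTm_ren σ Fin.elim0 Fin.elim0] at h
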